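/- **Lifting theorem for CBPV models.** *Locally indexed categories.* Let $\mathbb C$ be a category with chosen finite products. A locally $\mathbb C$-indexed category $\mathcal C$ has one collection of objects, for each $c\in\mathbb C$ a category $\mathcal C_c$ with these objects (write $k:A\to_c B$ for its maps), and, functorially in $\rho:d\to c$, identity-on-objects reindexing functors $\mathcal C_c\to\mathcal C_d$, $k\mapsto k\cdot\rho$. A locally $\mathbb C$-indexed functor is a map on objects with functors on all $\mathcal C_c$, commuting with reindexing; for $f:\mathbb C\to\mathbb D$, $(f^*\mathcal D)_c=\mathcal D_{f(c)}$. In the 2-category $\mathbf{LInd}$ the objects are the pairs $(\mathbb C,\mathcal C)$; a 1-cell $(\mathbb C,\mathcal C)\to(\mathbb D,\mathcal D)$ is a pair $(f,F)$ with $f:\mathbb C\to\mathbb D$ preserving finite products up to isomorphism and $F:\mathcal C\to f^*\mathcal D$ locally $\mathbb C$-indexed; a 2-cell $(f,F)\Rightarrow(g,G)$ is a natural transformation $\gamma:f\Rightarrow g$ with maps $\bar\gamma_A:FA\to_1 GA$ such that $(\bar\gamma_{B}\cdot{!})\circ F(k)=(G(k)\cdot\gamma_c)\circ(\bar\gamma_A\cdot{!})$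 for all $k:A\to_c B$. $\mathbf{DistCat}$ is the 2-category of distributive categories (with chosen finite products and coproducts), functors preserving finite products and coproducts up to isomorphism, and natural transformations. The 2-functor $\mathsf{self}:\mathbf{DistCat}\to\mathbf{LInd}$ sends $\mathbb C$ to the locally indexed category with the objects of $\mathbb C$ and with maps $A\to_c B$ the maps $c\times A\to B$ of $\mathbb C$. *Models.* A CBPV model $(\mathbb C,\mathcal C,F,U)$ consists of a distributive category $\mathbb C$, a locally $\mathbb C$-indexed category $\mathcal C$ and an adjunction $F\dashv U:\mathcal C\to\mathsf{self}\,\mathbb C$ of locally $\mathbb C$-indexed functors (an adjunction in $\mathbf{LInd}$ over $\mathrm{id}_{\mathbb C}$), such that $\mathcal C$ has chosen finite products (projections $\pi_i:\prod_j B_j\to_1 B_i$ inducing bijections $\mathcal C_c(A,\prod_j B_j)\cong\prod_j\mathcal C_c(A,B_j)$), chosen powers (maps $(c\Rightarrow B)\to_c B$ inducing bijections $\mathcal C_b(A,c\Rightarrow B)\cong\mathcal C_{b\times c}(A,B)$), and the finite coproducts of $\mathbb C$ are distributive in $\mathcal C$ (reindexing along the maps $a\times\mathrm{in}_i$ gives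 bijections $\mathcal C_{a\times\sum_i b_i}(A,B)\cong\prod_i\mathcal C_{a\times b_i}(A,B)$). *The 2-category $\mathbf{CBPV}^{\mathrm{fo}}_{\mathrm{lx}}$* has CBPV models as objects. A 1-cell $(\mathbb C,\mathcal C,F,U)\to(\mathbb D,\mathcal D,F',U')$ is a tuple $(h,H,\alpha,\beta)$ where $h:\mathbb C\to\mathbb D$ is a 1-cell of $\mathbf{DistCat}$, $H:\mathcal C\to h^*\mathcal D$ is a locally $\mathbb C$-indexed functor preserving finite products up to isomorphism, and $\alpha:(h,H)F\Rightarrow F'\,\mathsf{self}(h)$, $\beta:\mathsf{self}(h)\,U\Rightarrow U'(h,H)$ are 2-cells of $\mathbf{LInd}$ with identity base component which are compatible with the units and counits: $\varepsilon'(h,H)\circ F'\beta\circ\alpha U=(h,H)\varepsilon$ and $U'\alpha\circ\beta F\circ\mathsf{self}(h)\eta=\eta'\,\mathsf{self}(h)$. 1-cells compose by pasting. A 2-cell $(h,H,\alpha,\beta)\Rightarrow(h',H',\alpha',\beta')$ is a 2-cell $(\gamma,\bar\gamma):(h,H)\Rightarrow(h',H')$ of $\mathbf{LInd}$ which, together with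 $\mathsf{self}(\gamma)$, commutes with $\alpha,\alpha'$ and with $\beta,\beta'$. *Fibrations.* A 1-cell $p:E\to B$ of a 2-category is a fibration if for every object $X$ the functor $p\circ-:\mathrm{Hom}(X,E)\to\mathrm{Hom}(X,B)$ is a fibration of categories, and precomposition with any 1-cell $Y\to X$ preserves cartesian 2-cells. A CBPV fibration is a 1-cell $(p,P,\alpha,\beta)$ of $\mathbf{CBPV}^{\mathrm{fo}}_{\mathrm{lx}}$ such that $p$ preserves the chosen finite products and coproducts strictly, $P$ preserves the chosen products and powers strictly, $\alpha$ and $\beta$ are identities (so that one writes just $(p,P)$), $(p,P)$ is a fibration in $\mathbf{LInd}$, and $p$ is a bifibration (a fibration and an opfibration) of categories. It is split if $(p,P)$ has a splitting that is natural in $X$ and $p$ has a splitting both as a fibration and as an opfibration. *Theorem.* Let $(p,P):(\hat{\mathbb D},\hat{\mathcal D},F^{\hat{\mathcal D}},U^{\hat{\mathcal D}})\to(\mathbb D,\mathcal D,F^{\mathcal D},U^{\mathcal D})$ be a CBPV fibration and let $(h,H,\alpha,\beta):(\mathbb C,\mathcal C,F^{\mathcal C},U^{\mathcal C})\to(\mathbb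 D,\mathcal D,F^{\mathcal D},U^{\mathcal D})$ be a 1-cell of $\mathbf{CBPV}^{\mathrm{fo}}_{\mathrm{lx}}$. Then there are a CBPV model $(\hat{\mathbb C},\hat{\mathcal C},F^{\hat{\mathcal C}},U^{\hat{\mathcal C}})$ and 1-cells $(\hat h,\hat H,\hat\alpha,\hat\beta)$ to $(\hat{\mathbb D},\hat{\mathcal D},F^{\hat{\mathcal D}},U^{\hat{\mathcal D}})$ and $(q,Q)$ to $(\mathbb C,\mathcal C,F^{\mathcal C},U^{\mathcal C})$ such that: 1. the square $(p,P)\circ(\hat h,\hat H,\hat\alpha,\hat\beta)=(h,H,\alpha,\beta)\circ(q,Q)$ is a (strict, 2-categorical) pullback in $\mathbf{CBPV}^{\mathrm{fo}}_{\mathrm{lx}}$; 2. $(q,Q)$ is a CBPV fibration, and it is split if $(p,P)$ is split; 3. the square $p\hat h=hq$ is a pullback in $\mathbf{DistCat}$, and the square $(p,P)(\hat h,\hat H)=(h,H)(q,Q)$ is a pullback in $\mathbf{LInd}$; 4. $\hat\alpha:(\hat h,\hat H)F^{\hat{\mathcal C}}\Rightarrow F^{\hat{\mathcal D}}\,\mathsf{self}(\hat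 h)$ is a cartesian lift of $\alpha\,\mathsf{self}(q)$ along $(p,P)$, and $\hat\beta:\mathsf{self}(\hat h)\,U^{\hat{\mathcal C}}\Rightarrow U^{\hat{\mathcal D}}(\hat h,\hat H)$ is a cartesian lift of $\beta\,(q,Q)$ along $\mathsf{self}(p)$. -/

import Mathlib

open CategoryTheory Limits Bicategory

universe w v u

noncomputable section

namespace CBPV

/-! ### Morphisms of adjunctions, pullbacks and fibrations in a 2-category -/

section TwoCat

variable {B : Type u} [Bicategory.{w, v} B]

/-- Vertical pasting of two squares filled by 2-cells. -/
def paste {a b a' b' a'' b'' : B} {l : a ⟶ b} {l' : a' ⟶ b'} {l'' : a'' ⟶ b''}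
    {m : a ⟶ a'} {n : b ⟶ b'} {m' : a' ⟶ a''} {n' : b' ⟶ b''}
    (σ : l ≫ n ⟶ m ≫ l') (τ : l' ≫ n' ⟶ m' ≫ l'') : l ≫ n ≫ n' ⟶ (m ≫ m') ≫ l'' :=
  (α_ l n n').inv ≫ σ ▷ n' ≫ (α_ m l' n').hom ≫ m ◁ τ ≫ (α_ m m' l'').inv

/-- The identity square. -/
def pasteId {a b : B} (l : a ⟶ b) : l ≫ 𝟙 b ⟶ 𝟙 a ≫ l := (ρ_ l).hom ≫ (λ_ l).inv

/-- `(m, n, α, β)` is a lax morphism of adjunctions from `l ⊣ r` to `f ⊣ u`: the 2-cells `α` and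
`β` are compatible with the counits and with the units. -/
structure IsLaxAdjMor {a b c d : B} {l : a ⟶ b} {r : b ⟶ a} {f : c ⟶ d} {u : d ⟶ c}
    (adj : Bicategory.Adjunction l r) (adj' : Bicategory.Adjunction f u)
    {m : a ⟶ c} {n : b ⟶ d} (α : l ≫ n ⟶ m ≫ f) (β : r ≫ m ⟶ n ≫ u) : Prop where
  counit : adj.counit ▷ n ≫ (λ_ n).hom =
    (α_ r l n).hom ≫ r ◁ α ≫ (α_ r m f).inv ≫ β ▷ f ≫ (α_ n u f).hom ≫ n ◁ adj'.counit ≫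
      (ρ_ n).hom
  unit : (ρ_ m).inv ≫ m ◁ adj'.unit =
    (λ_ m).inv ≫ adj.unit ▷ m ≫ (α_ l r m).hom ≫ l ◁ β ≫ (α_ l n u).inv ≫ α ▷ u ≫
      (α_ m f u).hom

lemma isLaxAdjMor_id {a b : B} {l : a ⟶ b} {r : b ⟶ a} (adj : Bicategory.Adjunction l r) :
    IsLaxAdjMor adj adj (pasteId l) (pasteId r) where
  counit := by
    unfold pasteId
    bicategory
  unit := by
    unfold pasteId
    bicategory

lemma IsLaxAdjMor.paste {a b a' b' a'' b'' : B} {l : a ⟶ b} {r : b ⟶ a} {l' : a' ⟶ b'}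
    {r' : b' ⟶ a'} {l'' : a'' ⟶ b''} {r'' : b'' ⟶ a''}
    {adj : Bicategory.Adjunction l r} {adj' : Bicategory.Adjunction l' r'}
    {adj'' : Bicategory.Adjunction l'' r''}
    {m : a ⟶ a'} {n : b ⟶ b'} {m' : a' ⟶ a''} {n' : b' ⟶ b''}
    {α : l ≫ n ⟶ m ≫ l'} {β : r ≫ m ⟶ n ≫ r'}
    {α' : l' ≫ n' ⟶ m' ≫ l''} {β' : r' ≫ m' ⟶ n' ≫ r''}
    (h : IsLaxAdjMor adj adj' α β) (h' : IsLaxAdjMor adj' adj'' α' β') :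
    IsLaxAdjMor adj adj'' (CBPV.paste α α') (CBPV.paste β β') where
  counit := by
    symm
    calc
      _ = 𝟙 _ ⊗≫ r ◁ α ▷ n' ⊗≫ ((r ≫ m) ◁ α' ≫ β ▷ (m' ≫ l'')) ⊗≫ n ◁ β' ▷ l'' ⊗≫
          n ◁ n' ◁ adj''.counit ⊗≫ 𝟙 _ := by
        unfold CBPV.paste; bicategory
      _ = 𝟙 _ ⊗≫ r ◁ α ▷ n' ⊗≫ (β ▷ (l' ≫ n') ≫ (n ≫ r') ◁ α') ⊗≫ n ◁ β' ▷ l'' ⊗≫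
          n ◁ n' ◁ adj''.counit ⊗≫ 𝟙 _ := by
        rw [whisker_exchange]
      _ = 𝟙 _ ⊗≫ r ◁ α ▷ n' ⊗≫ β ▷ l' ▷ n' ⊗≫ n ◁ ((α_ r' l' n').hom ≫ r' ◁ α' ≫
          (α_ r' m' l'').inv ≫ β' ▷ l'' ≫ (α_ n' r'' l'').hom ≫ n' ◁ adj''.counit ≫
          (ρ_ n').hom) ⊗≫ 𝟙 _ := by
        bicategory
      _ = 𝟙 _ ⊗≫ ((α_ r l n).hom ≫ r ◁ α ≫ (α_ r m l').inv ≫ β ▷ l' ≫ (α_ n r' l').hom ≫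
          n ◁ adj'.counit ≫ (ρ_ n).hom) ▷ n' ⊗≫ 𝟙 _ := by
        rw [← h'.counit]; bicategory
      _ = _ := by
        rw [← h.counit]; bicategory
  unit := by
    symm
    calc
      _ = 𝟙 _ ⊗≫ adj.unit ▷ m ▷ m' ⊗≫ l ◁ β ▷ m' ⊗≫ (l ≫ n) ◁ β' ⊗≫ α ▷ n' ▷ r'' ⊗≫
          m ◁ α' ▷ r'' ⊗≫ 𝟙 _ := by
        unfold CBPV.paste; bicategory
      _ = 𝟙 _ ⊗≫ adj.unit ▷ m ▷ m' ⊗≫ l ◁ β ▷ m' ⊗≫ ((l ≫ n) ◁ β' ≫ α ▷ (n' ≫ r'')) ⊗≫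
          m ◁ α' ▷ r'' ⊗≫ 𝟙 _ := by
        bicategory
      _ = 𝟙 _ ⊗≫ adj.unit ▷ m ▷ m' ⊗≫ l ◁ β ▷ m' ⊗≫ (α ▷ (r' ≫ m') ≫ (m ≫ l') ◁ β') ⊗≫
          m ◁ α' ▷ r'' ⊗≫ 𝟙 _ := by
        rw [whisker_exchange]
      _ = 𝟙 _ ⊗≫ ((λ_ m).inv ≫ adj.unit ▷ m ≫ (α_ l r m).hom ≫ l ◁ β ≫ (α_ l n r').inv ≫
          α ▷ r' ≫ (α_ m l' r').hom) ▷ m' ⊗≫ m ◁ l' ◁ β' ⊗≫ m ◁ α' ▷ r'' ⊗≫ 𝟙 _ := by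
        bicategory
      _ = 𝟙 _ ⊗≫ m ◁ ((λ_ m').inv ≫ adj'.unit ▷ m' ≫ (α_ l' r' m').hom ≫ l' ◁ β' ≫
          (α_ l' n' r'').inv ≫ α' ▷ r'' ≫ (α_ m' l'' r'').hom) ⊗≫ 𝟙 _ := by
        rw [← h.unit]; bicategory
      _ = _ := by
        rw [← h'.unit]; bicategory

lemma IsLaxAdjMor.transport {a b c d : B} {l : a ⟶ b} {r : b ⟶ a} {f : c ⟶ d} {u : d ⟶ c}
    {adj : Bicategory.Adjunction l r} {adj' : Bicategory.Adjunction f u}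
    {m m' : a ⟶ c} {n : b ⟶ d} {α : l ≫ n ⟶ m ≫ f} {β : r ≫ m ⟶ n ≫ u} (e : m = m')
    (h : IsLaxAdjMor adj adj' α β) :
    IsLaxAdjMor adj adj' (α ≫ eqToHom e ▷ f) (r ◁ eqToHom e.symm ≫ β) := by
  subst e
  simpa using h

lemma paste_whiskerLeft {a b a' b' a'' b'' : B} {l : a ⟶ b} {l' : a' ⟶ b'} {l'' : a'' ⟶ b''}
    {m : a ⟶ a'} {n : b ⟶ b'} {m₁ m₂ : a' ⟶ a''} {n₁ n₂ : b' ⟶ b''}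
    (σ : l ≫ n ⟶ m ≫ l') (τ₁ : l' ≫ n₁ ⟶ m₁ ≫ l'') (τ₂ : l' ≫ n₂ ⟶ m₂ ≫ l'')
    (ν : n₁ ⟶ n₂) (μ : m₁ ⟶ m₂) (h : l' ◁ ν ≫ τ₂ = τ₁ ≫ μ ▷ l'') :
    l ◁ n ◁ ν ≫ paste σ τ₂ = paste σ τ₁ ≫ (m ◁ μ) ▷ l'' := by
  calc
    _ = 𝟙 _ ⊗≫ ((l ≫ n) ◁ ν ≫ σ ▷ n₂) ⊗≫ m ◁ τ₂ ⊗≫ 𝟙 _ := by unfold paste; bicategory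
    _ = 𝟙 _ ⊗≫ (σ ▷ n₁ ≫ (m ≫ l') ◁ ν) ⊗≫ m ◁ τ₂ ⊗≫ 𝟙 _ := by rw [whisker_exchange]
    _ = 𝟙 _ ⊗≫ σ ▷ n₁ ⊗≫ m ◁ (l' ◁ ν ≫ τ₂) ⊗≫ 𝟙 _ := by bicategory
    _ = _ := by rw [h]; unfold paste; bicategory

lemma paste_whiskerRight {a b a' b' a'' b'' : B} {l : a ⟶ b} {l' : a' ⟶ b'} {l'' : a'' ⟶ b''}
    {m₁ m₂ : a ⟶ a'} {n₁ n₂ : b ⟶ b'} {m : a' ⟶ a''} {n : b' ⟶ b''}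
    (σ₁ : l ≫ n₁ ⟶ m₁ ≫ l') (σ₂ : l ≫ n₂ ⟶ m₂ ≫ l') (τ : l' ≫ n ⟶ m ≫ l'')
    (ν : n₁ ⟶ n₂) (μ : m₁ ⟶ m₂) (h : l ◁ ν ≫ σ₂ = σ₁ ≫ μ ▷ l') :
    l ◁ (ν ▷ n) ≫ paste σ₂ τ = paste σ₁ τ ≫ (μ ▷ m) ▷ l'' := by
  calc
    _ = 𝟙 _ ⊗≫ (l ◁ ν ≫ σ₂) ▷ n ⊗≫ m₂ ◁ τ ⊗≫ 𝟙 _ := by unfold paste; bicategory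
    _ = 𝟙 _ ⊗≫ σ₁ ▷ n ⊗≫ (μ ▷ (l' ≫ n) ≫ m₂ ◁ τ) ⊗≫ 𝟙 _ := by rw [h]; bicategory
    _ = 𝟙 _ ⊗≫ σ₁ ▷ n ⊗≫ (m₁ ◁ τ ≫ μ ▷ (m ≫ l'')) ⊗≫ 𝟙 _ := by rw [whisker_exchange]
    _ = _ := by unfold paste; bicategory

lemma transport_left {a b c d : B} {l : a ⟶ b} {f : c ⟶ d} {n₁ n₂ : b ⟶ d}
    {m₁ m₁' m₂ m₂' : a ⟶ c} (e₁ : m₁' = m₁) (e₂ : m₂' = m₂) {σ₁ : l ≫ n₁ ⟶ m₁ ≫ f}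
    {σ₂ : l ≫ n₂ ⟶ m₂ ≫ f} {ν : n₁ ⟶ n₂} {μ : m₁ ⟶ m₂} (h : l ◁ ν ≫ σ₂ = σ₁ ≫ μ ▷ f)
    {μ' : m₁' ⟶ m₂'} (hμ : μ' = eqToHom e₁ ≫ μ ≫ eqToHom e₂.symm) :
    l ◁ ν ≫ (σ₂ ≫ eqToHom e₂.symm ▷ f) = (σ₁ ≫ eqToHom e₁.symm ▷ f) ≫ μ' ▷ f := by
  subst e₁ e₂ hμ
  simpa using h

lemma transport_right {a b c d : B} {r : b ⟶ a} {u : d ⟶ c} {n₁ n₂ : b ⟶ d}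
    {m₁ m₁' m₂ m₂' : a ⟶ c} (e₁ : m₁' = m₁) (e₂ : m₂' = m₂) {σ₁ : r ≫ m₁ ⟶ n₁ ≫ u}
    {σ₂ : r ≫ m₂ ⟶ n₂ ≫ u} {ν : n₁ ⟶ n₂} {μ : m₁ ⟶ m₂} (h : r ◁ μ ≫ σ₂ = σ₁ ≫ ν ▷ u)
    {μ' : m₁' ⟶ m₂'} (hμ : μ' = eqToHom e₁ ≫ μ ≫ eqToHom e₂.symm) :
    r ◁ μ' ≫ (r ◁ eqToHom e₂ ≫ σ₂) = (r ◁ eqToHom e₁ ≫ σ₁) ≫ ν ▷ u := by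
  subst e₁ e₂ hμ
  simpa using h

/-- A (strict, 2-categorical) pullback square: the square commutes on the nose, and it is universal
among such squares both for 1-cells and for 2-cells. -/
structure IsPullback₂ {P A C D : B} (fst : P ⟶ A) (snd : P ⟶ C) (f : A ⟶ D) (g : C ⟶ D) :
    Prop where
  w : fst ≫ f = snd ≫ g
  lift : ∀ {X : B} (a : X ⟶ A) (c : X ⟶ C), a ≫ f = c ≫ g →
    ∃! t : X ⟶ P, t ≫ fst = a ∧ t ≫ snd = c
  lift₂ : ∀ {X : B} (s t : X ⟶ P) (σ : s ≫ fst ⟶ t ≫ fst) (τ : s ≫ snd ⟶ t ≫ snd),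
    (α_ s fst f).inv ≫ σ ▷ f ≫ (α_ t fst f).hom ≫ t ◁ eqToHom w =
      s ◁ eqToHom w ≫ (α_ s snd g).inv ≫ τ ▷ g ≫ (α_ t snd g).hom →
    ∃! θ : s ⟶ t, θ ▷ fst = σ ∧ θ ▷ snd = τ

/-- A fibration in a 2-category: all functors `p ∘ -` between hom-categories are fibrations, and
precomposition preserves cartesian 2-cells. -/
structure IsFibration {E C : B} (p : E ⟶ C) : Prop where
  fibered : ∀ X : B, (postcomp X p).IsFibered
  precomp : ∀ {X Y : B} (h : Y ⟶ X) {e e' : X ⟶ E} (φ : e ⟶ e'),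
    (postcomp X p).IsCartesian ((postcomp X p).map φ) φ →
      (postcomp Y p).IsCartesian ((postcomp Y p).map (h ◁ φ)) (h ◁ φ)

end TwoCat

/-- A splitting of a functor: a choice of cartesian lifts which is strictly functorial. -/
structure Splitting {E : Type*} {C : Type*} [Category* E] [Category* C] (p : E ⥤ C) where
  obj : ∀ {c : C} (e : E), (c ⟶ p.obj e) → E
  lift : ∀ {c : C} (e : E) (f : c ⟶ p.obj e), obj e f ⟶ e
  cartesian : ∀ {c : C} (e : E) (f : c ⟶ p.obj e), p.IsStronglyCartesian f (lift e f)
  base_eq : ∀ {c : C} (e : E) (f : c ⟶ p.obj e), c = p.obj (obj e f)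
  obj_id : ∀ e : E, obj e (𝟙 (p.obj e)) = e
  lift_id : ∀ e : E, lift e (𝟙 (p.obj e)) = eqToHom (obj_id e)
  obj_comp : ∀ {c d : C} (e : E) (f : c ⟶ p.obj e) (g : d ⟶ c),
    obj e (g ≫ f) = obj (obj e f) (g ≫ eqToHom (base_eq e f))
  lift_comp : ∀ {c d : C} (e : E) (f : c ⟶ p.obj e) (g : d ⟶ c),
    lift e (g ≫ f) = eqToHom (obj_comp e f g) ≫ lift (obj e f) (g ≫ eqToHom (base_eq e f)) ≫ lift e f

/-- A splitting of a 1-cell in a 2-category: splittings of all functors `p ∘ -` between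
hom-categories that are strictly preserved by precomposition. -/
structure Splitting₂ {B : Type u} [Bicategory.{w, v} B] {E C : B} (p : E ⟶ C) where
  split : ∀ X : B, Splitting (postcomp X p)
  obj_precomp : ∀ {X Y : B} (h : Y ⟶ X) (e : X ⟶ E) {c : X ⟶ C} (σ : c ⟶ e ≫ p),
    (split Y).obj (h ≫ e) (h ◁ σ ≫ (α_ h e p).inv) = h ≫ (split X).obj e σ
  lift_precomp : ∀ {X Y : B} (h : Y ⟶ X) (e : X ⟶ E) {c : X ⟶ C} (σ : c ⟶ e ≫ p),
    (split Y).lift (h ≫ e) (h ◁ σ ≫ (α_ h e p).inv) =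
      eqToHom (obj_precomp h e σ) ≫ h ◁ (split X).lift e σ

open MonoidalCategory CartesianMonoidalCategory

/-! ### Locally indexed categories and functors over a fixed base -/

/-- A locally `C`-indexed category: one collection of objects, for every `c : C` a category
with these objects (`comp f g` is "first `f`, then `g`"), and for every `ρ : d ⟶ c` an
identity-on-objects reindexing functor, functorially in `ρ`. -/
structure IdxCat (C : Type u) [Category.{v} C] where
  Obj : Type w
  Hom : C → Obj → Obj → Type v
  id : ∀ (c : C) (A : Obj), Hom c A A
  comp : ∀ {c : C} {A B D : Obj}, Hom c A B → Hom c B D → Hom c A D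
  id_comp : ∀ {c : C} {A B : Obj} (f : Hom c A B), comp (id c A) f = f
  comp_id : ∀ {c : C} {A B : Obj} (f : Hom c A B), comp f (id c B) = f
  assoc : ∀ {c : C} {A B D E : Obj} (f : Hom c A B) (g : Hom c B D) (k : Hom c D E),
    comp (comp f g) k = comp f (comp g k)
  reind : ∀ {c d : C} {A B : Obj}, (d ⟶ c) → Hom c A B → Hom d A B
  reind_idm : ∀ {c d : C} (ρ : d ⟶ c) (A : Obj), reind ρ (id c A) = id d A
  reind_compm : ∀ {c d : C} (ρ : d ⟶ c) {A B D : Obj} (f : Hom c A B) (g : Hom c B D),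
    reind ρ (comp f g) = comp (reind ρ f) (reind ρ g)
  reind_id : ∀ {c : C} {A B : Obj} (f : Hom c A B), reind (𝟙 c) f = f
  reind_reind : ∀ {c d e : C} (ρ : d ⟶ c) (ρ' : e ⟶ d) {A B : Obj} (f : Hom c A B),
    reind ρ' (reind ρ f) = reind (ρ' ≫ ρ) f

attribute [simp] IdxCat.id_comp IdxCat.comp_id IdxCat.assoc IdxCat.reind_idm
  IdxCat.reind_compm IdxCat.reind_id IdxCat.reind_reind

/-- Change of base `f^* 𝒟` along a functor `f : C ⥤ D`. -/
@[reducible]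
def IdxCat.changeBase {C : Type u} [Category.{v} C] {D : Type u} [Category.{v} D]
    (𝒟 : IdxCat.{w} D) (f : C ⥤ D) : IdxCat.{w} C where
  Obj := 𝒟.Obj
  Hom c A B := 𝒟.Hom (f.obj c) A B
  id c A := 𝒟.id (f.obj c) A
  comp k l := 𝒟.comp k l
  id_comp := by simp
  comp_id := by simp
  assoc := by simp
  reind ρ k := 𝒟.reind (f.map ρ) k
  reind_idm := by simp
  reind_compm := by simp
  reind_id := by simp
  reind_reind := by simp

/-- A locally `C`-indexed functor. -/
structure IdxFunctor {C : Type u} [Category.{v} C] (𝒞 𝒟 : IdxCat.{w} C) where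
  obj : 𝒞.Obj → 𝒟.Obj
  map : ∀ {c : C} {A B : 𝒞.Obj}, 𝒞.Hom c A B → 𝒟.Hom c (obj A) (obj B)
  map_id : ∀ (c : C) (A : 𝒞.Obj), map (𝒞.id c A) = 𝒟.id c (obj A)
  map_comp : ∀ {c : C} {A B E : 𝒞.Obj} (f : 𝒞.Hom c A B) (g : 𝒞.Hom c B E),
    map (𝒞.comp f g) = 𝒟.comp (map f) (map g)
  map_reind : ∀ {c d : C} (ρ : d ⟶ c) {A B : 𝒞.Obj} (f : 𝒞.Hom c A B),
    map (𝒞.reind ρ f) = 𝒟.reind ρ (map f)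

lemma IdxFunctor.ext {C : Type u} [Category.{v} C] {𝒞 𝒟 : IdxCat.{w} C} {F G : IdxFunctor 𝒞 𝒟}
    (ho : ∀ A, F.obj A = G.obj A)
    (hm : ∀ {c : C} {A B : 𝒞.Obj} (k : 𝒞.Hom c A B), HEq (F.map k) (G.map k)) : F = G := by
  obtain ⟨o, m, _, _, _⟩ := F
  obtain ⟨o', m', _, _, _⟩ := G
  obtain rfl : o = o' := funext ho
  have : @m = @m' := by
    funext c A B k
    exact eq_of_heq (hm k)
  subst this
  rfl

/-! ### The 2-category `LInd` -/

/-- A locally indexed category: a category `base` with (chosen) finite products together with a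
locally `base`-indexed category. -/
structure LInd : Type (max (u + 1) (v + 1)) where
  base : Type (max u v)
  [cat : Category.{v} base]
  [cart : CartesianMonoidalCategory base]
  fib : IdxCat.{max u v} base

attribute [instance] LInd.cat LInd.cart

namespace LInd

/-- A locally indexed functor `(f, F)`: a functor `f` preserving finite products, and a locally
indexed functor `F` into the change of base along `f`. -/
structure Mor (X Y : LInd.{v, u}) where
  base : X.base ⥤ Y.base
  [pres : PreservesFiniteProducts base]
  fib : IdxFunctor X.fib (Y.fib.changeBase base)

attribute [instance] Mor.pres

namespace Mor

variable {X Y Z : LInd.{v, u}}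

/-- The action on objects of the indexed category. -/
abbrev obj (F : Mor X Y) (A : X.fib.Obj) : Y.fib.Obj := F.fib.obj A

/-- The action on morphisms: a morphism over `c` goes to a morphism over `f c`. -/
abbrev map (F : Mor X Y) {c : X.base} {A B : X.fib.Obj} (k : X.fib.Hom c A B) :
    Y.fib.Hom (F.base.obj c) (F.obj A) (F.obj B) := F.fib.map k

@[simp] lemma map_id (F : Mor X Y) (c : X.base) (A : X.fib.Obj) :
    F.map (X.fib.id c A) = Y.fib.id _ (F.obj A) := F.fib.map_id c A

@[simp] lemma map_comp (F : Mor X Y) {c : X.base} {A B E : X.fib.Obj}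
    (f : X.fib.Hom c A B) (g : X.fib.Hom c B E) :
    F.map (X.fib.comp f g) = Y.fib.comp (F.map f) (F.map g) := F.fib.map_comp f g

@[simp] lemma map_reind (F : Mor X Y) {c d : X.base} (ρ : d ⟶ c) {A B : X.fib.Obj}
    (f : X.fib.Hom c A B) :
    F.map (X.fib.reind ρ f) = Y.fib.reind (F.base.map ρ) (F.map f) := F.fib.map_reind ρ f

/-- The canonical isomorphism `1 ⟶ f 1`. -/
def unitIso (F : Mor X Y) : 𝟙_ Y.base ⟶ F.base.obj (𝟙_ X.base) :=
  inv (CartesianMonoidalCategory.terminalComparison F.base)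

lemma hom_unit_ext (F : Mor X Y) {c : Y.base} (f g : c ⟶ F.base.obj (𝟙_ X.base)) : f = g := by
  rw [← cancel_mono (CartesianMonoidalCategory.terminalComparison F.base)]
  exact toUnit_unique _ _

/-- Identity locally indexed functor. -/
@[simps]
def idm (X : LInd.{v, u}) : Mor X X where
  base := 𝟭 X.base
  fib :=
    { obj := fun A => A
      map := fun k => k
      map_id := fun _ _ => rfl
      map_comp := fun _ _ => rfl
      map_reind := fun _ _ _ _ => rfl }

/-- Composition of locally indexed functors, in diagrammatic order. -/
@[simps]
def comp (F : Mor X Y) (G : Mor Y Z) : Mor X Z where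
  base := F.base ⋙ G.base
  pres := Limits.comp_preservesFiniteProducts F.base G.base
  fib :=
    { obj := fun A => G.obj (F.obj A)
      map := fun k => G.map (F.map k)
      map_id := fun c A => by simp
      map_comp := fun f g => by simp
      map_reind := fun ρ _ _ f => by simp }

end Mor

/-- A locally indexed 2-cell: a natural transformation `γ` between the base functors and a family
of morphisms over the terminal object `1`, natural up to reindexing along `γ`. -/
@[ext]
structure Cell {X Y : LInd.{v, u}} (F G : Mor X Y) where
  base : F.base ⟶ G.base
  app : ∀ A : X.fib.Obj, Y.fib.Hom (𝟙_ Y.base) (F.obj A) (G.obj A)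
  naturality : ∀ {c : X.base} {A B : X.fib.Obj} (k : X.fib.Hom c A B),
    Y.fib.comp (F.map k) (Y.fib.reind (toUnit (F.base.obj c)) (app B)) =
      Y.fib.comp (Y.fib.reind (toUnit (F.base.obj c)) (app A))
        (Y.fib.reind (base.app c) (G.map k))

namespace Cell

variable {X Y Z : LInd.{v, u}}

/-- Identity 2-cell. -/
@[simps]
def idc (F : Mor X Y) : Cell F F where
  base := 𝟙 F.base
  app A := Y.fib.id _ (F.obj A)
  naturality k := by simp

/-- Vertical composition. -/
@[simps]
def vcomp {F G H : Mor X Y} (σ : Cell F G) (τ : Cell G H) : Cell F H where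
  base := σ.base ≫ τ.base
  app A := Y.fib.comp (σ.app A) (τ.app A)
  naturality {c A B} k := by
    have h := congrArg (Y.fib.reind (σ.base.app c)) (τ.naturality k)
    simp only [IdxCat.reind_compm, IdxCat.reind_reind, comp_toUnit] at h
    rw [IdxCat.reind_compm, ← IdxCat.assoc, σ.naturality, IdxCat.assoc, h]
    simp

end Cell

instance : CategoryStruct LInd.{v, u} where
  Hom := Mor
  id := Mor.idm
  comp := Mor.comp

instance homCategory (X Y : LInd.{v, u}) : Category (X ⟶ Y) where
  Hom F G := Cell F G
  id F := Cell.idc F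
  comp σ τ := Cell.vcomp σ τ
  id_comp _ := Cell.ext (Category.id_comp _) (funext fun _ => IdxCat.id_comp _ _)
  comp_id _ := Cell.ext (Category.comp_id _) (funext fun _ => IdxCat.comp_id _ _)
  assoc _ _ _ := Cell.ext (Category.assoc _ _ _) (funext fun _ => IdxCat.assoc _ _ _ _)

section

variable {X Y Z W : LInd.{v, u}}

@[ext] lemma cell_ext {F G : X ⟶ Y} {σ τ : F ⟶ G} (h : ∀ c, σ.base.app c = τ.base.app c)
    (h' : ∀ A, σ.app A = τ.app A) : σ = τ :=
  Cell.ext (NatTrans.ext (funext h)) (funext h')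

@[simp] lemma id_base (F : X ⟶ Y) : Cell.base (𝟙 F) = 𝟙 _ := rfl
@[simp] lemma id_app (F : X ⟶ Y) (A : X.fib.Obj) : Cell.app (𝟙 F) A = Y.fib.id _ _ := rfl
@[simp] lemma vcomp_base {F G H : X ⟶ Y} (σ : F ⟶ G) (τ : G ⟶ H) :
    Cell.base (σ ≫ τ) = σ.base ≫ τ.base := rfl
@[simp] lemma vcomp_app {F G H : X ⟶ Y} (σ : F ⟶ G) (τ : G ⟶ H) (A : X.fib.Obj) :
    Cell.app (σ ≫ τ) A = Y.fib.comp (σ.app A) (τ.app A) := rfl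

/-- Left whiskering. -/
@[simps]
def whiskerL (F : X ⟶ Y) {G H : Y ⟶ Z} (σ : G ⟶ H) : F ≫ G ⟶ F ≫ H where
  base := Functor.whiskerLeft F.base σ.base
  app A := σ.app (F.obj A)
  naturality k := σ.naturality (F.map k)

/-- Right whiskering: apply the functor to a component over `1`, and reindex along `1 ≅ h 1`. -/
@[simps]
def whiskerR {F G : X ⟶ Y} (σ : F ⟶ G) (H : Y ⟶ Z) : F ≫ H ⟶ G ≫ H where
  base := Functor.whiskerRight σ.base H.base
  app A := Z.fib.reind H.unitIso (H.map (σ.app A))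
  naturality {c A B} k := by
    have h := congrArg H.map (σ.naturality k)
    have e : toUnit (H.base.obj (F.base.obj c)) ≫ H.unitIso =
      H.base.map (toUnit (F.base.obj c)) := H.hom_unit_ext _ _
    simp only [Mor.map_comp, Mor.map_reind] at h
    change Z.fib.comp (H.map (F.map k)) (Z.fib.reind (toUnit (H.base.obj (F.base.obj c)))
      (Z.fib.reind H.unitIso (H.map (σ.app B)))) =
      Z.fib.comp (Z.fib.reind (toUnit (H.base.obj (F.base.obj c)))
        (Z.fib.reind H.unitIso (H.map (σ.app A))))
        (Z.fib.reind (H.base.map (σ.base.app c)) (H.map (G.map k)))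
    rw [IdxCat.reind_reind, IdxCat.reind_reind, e]
    exact h

end

lemma conj_id {X Y : LInd.{v, u}} {F G : X ⟶ Y} (σ : F ⟶ G) :
    σ = 𝟙 F ≫ σ ≫ 𝟙 G := by
  rw [Category.id_comp, Category.comp_id]

lemma whiskerR_id {X Y Z : LInd.{v, u}} (F : X ⟶ Y) (G : Y ⟶ Z) :
    whiskerR (𝟙 F) G = 𝟙 (F ≫ G) := by
  apply Cell.ext
  · exact Functor.whiskerRight_id' G.base
  · funext A
    change Z.fib.reind G.unitIso (G.map (Y.fib.id _ (F.obj A))) = Z.fib.id _ _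
    rw [Mor.map_id, IdxCat.reind_idm]

instance : Bicategory LInd.{v, u} where
  homCategory := homCategory
  whiskerLeft F _ _ σ := whiskerL F σ
  whiskerRight σ H := whiskerR σ H
  associator F G H := Iso.refl (F ≫ G ≫ H : Mor _ _)
  leftUnitor F := Iso.refl (F : Mor _ _)
  rightUnitor F := Iso.refl (F : Mor _ _)
  whiskerLeft_id _ _ := rfl
  whiskerLeft_comp _ _ _ _ _ _ := rfl
  id_whiskerLeft σ := conj_id σ
  comp_whiskerLeft F G _ _ σ := conj_id (whiskerL F (whiskerL G σ))
  id_whiskerRight F G := whiskerR_id F G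
  comp_whiskerRight {X Y Z _ _ _} σ τ H := by
    apply Cell.ext
    · exact Functor.whiskerRight_comp _ _ _
    · funext A
      change Z.fib.reind H.unitIso (H.map (Y.fib.comp (σ.app A) (τ.app A))) =
        Z.fib.comp (Z.fib.reind H.unitIso (H.map (σ.app A)))
          (Z.fib.reind H.unitIso (H.map (τ.app A)))
      rw [Mor.map_comp, IdxCat.reind_compm]
  whiskerRight_id {X Y _ _} σ := by
    refine Eq.trans (b := σ) (Cell.ext rfl ?_) (conj_id σ)
    funext A
    have e : Mor.unitIso (𝟙 Y) = 𝟙 (𝟙_ Y.base) := Mor.hom_unit_ext (𝟙 Y) _ _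
    change Y.fib.reind (Mor.unitIso (𝟙 Y)) (σ.app A) = σ.app A
    rw [e]
    exact Y.fib.reind_id _
  whiskerRight_comp {X Y Z W _ _} σ G H := by
    refine Eq.trans (b := whiskerR (whiskerR σ G) H) (Cell.ext rfl ?_)
      (conj_id (whiskerR (whiskerR σ G) H))
    funext A
    have e : Mor.unitIso (G ≫ H) = H.unitIso ≫ H.base.map G.unitIso :=
      Mor.hom_unit_ext (G ≫ H) _ _
    change W.fib.reind (Mor.unitIso (G ≫ H)) (H.map (G.map (σ.app A))) =
      W.fib.reind H.unitIso (H.map (Z.fib.reind G.unitIso (G.map (σ.app A))))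
    rw [Mor.map_reind, IdxCat.reind_reind, e]
    rfl
  whisker_assoc F _ _ σ H := conj_id (whiskerL F (whiskerR σ H))
  whisker_exchange {X Y Z F G H K} σ τ := by
    apply Cell.ext
    · ext c
      exact (τ.base.naturality (σ.base.app c)).symm
    · funext A
      have h := congrArg (Z.fib.reind H.unitIso) (τ.naturality (σ.app A))
      have e : H.unitIso ≫ toUnit _ = 𝟙 _ := toUnit_unique _ _
      have e' : H.unitIso ≫ τ.base.app _ = K.unitIso := Mor.hom_unit_ext K _ _
      rw [IdxCat.reind_compm, IdxCat.reind_compm, IdxCat.reind_reind, IdxCat.reind_reind,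
        IdxCat.reind_reind, e, e', IdxCat.reind_id, IdxCat.reind_id] at h
      exact h.symm
  pentagon F G H K := by
    have h := whiskerR_id (F ≫ G ≫ H) K
    exact congrArg (fun t => Cell.vcomp t (Cell.vcomp (Cell.idc _) (Cell.idc _))) h |>.trans
      (Category.id_comp (𝟙 (F ≫ G ≫ H ≫ K) ≫ 𝟙 (F ≫ G ≫ H ≫ K)))
  triangle F G := (Category.id_comp (𝟙 (F ≫ G))).trans (whiskerR_id F G).symm

instance : Bicategory.Strict LInd.{v, u} where
  id_comp _ := rfl
  comp_id _ := rfl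
  assoc _ _ _ := rfl
  leftUnitor_eqToIso _ := rfl
  rightUnitor_eqToIso _ := rfl
  associator_eqToIso _ _ _ := rfl

section

variable {X Y Z W : LInd.{v, u}}

lemma mor_id_base : Mor.base (𝟙 X) = 𝟭 _ := rfl
lemma mor_id_obj (A : X.fib.Obj) : Mor.obj (𝟙 X) A = A := rfl
lemma mor_comp_base (F : X ⟶ Y) (G : Y ⟶ Z) : Mor.base (F ≫ G) = F.base ⋙ G.base := rfl
lemma mor_comp_obj (F : X ⟶ Y) (G : Y ⟶ Z) (A : X.fib.Obj) :
    Mor.obj (F ≫ G) A = G.obj (F.obj A) := rfl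
lemma whiskerLeft_base (F : X ⟶ Y) {G H : Y ⟶ Z} (σ : G ⟶ H) (c : X.base) :
    (Cell.base (F ◁ σ)).app c = σ.base.app (F.base.obj c) := rfl
lemma whiskerLeft_app (F : X ⟶ Y) {G H : Y ⟶ Z} (σ : G ⟶ H) (A : X.fib.Obj) :
    Cell.app (F ◁ σ) A = σ.app (F.obj A) := rfl
lemma whiskerRight_base {F G : X ⟶ Y} (σ : F ⟶ G) (H : Y ⟶ Z) (c : X.base) :
    (Cell.base (σ ▷ H)).app c = H.base.map (σ.base.app c) := rfl
lemma whiskerRight_app {F G : X ⟶ Y} (σ : F ⟶ G) (H : Y ⟶ Z) (A : X.fib.Obj) :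
    Cell.app (σ ▷ H) A = Z.fib.reind H.unitIso (H.map (σ.app A)) := rfl
lemma eqToHom_base {F G : X ⟶ Y} (e : F = G) (c : X.base) :
    HEq ((Cell.base (eqToHom e)).app c) (𝟙 (F.base.obj c)) := by
  subst e
  rfl
lemma eqToHom_app {F G : X ⟶ Y} (e : F = G) (A : X.fib.Obj) :
    HEq (Cell.app (eqToHom e) A) (Y.fib.id (𝟙_ Y.base) (F.obj A)) := by
  subst e
  rfl

end

end LInd
/-! ### The 2-category of distributive categories -/

/-- A distributive category, with chosen finite products and chosen finite coproducts. -/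
structure DistCat : Type (max (u + 1) (v + 1)) where
  carrier : Type (max u v)
  [cat : Category.{v} carrier]
  [cart : CartesianMonoidalCategory carrier]
  zero : carrier
  isInitial : IsInitial zero
  sum : carrier → carrier → carrier
  inl : ∀ a b : carrier, a ⟶ sum a b
  inr : ∀ a b : carrier, b ⟶ sum a b
  isCoproduct : ∀ a b : carrier, IsColimit (BinaryCofan.mk (inl a b) (inr a b))
  distrib : ∀ x a b : carrier, IsIso ((isCoproduct (x ⊗ a) (x ⊗ b)).desc
    (BinaryCofan.mk (x ◁ inl a b) (x ◁ inr a b)))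

attribute [instance] DistCat.cat DistCat.cart

namespace DistCat

/-- A bicartesian functor: finite products and coproducts are preserved up to isomorphism. -/
@[ext]
structure Mor (C D : DistCat.{v, u}) where
  functor : C.carrier ⥤ D.carrier
  [presProd : PreservesFiniteProducts functor]
  [presCoprod : PreservesFiniteCoproducts functor]

attribute [instance] Mor.presProd Mor.presCoprod

instance : CategoryStruct DistCat.{v, u} where
  Hom := Mor
  id C := { functor := 𝟭 C.carrier }
  comp F G :=
    { functor := F.functor ⋙ G.functor
      presProd := Limits.comp_preservesFiniteProducts F.functor G.functor
      presCoprod := Limits.comp_preservesFiniteCoproducts F.functor G.functor }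

/-- The 2-cells are all natural transformations. -/
instance homCategory (C D : DistCat.{v, u}) : Category (C ⟶ D) where
  Hom F G := F.functor ⟶ G.functor
  id F := 𝟙 F.functor
  comp σ τ := NatTrans.vcomp σ τ
  id_comp σ := Category.id_comp (obj := C.carrier ⥤ D.carrier) σ
  comp_id σ := Category.comp_id (obj := C.carrier ⥤ D.carrier) σ
  assoc σ τ υ := Category.assoc (obj := C.carrier ⥤ D.carrier) σ τ υ

lemma conj_id {C D : DistCat.{v, u}} {F G : C ⟶ D} (σ : F ⟶ G) :
    σ = 𝟙 F ≫ σ ≫ 𝟙 G := by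
  rw [Category.id_comp, Category.comp_id]

lemma whiskerR_id {C D E : DistCat.{v, u}} (F : C ⟶ D) (G : D ⟶ E) :
    Functor.whiskerRight (𝟙 F.functor) G.functor = 𝟙 (F.functor ⋙ G.functor) :=
  Functor.whiskerRight_id' G.functor

instance : Bicategory DistCat.{v, u} where
  homCategory := homCategory
  whiskerLeft F _ _ σ := Functor.whiskerLeft F.functor σ
  whiskerRight σ H := Functor.whiskerRight σ H.functor
  associator F G H := Iso.refl (F ≫ G ≫ H : Mor _ _)
  leftUnitor F := Iso.refl (F : Mor _ _)
  rightUnitor F := Iso.refl (F : Mor _ _)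
  whiskerLeft_id _ _ := rfl
  whiskerLeft_comp _ _ _ _ _ _ := rfl
  id_whiskerLeft σ := conj_id σ
  comp_whiskerLeft F G _ _ σ :=
    conj_id (F := F ≫ G ≫ _) (G := F ≫ G ≫ _)
      (Functor.whiskerLeft F.functor (Functor.whiskerLeft G.functor σ))
  id_whiskerRight F G := whiskerR_id F G
  comp_whiskerRight σ τ H := Functor.whiskerRight_comp _ _ _
  whiskerRight_id σ := conj_id σ
  whiskerRight_comp σ G H :=
    conj_id (F := (_ ≫ G) ≫ H) (G := (_ ≫ G) ≫ H)
      (Functor.whiskerRight (Functor.whiskerRight σ G.functor) H.functor)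
  whisker_assoc F _ _ σ H :=
    conj_id (F := F ≫ _ ≫ H) (G := F ≫ _ ≫ H)
      (Functor.whiskerLeft F.functor (Functor.whiskerRight σ H.functor))
  whisker_exchange σ τ := by
    apply NatTrans.ext
    funext c
    exact (NatTrans.naturality τ (NatTrans.app σ c)).symm
  pentagon F G H K := by
    have h := whiskerR_id (F ≫ G ≫ H) K
    exact congrArg (fun t => NatTrans.vcomp t (NatTrans.vcomp (NatTrans.id _) (NatTrans.id _))) h
      |>.trans (Category.id_comp (𝟙 (F ≫ G ≫ H ≫ K) ≫ 𝟙 (F ≫ G ≫ H ≫ K)))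
  triangle F G := (Category.id_comp (𝟙 (F ≫ G))).trans (whiskerR_id F G).symm

instance : Bicategory.Strict DistCat.{v, u} where
  id_comp _ := rfl
  comp_id _ := rfl
  assoc _ _ _ := rfl
  leftUnitor_eqToIso _ := rfl
  rightUnitor_eqToIso _ := rfl
  associator_eqToIso _ _ _ := rfl

/-- All the chosen bicartesian structure is preserved on the nose. -/
structure Mor.IsStrict {C D : DistCat.{v, u}} (h : C ⟶ D) : Prop where
  unit : h.functor.obj (𝟙_ C.carrier) = 𝟙_ D.carrier
  prod : ∀ a b, h.functor.obj (a ⊗ b) = h.functor.obj a ⊗ h.functor.obj b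
  fst : ∀ a b, HEq (h.functor.map (fst a b)) (fst (h.functor.obj a) (h.functor.obj b))
  snd : ∀ a b, HEq (h.functor.map (snd a b)) (snd (h.functor.obj a) (h.functor.obj b))
  zero : h.functor.obj C.zero = D.zero
  sum : ∀ a b, h.functor.obj (C.sum a b) = D.sum (h.functor.obj a) (h.functor.obj b)
  inl : ∀ a b, HEq (h.functor.map (C.inl a b)) (D.inl (h.functor.obj a) (h.functor.obj b))
  inr : ∀ a b, HEq (h.functor.map (C.inr a b)) (D.inr (h.functor.obj a) (h.functor.obj b))

/-! ### The 2-functor `self` -/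

/-- The locally indexed category `self C`: morphisms `A ⟶ B` over `c` are morphisms `c × A ⟶ B`. -/
@[reducible]
def selfIdx (C : Type u) [Category.{v} C] [CartesianMonoidalCategory C] : IdxCat.{u} C where
  Obj := C
  Hom c A B := c ⊗ A ⟶ B
  id c A := snd c A
  comp {c A _ _} f g := lift (fst c A) f ≫ g
  id_comp := by simp
  comp_id := by simp
  assoc f g k := by
    rw [← Category.assoc]
    congr 1
    ext <;> simp
  reind {_ _ A _} ρ f := ρ ▷ A ≫ f
  reind_idm := by simp
  reind_compm ρ A B D f g := by
    rw [← Category.assoc, ← Category.assoc]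
    congr 1
    ext <;> simp
  reind_id := by simp
  reind_reind := by simp

/-- `self` on objects. -/
@[reducible]
def self (C : DistCat.{v, u}) : LInd.{v, u} where
  base := C.carrier
  fib := selfIdx C.carrier

/-- The canonical isomorphism `h a × h b ≅ h (a × b)`. -/
def prodInv {C D : DistCat.{v, u}} (h : C ⟶ D) (a b : C.carrier) :
    h.functor.obj a ⊗ h.functor.obj b ⟶ h.functor.obj (a ⊗ b) :=
  haveI := h.presProd
  inv (CartesianMonoidalCategory.prodComparison h.functor a b)

@[simp] lemma prodInv_fst {C D : DistCat.{v, u}} (h : C ⟶ D) (a b : C.carrier) :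
    prodInv h a b ≫ h.functor.map (fst a b) = fst _ _ := by
  have := h.presProd
  simp [prodInv]

@[simp] lemma prodInv_snd {C D : DistCat.{v, u}} (h : C ⟶ D) (a b : C.carrier) :
    prodInv h a b ≫ h.functor.map (snd a b) = snd _ _ := by
  have := h.presProd
  simp [prodInv]

lemma prod_hom_ext {C D : DistCat.{v, u}} (h : C ⟶ D) {a b : C.carrier} {x : D.carrier}
    {f g : x ⟶ h.functor.obj (a ⊗ b)}
    (h₁ : f ≫ h.functor.map (fst a b) = g ≫ h.functor.map (fst a b))
    (h₂ : f ≫ h.functor.map (snd a b) = g ≫ h.functor.map (snd a b)) : f = g := by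
  have := h.presProd
  rw [← cancel_mono (CartesianMonoidalCategory.prodComparison h.functor a b)]
  apply CartesianMonoidalCategory.hom_ext <;> simpa

lemma prodInv_lift {C D : DistCat.{v, u}} (h : C ⟶ D) {c A B : C.carrier} (f : c ⊗ A ⟶ B) :
    prodInv h c A ≫ h.functor.map (lift (fst c A) f) =
      lift (fst _ _) (prodInv h c A ≫ h.functor.map f) ≫ prodInv h c B := by
  apply prod_hom_ext h
  · rw [Category.assoc, Category.assoc, ← Functor.map_comp, lift_fst, prodInv_fst, prodInv_fst,
      lift_fst]
  · rw [Category.assoc, Category.assoc, ← Functor.map_comp, lift_snd, prodInv_snd, lift_snd]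

lemma prodInv_whiskerRight {C D : DistCat.{v, u}} (h : C ⟶ D) {c d : C.carrier} (ρ : d ⟶ c)
    (A : C.carrier) :
    prodInv h d A ≫ h.functor.map (ρ ▷ A) = h.functor.map ρ ▷ h.functor.obj A ≫ prodInv h c A := by
  apply prod_hom_ext h
  · rw [Category.assoc, Category.assoc, ← Functor.map_comp, whiskerRight_fst, prodInv_fst,
      Functor.map_comp, ← Category.assoc, prodInv_fst, whiskerRight_fst]
  · rw [Category.assoc, Category.assoc, ← Functor.map_comp, whiskerRight_snd, prodInv_snd,
      prodInv_snd, whiskerRight_snd]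

lemma prodInv_natural {C D : DistCat.{v, u}} (h k : C ⟶ D) (γ : h.functor ⟶ k.functor)
    (c A : C.carrier) :
    prodInv h c A ≫ γ.app (c ⊗ A) = (γ.app c ⊗ₘ γ.app A) ≫ prodInv k c A := by
  apply prod_hom_ext k
  · rw [Category.assoc, Category.assoc, ← γ.naturality, prodInv_fst, ← Category.assoc,
      prodInv_fst, tensorHom_fst]
  · rw [Category.assoc, Category.assoc, ← γ.naturality, prodInv_snd, ← Category.assoc,
      prodInv_snd, tensorHom_snd]

lemma prodInv_id (C : DistCat.{v, u}) (a b : C.carrier) : prodInv (𝟙 C) a b = 𝟙 (a ⊗ b) :=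
  prod_hom_ext (𝟙 C) ((prodInv_fst (𝟙 C) a b).trans (Category.id_comp _).symm)
    ((prodInv_snd (𝟙 C) a b).trans (Category.id_comp _).symm)

lemma prodInv_comp {C D E : DistCat.{v, u}} (h : C ⟶ D) (k : D ⟶ E) (a b : C.carrier) :
    prodInv (h ≫ k) a b = prodInv k _ _ ≫ k.functor.map (prodInv h a b) := by
  apply prod_hom_ext (h ≫ k)
  · refine (prodInv_fst (h ≫ k) a b).trans ?_
    change _ = (prodInv k _ _ ≫ k.functor.map (prodInv h a b)) ≫
      k.functor.map (h.functor.map (fst a b))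
    rw [Category.assoc, ← Functor.map_comp, prodInv_fst, prodInv_fst]
    rfl
  · refine (prodInv_snd (h ≫ k) a b).trans ?_
    change _ = (prodInv k _ _ ≫ k.functor.map (prodInv h a b)) ≫
      k.functor.map (h.functor.map (snd a b))
    rw [Category.assoc, ← Functor.map_comp, prodInv_snd, prodInv_snd]
    rfl

/-- `self` on 1-cells. -/
@[simps]
def selfMap {C D : DistCat.{v, u}} (h : C ⟶ D) : self C ⟶ self D where
  base := h.functor
  pres := h.presProd
  fib :=
    { obj := fun A => h.functor.obj A
      map := fun {c A _} k => prodInv h c A ≫ h.functor.map k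
      map_id := fun c A => prodInv_snd h c A
      map_comp := fun {c A B E} f g => by
        have e := prodInv_lift h f
        change prodInv h c A ≫ h.functor.map (lift (fst c A) f ≫ g) =
          lift (fst _ _) (prodInv h c A ≫ h.functor.map f) ≫ prodInv h c B ≫ h.functor.map g
        rw [Functor.map_comp, ← Category.assoc, e, Category.assoc]
      map_reind := fun {c d} ρ A B f => by
        have e := prodInv_whiskerRight h ρ A
        change prodInv h d A ≫ h.functor.map (ρ ▷ A ≫ f) =
          h.functor.map ρ ▷ _ ≫ prodInv h c A ≫ h.functor.map f
        rw [Functor.map_comp, ← Category.assoc, e, Category.assoc] }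

/-- `self` on 2-cells. -/
@[simps]
def selfMap₂ {C D : DistCat.{v, u}} {h k : C ⟶ D} (γ : h ⟶ k) : selfMap h ⟶ selfMap k where
  base := γ
  app A := snd _ _ ≫ NatTrans.app γ A
  naturality {c A B} f := by
    have n : h.functor.map f ≫ NatTrans.app γ B = NatTrans.app γ (c ⊗ A) ≫ k.functor.map f :=
      NatTrans.naturality γ f
    have e := prodInv_natural h k γ c A
    have e' : lift (fst _ _) (toUnit (h.functor.obj c) ▷ h.functor.obj A ≫ snd _ _ ≫
        NatTrans.app γ A) ≫ NatTrans.app γ c ▷ _ = (NatTrans.app γ c ⊗ₘ NatTrans.app γ A) := by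
      ext <;> simp
    change lift (fst _ _) (prodInv h c A ≫ h.functor.map f) ≫ toUnit _ ▷ _ ≫ snd _ _ ≫
        NatTrans.app γ B = lift (fst _ _) (toUnit _ ▷ _ ≫ snd _ _ ≫ NatTrans.app γ A) ≫
        NatTrans.app γ c ▷ _ ≫ prodInv k c A ≫ k.functor.map f
    rw [← Category.assoc (lift _ _) (NatTrans.app γ c ▷ _), e', ← Category.assoc (_ ⊗ₘ _), ← e,
      Category.assoc, ← n]
    simp

lemma selfMap_id (C : DistCat.{v, u}) : selfMap (𝟙 C) = 𝟙 (self C) := by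
  refine congrArg (fun t => (LInd.Mor.mk (𝟭 C.carrier) t : LInd.Mor (self C) (self C)))
    (IdxFunctor.ext (fun _ => rfl) fun {c A B} k => heq_of_eq ?_)
  change prodInv (𝟙 C) c A ≫ k = k
  rw [prodInv_id]
  exact Category.id_comp k

lemma selfMap_comp {C D E : DistCat.{v, u}} (h : C ⟶ D) (k : D ⟶ E) :
    selfMap (h ≫ k) = selfMap h ≫ selfMap k := by
  refine congrArg (fun t => (@LInd.Mor.mk (self C) (self E) (h.functor ⋙ k.functor)
    (h ≫ k).presProd t)) (IdxFunctor.ext (fun _ => rfl) fun {c A B} l => heq_of_eq ?_)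
  change prodInv (h ≫ k) c A ≫ k.functor.map (h.functor.map l) =
    prodInv k _ _ ≫ k.functor.map (prodInv h c A ≫ h.functor.map l)
  rw [prodInv_comp, Functor.map_comp]
  exact Category.assoc _ _ _

lemma selfMap₂_id {C D : DistCat.{v, u}} (h : C ⟶ D) : selfMap₂ (𝟙 h) = 𝟙 (selfMap h) := by
  apply LInd.cell_ext
  · intro c
    rfl
  · intro A
    exact Category.comp_id (snd (𝟙_ D.carrier) (h.functor.obj A))

lemma selfMap₂_vcomp {C D : DistCat.{v, u}} {h k l : C ⟶ D} (γ : h ⟶ k) (δ : k ⟶ l) :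
    selfMap₂ (γ ≫ δ) = selfMap₂ γ ≫ selfMap₂ δ := by
  apply LInd.cell_ext
  · intro c
    rfl
  · intro A
    change snd (𝟙_ D.carrier) _ ≫ NatTrans.app γ A ≫ NatTrans.app δ A =
      lift (fst _ _) (snd _ _ ≫ NatTrans.app γ A) ≫ snd _ _ ≫ NatTrans.app δ A
    rw [← Category.assoc (lift _ _), lift_snd, Category.assoc]

lemma conj_eqToHom {X Y : LInd.{v, u}} {F F' G G' : X ⟶ Y} (e : F = F') (e' : G' = G)
    (σ : F' ⟶ G') (τ : F ⟶ G) (hb : ∀ c, HEq ((LInd.Cell.base σ).app c) ((LInd.Cell.base τ).app c))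
    (ha : ∀ A, HEq (LInd.Cell.app σ A) (LInd.Cell.app τ A)) :
    τ = eqToHom e ≫ σ ≫ eqToHom e' := by
  subst e e'
  rw [eqToHom_refl, eqToHom_refl, Category.id_comp, Category.comp_id]
  exact LInd.cell_ext (fun c => (eq_of_heq (hb c)).symm) (fun A => (eq_of_heq (ha A)).symm)

lemma selfMap₂_whiskerLeft {C D E : DistCat.{v, u}} (h : C ⟶ D) {k l : D ⟶ E} (γ : k ⟶ l) :
    selfMap₂ (h ◁ γ) = eqToHom (selfMap_comp h k) ≫ selfMap h ◁ selfMap₂ γ ≫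
      eqToHom (selfMap_comp h l).symm :=
  conj_eqToHom _ _ _ _ (fun _ => HEq.rfl) (fun _ => HEq.rfl)

lemma selfMap₂_whiskerRight {C D E : DistCat.{v, u}} {h k : C ⟶ D} (γ : h ⟶ k) (l : D ⟶ E) :
    selfMap₂ (γ ▷ l) = eqToHom (selfMap_comp h l) ≫ selfMap₂ γ ▷ selfMap l ≫
      eqToHom (selfMap_comp k l).symm := by
  refine conj_eqToHom _ _ _ _ (fun _ => HEq.rfl) (fun A => heq_of_eq ?_)
  change LInd.Mor.unitIso (selfMap l) ▷ l.functor.obj (h.functor.obj A) ≫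
    prodInv l (𝟙_ D.carrier) (h.functor.obj A) ≫ l.functor.map (snd _ _ ≫ NatTrans.app γ A) =
    snd _ _ ≫ l.functor.map (NatTrans.app γ A)
  have e : ∀ (x y z : D.carrier) (t : E.carrier) (ι : t ⟶ l.functor.obj x) (s : y ⟶ z),
      ι ▷ l.functor.obj y ≫ prodInv l x y ≫ l.functor.map (snd _ _ ≫ s) =
        snd _ _ ≫ l.functor.map s := by
    intro x y z t ι s
    rw [Functor.map_comp, ← Category.assoc (prodInv _ _ _), prodInv_snd, ← Category.assoc,
      whiskerRight_snd]
  exact e _ _ _ _ _ _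

end DistCat

/-! ### Products, powers and distributive coproducts in a locally indexed category -/

section Structure

variable {C : Type u} [Category.{v} C] [CartesianMonoidalCategory C]

/-- (Chosen) finite products in a locally indexed category. -/
structure IdxCat.Products (𝒞 : IdxCat.{w} C) where
  obj : ∀ {n : ℕ}, (Fin n → 𝒞.Obj) → 𝒞.Obj
  π : ∀ {n : ℕ} (B : Fin n → 𝒞.Obj) (i : Fin n), 𝒞.Hom (𝟙_ C) (obj B) (B i)
  universal : ∀ {n : ℕ} (B : Fin n → 𝒞.Obj) (c : C) (A : 𝒞.Obj),
    Function.Bijective fun (f : 𝒞.Hom c A (obj B)) (i : Fin n) =>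
      𝒞.comp f (𝒞.reind (toUnit c) (π B i))

/-- (Chosen) powers `c ⇒ B` in a locally indexed category. -/
structure IdxCat.Powers (𝒞 : IdxCat.{w} C) where
  obj : C → 𝒞.Obj → 𝒞.Obj
  eval : ∀ (c : C) (B : 𝒞.Obj), 𝒞.Hom c (obj c B) B
  universal : ∀ (b c : C) (A B : 𝒞.Obj),
    Function.Bijective fun f : 𝒞.Hom b A (obj c B) =>
      𝒞.comp (𝒞.reind (fst b c) f) (𝒞.reind (snd b c) (eval c B))

/-- The finite coproducts of `C` are distributive in `𝒞`. -/
def IdxCat.CoproductsDistribute (𝒞 : IdxCat.{w} C) : Prop :=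
  ∀ {n : ℕ} (b : Fin n → C) (s : Cofan b), IsColimit s → ∀ (a : C) (A B : 𝒞.Obj),
    Function.Bijective fun (f : 𝒞.Hom (a ⊗ s.pt) A B) (i : Fin n) => 𝒞.reind (a ◁ s.inj i) f

variable {D : Type u} [Category.{v} D] [CartesianMonoidalCategory D]

/-- `H : 𝒞 ⟶ h^* 𝒟` preserves finite products: the canonical map `⟨H π_i⟩_i`, which is a map over
the index `1` of `h^* 𝒟`, is invertible. -/
def IdxFunctor.PreservesProducts {𝒞 : IdxCat.{w} C} {𝒟 : IdxCat.{w} D} {h : C ⥤ D}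
    (H : IdxFunctor 𝒞 (𝒟.changeBase h)) (P : 𝒞.Products) (Q : 𝒟.Products) : Prop :=
  ∀ {n : ℕ} (B : Fin n → 𝒞.Obj),
    ∃ (m : 𝒟.Hom (h.obj (𝟙_ C)) (H.obj (P.obj B)) (Q.obj fun i => H.obj (B i)))
      (m' : 𝒟.Hom (h.obj (𝟙_ C)) (Q.obj fun i => H.obj (B i)) (H.obj (P.obj B))),
      (∀ i, 𝒟.comp m (𝒟.reind (toUnit _) (Q.π (fun i => H.obj (B i)) i)) = H.map (P.π B i)) ∧
      𝒟.comp m m' = 𝒟.id _ _ ∧ 𝒟.comp m' m = 𝒟.id _ _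

/-- `H` preserves the chosen finite products on the nose (by uniqueness it then also preserves
tuples). -/
structure IdxFunctor.StrictlyPreservesProducts {𝒞 : IdxCat.{w} C} {𝒟 : IdxCat.{w} D} {h : C ⥤ D}
    (H : IdxFunctor 𝒞 (𝒟.changeBase h)) (P : 𝒞.Products) (Q : 𝒟.Products) : Prop where
  obj : ∀ {n : ℕ} (B : Fin n → 𝒞.Obj), H.obj (P.obj B) = Q.obj fun i => H.obj (B i)
  π : ∀ {n : ℕ} (B : Fin n → 𝒞.Obj) (i : Fin n),
    HEq (H.map (P.π B i)) (Q.π (fun i => H.obj (B i)) i)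

/-- `H` preserves the chosen powers on the nose (by uniqueness it then also preserves
transposes). -/
structure IdxFunctor.StrictlyPreservesPowers {𝒞 : IdxCat.{w} C} {𝒟 : IdxCat.{w} D} {h : C ⥤ D}
    (H : IdxFunctor 𝒞 (𝒟.changeBase h)) (P : 𝒞.Powers) (Q : 𝒟.Powers) : Prop where
  obj : ∀ (c : C) (B : 𝒞.Obj), H.obj (P.obj c B) = Q.obj (h.obj c) (H.obj B)
  eval : ∀ (c : C) (B : 𝒞.Obj), HEq (H.map (P.eval c B)) (Q.eval (h.obj c) (H.obj B))

end Structure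

/-- A locally `C`-indexed functor as a 1-cell `(id_C, F)` of `LInd`. -/
@[simps]
def IdxFunctor.toLInd {C : Type (max u v)} [Category.{v} C] [CartesianMonoidalCategory C]
    {𝒞 𝒟 : IdxCat.{max u v} C} (F : IdxFunctor 𝒞 𝒟) :
    (LInd.mk C 𝒞 : LInd.{v, u}) ⟶ LInd.mk C 𝒟 where
  base := 𝟭 C
  fib :=
    { obj := F.obj
      map := F.map
      map_id := F.map_id
      map_comp := F.map_comp
      map_reind := F.map_reind }

/-! ### CBPV models -/

/-- A CBPV model: a distributive category `val` of values, a locally indexed category `comp` of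
computations, an adjunction `F ⊣ U` of locally `val`-indexed functors between `self val` and `comp`
(that is, an adjunction in `LInd` all of whose base components are identities), such that `comp`
has products and powers and the coproducts of `val` are distributive in `comp`. -/
structure Model : Type (max (u + 1) (v + 1)) where
  val : DistCat.{v, u}
  comp : IdxCat.{max u v} val.carrier
  F : IdxFunctor (DistCat.selfIdx val.carrier) comp
  U : IdxFunctor comp (DistCat.selfIdx val.carrier)
  adj : Bicategory.Adjunction F.toLInd U.toLInd
  unit_base : ∀ c : val.carrier, (LInd.Cell.base adj.unit).app c = 𝟙 c
  counit_base : ∀ c : val.carrier, (LInd.Cell.base adj.counit).app c = 𝟙 c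
  products : comp.Products
  powers : comp.Powers
  distributive : comp.CoproductsDistribute

namespace Model

/-- The underlying locally indexed category `(C, 𝒞)` of a model. -/
abbrev lind (M : Model.{v, u}) : LInd.{v, u} := LInd.mk M.val.carrier M.comp

/-- The left adjoint as a 1-cell of `LInd`. -/
abbrev left (M : Model.{v, u}) : DistCat.self M.val ⟶ M.lind := M.F.toLInd

/-- The right adjoint as a 1-cell of `LInd`. -/
abbrev right (M : Model.{v, u}) : M.lind ⟶ DistCat.self M.val := M.U.toLInd

/-- The 1-cell `(h, H)` of `LInd`. -/
abbrev pair {M N : Model.{v, u}} (h : M.val ⟶ N.val)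
    (H : IdxFunctor M.comp (N.comp.changeBase h.functor)) : M.lind ⟶ N.lind :=
  @LInd.Mor.mk M.lind N.lind h.functor h.presProd H

/-- A lax (first-order) 1-cell of CBPV models: a bicartesian functor `h`, a locally indexed functor
`H` preserving products, and 2-cells `(id, α)`, `(id, β)` making
`(self h, (h, H), (id, α), (id, β))` a lax morphism of adjunctions in `LInd`. -/
structure Mor (M N : Model.{v, u}) where
  h : M.val ⟶ N.val
  H : IdxFunctor M.comp (N.comp.changeBase h.functor)
  preservesProducts : H.PreservesProducts M.products N.products
  α : M.left ≫ pair h H ⟶ DistCat.selfMap h ≫ N.left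
  β : M.right ≫ DistCat.selfMap h ⟶ pair h H ≫ N.right
  α_base : ∀ c : M.val.carrier, (LInd.Cell.base α).app c = 𝟙 (h.functor.obj c)
  β_base : ∀ c : M.val.carrier, (LInd.Cell.base β).app c = 𝟙 (h.functor.obj c)
  isLax : IsLaxAdjMor M.adj N.adj α β

namespace Mor

/-- The underlying 1-cell `(h, H)` of `LInd`. -/
abbrev lind {M N : Model.{v, u}} (f : Mor M N) : M.lind ⟶ N.lind := pair f.h f.H

lemma ext_of_eq {M N : Model.{v, u}} {f g : Mor M N} (h₁ : f.h = g.h) (h₂ : HEq f.H g.H)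
    (h₃ : HEq f.α g.α) (h₄ : HEq f.β g.β) : f = g := by
  obtain ⟨h, H, _, α, β, _, _, _⟩ := f
  obtain ⟨h', H', _, α', β', _, _, _⟩ := g
  obtain rfl : h = h' := h₁
  obtain rfl : H = H' := eq_of_heq h₂
  obtain rfl : α = α' := eq_of_heq h₃
  obtain rfl : β = β' := eq_of_heq h₄
  rfl

section Components

variable {X₀ X₁ Y₀ Y₁ Z₀ Z₁ : LInd.{v, u}} {l : X₀ ⟶ X₁} {l' : Y₀ ⟶ Y₁} {l'' : Z₀ ⟶ Z₁}
  {m : X₀ ⟶ Y₀} {n : X₁ ⟶ Y₁} {m' : Y₀ ⟶ Z₀} {n' : Y₁ ⟶ Z₁}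

lemma paste_base (σ : l ≫ n ⟶ m ≫ l') (τ : l' ≫ n' ⟶ m' ≫ l'') (c : X₀.base) :
    (LInd.Cell.base (paste σ τ)).app c =
      n'.base.map ((LInd.Cell.base σ).app c) ≫ (LInd.Cell.base τ).app (m.base.obj c) := by
  refine (Category.id_comp _).trans ?_
  refine congrArg (_ ≫ ·) ?_
  refine (Category.id_comp _).trans ?_
  exact Category.comp_id _

lemma paste_app (σ : l ≫ n ⟶ m ≫ l') (τ : l' ≫ n' ⟶ m' ≫ l'') (A : X₀.fib.Obj) :
    LInd.Cell.app (paste σ τ) A = Z₁.fib.comp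
      (Z₁.fib.reind n'.unitIso (n'.map (LInd.Cell.app σ A))) (LInd.Cell.app τ (m.obj A)) := by
  refine (Z₁.fib.id_comp _).trans ?_
  refine congrArg (Z₁.fib.comp _) ?_
  refine (Z₁.fib.id_comp _).trans ?_
  exact Z₁.fib.comp_id _

lemma comp_eqToHom_whiskerRight_heq {m₁ m₂ : X₀ ⟶ Y₀} (e : m₁ = m₂) {t : X₀ ⟶ Y₁}
    (σ : t ⟶ m₁ ≫ l') : HEq (σ ≫ eqToHom e ▷ l') σ := by
  subst e
  simp

lemma eqToHom_whiskerLeft_comp_heq {m₁ m₂ : X₀ ⟶ Y₀} (e : m₁ = m₂) {r : Y₁ ⟶ X₀} {t : Y₁ ⟶ Y₀}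
    (σ : r ≫ m₂ ⟶ t) : HEq (r ◁ eqToHom e ≫ σ) σ := by
  subst e
  simp

lemma cell_base_heq {X Y : LInd.{v, u}} {F F' G G' : X ⟶ Y} (e : F = F') (e' : G = G')
    {σ : F ⟶ G} {τ : F' ⟶ G'} (h : HEq σ τ) (c : X.base) :
    HEq ((LInd.Cell.base σ).app c) ((LInd.Cell.base τ).app c) := by
  subst e e' h
  rfl

lemma cell_app_heq {X Y : LInd.{v, u}} {F F' G G' : X ⟶ Y} (e : F = F') (e' : G = G')
    {σ : F ⟶ G} {τ : F' ⟶ G'} (h : HEq σ τ) (A : X.fib.Obj) :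
    HEq (LInd.Cell.app σ A) (LInd.Cell.app τ A) := by
  subst e e' h
  rfl

end Components

/-- Identity 1-cell. -/
def idm (M : Model.{v, u}) : Mor M M where
  h := 𝟙 M.val
  H := LInd.Mor.fib (𝟙 M.lind)
  preservesProducts B := ⟨M.comp.id _ _, M.comp.id _ _, fun i => by
    have e : toUnit (𝟙_ M.val.carrier) = 𝟙 _ := toUnit_unique _ _
    change M.comp.comp (M.comp.id _ _) (M.comp.reind (toUnit (𝟙_ M.val.carrier)) _) = _
    rw [M.comp.id_comp, e]
    exact M.comp.reind_id _, M.comp.id_comp _, M.comp.id_comp _⟩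
  α := pasteId M.left ≫ eqToHom (DistCat.selfMap_id M.val).symm ▷ M.left
  β := M.right ◁ eqToHom (DistCat.selfMap_id M.val) ≫ pasteId M.right
  α_base c := (eq_of_heq (cell_base_heq rfl (by rw [DistCat.selfMap_id])
    (comp_eqToHom_whiskerRight_heq (DistCat.selfMap_id M.val).symm (pasteId M.left)) c)).trans
    (Category.comp_id _)
  β_base c := (eq_of_heq (cell_base_heq (by rw [DistCat.selfMap_id]) rfl
    (eqToHom_whiskerLeft_comp_heq (DistCat.selfMap_id M.val) (pasteId M.right)) c)).trans
    (Category.comp_id _)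
  isLax := (isLaxAdjMor_id M.adj).transport (DistCat.selfMap_id M.val).symm

/-- Composition of 1-cells: paste the 2-cells. -/
def comp {M N K : Model.{v, u}} (f : Mor M N) (g : Mor N K) : Mor M K where
  h := f.h ≫ g.h
  H := LInd.Mor.fib (f.lind ≫ g.lind)
  preservesProducts B := by
    obtain ⟨m, m', h₁, h₂, h₃⟩ := f.preservesProducts B
    obtain ⟨k, k', h₁', h₂', h₃'⟩ := g.preservesProducts (fun i => f.H.obj (B i))
    let ρ : g.h.functor.obj (f.h.functor.obj (𝟙_ _)) ⟶ g.h.functor.obj (𝟙_ _) :=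
      g.h.functor.map (toUnit _)
    refine ⟨K.comp.comp (g.lind.map m) (K.comp.reind ρ k),
      K.comp.comp (K.comp.reind ρ k') (g.lind.map m'), fun i => ?_, ?_, ?_⟩
    · have e := congrArg (fun t => K.comp.comp (g.lind.map m) (K.comp.reind ρ t)) (h₁' i)
      have e' := congrArg g.lind.map (h₁ i)
      have e'' : ρ ≫ toUnit _ = toUnit _ := toUnit_unique _ _
      rw [LInd.Mor.map_comp, LInd.Mor.map_reind] at e'
      rw [IdxCat.reind_compm, IdxCat.reind_reind, e''] at e
      exact (K.comp.assoc _ _ _).trans (e.trans e')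
    · have e := congrArg (K.comp.reind ρ) h₂'
      have e' := congrArg g.lind.map h₂
      rw [IdxCat.reind_compm, IdxCat.reind_idm] at e
      rw [LInd.Mor.map_comp, LInd.Mor.map_id] at e'
      refine (K.comp.assoc _ _ _).trans ?_
      refine (congrArg (K.comp.comp (g.lind.map m)) ((K.comp.assoc _ _ _).symm)).trans ?_
      refine (congrArg (fun t => K.comp.comp (g.lind.map m) (K.comp.comp t (g.lind.map m')))
        e).trans ?_
      exact (congrArg (K.comp.comp (g.lind.map m)) (K.comp.id_comp _)).trans e'
    · have e := congrArg (K.comp.reind ρ) h₃'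
      have e' := congrArg g.lind.map h₃
      rw [IdxCat.reind_compm, IdxCat.reind_idm] at e
      rw [LInd.Mor.map_comp, LInd.Mor.map_id] at e'
      refine (K.comp.assoc _ _ _).trans ?_
      refine (congrArg (K.comp.comp (K.comp.reind ρ k')) ((K.comp.assoc _ _ _).symm)).trans ?_
      refine (congrArg (fun t => K.comp.comp (K.comp.reind ρ k')
        (K.comp.comp t (K.comp.reind ρ k))) e').trans ?_
      exact (congrArg (K.comp.comp (K.comp.reind ρ k')) (K.comp.id_comp _)).trans e
  α := paste f.α g.α ≫ eqToHom (DistCat.selfMap_comp f.h g.h).symm ▷ K.left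
  β := M.right ◁ eqToHom (DistCat.selfMap_comp f.h g.h) ≫ paste f.β g.β
  α_base c := by
    refine (eq_of_heq (cell_base_heq rfl (by rw [DistCat.selfMap_comp])
      (comp_eqToHom_whiskerRight_heq (DistCat.selfMap_comp f.h g.h).symm (paste f.α g.α))
      c)).trans ?_
    refine (paste_base f.α g.α c).trans ?_
    rw [f.α_base]
    exact (congrArg (_ ≫ ·) (g.α_base _)).trans
      ((Category.comp_id _).trans (g.h.functor.map_id _))
  β_base c := by
    refine (eq_of_heq (cell_base_heq (by rw [DistCat.selfMap_comp]) rfl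
      (eqToHom_whiskerLeft_comp_heq (DistCat.selfMap_comp f.h g.h) (paste f.β g.β)) c)).trans ?_
    refine (paste_base f.β g.β c).trans ?_
    rw [f.β_base]
    exact (congrArg (_ ≫ ·) (g.β_base _)).trans
      ((Category.comp_id _).trans (g.h.functor.map_id _))
  isLax := (f.isLax.paste g.isLax).transport (DistCat.selfMap_comp f.h g.h).symm

lemma idm_α_app (M : Model.{v, u}) (A : M.val.carrier) :
    LInd.Cell.app (idm M).α A = M.comp.id _ _ :=
  (eq_of_heq (cell_app_heq rfl (by rw [DistCat.selfMap_id])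
    (comp_eqToHom_whiskerRight_heq (DistCat.selfMap_id M.val).symm (pasteId M.left)) A)).trans
    (M.comp.id_comp _)

lemma idm_β_app (M : Model.{v, u}) (A : M.comp.Obj) :
    LInd.Cell.app (idm M).β A = (DistCat.self M.val).fib.id _ _ :=
  (eq_of_heq (cell_app_heq (by rw [DistCat.selfMap_id]) rfl
    (eqToHom_whiskerLeft_comp_heq (DistCat.selfMap_id M.val) (pasteId M.right)) A)).trans
    ((DistCat.self M.val).fib.id_comp _)

lemma comp_α_app {M N K : Model.{v, u}} (f : Mor M N) (g : Mor N K) (A : M.val.carrier) :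
    LInd.Cell.app (f.comp g).α A = K.comp.comp
      (K.comp.reind g.lind.unitIso (g.lind.map (LInd.Cell.app f.α A)))
      (LInd.Cell.app g.α (f.h.functor.obj A)) :=
  (eq_of_heq (cell_app_heq rfl (by rw [DistCat.selfMap_comp])
    (comp_eqToHom_whiskerRight_heq (DistCat.selfMap_comp f.h g.h).symm (paste f.α g.α)) A)).trans
    (paste_app f.α g.α A)

lemma comp_β_app {M N K : Model.{v, u}} (f : Mor M N) (g : Mor N K) (A : M.comp.Obj) :
    LInd.Cell.app (f.comp g).β A = (DistCat.self K.val).fib.comp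
      ((DistCat.self K.val).fib.reind (LInd.Mor.unitIso (DistCat.selfMap g.h))
        ((LInd.Mor.map (DistCat.selfMap g.h)) (LInd.Cell.app f.β A)))
      (LInd.Cell.app g.β (f.H.obj A)) :=
  (eq_of_heq (cell_app_heq (by rw [DistCat.selfMap_comp]) rfl
    (eqToHom_whiskerLeft_comp_heq (DistCat.selfMap_comp f.h g.h) (paste f.β g.β)) A)).trans
    (paste_app f.β g.β A)

end Mor

/-- A 2-cell of CBPV models: a 2-cell `(γ, γ')` of `LInd` such that `(self γ, (γ, γ'))` is a
modification of lax morphisms of adjunctions. -/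
structure Cell {M N : Model.{v, u}} (f g : Mor M N) where
  cell : f.lind ⟶ g.lind
  left : M.left ◁ cell ≫ g.α =
    f.α ≫ DistCat.selfMap₂ (h := f.h) (k := g.h) (LInd.Cell.base cell) ▷ N.left
  right : M.right ◁ DistCat.selfMap₂ (h := f.h) (k := g.h) (LInd.Cell.base cell) ≫ g.β =
    f.β ≫ cell ▷ N.right

lemma Cell.ext {M N : Model.{v, u}} {f g : Mor M N} {σ τ : Cell f g} (h : σ.cell = τ.cell) :
    σ = τ := by
  cases σ
  cases τ
  cases h
  rfl

instance : CategoryStruct Model.{v, u} where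
  Hom := Mor
  id := Mor.idm
  comp := Mor.comp

instance homCategory (M N : Model.{v, u}) : Category (M ⟶ N) where
  Hom f g := Cell f g
  id f := ⟨𝟙 f.lind, by
    have e : DistCat.selfMap₂ (h := f.h) (k := f.h) (LInd.Cell.base (𝟙 f.lind)) = 𝟙 _ :=
      DistCat.selfMap₂_id f.h
    rw [e, Bicategory.whiskerLeft_id, Bicategory.id_whiskerRight, Category.id_comp,
      Category.comp_id], by
    have e : DistCat.selfMap₂ (h := f.h) (k := f.h) (LInd.Cell.base (𝟙 f.lind)) = 𝟙 _ :=
      DistCat.selfMap₂_id f.h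
    rw [e, Bicategory.whiskerLeft_id, Bicategory.id_whiskerRight, Category.id_comp,
      Category.comp_id]⟩
  comp {f g k} σ τ := ⟨σ.cell ≫ τ.cell, by
    have e : DistCat.selfMap₂ (h := f.h) (k := k.h) (LInd.Cell.base (σ.cell ≫ τ.cell)) =
        DistCat.selfMap₂ (h := f.h) (k := g.h) (LInd.Cell.base σ.cell) ≫
          DistCat.selfMap₂ (h := g.h) (k := k.h) (LInd.Cell.base τ.cell) :=
      DistCat.selfMap₂_vcomp (h := f.h) (k := g.h) (l := k.h) _ _
    rw [e, Bicategory.whiskerLeft_comp, Bicategory.comp_whiskerRight, Category.assoc, τ.left,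
      ← Category.assoc, σ.left, Category.assoc], by
    have e : DistCat.selfMap₂ (h := f.h) (k := k.h) (LInd.Cell.base (σ.cell ≫ τ.cell)) =
        DistCat.selfMap₂ (h := f.h) (k := g.h) (LInd.Cell.base σ.cell) ≫
          DistCat.selfMap₂ (h := g.h) (k := k.h) (LInd.Cell.base τ.cell) :=
      DistCat.selfMap₂_vcomp (h := f.h) (k := g.h) (l := k.h) _ _
    rw [e, Bicategory.whiskerLeft_comp, Bicategory.comp_whiskerRight, Category.assoc, τ.right,
      ← Category.assoc, σ.right, Category.assoc]⟩
  id_comp _ := Cell.ext (Category.id_comp _)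
  comp_id _ := Cell.ext (Category.comp_id _)
  assoc _ _ _ := Cell.ext (Category.assoc _ _ _)

lemma id_cell {M N : Model.{v, u}} (f : M ⟶ N) : Cell.cell (𝟙 f) = 𝟙 (Mor.lind f) := rfl

lemma vcomp_cell {M N : Model.{v, u}} {f g k : M ⟶ N} (σ : f ⟶ g) (τ : g ⟶ k) :
    Cell.cell (σ ≫ τ) = Cell.cell σ ≫ Cell.cell τ := rfl

/-- Left whiskering. -/
def whiskerL {M N K : Model.{v, u}} (f : M ⟶ N) {g k : N ⟶ K} (σ : g ⟶ k) : f ≫ g ⟶ f ≫ k where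
  cell := Mor.lind f ◁ σ.cell
  left := transport_left (DistCat.selfMap_comp f.h g.h) (DistCat.selfMap_comp f.h k.h)
    (paste_whiskerLeft f.α g.α k.α _ _ σ.left)
    (DistCat.selfMap₂_whiskerLeft f.h (k := g.h) (l := k.h) (LInd.Cell.base σ.cell))
  right := transport_right (DistCat.selfMap_comp f.h g.h) (DistCat.selfMap_comp f.h k.h)
    (paste_whiskerLeft f.β g.β k.β _ _ σ.right)
    (DistCat.selfMap₂_whiskerLeft f.h (k := g.h) (l := k.h) (LInd.Cell.base σ.cell))

/-- Right whiskering. -/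
def whiskerR {M N K : Model.{v, u}} {f g : M ⟶ N} (σ : f ⟶ g) (k : N ⟶ K) : f ≫ k ⟶ g ≫ k where
  cell := σ.cell ▷ Mor.lind k
  left := transport_left (DistCat.selfMap_comp f.h k.h) (DistCat.selfMap_comp g.h k.h)
    (paste_whiskerRight f.α g.α k.α _ _ σ.left)
    (DistCat.selfMap₂_whiskerRight (h := f.h) (k := g.h) (LInd.Cell.base σ.cell) k.h)
  right := transport_right (DistCat.selfMap_comp f.h k.h) (DistCat.selfMap_comp g.h k.h)
    (paste_whiskerRight f.β g.β k.β _ _ σ.right)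
    (DistCat.selfMap₂_whiskerRight (h := f.h) (k := g.h) (LInd.Cell.base σ.cell) k.h)

lemma mor_ext {M N : Model.{v, u}} {f g : Mor M N} (h₁ : f.h = g.h) (h₂ : HEq f.H g.H)
    (h₃ : ∀ A, HEq (LInd.Cell.app f.α A) (LInd.Cell.app g.α A))
    (h₄ : ∀ A, HEq (LInd.Cell.app f.β A) (LInd.Cell.app g.β A)) : f = g := by
  obtain ⟨h, H, hp, α, β, hα, hβ, hl⟩ := f
  obtain ⟨h', H', hp', α', β', hα', hβ', hl'⟩ := g
  obtain rfl : h = h' := h₁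
  obtain rfl : H = H' := eq_of_heq h₂
  obtain rfl : α = α' :=
    LInd.cell_ext (fun c => (hα c).trans (hα' c).symm) fun A => eq_of_heq (h₃ A)
  obtain rfl : β = β' :=
    LInd.cell_ext (fun c => (hβ c).trans (hβ' c).symm) fun A => eq_of_heq (h₄ A)
  rfl

lemma whisker_id_app {X Y : LInd.{v, u}} (F : X ⟶ Y) (A : X.fib.Obj) :
    Y.fib.reind (LInd.Mor.unitIso F) (LInd.Mor.map F (X.fib.id (𝟙_ X.base) A)) =
      Y.fib.id _ _ := by
  rw [LInd.Mor.map_id, IdxCat.reind_idm]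

lemma whisker_app_id {X : LInd.{v, u}} {A B : X.fib.Obj} (k : X.fib.Hom (𝟙_ X.base) A B) :
    X.fib.reind (LInd.Mor.unitIso (𝟙 X)) k = k := by
  have e : LInd.Mor.unitIso (𝟙 X) = 𝟙 (𝟙_ X.base) := LInd.Mor.hom_unit_ext (𝟙 X) _ _
  rw [e]
  exact X.fib.reind_id _

lemma whisker_app_comp {X Y Z : LInd.{v, u}} (F : X ⟶ Y) (G : Y ⟶ Z) {A B : X.fib.Obj}
    (k : X.fib.Hom (𝟙_ X.base) A B) :
    Z.fib.reind (LInd.Mor.unitIso (F ≫ G)) (LInd.Mor.map (F ≫ G) k) =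
      Z.fib.reind G.unitIso (G.map (Y.fib.reind F.unitIso (F.map k))) := by
  have e : LInd.Mor.unitIso (F ≫ G) = G.unitIso ≫ G.base.map F.unitIso :=
    LInd.Mor.hom_unit_ext (F ≫ G) _ _
  rw [LInd.Mor.map_reind, IdxCat.reind_reind, e]
  rfl

lemma whisker_comp_app {X Y : LInd.{v, u}} (F : X ⟶ Y) {A B E : X.fib.Obj}
    (k : X.fib.Hom (𝟙_ X.base) A B) (l : X.fib.Hom (𝟙_ X.base) B E) :
    Y.fib.reind (LInd.Mor.unitIso F) (LInd.Mor.map F (X.fib.comp k l)) =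
      Y.fib.comp (Y.fib.reind (LInd.Mor.unitIso F) (LInd.Mor.map F k))
        (Y.fib.reind (LInd.Mor.unitIso F) (LInd.Mor.map F l)) := by
  rw [LInd.Mor.map_comp, IdxCat.reind_compm]

lemma whisker_app_heq {X Y : LInd.{v, u}} {F G : X ⟶ Y} (e : F = G) {A B : X.fib.Obj}
    (k : X.fib.Hom (𝟙_ X.base) A B) :
    HEq (Y.fib.reind (LInd.Mor.unitIso F) (LInd.Mor.map F k))
      (Y.fib.reind (LInd.Mor.unitIso G) (LInd.Mor.map G k)) := by
  subst e
  rfl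

lemma mor_id_comp {M N : Model.{v, u}} (f : M ⟶ N) : 𝟙 M ≫ f = f := by
  refine mor_ext rfl HEq.rfl (fun A => heq_of_eq ?_) (fun A => heq_of_eq ?_)
  · refine (Mor.comp_α_app (Mor.idm M) f A).trans ?_
    rw [Mor.idm_α_app]
    refine (congrArg (fun t => N.comp.comp t _) (whisker_id_app f.lind _)).trans ?_
    exact N.comp.id_comp _
  · refine (Mor.comp_β_app (Mor.idm M) f A).trans ?_
    rw [Mor.idm_β_app]
    refine (congrArg (fun t => (DistCat.self N.val).fib.comp t _)
      (whisker_id_app (DistCat.selfMap f.h) _)).trans ?_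
    exact (DistCat.self N.val).fib.id_comp _

lemma mor_comp_id {M N : Model.{v, u}} (f : M ⟶ N) : f ≫ 𝟙 N = f := by
  refine mor_ext rfl HEq.rfl (fun A => heq_of_eq ?_) (fun A => heq_of_eq ?_)
  · refine (Mor.comp_α_app f (Mor.idm N) A).trans ?_
    rw [Mor.idm_α_app]
    exact (N.comp.comp_id _).trans (whisker_app_id (X := N.lind) _)
  · refine (Mor.comp_β_app f (Mor.idm N) A).trans ?_
    rw [Mor.idm_β_app]
    refine ((DistCat.self N.val).fib.comp_id _).trans ?_
    exact (eq_of_heq (whisker_app_heq (DistCat.selfMap_id N.val) _)).trans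
      (whisker_app_id (X := DistCat.self N.val) _)

lemma mor_assoc {M N K L : Model.{v, u}} (f : M ⟶ N) (g : N ⟶ K) (k : K ⟶ L) :
    (f ≫ g) ≫ k = f ≫ g ≫ k := by
  refine mor_ext rfl HEq.rfl (fun A => heq_of_eq ?_) (fun A => heq_of_eq ?_)
  · refine (Mor.comp_α_app (f.comp g) k A).trans ?_
    refine Eq.trans ?_ (Mor.comp_α_app f (g.comp k) A).symm
    rw [Mor.comp_α_app, Mor.comp_α_app]
    refine (congrArg (fun t => L.comp.comp t _) (whisker_comp_app k.lind _ _)).trans ?_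
    refine (L.comp.assoc _ _ _).trans ?_
    exact congrArg (fun t => L.comp.comp t _) (whisker_app_comp g.lind k.lind _).symm
  · refine (Mor.comp_β_app (f.comp g) k A).trans ?_
    refine Eq.trans ?_ (Mor.comp_β_app f (g.comp k) A).symm
    rw [Mor.comp_β_app, Mor.comp_β_app]
    refine (congrArg (fun t => (DistCat.self L.val).fib.comp t _)
      (whisker_comp_app (DistCat.selfMap k.h) _ _)).trans ?_
    refine ((DistCat.self L.val).fib.assoc _ _ _).trans ?_
    exact congrArg (fun t => (DistCat.self L.val).fib.comp t _)
      ((eq_of_heq (whisker_app_heq (DistCat.selfMap_comp g.h k.h) _)).trans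
        (whisker_app_comp (DistCat.selfMap g.h) (DistCat.selfMap k.h) _)).symm

lemma eqToHom_cell {M N : Model.{v, u}} {f g : M ⟶ N} (e : f = g) :
    Cell.cell (eqToHom e) = eqToHom (congrArg Mor.lind e) := by
  subst e
  rfl

lemma whiskerR_eqToHom {M N K : Model.{v, u}} {f g : M ⟶ N} (e : f = g) (k : N ⟶ K) :
    whiskerR (eqToHom e) k = eqToHom (congrArg (· ≫ k) e) := by
  subst e
  exact Cell.ext (Bicategory.id_whiskerRight (Mor.lind f) (Mor.lind k))

lemma whiskerL_eqToHom {M N K : Model.{v, u}} (f : M ⟶ N) {g k : N ⟶ K} (e : g = k) :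
    whiskerL f (eqToHom e) = eqToHom (congrArg (f ≫ ·) e) := by
  subst e
  exact Cell.ext (Bicategory.whiskerLeft_id (Mor.lind f) (Mor.lind g))

instance : Bicategory Model.{v, u} where
  homCategory := homCategory
  whiskerLeft f _ _ σ := whiskerL f σ
  whiskerRight σ k := whiskerR σ k
  associator f g k := eqToIso (mor_assoc f g k)
  leftUnitor f := eqToIso (mor_id_comp f)
  rightUnitor f := eqToIso (mor_comp_id f)
  whiskerLeft_id f g := Cell.ext (Bicategory.whiskerLeft_id (Mor.lind f) (Mor.lind g))
  whiskerLeft_comp f _ _ _ σ τ :=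
    Cell.ext (Bicategory.whiskerLeft_comp (Mor.lind f) (Cell.cell σ) (Cell.cell τ))
  id_whiskerLeft {_ _ f g} σ := Cell.ext <| (Bicategory.id_whiskerLeft (Cell.cell σ)).trans <|
    congrArg₂ (fun s t => s ≫ Cell.cell σ ≫ t) (eqToHom_cell (mor_id_comp f)).symm
      (eqToHom_cell (mor_id_comp g).symm).symm
  comp_whiskerLeft f g k l σ := Cell.ext <|
    (Bicategory.comp_whiskerLeft (Mor.lind f) (Mor.lind g) (Cell.cell σ)).trans <|
    congrArg₂ (fun s t => s ≫ (Mor.lind f ◁ Mor.lind g ◁ Cell.cell σ) ≫ t)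
      (eqToHom_cell (mor_assoc f g k)).symm (eqToHom_cell (mor_assoc f g l).symm).symm
  id_whiskerRight f g := Cell.ext (Bicategory.id_whiskerRight (Mor.lind f) (Mor.lind g))
  comp_whiskerRight σ τ k :=
    Cell.ext (Bicategory.comp_whiskerRight (Cell.cell σ) (Cell.cell τ) (Mor.lind k))
  whiskerRight_id {_ _ f g} σ := Cell.ext <| (Bicategory.whiskerRight_id (Cell.cell σ)).trans <|
    congrArg₂ (fun s t => s ≫ Cell.cell σ ≫ t) (eqToHom_cell (mor_comp_id f)).symm
      (eqToHom_cell (mor_comp_id g).symm).symm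
  whiskerRight_comp {_ _ _ _ f f'} σ g k := Cell.ext <|
    (Bicategory.whiskerRight_comp (Cell.cell σ) (Mor.lind g) (Mor.lind k)).trans <|
    congrArg₂ (fun s t => s ≫ (Cell.cell σ ▷ Mor.lind g) ▷ Mor.lind k ≫ t)
      (eqToHom_cell (mor_assoc f g k).symm).symm (eqToHom_cell (mor_assoc f' g k)).symm
  whisker_assoc f g g' σ k := Cell.ext <|
    (Bicategory.whisker_assoc (Mor.lind f) (Cell.cell σ) (Mor.lind k)).trans <|
    congrArg₂ (fun s t => s ≫ Mor.lind f ◁ (Cell.cell σ ▷ Mor.lind k) ≫ t)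
      (eqToHom_cell (mor_assoc f g k)).symm (eqToHom_cell (mor_assoc f g' k).symm).symm
  whisker_exchange σ τ := Cell.ext (Bicategory.whisker_exchange (Cell.cell σ) (Cell.cell τ))
  pentagon f g k l := by
    change whiskerR (eqToHom (mor_assoc f g k)) l ≫ eqToHom (mor_assoc f (g ≫ k) l) ≫
      whiskerL f (eqToHom (mor_assoc g k l)) =
      eqToHom (mor_assoc (f ≫ g) k l) ≫ eqToHom (mor_assoc f g (k ≫ l))
    rw [whiskerR_eqToHom, whiskerL_eqToHom, eqToHom_trans, eqToHom_trans, eqToHom_trans]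
  triangle f g := by
    change eqToHom (mor_assoc f (𝟙 _) g) ≫ whiskerL f (eqToHom (mor_id_comp g)) =
      whiskerR (eqToHom (mor_comp_id f)) g
    rw [whiskerR_eqToHom, whiskerL_eqToHom, eqToHom_trans]

instance : Bicategory.Strict Model.{v, u} where
  id_comp := mor_id_comp
  comp_id := mor_comp_id
  assoc := mor_assoc
  leftUnitor_eqToIso _ := rfl
  rightUnitor_eqToIso _ := rfl
  associator_eqToIso _ _ _ := rfl

/-- A strict 1-cell: the bicartesian structure, the products and the powers are preserved on the
nose, and `α`, `β` are identities. -/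
structure Mor.IsStrict {M N : Model.{v, u}} (f : M ⟶ N) : Prop where
  base : DistCat.Mor.IsStrict f.h
  products : f.H.StrictlyPreservesProducts M.products N.products
  powers : f.H.StrictlyPreservesPowers M.powers N.powers
  left : ∃ e : M.left ≫ f.lind = DistCat.selfMap f.h ≫ N.left, f.α = eqToHom e
  right : ∃ e : M.right ≫ DistCat.selfMap f.h = f.lind ≫ N.right, f.β = eqToHom e

/-- A CBPV fibration: a strict 1-cell `(p, P)` which is a fibration in `LInd` and such that `p` is
a bifibration of categories (an opfibration is a functor whose opposite is a fibration). -/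
structure IsCBPVFibration {E N : Model.{v, u}} (p : E ⟶ N) : Prop where
  strict : p.IsStrict
  fibration : IsFibration p.lind
  baseFibration : p.h.functor.IsFibered
  baseOpfibration : p.h.functor.op.IsFibered

/-- A split CBPV fibration: all the fibrations involved admit splittings. -/
structure IsSplitCBPVFibration {E N : Model.{v, u}} (p : E ⟶ N) : Prop extends
    IsCBPVFibration p where
  split : Nonempty (Splitting₂ p.lind)
  baseSplit : Nonempty (Splitting p.h.functor)
  baseOpsplit : Nonempty (Splitting p.h.functor.op)

end Model

end CBPV

end

noncomputable section

namespace CBPV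

/-! ### Heterogeneous equality of morphisms -/

section HEqCat

variable {C : Type*} [Category* C]

/-! Let `p : E ⟶ N` be the fibration, `f : M ⟶ N` the lax 1-cell and `K` the model to be built.
Values and computations of `K` are strict pullbacks: an object is a pair of objects of `E` and `M`
with the same image in `N`. All structure of `K` is built with the chosen structure of `M` as its
second component, so that `q` is strict. Only the component in `E` must be moved into the right
fibre, by lifting along `p`.

Two kinds of lift do this. Where `f` preserves structure up to isomorphism (finite products and
coproducts of values, finite products of computations), the structure of `E` lies over the right
object of `N` up to a canonical isomorphism, and that isomorphism is lifted. Where `f` has only a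
comparison map, its cartesian lift is taken. The left adjoint of `K` at `A` is the domain of the
lift of `α` into the left adjoint of `E`, the right adjoint at `B` is the domain of the lift of `β`,
and a power is the domain of the lift of the map from the image of a power in `M` to the power in
`N`. A map into such a domain amounts to a map in `M` and a map in `E` into the codomain of the lift
that agree in `N` (`PbLift.exists_hom`, `PbLift.hom_ext`). Functoriality, naturality and the
triangle identities are checked on these two components.

The lifted counit pairs the counit of `M` with the composite of the lift of `α`, the transpose of
the lift of `β` and the counit of `E`. For the unit, the unit at `A` of `E` ends at the wrong object
and has to be composed with an inverse of the lift of `α`. This inverse exists by doctrinal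
adjunction: the mate of `β` is inverse to `α` (`Mor.exists_a_inv`), and a cartesian map over an
isomorphism is an isomorphism (`IsCart.exists_inv`).

Lifts of single maps must be extracted from a definition of fibration that speaks of 2-cells only.
Lifting the universal 2-cell of the comma object of `N` over `p` yields them all at once
(`hasLifts_of_isFibration`). For `self p` they come from the fibration of value categories
(`hasLifts_selfMap`).

Conversely a 2-cell with invertible base and pointwise cartesian components is cartesian, which
gives the last claim on `α` and `β`. A 1-cell into `K` is given by 1-cells into the pullbacks in
`DistCat` and `LInd`, with `α` and `β` supplied by the universal property of the lifts; 2-cells come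
from the pullback in `LInd`. Finally `q` is a fibration because each functor `q ∘ -` is a strict
pullback of `p ∘ -`, and fibrations, opfibrations and splittings are stable under strict pullback.
Since strictness produces equalities of objects, morphisms with propositionally equal endpoints are
compared by `HEq`. -/

lemma heq_comp {a b c a' b' c' : C} {f : a ⟶ b} {g : b ⟶ c} {f' : a' ⟶ b'} {g' : b' ⟶ c'}
    (ha : a = a') (hb : b = b') (hc : c = c') (hf : HEq f f') (hg : HEq g g') :
    HEq (f ≫ g) (f' ≫ g') := by
  subst ha hb hc hf hg
  rfl

lemma heq_id {a a' : C} (ha : a = a') : HEq (𝟙 a) (𝟙 a') := by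
  subst ha
  rfl

lemma eqToHom_comp_heq' {a b c : C} (h : a = b) (f : b ⟶ c) : HEq (eqToHom h ≫ f) f := by
  subst h
  simp

lemma comp_eqToHom_heq' {a b c : C} (f : a ⟶ b) (h : b = c) : HEq (f ≫ eqToHom h) f := by
  subst h
  simp

lemma eq_conj_of_heq {a b a' b' : C} {f : a ⟶ b} {f' : a' ⟶ b'} (ha : a = a') (hb : b = b')
    (h : HEq f f') : f = eqToHom ha ≫ f' ≫ eqToHom hb.symm := by
  subst ha hb h
  simp

lemma eqToHom_heq_id {a b : C} (h : a = b) : HEq (eqToHom h) (𝟙 a) := by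
  subst h
  rfl

lemma functor_map_heq {D : Type*} [Category* D] {F G : C ⥤ D} (e : F = G) {a b : C} (f : a ⟶ b) :
    HEq (F.map f) (G.map f) := by
  subst e
  rfl

lemma isIso_of_heq {a b a' b' : C} {f : a ⟶ b} {f' : a' ⟶ b'} (ha : a = a') (hb : b = b')
    (h : HEq f f') (hf : IsIso f) : IsIso f' := by
  subst ha hb h
  exact hf

end HEqCat

/-! ### Cartesian morphisms over the image -/

section Cartesian

variable {E C : Type*} [Category* E] [Category* C] {P : E ⥤ C}

/-- Over a morphism of the form `P.map φ`, the predicate `IsHomLift` becomes a plain equation, so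
the universal property can be used without tracking equalities of objects. -/
lemma isStronglyCartesian_map_iff {a b : E} {φ : a ⟶ b} :
    P.IsStronglyCartesian (P.map φ) φ ↔
      ∀ {z : E} (g : P.obj z ⟶ P.obj a) (ψ : z ⟶ b), P.map ψ = g ≫ P.map φ →
        ∃! χ : z ⟶ a, P.map χ = g ∧ χ ≫ φ = ψ := by
  constructor
  · intro h z g ψ hψ
    have : P.IsHomLift (g ≫ P.map φ) ψ := hψ ▸ inferInstance
    obtain ⟨χ, ⟨h₁, h₂⟩, h₃⟩ := h.universal_property' g ψ
    refine ⟨χ, ⟨(IsHomLift.eq_of_isHomLift P g χ).symm, h₂⟩, fun y hy => h₃ y ⟨?_, hy.2⟩⟩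
    exact hy.1 ▸ inferInstance
  · intro h
    refine ⟨fun {z} g ψ hψ => ?_⟩
    obtain ⟨χ, ⟨h₁, h₂⟩, h₃⟩ := h g ψ (IsHomLift.eq_of_isHomLift P _ ψ).symm
    refine ⟨χ, ⟨h₁ ▸ inferInstance, h₂⟩, fun y hy => h₃ y ⟨?_, hy.2⟩⟩
    have := hy.1
    exact (IsHomLift.eq_of_isHomLift P g y).symm

lemma isHomLift_of_heq {a b : E} {φ : a ⟶ b} {R S : C} {f : R ⟶ S} (ha : P.obj a = R)
    (hb : P.obj b = S) (h : HEq (P.map φ) f) : P.IsHomLift f φ := by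
  subst ha hb h
  infer_instance

lemma heq_of_isHomLift {a b : E} {φ : a ⟶ b} {R S : C} {f : R ⟶ S} (h : P.IsHomLift f φ) :
    HEq (P.map φ) f := by
  obtain ⟨⟩ := h
  rfl

lemma isStronglyCartesian_of_heq {a b : E} {φ : a ⟶ b} {R S : C} {f : R ⟶ S} (ha : P.obj a = R)
    (hb : P.obj b = S) (h : HEq (P.map φ) f) (hφ : P.IsStronglyCartesian (P.map φ) φ) :
    P.IsStronglyCartesian f φ := by
  subst ha hb h
  exact hφ

lemma isStronglyCartesian_map {a b : E} {φ : a ⟶ b} {R S : C} {f : R ⟶ S}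
    (hφ : P.IsStronglyCartesian f φ) : P.IsStronglyCartesian (P.map φ) φ := by
  obtain ⟨⟩ := hφ.toIsHomLift
  exact hφ

lemma isCartesian_map {a b : E} {φ : a ⟶ b} {R S : C} {f : R ⟶ S}
    (hφ : P.IsCartesian f φ) : P.IsCartesian (P.map φ) φ := by
  obtain ⟨⟩ := hφ.toIsHomLift
  exact hφ

lemma isStronglyCartesian_congr {a b a' b' : E} {φ : a ⟶ b} {φ' : a' ⟶ b'} (ha : a = a')
    (hb : b = b') (h : HEq φ φ') (hφ : P.IsStronglyCartesian (P.map φ) φ) :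
    P.IsStronglyCartesian (P.map φ') φ' := by
  subst ha hb h
  exact hφ

/-- Isomorphisms lift along fibrations. -/
lemma exists_iso_lift [P.IsFibered] {e : E} {c : C} (i : c ≅ P.obj e) :
    ∃ (e' : E) (_ : P.obj e' = c) (φ : e' ≅ e), HEq (P.map φ.hom) i.hom := by
  obtain ⟨e', φ, hφ⟩ := Functor.IsPreFibered.exists_isCartesian' i.hom
  -- In a fibration a cartesian lift is strongly cartesian, and over an isomorphism this makes it
  -- invertible.
  have h1 : P.IsStronglyCartesian i.hom φ := inferInstance
  have : IsIso φ := Functor.IsStronglyCartesian.isIso_of_base_isIso P i.hom φ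
  exact ⟨e', IsHomLift.domain_eq P i.hom φ, asIso φ, heq_of_isHomLift hφ.toIsHomLift⟩

end Cartesian

/-! ### Strict pullback squares of functors -/

/-- A strict pullback square of categories, stated on objects and on morphisms. -/
structure IsStrictPb {K E M N : Type*} [Category* K] [Category* E] [Category* M] [Category* N]
    (G : K ⥤ E) (Q : K ⥤ M) (P : E ⥤ N) (F : M ⥤ N) : Prop where
  w : G ⋙ P = Q ⋙ F
  obj : ∀ e m, P.obj e = F.obj m → ∃ k, G.obj k = e ∧ Q.obj k = m
  obj_ext : ∀ {k k'}, G.obj k = G.obj k' → Q.obj k = Q.obj k' → k = k'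
  hom : ∀ {k k' : K} (a : G.obj k ⟶ G.obj k') (b : Q.obj k ⟶ Q.obj k'),
    HEq (P.map a) (F.map b) → ∃ θ : k ⟶ k', G.map θ = a ∧ Q.map θ = b
  hom_ext : ∀ {k k' : K} {θ θ' : k ⟶ k'}, G.map θ = G.map θ' → Q.map θ = Q.map θ' → θ = θ'

namespace IsStrictPb

variable {K E M N : Type*} [Category* K] [Category* E] [Category* M] [Category* N]
  {G : K ⥤ E} {Q : K ⥤ M} {P : E ⥤ N} {F : M ⥤ N}

lemma w_obj (S : IsStrictPb G Q P F) (k : K) : P.obj (G.obj k) = F.obj (Q.obj k) := Functor.congr_obj S.w k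

lemma w_map (S : IsStrictPb G Q P F) {k k' : K} (θ : k ⟶ k') : HEq (P.map (G.map θ)) (F.map (Q.map θ)) :=
  functor_map_heq S.w θ

/-- The notion is self-dual; through this, statements about fibrations and their splittings also
apply to opfibrations. -/
lemma op (S : IsStrictPb G Q P F) : IsStrictPb G.op Q.op P.op F.op where
  w := congrArg Functor.op S.w
  obj e m h := by
    obtain ⟨k, h₁, h₂⟩ := S.obj e.unop m.unop (congrArg Opposite.unop h)
    exact ⟨Opposite.op k, congrArg Opposite.op h₁, congrArg Opposite.op h₂⟩
  obj_ext h h' := Opposite.unop_injective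
    (S.obj_ext (congrArg Opposite.unop h) (congrArg Opposite.unop h'))
  hom {k k'} a b h := by
    have e : ∀ {x y x' y' : N} (u : x ⟶ y) (u' : x' ⟶ y'), x = x' → y = y' → HEq u.op u'.op →
        HEq u u' := by
      rintro x y _ _ u u' rfl rfl h
      exact heq_of_eq (Quiver.Hom.op_inj (eq_of_heq h))
    obtain ⟨θ, h₁, h₂⟩ := S.hom a.unop b.unop (e (P.map a.unop) (F.map b.unop) (S.w_obj _)
      (S.w_obj _) h)
    exact ⟨θ.op, congrArg Quiver.Hom.op h₁, congrArg Quiver.Hom.op h₂⟩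
  hom_ext h h' := Quiver.Hom.unop_inj
    (S.hom_ext (congrArg Quiver.Hom.unop h) (congrArg Quiver.Hom.unop h'))

/-- A factorization through `φ` has a prescribed component `g` in `M`; its component in `E` is given
by the cartesian property of `G.map φ`. The two agree in `N` and glue to a unique morphism. -/
lemma isStronglyCartesian (S : IsStrictPb G Q P F) {k k' : K} {φ : k ⟶ k'}
    (hφ : P.IsStronglyCartesian (P.map (G.map φ)) (G.map φ)) :
    Q.IsStronglyCartesian (Q.map φ) φ := by
  rw [isStronglyCartesian_map_iff] at hφ ⊢
  intro z g ψ hψ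
  have e₁ := eq_conj_of_heq (S.w_obj _) (S.w_obj _) (S.w_map ψ)
  have e₂ := eq_conj_of_heq (S.w_obj _) (S.w_obj _) (S.w_map φ)
  obtain ⟨a, ⟨h₁, h₂⟩, h₃⟩ := hφ (eqToHom (S.w_obj z) ≫ F.map g ≫ eqToHom (S.w_obj k).symm)
    (G.map ψ) (by simp [e₁, e₂, hψ])
  obtain ⟨θ, t₁, t₂⟩ := S.hom a g (by
    rw [h₁]
    exact (eqToHom_comp_heq' _ _).trans (comp_eqToHom_heq' _ _))
  refine ⟨θ, ⟨t₂, S.hom_ext (by rw [G.map_comp, t₁, h₂]) (by rw [Q.map_comp, t₂, hψ])⟩, ?_⟩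
  rintro θ' ⟨t₁', s₂⟩
  refine S.hom_ext ((h₃ _ ⟨?_, ?_⟩).trans t₁.symm) (t₁'.trans t₂.symm)
  · rw [← t₁']
    exact eq_conj_of_heq (S.w_obj _) (S.w_obj _) (S.w_map θ')
  · rw [← G.map_comp, s₂]

/-- A lift of a morphism of `M` from a cartesian lift in `E`. -/
lemma exists_lift (S : IsStrictPb G Q P F) {k : K} {c : M} (f : c ⟶ Q.obj k) {e : E} (ψ : e ⟶ G.obj k)
    (he : P.obj e = F.obj c) (hψ : HEq (P.map ψ) (F.map f)) :
    ∃ (k' : K) (φ : k' ⟶ k), G.obj k' = e ∧ Q.obj k' = c ∧ HEq (G.map φ) ψ ∧ HEq (Q.map φ) f := by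
  obtain ⟨k', rfl, rfl⟩ := S.obj e c he
  obtain ⟨φ, rfl, rfl⟩ := S.hom ψ f hψ
  exact ⟨k', φ, rfl, rfl, HEq.rfl, HEq.rfl⟩

/-- Recording that the image under `G` is cartesian too lets `isStronglyCartesian_fst` compare an
arbitrary cartesian morphism with this lift. -/
lemma exists_stronglyCartesian (S : IsStrictPb G Q P F) [P.IsFibered] (k : K) (c : M) (f : c ⟶ Q.obj k) :
    ∃ (k' : K) (φ : k' ⟶ k), Q.IsStronglyCartesian f φ ∧
      P.IsStronglyCartesian (P.map (G.map φ)) (G.map φ) := by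
  obtain ⟨e, ψ, hψ⟩ := IsPreFibered.exists_isCartesian P (S.w_obj k) (F.map f)
  have hψ' : P.IsStronglyCartesian (F.map f) ψ := inferInstance
  obtain ⟨k', φ, h₁, h₂, h₃, h₄⟩ := S.exists_lift f ψ (IsHomLift.domain_eq P (F.map f) ψ)
    (heq_of_isHomLift inferInstance)
  have h₅ := isStronglyCartesian_congr h₁.symm rfl h₃.symm (isStronglyCartesian_map hψ')
  exact ⟨k', φ, isStronglyCartesian_of_heq h₂ rfl h₄ (S.isStronglyCartesian h₅), h₅⟩

lemma isFibered (S : IsStrictPb G Q P F) (hP : P.IsFibered) : Q.IsFibered :=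
  Functor.IsFibered.of_exists_isStronglyCartesian fun k c f => by
    obtain ⟨k', φ, h, _⟩ := S.exists_stronglyCartesian k c f
    exact ⟨k', φ, h⟩

/-- Any cartesian `φ` differs from the lift built above by an isomorphism of domains. Functors
preserve isomorphisms, these are cartesian, and cartesian morphisms compose. -/
lemma isStronglyCartesian_fst (S : IsStrictPb G Q P F) (hP : P.IsFibered) {k k' : K} {φ : k ⟶ k'}
    (hφ : Q.IsCartesian (Q.map φ) φ) : P.IsStronglyCartesian (P.map (G.map φ)) (G.map φ) := by
  have := S.isFibered hP
  obtain ⟨l, ψ, h₁, h₂⟩ := S.exists_stronglyCartesian k' _ (Q.map φ)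
  let i := Functor.IsCartesian.domainUniqueUpToIso Q (Q.map φ) ψ φ
  have e : φ = i.hom ≫ ψ := (Functor.IsCartesian.fac Q (Q.map φ) ψ φ).symm
  have : P.IsStronglyCartesian (P.map (G.map i.hom) ≫ P.map (G.map ψ))
    (G.map i.hom ≫ G.map ψ) := inferInstance
  rw [e]
  simpa using this

end IsStrictPb

/-! ### Splittings and their transport along strict pullbacks -/

namespace Splitting

variable {E C : Type*} [Category* E] [Category* C] {P : E ⥤ C} (T : Splitting P)

lemma obj_congr {c c' : C} {e e' : E} {f : c ⟶ P.obj e} {f' : c' ⟶ P.obj e'} (hc : c = c')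
    (he : e = e') (hf : HEq f f') : T.obj e f = T.obj e' f' := by
  subst hc he hf
  rfl

lemma lift_congr {c c' : C} {e e' : E} {f : c ⟶ P.obj e} {f' : c' ⟶ P.obj e'} (hc : c = c')
    (he : e = e') (hf : HEq f f') : HEq (T.lift e f) (T.lift e' f') := by
  subst hc he hf
  rfl

lemma map_lift_heq {c : C} (e : E) (f : c ⟶ P.obj e) : HEq (P.map (T.lift e f)) f :=
  heq_of_isHomLift (T.cartesian e f).toIsHomLift

end Splitting

namespace IsStrictPb

variable {K E M N : Type*} [Category* K] [Category* E] [Category* M] [Category* N]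
  {G : K ⥤ E} {Q : K ⥤ M} {P : E ⥤ N} {F : M ⥤ N} (S : IsStrictPb G Q P F) (T : Splitting P)

/-- The morphism of `N` whose lift is transported to the pullback. -/
abbrev splitBase {c : M} (k : K) (f : c ⟶ Q.obj k) : F.obj c ⟶ P.obj (G.obj k) :=
  F.map f ≫ eqToHom (S.w_obj k).symm

lemma exists_splitting_lift {c : M} (k : K) (f : c ⟶ Q.obj k) :
    ∃ (k' : K) (φ : k' ⟶ k), G.obj k' = T.obj (G.obj k) (S.splitBase k f) ∧ Q.obj k' = c ∧
      HEq (G.map φ) (T.lift (G.obj k) (S.splitBase k f)) ∧ HEq (Q.map φ) f :=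
  S.exists_lift f (T.lift (G.obj k) (S.splitBase k f)) (T.base_eq _ _).symm
    ((T.map_lift_heq _ _).trans (comp_eqToHom_heq' _ _))

/-- The object part of the splitting transported to the pullback. -/
def splitObj {c : M} (k : K) (f : c ⟶ Q.obj k) : K := (S.exists_splitting_lift T k f).choose

/-- The morphism part of the splitting transported to the pullback. -/
def splitLift {c : M} (k : K) (f : c ⟶ Q.obj k) : S.splitObj T k f ⟶ k :=
  (S.exists_splitting_lift T k f).choose_spec.choose

lemma fst_splitObj {c : M} (k : K) (f : c ⟶ Q.obj k) :
    G.obj (S.splitObj T k f) = T.obj (G.obj k) (S.splitBase k f) :=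
  (S.exists_splitting_lift T k f).choose_spec.choose_spec.1

lemma snd_splitObj {c : M} (k : K) (f : c ⟶ Q.obj k) : Q.obj (S.splitObj T k f) = c :=
  (S.exists_splitting_lift T k f).choose_spec.choose_spec.2.1

lemma fst_splitLift {c : M} (k : K) (f : c ⟶ Q.obj k) :
    HEq (G.map (S.splitLift T k f)) (T.lift (G.obj k) (S.splitBase k f)) :=
  (S.exists_splitting_lift T k f).choose_spec.choose_spec.2.2.1

lemma snd_splitLift {c : M} (k : K) (f : c ⟶ Q.obj k) : HEq (Q.map (S.splitLift T k f)) f :=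
  (S.exists_splitting_lift T k f).choose_spec.choose_spec.2.2.2

/-- Both sides are `F.map g` up to identity morphisms; this matches the second step of an iterated
lift along `Q` with that along `P`. -/
lemma splitBase_comp_heq {c d : M} (k : K) (f : c ⟶ Q.obj k) (g : d ⟶ c) :
    HEq (F.map g ≫ eqToHom (T.base_eq (G.obj k) (S.splitBase k f)))
      (S.splitBase (S.splitObj T k f) (g ≫ eqToHom (S.snd_splitObj T k f).symm)) := by
  refine (comp_eqToHom_heq' _ _).trans (HEq.trans ?_ (comp_eqToHom_heq' _ _).symm)
  rw [F.map_comp, eqToHom_map]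
  exact (comp_eqToHom_heq' _ _).symm

/-- Objects and morphisms of the pullback are determined by their two images, so each strict law is
the law of `T` on one side and holds by construction on the other. -/
lemma splitObj_id (k : K) : S.splitObj T k (𝟙 (Q.obj k)) = k := by
  refine S.obj_ext ?_ (S.snd_splitObj T k _)
  refine (S.fst_splitObj T k _).trans (Eq.trans ?_ (T.obj_id (G.obj k)))
  refine T.obj_congr (S.w_obj k).symm rfl ?_
  simpa [splitBase] using (eqToHom_heq_id _).trans (heq_id (S.w_obj k).symm)

lemma splitObj_comp {c d : M} (k : K) (f : c ⟶ Q.obj k) (g : d ⟶ c) :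
    S.splitObj T k (g ≫ f) =
      S.splitObj T (S.splitObj T k f) (g ≫ eqToHom (S.snd_splitObj T k f).symm) := by
  refine S.obj_ext ?_ ((S.snd_splitObj T _ _).trans (S.snd_splitObj T _ _).symm)
  rw [S.fst_splitObj, S.fst_splitObj]
  have e : S.splitBase k (g ≫ f) = F.map g ≫ S.splitBase k f := by simp [splitBase]
  rw [e, T.obj_comp]
  exact T.obj_congr rfl (S.fst_splitObj T k f).symm (S.splitBase_comp_heq T k f g)

/-- A splitting is inherited by a strict pullback. -/
def splitting : Splitting Q where
  obj k f := S.splitObj T k f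
  lift k f := S.splitLift T k f
  cartesian k f := isStronglyCartesian_of_heq (S.snd_splitObj T k f) rfl (S.snd_splitLift T k f)
    (S.isStronglyCartesian (isStronglyCartesian_congr (S.fst_splitObj T k f).symm rfl
      (S.fst_splitLift T k f).symm (isStronglyCartesian_map (T.cartesian _ _))))
  base_eq k f := (S.snd_splitObj T k f).symm
  obj_id := S.splitObj_id T
  lift_id k := by
    refine S.hom_ext (eq_of_heq ?_) (eq_of_heq ?_)
    · refine (S.fst_splitLift T k _).trans ?_
      rw [eqToHom_map]
      refine HEq.trans ?_ (((heq_of_eq (T.lift_id (G.obj k))).trans (eqToHom_heq_id _)).trans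
        ((heq_id ?_).trans (eqToHom_heq_id _).symm))
      · refine T.lift_congr (S.w_obj k).symm rfl ?_
        simpa [splitBase] using (eqToHom_heq_id _).trans (heq_id (S.w_obj k).symm)
      · rw [T.obj_id, S.splitObj_id]
    · refine (S.snd_splitLift T k _).trans ?_
      rw [eqToHom_map]
      exact (heq_id (by rw [S.splitObj_id])).trans (eqToHom_heq_id _).symm
  obj_comp := S.splitObj_comp T
  lift_comp k f g := by
    refine S.hom_ext (eq_of_heq ?_) (eq_of_heq ?_)
    · refine (S.fst_splitLift T k _).trans ?_
      rw [G.map_comp, G.map_comp, eqToHom_map]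
      refine HEq.trans ?_ (eqToHom_comp_heq' _ _).symm
      have e : S.splitBase k (g ≫ f) = F.map g ≫ S.splitBase k f := by simp [splitBase]
      rw [e, T.lift_comp]
      refine (eqToHom_comp_heq' _ _).trans ?_
      refine heq_comp ?_ (S.fst_splitObj T k f).symm rfl ?_ (S.fst_splitLift T k f).symm
      · rw [S.fst_splitObj]
        exact T.obj_congr rfl (S.fst_splitObj T k f).symm (S.splitBase_comp_heq T k f g)
      · refine HEq.trans ?_ (S.fst_splitLift T _ _).symm
        exact T.lift_congr rfl (S.fst_splitObj T k f).symm (S.splitBase_comp_heq T k f g)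
    · refine (S.snd_splitLift T k _).trans ?_
      rw [Q.map_comp, Q.map_comp, eqToHom_map]
      refine HEq.trans ?_ (eqToHom_comp_heq' _ _).symm
      refine heq_comp (S.snd_splitObj T _ _).symm (S.snd_splitObj T k f).symm rfl ?_
        (S.snd_splitLift T k f).symm
      exact ((S.snd_splitLift T _ _).trans (comp_eqToHom_heq' _ _)).symm

end IsStrictPb

open MonoidalCategory CartesianMonoidalCategory

/-! ### The strict pullback of two functors -/

section Pb

variable {E M N : Type u} [Category.{v} E] [Category.{v} M] [Category.{v} N]

/-- An object of the strict pullback of `P` and `F`. -/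
@[ext]
structure Pb (P : E ⥤ N) (F : M ⥤ N) where
  left : E
  right : M
  eq : P.obj left = F.obj right

namespace Pb

variable {P : E ⥤ N} {F : M ⥤ N}

/-- A morphism of the strict pullback. -/
@[ext]
structure Hom (x y : Pb P F) where
  left : x.left ⟶ y.left
  right : x.right ⟶ y.right
  w : HEq (P.map left) (F.map right)

@[simps]
instance : Category (Pb P F) where
  Hom := Hom
  id x := ⟨𝟙 _, 𝟙 _, by rw [P.map_id, F.map_id]; exact heq_id x.eq⟩
  comp {x y z} f g := ⟨f.left ≫ g.left, f.right ≫ g.right, by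
    rw [P.map_comp, F.map_comp]
    exact heq_comp x.eq y.eq z.eq f.w g.w⟩

@[ext]
lemma hom_ext {x y : Pb P F} {f g : x ⟶ y} (h : f.left = g.left) (h' : f.right = g.right) :
    f = g := Hom.ext h h'

lemma hom_w {x y : Pb P F} (f : x ⟶ y) :
    P.map f.left = eqToHom x.eq ≫ F.map f.right ≫ eqToHom y.eq.symm :=
  eq_conj_of_heq x.eq y.eq f.w

lemma hom_w' {x y : Pb P F} (f : x ⟶ y) :
    F.map f.right = eqToHom x.eq.symm ≫ P.map f.left ≫ eqToHom y.eq :=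
  eq_conj_of_heq x.eq.symm y.eq.symm f.w.symm

/-- The first projection. -/
@[simps]
def fst (P : E ⥤ N) (F : M ⥤ N) : Pb P F ⥤ E where
  obj x := x.left
  map f := f.left

/-- The second projection. -/
@[simps]
def snd (P : E ⥤ N) (F : M ⥤ N) : Pb P F ⥤ M where
  obj x := x.right
  map f := f.right

lemma fst_comp_eq (P : E ⥤ N) (F : M ⥤ N) : fst P F ⋙ P = snd P F ⋙ F :=
  CategoryTheory.Functor.ext (fun x => x.eq) fun _ _ f => hom_w f

lemma isStrictPb (P : E ⥤ N) (F : M ⥤ N) : IsStrictPb (fst P F) (snd P F) P F where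
  w := fst_comp_eq P F
  obj e m h := ⟨⟨e, m, h⟩, rfl, rfl⟩
  obj_ext h h' := Pb.ext h h'
  hom a b h := ⟨⟨a, b, h⟩, rfl, rfl⟩
  hom_ext hl hr := hom_ext hl hr

/-- The functor into the pullback induced by a commutative square. -/
@[simps]
def lift {X : Type*} [Category* X] (a : X ⥤ E) (c : X ⥤ M) (e : a ⋙ P = c ⋙ F) : X ⥤ Pb P F where
  obj x := ⟨a.obj x, c.obj x, Functor.congr_obj e x⟩
  map f := ⟨a.map f, c.map f, functor_map_heq e f⟩
  map_id x := hom_ext (a.map_id x) (c.map_id x)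
  map_comp f g := hom_ext (a.map_comp f g) (c.map_comp f g)

lemma functor_ext {X : Type*} [Category* X] {a b : X ⥤ Pb P F} (h : a ⋙ fst P F = b ⋙ fst P F)
    (h' : a ⋙ snd P F = b ⋙ snd P F) : a = b := by
  have ho : ∀ x, a.obj x = b.obj x := fun x =>
    Pb.ext (Functor.congr_obj h x) (Functor.congr_obj h' x)
  have hom_heq : ∀ {x y x' y' : Pb P F} (f : x ⟶ y) (f' : x' ⟶ y'), x = x' → y = y' →
      HEq f.left f'.left → HEq f.right f'.right → HEq f f' := by
    rintro x y _ _ f f' rfl rfl h h'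
    exact heq_of_eq (hom_ext (eq_of_heq h) (eq_of_heq h'))
  refine CategoryTheory.Functor.hext ho fun x y f => ?_
  exact hom_heq _ _ (ho x) (ho y) (functor_map_heq h f) (functor_map_heq h' f)

/-- Two morphisms obtained from separate universal properties in `E` and `M` form a morphism of the
pullback once their images in `N` agree. The agreement is tested against a family that `F` keeps
jointly monic, so `P` need not preserve anything here. -/
lemma heq_of_jointly_mono {ι : Type*} {x y : Pb P F} (l : x.left ⟶ y.left) (r : x.right ⟶ y.right)
    {z : ι → Pb P F} (f : ∀ j, y ⟶ z j) (g : ∀ j, x ⟶ z j) (hl : ∀ j, l ≫ (f j).left = (g j).left)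
    (hr : ∀ j, r ≫ (f j).right = (g j).right)
    (hN : ∀ s t : F.obj x.right ⟶ F.obj y.right,
      (∀ j, s ≫ F.map (f j).right = t ≫ F.map (f j).right) → s = t) :
    HEq (P.map l) (F.map r) := by
  have : F.map r = eqToHom x.eq.symm ≫ P.map l ≫ eqToHom y.eq := by
    refine hN _ _ fun j => ?_
    rw [← F.map_comp, hr, hom_w', hom_w', ← hl]
    simp
  rw [this]
  exact ((eqToHom_comp_heq' _ _).trans (comp_eqToHom_heq' _ _)).symm

lemma heq_of_jointly_epi {ι : Type*} {x y : Pb P F} (l : y.left ⟶ x.left) (r : y.right ⟶ x.right)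
    {z : ι → Pb P F} (f : ∀ j, z j ⟶ y) (g : ∀ j, z j ⟶ x) (hl : ∀ j, (f j).left ≫ l = (g j).left)
    (hr : ∀ j, (f j).right ≫ r = (g j).right)
    (hN : ∀ s t : F.obj y.right ⟶ F.obj x.right,
      (∀ j, F.map (f j).right ≫ s = F.map (f j).right ≫ t) → s = t) :
    HEq (P.map l) (F.map r) := by
  have : F.map r = eqToHom y.eq.symm ≫ P.map l ≫ eqToHom x.eq := by
    refine hN _ _ fun j => ?_
    rw [← F.map_comp, hr, hom_w', hom_w', ← hl]
    simp
  rw [this]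
  exact ((eqToHom_comp_heq' _ _).trans (comp_eqToHom_heq' _ _)).symm

section Limits

variable {J : Type*} [Category* J] {D : J ⥤ Pb P F}

/-- A cone in the pullback is a limit if its components are limits and `F` preserves one of them. -/
def isLimitOf (s : Cone D) (hE : IsLimit ((fst P F).mapCone s)) (hM : IsLimit ((snd P F).mapCone s))
    (hN : IsLimit ((snd P F ⋙ F).mapCone s)) : IsLimit s where
  lift t := ⟨hE.lift ((fst P F).mapCone t), hM.lift ((snd P F).mapCone t),
    heq_of_jointly_mono (x := t.pt) (y := s.pt) (z := D.obj) _ _ s.π.app t.π.app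
      (hE.fac ((fst P F).mapCone t)) (hM.fac ((snd P F).mapCone t)) fun _ _ h => hN.hom_ext h⟩
  fac t j := hom_ext (hE.fac ((fst P F).mapCone t) j) (hM.fac ((snd P F).mapCone t) j)
  uniq t m h := hom_ext
    (hE.uniq ((fst P F).mapCone t) m.left fun j => congrArg Hom.left (h j))
    (hM.uniq ((snd P F).mapCone t) m.right fun j => congrArg Hom.right (h j))

/-- A cocone in the pullback is a colimit if its components are colimits and `F` preserves one of
them. -/
def isColimitOf (s : Cocone D) (hE : IsColimit ((fst P F).mapCocone s))
    (hM : IsColimit ((snd P F).mapCocone s)) (hN : IsColimit ((snd P F ⋙ F).mapCocone s)) :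
    IsColimit s where
  desc t := ⟨hE.desc ((fst P F).mapCocone t), hM.desc ((snd P F).mapCocone t),
    heq_of_jointly_epi (x := t.pt) (y := s.pt) (z := D.obj) _ _ s.ι.app t.ι.app
      (hE.fac ((fst P F).mapCocone t)) (hM.fac ((snd P F).mapCocone t)) fun _ _ h => hN.hom_ext h⟩
  fac t j := hom_ext (hE.fac ((fst P F).mapCocone t) j) (hM.fac ((snd P F).mapCocone t) j)
  uniq t m h := hom_ext
    (hE.uniq ((fst P F).mapCocone t) m.left fun j => congrArg Hom.left (h j))
    (hM.uniq ((snd P F).mapCocone t) m.right fun j => congrArg Hom.right (h j))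

/-- The components of the image cone are limits by preservation along `a` and `c`, and its image in
`N` is one by preservation along `F`. -/
lemma lift_preservesFiniteProducts {X : Type*} [Category* X] (a : X ⥤ E) (c : X ⥤ M)
    (e : a ⋙ P = c ⋙ F) [PreservesFiniteProducts a] [PreservesFiniteProducts c]
    [PreservesFiniteProducts F] : PreservesFiniteProducts (lift a c e) where
  preserves _ := ⟨⟨fun hs => ⟨isLimitOf _ (isLimitOfPreserves a hs)
    (isLimitOfPreserves c hs) (isLimitOfPreserves F (isLimitOfPreserves c hs))⟩⟩⟩

lemma lift_preservesFiniteCoproducts {X : Type*} [Category* X] (a : X ⥤ E) (c : X ⥤ M)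
    (e : a ⋙ P = c ⋙ F) [PreservesFiniteCoproducts a] [PreservesFiniteCoproducts c]
    [PreservesFiniteCoproducts F] : PreservesFiniteCoproducts (lift a c e) where
  preserves _ := ⟨⟨fun hs => ⟨isColimitOf _ (isColimitOfPreserves a hs)
    (isColimitOfPreserves c hs) (isColimitOfPreserves F (isColimitOfPreserves c hs))⟩⟩⟩

end Limits

end Pb

end Pb

/-! ### Finite products and coproducts in the strict pullback -/

section Preserves

variable {C D : Type*} [Category* C] [Category* D] (G : C ⥤ D)

/-- Preservation of one limit cone per diagram suffices, so the chosen products decide. -/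
lemma preservesFiniteProducts_of_chosen [CartesianMonoidalCategory C]
    (h₁ : Nonempty (IsTerminal (G.obj (𝟙_ C))))
    (h₂ : ∀ x y : C, Nonempty (IsLimit (BinaryFan.mk (G.map (fst x y)) (G.map (snd x y))))) :
    PreservesFiniteProducts G := by
  have : PreservesLimitsOfShape (Discrete WalkingPair) G := by
    refine ⟨fun {K} => ?_⟩
    have : PreservesLimit (pair (K.obj ⟨.left⟩) (K.obj ⟨.right⟩)) G :=
      preservesLimit_of_preserves_limit_cone (tensorProductIsBinaryProduct _ _)
        ((isLimitMapConeBinaryFanEquiv G _ _).symm (h₂ _ _).some)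
    exact preservesLimit_of_iso_diagram G (diagramIsoPair K).symm
  have : PreservesLimitsOfShape (Discrete.{0} PEmpty) G := by
    have : PreservesLimit (Functor.empty.{0} C) G :=
      preservesLimit_of_preserves_limit_cone isTerminalTensorUnit
        ((isLimitMapConeEmptyConeEquiv G _).symm h₁.some)
    exact preservesLimitsOfShape_pempty_of_preservesTerminal G
  exact PreservesFiniteProducts.of_preserves_binary_and_terminal G

lemma preservesFiniteCoproducts_of_chosen {z : C} (hz : IsInitial z) (sum : C → C → C)
    (inl : ∀ a b, a ⟶ sum a b) (inr : ∀ a b, b ⟶ sum a b)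
    (hs : ∀ a b, IsColimit (BinaryCofan.mk (inl a b) (inr a b)))
    (h₁ : Nonempty (IsInitial (G.obj z)))
    (h₂ : ∀ x y : C, Nonempty (IsColimit (BinaryCofan.mk (G.map (inl x y)) (G.map (inr x y))))) :
    PreservesFiniteCoproducts G := by
  have : PreservesColimitsOfShape (Discrete WalkingPair) G := by
    refine ⟨fun {K} => ?_⟩
    have : PreservesColimit (pair (K.obj ⟨.left⟩) (K.obj ⟨.right⟩)) G :=
      preservesColimit_of_preserves_colimit_cocone (hs _ _)
        ((isColimitMapCoconeBinaryCofanEquiv G _ _).symm (h₂ _ _).some)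
    exact preservesColimit_of_iso_diagram G (diagramIsoPair K).symm
  have : PreservesColimitsOfShape (Discrete.{0} PEmpty) G := by
    have : PreservesColimit (Functor.empty.{0} C) G :=
      preservesColimit_of_preserves_colimit_cocone hz
        ((isColimitMapCoconeEmptyCoconeEquiv G _).symm h₁.some)
    exact preservesColimitsOfShape_pempty_of_preservesInitial G
  have : HasBinaryCoproducts C := by
    have : ∀ {X Y : C}, HasColimit (pair X Y) := ⟨⟨⟨_, hs _ _⟩⟩⟩
    exact hasBinaryCoproducts_of_hasColimit_pair C
  have : HasInitial C := hz.hasInitial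
  have : HasFiniteCoproducts C := hasFiniteCoproducts_of_has_binary_and_initial
  exact ⟨fun n => PreservesFiniteCoproducts.of_preserves_binary_and_initial G (Fin n)⟩

end Preserves

lemma isColimit_binaryCofan_of_iso {C : Type*} [Category* C] {a b s a' b' s' : C} {i : a ⟶ s}
    {j : b ⟶ s} {i' : a' ⟶ s'} {j' : b' ⟶ s'} (ea : a ≅ a') (eb : b ≅ b') (es : s ≅ s')
    (hi : i ≫ es.hom = ea.hom ≫ i') (hj : j ≫ es.hom = eb.hom ≫ j')
    (h : IsColimit (BinaryCofan.mk i' j')) : Nonempty (IsColimit (BinaryCofan.mk i j)) := by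
  refine ⟨(IsColimit.equivOfNatIsoOfIso (mapPairIso ea eb) (BinaryCofan.mk i j)
    (BinaryCofan.mk i' j') (Cocone.ext es ?_)).symm h⟩
  rintro ⟨_ | _⟩
  · exact (Category.assoc _ _ _).trans ((congrArg (ea.inv ≫ ·) hi).trans (ea.inv_hom_id_assoc i'))
  · exact (Category.assoc _ _ _).trans ((congrArg (eb.inv ≫ ·) hj).trans (eb.inv_hom_id_assoc j'))

namespace DistCat

/-- Distributivity for the chosen coproduct says that tensoring with `x` preserves it, hence
preserves every coproduct of the same pair. -/
lemma isColimit_whiskerLeft (D : DistCat.{v, u}) (x : D.carrier) {a b s : D.carrier} (i : a ⟶ s)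
    (j : b ⟶ s) (h : IsColimit (BinaryCofan.mk i j)) :
    Nonempty (IsColimit (BinaryCofan.mk (x ◁ i) (x ◁ j))) := by
  have := D.distrib x a b
  have h₁ : IsColimit (BinaryCofan.mk (x ◁ D.inl a b) (x ◁ D.inr a b)) :=
    IsColimit.ofPointIso (D.isCoproduct (x ⊗ a) (x ⊗ b))
  have : PreservesColimit (pair a b) (tensorLeft x) :=
    preservesColimit_of_preserves_colimit_cocone (D.isCoproduct a b)
      ((isColimitMapCoconeBinaryCofanEquiv (tensorLeft x) _ _).symm h₁)
  exact ⟨mapIsColimitOfPreservesOfIsColimit (tensorLeft x) i j h⟩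

/-- `K` itself is not known to be distributive at this point: distributivity is borrowed from `D`
and carried along the product comparison isomorphisms of `G`. -/
lemma isColimit_map_whiskerLeft {K : Type (max u v)} [Category.{v} K] [CartesianMonoidalCategory K]
    {D : DistCat.{v, u}} (G : K ⥤ D.carrier) [PreservesFiniteProducts G]
    [PreservesFiniteCoproducts G] (x : K) {a b s : K} (i : a ⟶ s)
    (j : b ⟶ s) (h : IsColimit (BinaryCofan.mk i j)) :
    Nonempty (IsColimit (BinaryCofan.mk (G.map (x ◁ i)) (G.map (x ◁ j)))) := by
  obtain ⟨h₁⟩ := D.isColimit_whiskerLeft (G.obj x) _ _ (mapIsColimitOfPreservesOfIsColimit G i j h)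
  exact isColimit_binaryCofan_of_iso (asIso (prodComparison G x a)) (asIso (prodComparison G x b))
    (asIso (prodComparison G x s)) (prodComparison_natural_whiskerLeft G i)
    (prodComparison_natural_whiskerLeft G j) h₁

end DistCat

namespace Pb

variable {E M N : Type u} [Category.{v} E] [Category.{v} M] [Category.{v} N]
  {P : E ⥤ N} {F : M ⥤ N} [P.IsFibered]

section Prod

variable [CartesianMonoidalCategory E] [CartesianMonoidalCategory M]
  [PreservesFiniteProducts P] [PreservesFiniteProducts F]

/-- The images of the two terminal objects are terminal in `N`, hence isomorphic, and the
isomorphism lifts. This keeps the chosen terminal object of `M` as second component. -/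
lemma exists_unit : ∃ (e : E) (_ : P.obj e = F.obj (𝟙_ M)), Nonempty (e ≅ 𝟙_ E) := by
  have h₁ : IsTerminal (P.obj (𝟙_ E)) := isTerminalTensorUnit.isTerminalObj P
  have h₂ : IsTerminal (F.obj (𝟙_ M)) := isTerminalTensorUnit.isTerminalObj F
  obtain ⟨e, he, φ, -⟩ := exists_iso_lift (P := P) (h₂.uniqueUpToIso h₁)
  exact ⟨e, he, ⟨φ⟩⟩

/-- The product in `E` lies over the product in `M` only up to the isomorphism compatible with the
projections; lifting it gives an object over the image of the chosen product on the nose. -/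
lemma exists_prod (x y : Pb P F) : ∃ (e : E) (_ : P.obj e = F.obj (x.right ⊗ y.right))
    (φ : e ≅ x.left ⊗ y.left),
    HEq (P.map (φ.hom ≫ CartesianMonoidalCategory.fst _ _))
      (F.map (CartesianMonoidalCategory.fst x.right y.right)) ∧
    HEq (P.map (φ.hom ≫ CartesianMonoidalCategory.snd _ _))
      (F.map (CartesianMonoidalCategory.snd x.right y.right)) := by
  have h₁ := mapIsLimitOfPreservesOfIsLimit P _ _ (tensorProductIsBinaryProduct x.left y.left)
  have h₂ := mapIsLimitOfPreservesOfIsLimit F _ _ (tensorProductIsBinaryProduct x.right y.right)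
  -- The endpoints are kept free so that the equalities `x.eq` and `y.eq` can be substituted.
  have key : ∀ {a b a' b' c d : N} (s : c ⟶ a) (t : c ⟶ b) (s' : d ⟶ a') (t' : d ⟶ b'), a = a' →
      b = b' → IsLimit (BinaryFan.mk s t) → IsLimit (BinaryFan.mk s' t') →
      ∃ i : c ≅ d, HEq (i.hom ≫ s') s ∧ HEq (i.hom ≫ t') t := by
    rintro a b _ _ c d s t s' t' rfl rfl h h'
    exact ⟨h.conePointUniqueUpToIso h',
      heq_of_eq (h.conePointUniqueUpToIso_hom_comp h' ⟨.left⟩),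
      heq_of_eq (h.conePointUniqueUpToIso_hom_comp h' ⟨.right⟩)⟩
  obtain ⟨i, hi₁, hi₂⟩ := key _ _ _ _ x.eq.symm y.eq.symm h₂ h₁
  obtain ⟨e, he, φ, hφ⟩ := exists_iso_lift (P := P) i
  refine ⟨e, he, φ, ?_, ?_⟩
  · rw [P.map_comp]
    exact (heq_comp he rfl rfl hφ HEq.rfl).trans hi₁
  · rw [P.map_comp]
    exact (heq_comp he rfl rfl hφ HEq.rfl).trans hi₂

/-- The chosen terminal object of the pullback. -/
def unitObj : Pb P F := ⟨exists_unit.choose, 𝟙_ M, exists_unit.choose_spec.choose⟩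

/-- The chosen product of the pullback. -/
def prodObj (x y : Pb P F) : Pb P F :=
  ⟨(exists_prod x y).choose, x.right ⊗ y.right, (exists_prod x y).choose_spec.choose⟩

/-- The comparison of products in the first component. -/
def prodIso (x y : Pb P F) : (prodObj x y).left ≅ x.left ⊗ y.left :=
  (exists_prod x y).choose_spec.choose_spec.choose

/-- The first projection from the chosen product. -/
def prodFst (x y : Pb P F) : prodObj x y ⟶ x :=
  ⟨(prodIso x y).hom ≫ CartesianMonoidalCategory.fst _ _, CartesianMonoidalCategory.fst _ _,
    (exists_prod x y).choose_spec.choose_spec.choose_spec.1⟩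

/-- The second projection from the chosen product. -/
def prodSnd (x y : Pb P F) : prodObj x y ⟶ y :=
  ⟨(prodIso x y).hom ≫ CartesianMonoidalCategory.snd _ _, CartesianMonoidalCategory.snd _ _,
    (exists_prod x y).choose_spec.choose_spec.choose_spec.2⟩

lemma isTerminal_unitObj_left : Nonempty (IsTerminal (unitObj : Pb P F).left) :=
  ⟨isTerminalTensorUnit.ofIso exists_unit.choose_spec.choose_spec.some.symm⟩

lemma isLimit_prod_left (x y : Pb P F) :
    Nonempty (IsLimit (BinaryFan.mk (prodFst x y).left (prodSnd x y).left)) :=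
  ⟨IsLimit.ofIsoLimit (tensorProductIsBinaryProduct x.left y.left)
    (BinaryFan.ext (prodIso x y).symm (((prodIso x y).inv_hom_id_assoc _).symm)
      (((prodIso x y).inv_hom_id_assoc _).symm))⟩

/-- The chosen terminal object is terminal. -/
def isTerminalUnitObj : IsTerminal (unitObj : Pb P F) :=
  isLimitOf (asEmptyCone unitObj)
    ((isLimitMapConeEmptyConeEquiv _ _).symm isTerminal_unitObj_left.some)
    ((isLimitMapConeEmptyConeEquiv _ _).symm (isTerminalTensorUnit (C := M)))
    ((isLimitMapConeEmptyConeEquiv _ _).symm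
      ((isTerminalTensorUnit (C := M)).isTerminalObj F))

/-- The chosen product is a product. -/
def isLimitProd (x y : Pb P F) : IsLimit (BinaryFan.mk (prodFst x y) (prodSnd x y)) :=
  isLimitOf _ ((isLimitMapConeBinaryFanEquiv _ _ _).symm (isLimit_prod_left x y).some)
    ((isLimitMapConeBinaryFanEquiv _ _ _).symm (tensorProductIsBinaryProduct x.right y.right))
    ((isLimitMapConeBinaryFanEquiv _ _ _).symm
      (mapIsLimitOfPreservesOfIsLimit F _ _ (tensorProductIsBinaryProduct x.right y.right)))

/-- The chosen finite products of the pullback; the second projection preserves them strictly. -/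
@[reducible]
def cartesian (P : E ⥤ N) (F : M ⥤ N) [P.IsFibered] [PreservesFiniteProducts P]
    [PreservesFiniteProducts F] : CartesianMonoidalCategory (Pb P F) :=
  .ofChosenFiniteProducts ⟨_, isTerminalUnitObj⟩ fun x y => ⟨_, isLimitProd x y⟩

lemma fst_preservesFiniteProducts : PreservesFiniteProducts (Pb.fst P F) :=
  letI := cartesian P F
  preservesFiniteProducts_of_chosen _ isTerminal_unitObj_left isLimit_prod_left

lemma snd_preservesFiniteProducts : PreservesFiniteProducts (Pb.snd P F) :=
  letI := cartesian P F
  preservesFiniteProducts_of_chosen _ ⟨isTerminalTensorUnit (C := M)⟩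
    fun x y => ⟨tensorProductIsBinaryProduct x.right y.right⟩

end Prod

section Coprod

variable [PreservesFiniteCoproducts P] [PreservesFiniteCoproducts F]

lemma exists_zero {e : E} (he : IsInitial e) {m : M} (hm : IsInitial m) :
    ∃ (e' : E) (_ : P.obj e' = F.obj m), Nonempty (e' ≅ e) := by
  obtain ⟨e', he', φ, -⟩ := exists_iso_lift (P := P)
    ((hm.isInitialObj F).uniqueUpToIso (he.isInitialObj P))
  exact ⟨e', he', ⟨φ⟩⟩

/-- The opfibration hypothesis plays no role for coproducts: only an isomorphism is lifted, and a
fibration suffices for that. -/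
lemma exists_sum (x y : Pb P F) {e : E} {i : x.left ⟶ e} {j : y.left ⟶ e}
    (h : IsColimit (BinaryCofan.mk i j)) {m : M} {i' : x.right ⟶ m} {j' : y.right ⟶ m}
    (h' : IsColimit (BinaryCofan.mk i' j')) : ∃ (e' : E) (_ : P.obj e' = F.obj m) (φ : e' ≅ e),
      HEq (P.map (i ≫ φ.inv)) (F.map i') ∧ HEq (P.map (j ≫ φ.inv)) (F.map j') := by
  have h₁ := mapIsColimitOfPreservesOfIsColimit P _ _ h
  have h₂ := mapIsColimitOfPreservesOfIsColimit F _ _ h'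
  have key : ∀ {a b a' b' c d : N} (s : a ⟶ c) (t : b ⟶ c) (s' : a' ⟶ d) (t' : b' ⟶ d), a = a' →
      b = b' → IsColimit (BinaryCofan.mk s t) → IsColimit (BinaryCofan.mk s' t') →
      ∃ i : c ≅ d, HEq (s' ≫ i.inv) s ∧ HEq (t' ≫ i.inv) t := by
    rintro a b _ _ c d s t s' t' rfl rfl h h'
    exact ⟨h.coconePointUniqueUpToIso h',
      heq_of_eq (h.comp_coconePointUniqueUpToIso_inv h' ⟨.left⟩),
      heq_of_eq (h.comp_coconePointUniqueUpToIso_inv h' ⟨.right⟩)⟩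
  have inv_heq : ∀ {a b a' : N} (s : a ≅ b) (t : a' ≅ b), a = a' → HEq s.hom t.hom →
      HEq s.inv t.inv := by
    rintro a b _ s t rfl h
    obtain rfl : s = t := Iso.ext (eq_of_heq h)
    rfl
  obtain ⟨k, hk₁, hk₂⟩ := key _ _ _ _ x.eq.symm y.eq.symm h₂ h₁
  obtain ⟨e', he', φ, hφ⟩ := exists_iso_lift (P := P) k
  have hφ' := inv_heq (P.mapIso φ) k he' hφ
  refine ⟨e', he', φ, ?_, ?_⟩
  · rw [P.map_comp]
    exact (heq_comp rfl rfl he' HEq.rfl hφ').trans hk₁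
  · rw [P.map_comp]
    exact (heq_comp rfl rfl he' HEq.rfl hφ').trans hk₂

end Coprod

end Pb

/-! ### The pullback of distributive categories -/

namespace DistCat

variable {E M N : DistCat.{v, u}} (p : E ⟶ N) (f : M ⟶ N) [p.functor.IsFibered]

/-- The carrier of the pullback of distributive categories. -/
abbrev PbCarrier : Type (max u v) := Pb p.functor f.functor

instance : CartesianMonoidalCategory (PbCarrier p f) :=
  haveI := p.presProd
  haveI := f.presProd
  Pb.cartesian p.functor f.functor

instance : PreservesFiniteProducts (Pb.fst p.functor f.functor) :=
  haveI := p.presProd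
  haveI := f.presProd
  Pb.fst_preservesFiniteProducts

instance : PreservesFiniteProducts (Pb.snd p.functor f.functor) :=
  haveI := p.presProd
  haveI := f.presProd
  Pb.snd_preservesFiniteProducts

lemma exists_zero : ∃ (e : E.carrier) (_ : p.functor.obj e = f.functor.obj M.zero),
    Nonempty (e ≅ E.zero) :=
  haveI := p.presCoprod
  haveI := f.presCoprod
  Pb.exists_zero E.isInitial M.isInitial

lemma exists_sum (x y : PbCarrier p f) :
    ∃ (e : E.carrier) (_ : p.functor.obj e = f.functor.obj (M.sum x.right y.right))
      (φ : e ≅ E.sum x.left y.left),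
      HEq (p.functor.map (E.inl _ _ ≫ φ.inv)) (f.functor.map (M.inl x.right y.right)) ∧
      HEq (p.functor.map (E.inr _ _ ≫ φ.inv)) (f.functor.map (M.inr x.right y.right)) :=
  haveI := p.presCoprod
  haveI := f.presCoprod
  Pb.exists_sum x y (E.isCoproduct _ _) (M.isCoproduct _ _)

/-- The chosen initial object of the pullback. -/
def pbZero : PbCarrier p f :=
  ⟨(exists_zero p f).choose, M.zero, (exists_zero p f).choose_spec.choose⟩

/-- The chosen coproduct of the pullback. -/
def pbSum (x y : PbCarrier p f) : PbCarrier p f :=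
  ⟨(exists_sum p f x y).choose, M.sum x.right y.right, (exists_sum p f x y).choose_spec.choose⟩

/-- The comparison of coproducts in the first component. -/
def pbSumIso (x y : PbCarrier p f) : (pbSum p f x y).left ≅ E.sum x.left y.left :=
  (exists_sum p f x y).choose_spec.choose_spec.choose

/-- The first injection into the chosen coproduct. -/
def pbInl (x y : PbCarrier p f) : x ⟶ pbSum p f x y :=
  ⟨E.inl _ _ ≫ (pbSumIso p f x y).inv, M.inl _ _,
    (exists_sum p f x y).choose_spec.choose_spec.choose_spec.1⟩

/-- The second injection into the chosen coproduct. -/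
def pbInr (x y : PbCarrier p f) : y ⟶ pbSum p f x y :=
  ⟨E.inr _ _ ≫ (pbSumIso p f x y).inv, M.inr _ _,
    (exists_sum p f x y).choose_spec.choose_spec.choose_spec.2⟩

lemma isInitial_pbZero_left : Nonempty (IsInitial (pbZero p f).left) :=
  ⟨E.isInitial.ofIso (exists_zero p f).choose_spec.choose_spec.some.symm⟩

lemma isColimit_pbSum_left (x y : PbCarrier p f) :
    Nonempty (IsColimit (BinaryCofan.mk (pbInl p f x y).left (pbInr p f x y).left)) :=
  isColimit_binaryCofan_of_iso (Iso.refl _) (Iso.refl _) (pbSumIso p f x y)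
    ((Category.assoc _ _ _).trans (by simp)) ((Category.assoc _ _ _).trans (by simp))
    (E.isCoproduct x.left y.left)

/-- The chosen initial object is initial. -/
def isInitialPbZero : IsInitial (pbZero p f) :=
  haveI := f.presCoprod
  Pb.isColimitOf (asEmptyCocone (pbZero p f))
    ((isColimitMapCoconeEmptyCoconeEquiv _ _).symm (isInitial_pbZero_left p f).some)
    ((isColimitMapCoconeEmptyCoconeEquiv _ _).symm M.isInitial)
    ((isColimitMapCoconeEmptyCoconeEquiv _ _).symm (M.isInitial.isInitialObj f.functor))

/-- The chosen coproduct is a coproduct. -/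
def isColimitPbSum (x y : PbCarrier p f) :
    IsColimit (BinaryCofan.mk (pbInl p f x y) (pbInr p f x y)) :=
  haveI := f.presCoprod
  Pb.isColimitOf _
    ((isColimitMapCoconeBinaryCofanEquiv _ _ _).symm (isColimit_pbSum_left p f x y).some)
    ((isColimitMapCoconeBinaryCofanEquiv _ _ _).symm (M.isCoproduct x.right y.right))
    ((isColimitMapCoconeBinaryCofanEquiv _ _ _).symm
      (mapIsColimitOfPreservesOfIsColimit f.functor _ _ (M.isCoproduct x.right y.right)))

instance : PreservesFiniteCoproducts (Pb.fst p.functor f.functor) :=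
  preservesFiniteCoproducts_of_chosen _ (isInitialPbZero p f) (pbSum p f) (pbInl p f) (pbInr p f)
    (isColimitPbSum p f) (isInitial_pbZero_left p f) (isColimit_pbSum_left p f)

instance : PreservesFiniteCoproducts (Pb.snd p.functor f.functor) :=
  preservesFiniteCoproducts_of_chosen _ (isInitialPbZero p f) (pbSum p f) (pbInl p f) (pbInr p f)
    (isColimitPbSum p f) ⟨M.isInitial⟩ fun x y => ⟨M.isCoproduct x.right y.right⟩

/-- The cocone is a colimit because its images in `E`, `M` and `N` are, each of these being
distributive and reached by a bicartesian functor. -/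
lemma isColimit_pb_whiskerLeft (x a b : PbCarrier p f) :
    Nonempty (IsColimit (BinaryCofan.mk (x ◁ pbInl p f a b) (x ◁ pbInr p f a b))) := by
  have := f.presProd
  have := f.presCoprod
  have := comp_preservesFiniteProducts (Pb.snd p.functor f.functor) f.functor
  have := comp_preservesFiniteCoproducts (Pb.snd p.functor f.functor) f.functor
  obtain ⟨h₁⟩ := isColimit_map_whiskerLeft (Pb.fst p.functor f.functor) x _ _
    (isColimitPbSum p f a b)
  obtain ⟨h₂⟩ := isColimit_map_whiskerLeft (Pb.snd p.functor f.functor) x _ _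
    (isColimitPbSum p f a b)
  obtain ⟨h₃⟩ := isColimit_map_whiskerLeft (Pb.snd p.functor f.functor ⋙ f.functor) x _ _
    (isColimitPbSum p f a b)
  exact ⟨Pb.isColimitOf _ ((isColimitMapCoconeBinaryCofanEquiv _ _ _).symm h₁)
    ((isColimitMapCoconeBinaryCofanEquiv _ _ _).symm h₂)
    ((isColimitMapCoconeBinaryCofanEquiv _ _ _).symm h₃)⟩

/-- The pullback of distributive categories along a fibration. -/
@[reducible]
def pb : DistCat.{v, u} where
  carrier := PbCarrier p f
  zero := pbZero p f
  isInitial := isInitialPbZero p f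
  sum := pbSum p f
  inl := pbInl p f
  inr := pbInr p f
  isCoproduct := isColimitPbSum p f
  distrib x a b := by
    -- The distributivity map is the canonical comparison between two coproduct cocones on the same
    -- pair.
    obtain ⟨h⟩ := isColimit_pb_whiskerLeft p f x a b
    exact inferInstanceAs (IsIso
      ((isColimitPbSum p f (x ⊗ a) (x ⊗ b)).coconePointUniqueUpToIso h).hom)

/-- The first projection. -/
@[reducible]
def pbFst : pb p f ⟶ E where
  functor := Pb.fst p.functor f.functor
  presProd := inferInstanceAs (PreservesFiniteProducts (Pb.fst p.functor f.functor))
  presCoprod := inferInstanceAs (PreservesFiniteCoproducts (Pb.fst p.functor f.functor))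

/-- The second projection. -/
@[reducible]
def pbSnd : pb p f ⟶ M where
  functor := Pb.snd p.functor f.functor
  presProd := inferInstanceAs (PreservesFiniteProducts (Pb.snd p.functor f.functor))
  presCoprod := inferInstanceAs (PreservesFiniteCoproducts (Pb.snd p.functor f.functor))

/-- Definitional, since every choice was made with the chosen structure of `M` as second component.
-/
lemma pbSnd_isStrict : (pbSnd p f).IsStrict where
  unit := rfl
  prod _ _ := rfl
  fst _ _ := HEq.rfl
  snd _ _ := HEq.rfl
  zero := rfl
  sum _ _ := rfl
  inl _ _ := HEq.rfl
  inr _ _ := HEq.rfl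

lemma pb_w : pbFst p f ≫ p = pbSnd p f ≫ f := Mor.ext (Pb.fst_comp_eq p.functor f.functor)

/-- The 1-cell into the pullback induced by a commutative square. -/
@[reducible]
def pbLift {X : DistCat.{v, u}} (a : X ⟶ E) (c : X ⟶ M) (e : a ≫ p = c ≫ f) : X ⟶ pb p f where
  functor := Pb.lift a.functor c.functor (congrArg Mor.functor e)
  presProd := haveI := a.presProd; haveI := c.presProd; haveI := f.presProd
    Pb.lift_preservesFiniteProducts a.functor c.functor (congrArg Mor.functor e)
  presCoprod := haveI := a.presCoprod; haveI := c.presCoprod; haveI := f.presCoprod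
    Pb.lift_preservesFiniteCoproducts a.functor c.functor (congrArg Mor.functor e)

lemma eqToHom_functor {C D : DistCat.{v, u}} {F G : C ⟶ D} (e : F = G) (c : C.carrier) :
    NatTrans.app (eqToHom e : F ⟶ G) c =
      eqToHom (congrArg (fun t : C ⟶ D => t.functor.obj c) e) := by
  subst e
  rfl

lemma isPullback_pb : IsPullback₂ (pbFst p f) (pbSnd p f) p f where
  w := pb_w p f
  lift {X} a c e := by
    refine ⟨pbLift p f a c e, ⟨rfl, rfl⟩, fun t ht => Mor.ext (Pb.functor_ext ?_ ?_)⟩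
    · exact congrArg Mor.functor ht.1
    · exact congrArg Mor.functor ht.2
  lift₂ {X} s t σ τ h := by
    -- In components the coherence cells are identities, so the compatibility condition says that
    -- the two families have the same image in `N`.
    have hw : ∀ x, HEq (p.functor.map (NatTrans.app σ x)) (f.functor.map (NatTrans.app τ x)) := by
      intro x
      have e : 𝟙 _ ≫ p.functor.map (NatTrans.app σ x) ≫ 𝟙 _ ≫
          NatTrans.app (eqToHom (pb_w p f)) (t.functor.obj x) =
          NatTrans.app (eqToHom (pb_w p f)) (s.functor.obj x) ≫ 𝟙 _ ≫
            f.functor.map (NatTrans.app τ x) ≫ 𝟙 _ :=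
        congrArg (fun u : (s ≫ pbFst p f) ≫ p ⟶ t ≫ pbSnd p f ≫ f => NatTrans.app u x) h
      rw [eqToHom_functor, eqToHom_functor, Category.id_comp, Category.id_comp, Category.id_comp,
        Category.comp_id] at e
      exact ((comp_eqToHom_heq' _ _).symm.trans (heq_of_eq e)).trans (eqToHom_comp_heq' _ _)
    let θ : s.functor ⟶ t.functor :=
      { app := fun x => ⟨NatTrans.app σ x, NatTrans.app τ x, hw x⟩
        naturality := fun x y k => Pb.hom_ext (NatTrans.naturality σ k) (NatTrans.naturality τ k) }
    refine ⟨θ, ⟨rfl, rfl⟩, fun θ' hθ => NatTrans.ext (funext fun x => Pb.hom_ext ?_ ?_)⟩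
    · exact congrArg (fun u : s ≫ pbFst p f ⟶ t ≫ pbFst p f => NatTrans.app u x) hθ.1
    · exact congrArg (fun u : s ≫ pbSnd p f ⟶ t ≫ pbSnd p f => NatTrans.app u x) hθ.2

end DistCat

/-! ### Heterogeneous equality in locally indexed categories -/

namespace IdxCat

variable {C : Type u} [Category.{v} C] {𝒞 : IdxCat.{w} C}

lemma heq_comp {c c' : C} {A B D A' B' D' : 𝒞.Obj} {k : 𝒞.Hom c A B} {l : 𝒞.Hom c B D}
    {k' : 𝒞.Hom c' A' B'} {l' : 𝒞.Hom c' B' D'} (hc : c = c') (hA : A = A') (hB : B = B')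
    (hD : D = D') (hk : HEq k k') (hl : HEq l l') : HEq (𝒞.comp k l) (𝒞.comp k' l') := by
  subst hc hA hB hD hk hl
  rfl

lemma heq_reind {c c' d d' : C} {A B A' B' : 𝒞.Obj} {ρ : d ⟶ c} {ρ' : d' ⟶ c'}
    {k : 𝒞.Hom c A B} {k' : 𝒞.Hom c' A' B'} (hc : c = c') (hd : d = d') (hA : A = A')
    (hB : B = B') (hρ : HEq ρ ρ') (hk : HEq k k') : HEq (𝒞.reind ρ k) (𝒞.reind ρ' k') := by
  subst hc hd hA hB hρ hk
  rfl

lemma heq_id {c c' : C} {A A' : 𝒞.Obj} (hc : c = c') (hA : A = A') :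
    HEq (𝒞.id c A) (𝒞.id c' A') := by
  subst hc hA
  rfl

lemma heq_comp_id {c : C} {A B D : 𝒞.Obj} (k : 𝒞.Hom c A B) {l : 𝒞.Hom c B D} (hD : B = D)
    (hl : HEq l (𝒞.id c B)) : HEq (𝒞.comp k l) k := by
  subst hD hl
  exact heq_of_eq (𝒞.comp_id k)

lemma heq_id_comp {c : C} {A B D : 𝒞.Obj} {k : 𝒞.Hom c A B} (l : 𝒞.Hom c B D) (hA : A = B)
    (hk : HEq k (𝒞.id c B)) : HEq (𝒞.comp k l) l := by
  subst hA hk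
  exact heq_of_eq (𝒞.id_comp l)

variable [CartesianMonoidalCategory C]

lemma heq_reind_toUnit {c c' : C} {A B A' B' : 𝒞.Obj} {k : 𝒞.Hom (𝟙_ C) A B}
    {k' : 𝒞.Hom (𝟙_ C) A' B'} (hc : c = c') (hA : A = A') (hB : B = B') (hk : HEq k k') :
    HEq (𝒞.reind (toUnit c) k) (𝒞.reind (toUnit c') k') := by
  subst hc hA hB hk
  rfl

@[simp] lemma reind_toUnit_unit {A B : 𝒞.Obj} (k : 𝒞.Hom (𝟙_ C) A B) :
    𝒞.reind (toUnit (𝟙_ C)) k = k := by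
  rw [toUnit_unique (toUnit (𝟙_ C)) (𝟙 _), 𝒞.reind_id]

lemma reind_toUnit {c d : C} (ρ : d ⟶ c) {A B : 𝒞.Obj} (k : 𝒞.Hom (𝟙_ C) A B) :
    𝒞.reind ρ (𝒞.reind (toUnit c) k) = 𝒞.reind (toUnit d) k := by
  rw [𝒞.reind_reind, comp_toUnit]

end IdxCat

/-! ### 1-cells of `LInd`, their action over the terminal index, and coherence cells -/

namespace LInd

namespace Mor

variable {X Y Z : LInd.{v, u}}

lemma hext {F G : X ⟶ Y} (hb : Mor.base F = Mor.base G) (ho : ∀ A, Mor.obj F A = Mor.obj G A)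
    (hm : ∀ {c : X.base} {A B : X.fib.Obj} (k : X.fib.Hom c A B),
      HEq (Mor.map F k) (Mor.map G k)) : F = G := by
  obtain ⟨b, φ⟩ := F
  obtain ⟨b', φ'⟩ := G
  obtain rfl : b = b' := hb
  obtain rfl : φ = φ' := IdxFunctor.ext ho hm
  rfl

lemma congr_base {F G : X ⟶ Y} (e : F = G) : Mor.base F = Mor.base G := congrArg _ e

lemma congr_base_obj {F G : X ⟶ Y} (e : F = G) (c : X.base) :
    (Mor.base F).obj c = (Mor.base G).obj c := by rw [e]

lemma congr_base_map {F G : X ⟶ Y} (e : F = G) {c d : X.base} (ρ : d ⟶ c) :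
    HEq ((Mor.base F).map ρ) ((Mor.base G).map ρ) := by rw [e]

lemma congr_obj {F G : X ⟶ Y} (e : F = G) (A : X.fib.Obj) : Mor.obj F A = Mor.obj G A := by rw [e]

lemma congr_map {F G : X ⟶ Y} (e : F = G) {c : X.base} {A B : X.fib.Obj} (k : X.fib.Hom c A B) :
    HEq (Mor.map F k) (Mor.map G k) := by rw [e]

lemma map_heq (F : X ⟶ Y) {c c' : X.base} {A B A' B' : X.fib.Obj} {k : X.fib.Hom c A B}
    {k' : X.fib.Hom c' A' B'} (hc : c = c') (hA : A = A') (hB : B = B') (hk : HEq k k') :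
    HEq (F.map k) (F.map k') := by
  subst hc hA hB hk
  rfl

/-- The action of a 1-cell on morphisms over the terminal object. -/
def map₁ (F : X ⟶ Y) {A B : X.fib.Obj} (k : X.fib.Hom (𝟙_ X.base) A B) :
    Y.fib.Hom (𝟙_ Y.base) (F.obj A) (F.obj B) := Y.fib.reind F.unitIso (F.map k)

/-- `F.base` preserves the terminal object, so any two index maps into `F.base.obj (𝟙_ X.base)`
coincide and the reindexing is forced. -/
lemma map_reind_toUnit (F : X ⟶ Y) (c : X.base) {A B : X.fib.Obj}
    (k : X.fib.Hom (𝟙_ X.base) A B) :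
    F.map (X.fib.reind (toUnit c) k) = Y.fib.reind (toUnit (F.base.obj c)) (F.map₁ k) := by
  rw [map_reind, map₁, IdxCat.reind_reind]
  congr 1
  exact F.hom_unit_ext _ _

lemma map_eq_reind_map₁ (F : X ⟶ Y) {A B : X.fib.Obj} (k : X.fib.Hom (𝟙_ X.base) A B) :
    F.map k = Y.fib.reind (toUnit _) (F.map₁ k) := by
  rw [← map_reind_toUnit, IdxCat.reind_toUnit_unit]

lemma reind_map₁ (F : X ⟶ Y) {c : Y.base} (ρ : c ⟶ F.base.obj (𝟙_ X.base)) {A B : X.fib.Obj}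
    (k : X.fib.Hom (𝟙_ X.base) A B) : Y.fib.reind ρ (F.map k) = Y.fib.reind (toUnit c) (F.map₁ k) := by
  rw [map₁, IdxCat.reind_reind]
  congr 1
  exact F.hom_unit_ext _ _

@[simp] lemma map₁_id (F : X ⟶ Y) (A : X.fib.Obj) :
    F.map₁ (X.fib.id _ A) = Y.fib.id _ (F.obj A) := by
  rw [map₁, map_id, IdxCat.reind_idm]

@[simp] lemma map₁_comp (F : X ⟶ Y) {A B D : X.fib.Obj} (k : X.fib.Hom (𝟙_ X.base) A B)
    (l : X.fib.Hom (𝟙_ X.base) B D) :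
    F.map₁ (X.fib.comp k l) = Y.fib.comp (F.map₁ k) (F.map₁ l) := by
  rw [map₁, map_comp, IdxCat.reind_compm]
  rfl

lemma comp_map₁ (F : X ⟶ Y) (G : Y ⟶ Z) {A B : X.fib.Obj} (k : X.fib.Hom (𝟙_ X.base) A B) :
    map₁ (F ≫ G) k = G.map₁ (F.map₁ k) := Model.whisker_app_comp F G k

lemma map₁_heq (F : X ⟶ Y) {A B A' B' : X.fib.Obj} {k : X.fib.Hom (𝟙_ X.base) A B}
    {k' : X.fib.Hom (𝟙_ X.base) A' B'} (hA : A = A') (hB : B = B') (hk : HEq k k') :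
    HEq (F.map₁ k) (F.map₁ k') := by
  subst hA hB hk
  rfl

lemma congr_map₁ {F G : X ⟶ Y} (e : F = G) {A B : X.fib.Obj} (k : X.fib.Hom (𝟙_ X.base) A B) :
    HEq (F.map₁ k) (G.map₁ k) := by rw [e]

lemma congr_map_of_sq {W : LInd.{v, u}} {g : X ⟶ Y} {p : Y ⟶ W} {q : X ⟶ Z} {f : Z ⟶ W}
    (e : g ≫ p = q ≫ f) {c : X.base} {A B : X.fib.Obj} (k : X.fib.Hom c A B) :
    HEq (p.map (g.map k)) (f.map (q.map k)) := congr_map e k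

lemma congr_map₁_of_sq {W : LInd.{v, u}} {g : X ⟶ Y} {p : Y ⟶ W} {q : X ⟶ Z} {f : Z ⟶ W}
    (e : g ≫ p = q ≫ f) {A B : X.fib.Obj} (k : X.fib.Hom (𝟙_ X.base) A B) :
    HEq (p.map₁ (g.map₁ k)) (f.map₁ (q.map₁ k)) := by
  rw [← comp_map₁, ← comp_map₁]
  exact congr_map₁ e k

end Mor

lemma cell_hext {X Y : LInd.{v, u}} {F F' G G' : X ⟶ Y} {σ : F ⟶ G} {τ : F' ⟶ G'} (e : F = F')
    (e' : G = G') (hb : ∀ c, HEq ((Cell.base σ).app c) ((Cell.base τ).app c))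
    (ha : ∀ A, HEq (Cell.app σ A) (Cell.app τ A)) : HEq σ τ := by
  subst e e'
  exact heq_of_eq (cell_ext (fun c => eq_of_heq (hb c)) fun A => eq_of_heq (ha A))

lemma comp_whiskerRight_sq {X Y Z : LInd.{v, u}} {F G : X ⟶ Y} (σ : F ⟶ G) (H : Y ⟶ Z)
    {W : LInd.{v, u}} (K : Z ⟶ W) : (σ ▷ H) ▷ K = σ ▷ (H ≫ K) := by
  rw [Bicategory.whiskerRight_comp]
  exact (conj_id ((σ ▷ H) ▷ K))

lemma whiskerRight_heq {X Y Z : LInd.{v, u}} {F G : X ⟶ Y} (σ : F ⟶ G) {H K : Y ⟶ Z} (e : H = K) :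
    HEq (σ ▷ H) (σ ▷ K) := by
  subst e
  rfl

lemma whiskerRight_sq_heq {X K E M N : LInd.{v, u}} {g : K ⟶ E} {q : K ⟶ M} {p : E ⟶ N}
    {f : M ⟶ N} (w : g ≫ p = q ≫ f) {s t : X ⟶ K} (σ : s ⟶ t) :
    HEq ((σ ▷ g) ▷ p) ((σ ▷ q) ▷ f) :=
  ((heq_of_eq (comp_whiskerRight_sq σ g p)).trans (whiskerRight_heq σ w)).trans
    (heq_of_eq (comp_whiskerRight_sq σ q f)).symm

/-- Strips the associators and transports from the 2-dimensional condition of `IsPullback₂`, leaving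
a bare `HEq` of the whiskered cells. -/
lemma conj_id_eqToHom_iff {C : Type*} [Category* C] {a b a' b' : C} (σ : a ⟶ b) (τ : a' ⟶ b')
    {i : a ⟶ a} {j : b ⟶ b} {i' : a' ⟶ a'} {j' : b' ⟶ b'} {x : b ⟶ b'} {y : a ⟶ a'}
    (hi : i = 𝟙 a) (hj : j = 𝟙 b) (hi' : i' = 𝟙 a') (hj' : j' = 𝟙 b') (ea : a = a') (eb : b = b')
    (hx : x = eqToHom eb) (hy : y = eqToHom ea) :
    i ≫ σ ≫ j ≫ x = y ≫ i' ≫ τ ≫ j' ↔ HEq σ τ := by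
  subst hi hj hi' hj' ea eb hx hy
  simp

lemma lift₂_condition_iff {X K E M N : LInd.{v, u}} {g : K ⟶ E} {q : K ⟶ M} {p : E ⟶ N}
    {f : M ⟶ N} (w : g ≫ p = q ≫ f) {s t : X ⟶ K} (σ : s ≫ g ⟶ t ≫ g) (τ : s ≫ q ⟶ t ≫ q) :
    (α_ s g p).inv ≫ σ ▷ p ≫ (α_ t g p).hom ≫ t ◁ eqToHom w =
      s ◁ eqToHom w ≫ (α_ s q f).inv ≫ τ ▷ f ≫ (α_ t q f).hom ↔ HEq (σ ▷ p) (τ ▷ f) :=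
  conj_id_eqToHom_iff (σ ▷ p) (τ ▷ f) rfl rfl rfl rfl (congrArg (s ≫ ·) w) (congrArg (t ≫ ·) w)
    (Bicategory.whiskerLeft_eqToHom t w) (Bicategory.whiskerLeft_eqToHom s w)

/-! ### Pullbacks of locally indexed categories -/

/-- A strict pullback square on the level of objects and indexed morphisms. -/
structure IsFibPb {K E M N : LInd.{v, u}} (g : K ⟶ E) (q : K ⟶ M) (p : E ⟶ N) (f : M ⟶ N) :
    Prop where
  w : g ≫ p = q ≫ f
  obj : ∀ A B, p.obj A = f.obj B → ∃ C, g.obj C = A ∧ q.obj C = B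
  obj_ext : ∀ {C C'}, g.obj C = g.obj C' → q.obj C = q.obj C' → C = C'
  hom : ∀ {c : K.base} {C C' : K.fib.Obj} (k : E.fib.Hom (g.base.obj c) (g.obj C) (g.obj C'))
    (l : M.fib.Hom (q.base.obj c) (q.obj C) (q.obj C')), HEq (p.map k) (f.map l) →
    ∃ t : K.fib.Hom c C C', g.map t = k ∧ q.map t = l
  hom_ext : ∀ {c : K.base} {C C' : K.fib.Obj} {t t' : K.fib.Hom c C C'}, g.map t = g.map t' →
    q.map t = q.map t' → t = t'

namespace IsFibPb

variable {K E M N : LInd.{v, u}} {g : K ⟶ E} {q : K ⟶ M} {p : E ⟶ N} {f : M ⟶ N}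

lemma hom₁_ext (S : IsFibPb g q p f) {C C' : K.fib.Obj} {t t' : K.fib.Hom (𝟙_ K.base) C C'}
    (h : g.map₁ t = g.map₁ t') (h' : q.map₁ t = q.map₁ t') : t = t' := by
  refine S.hom_ext ?_ ?_
  · rw [Mor.map_eq_reind_map₁, h, ← Mor.map_eq_reind_map₁]
  · rw [Mor.map_eq_reind_map₁, h', ← Mor.map_eq_reind_map₁]

/-- The base functors send the terminal index only to an isomorphic copy of it, so `k` and `l` are
reindexed to those copies before being glued. -/
lemma hom₁ (S : IsFibPb g q p f) {C C' : K.fib.Obj}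
    (k : E.fib.Hom (𝟙_ E.base) (g.obj C) (g.obj C'))
    (l : M.fib.Hom (𝟙_ M.base) (q.obj C) (q.obj C')) (h : HEq (p.map₁ k) (f.map₁ l)) :
    ∃ t : K.fib.Hom (𝟙_ K.base) C C', g.map₁ t = k ∧ q.map₁ t = l := by
  obtain ⟨t, h₁, h₂⟩ := S.hom (E.fib.reind (toUnit (g.base.obj (𝟙_ K.base))) k)
    (M.fib.reind (toUnit (q.base.obj (𝟙_ K.base))) l) (by
      rw [Mor.map_reind_toUnit, Mor.map_reind_toUnit]
      exact IdxCat.heq_reind_toUnit (Mor.congr_base_obj S.w _) (Mor.congr_obj S.w C)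
        (Mor.congr_obj S.w C') h)
  refine ⟨t, ?_, ?_⟩
  · rw [Mor.map₁, h₁, IdxCat.reind_toUnit, IdxCat.reind_toUnit_unit]
  · rw [Mor.map₁, h₂, IdxCat.reind_toUnit, IdxCat.reind_toUnit_unit]

end IsFibPb

section Pb

variable {E M N : LInd.{v, u}} (p : E ⟶ N) (f : M ⟶ N)

/-- An object of the pullback. -/
@[ext]
structure PbObj where
  left : E.fib.Obj
  right : M.fib.Obj
  eq : p.obj left = f.obj right

variable {p f} in
/-- An indexed morphism of the pullback. -/
@[ext]
structure PbHom (c : CBPV.Pb p.base f.base) (A B : PbObj p f) where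
  left : E.fib.Hom c.left A.left B.left
  right : M.fib.Hom c.right A.right B.right
  w : HEq (p.map left) (f.map right)

/-- The indexed category underlying the pullback. -/
@[reducible]
def pbFib : IdxCat.{max u v} (CBPV.Pb p.base f.base) where
  Obj := PbObj p f
  Hom c A B := PbHom c A B
  id c A := ⟨E.fib.id _ _, M.fib.id _ _, by
    rw [Mor.map_id, Mor.map_id]
    exact IdxCat.heq_id c.eq A.eq⟩
  comp {c A B D} k l := ⟨E.fib.comp k.left l.left, M.fib.comp k.right l.right, by
    rw [Mor.map_comp, Mor.map_comp]
    exact IdxCat.heq_comp c.eq A.eq B.eq D.eq k.w l.w⟩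
  id_comp k := PbHom.ext (E.fib.id_comp _) (M.fib.id_comp _)
  comp_id k := PbHom.ext (E.fib.comp_id _) (M.fib.comp_id _)
  assoc _ _ _ := PbHom.ext (E.fib.assoc _ _ _) (M.fib.assoc _ _ _)
  reind {c d A B} ρ k := ⟨E.fib.reind ρ.left k.left, M.fib.reind ρ.right k.right, by
    rw [Mor.map_reind, Mor.map_reind]
    exact IdxCat.heq_reind c.eq d.eq A.eq B.eq ρ.w k.w⟩
  reind_idm ρ A := PbHom.ext (E.fib.reind_idm _ _) (M.fib.reind_idm _ _)
  reind_compm ρ _ _ _ k l := PbHom.ext (E.fib.reind_compm _ _ _) (M.fib.reind_compm _ _ _)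
  reind_id k := PbHom.ext (E.fib.reind_id _) (M.fib.reind_id _)
  reind_reind ρ ρ' _ _ k := PbHom.ext (E.fib.reind_reind _ _ _) (M.fib.reind_reind _ _ _)

variable {p f} in
lemma pb_hom_heq {c c' : CBPV.Pb p.base f.base} {A B A' B' : PbObj p f} {k : PbHom c A B}
    {k' : PbHom c' A' B'} (hc : c = c') (hA : A = A') (hB : B = B') (hl : HEq k.left k'.left)
    (hr : HEq k.right k'.right) : HEq k k' := by
  subst hc hA hB
  exact heq_of_eq (PbHom.ext (eq_of_heq hl) (eq_of_heq hr))

variable [CartesianMonoidalCategory (CBPV.Pb p.base f.base)]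

/-- The pullback of locally indexed categories. -/
@[reducible]
def pb : LInd.{v, u} where
  base := CBPV.Pb p.base f.base
  fib := pbFib p f

variable [PreservesFiniteProducts (CBPV.Pb.fst p.base f.base)]
  [PreservesFiniteProducts (CBPV.Pb.snd p.base f.base)]

/-- The first projection. -/
@[reducible]
def pbFst : pb p f ⟶ E where
  base := CBPV.Pb.fst p.base f.base
  pres := inferInstance
  fib :=
    { obj := fun A => A.left
      map := fun k => k.left
      map_id := fun _ _ => rfl
      map_comp := fun _ _ => rfl
      map_reind := fun _ _ _ _ => rfl }

/-- The second projection. -/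
@[reducible]
def pbSnd : pb p f ⟶ M where
  base := CBPV.Pb.snd p.base f.base
  pres := inferInstance
  fib :=
    { obj := fun A => A.right
      map := fun k => k.right
      map_id := fun _ _ => rfl
      map_comp := fun _ _ => rfl
      map_reind := fun _ _ _ _ => rfl }

lemma pb_w : pbFst p f ≫ p = pbSnd p f ≫ f :=
  Mor.hext (CBPV.Pb.fst_comp_eq p.base f.base) (fun A => A.eq) fun k => k.w

lemma isFibPb_pb : IsFibPb (pbFst p f) (pbSnd p f) p f where
  w := pb_w p f
  obj A B h := ⟨⟨A, B, h⟩, rfl, rfl⟩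
  obj_ext h h' := PbObj.ext h h'
  hom k l h := ⟨⟨k, l, h⟩, rfl, rfl⟩
  hom_ext h h' := PbHom.ext h h'

variable {p f} in
/-- The indexed functor into the pullback induced by a commutative square. -/
@[reducible]
def pbLiftFib {X : LInd.{v, u}} (a : X ⟶ E) (c : X ⟶ M) (e : a ≫ p = c ≫ f) :
    IdxFunctor X.fib ((pbFib p f).changeBase
      (CBPV.Pb.lift a.base c.base (Mor.congr_base e))) where
  obj A := ⟨a.obj A, c.obj A, Mor.congr_obj e A⟩
  map k := ⟨a.map k, c.map k, Mor.congr_map e k⟩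
  map_id x A := PbHom.ext (a.map_id x A) (c.map_id x A)
  map_comp k l := PbHom.ext (a.map_comp k l) (c.map_comp k l)
  map_reind ρ _ _ k := PbHom.ext (a.map_reind ρ k) (c.map_reind ρ k)

variable {p f} in
/-- The 1-cell into the pullback induced by a commutative square. -/
@[reducible]
def pbLift {X : LInd.{v, u}} (a : X ⟶ E) (c : X ⟶ M) (e : a ≫ p = c ≫ f) : X ⟶ pb p f where
  base := CBPV.Pb.lift a.base c.base (Mor.congr_base e)
  pres := CBPV.Pb.lift_preservesFiniteProducts a.base c.base (Mor.congr_base e)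
  fib := pbLiftFib a c e

lemma pb_mor_ext {X : LInd.{v, u}} {s t : X ⟶ pb p f} (h : s ≫ pbFst p f = t ≫ pbFst p f)
    (h' : s ≫ pbSnd p f = t ≫ pbSnd p f) : s = t := by
  have hb : Mor.base s = Mor.base t :=
    CBPV.Pb.functor_ext (Mor.congr_base h) (Mor.congr_base h')
  have ho : ∀ A, Mor.obj s A = Mor.obj t A := fun A =>
    PbObj.ext (Mor.congr_obj h A) (Mor.congr_obj h' A)
  exact Mor.hext hb ho fun {c A B} k => pb_hom_heq (Functor.congr_obj hb c) (ho A) (ho B)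
    (Mor.congr_map h k) (Mor.congr_map h' k)

lemma isPullback_pb : IsPullback₂ (pbFst p f) (pbSnd p f) p f where
  w := pb_w p f
  lift {X} a c e := ⟨pbLift a c e, ⟨rfl, rfl⟩, fun t ht => pb_mor_ext p f ht.1 ht.2⟩
  lift₂ {X} s t σ τ h := by
    have h' := (lift₂_condition_iff (pb_w p f) σ τ).1 h
    have es : (s ≫ pbFst p f) ≫ p = (s ≫ pbSnd p f) ≫ f := congrArg (s ≫ ·) (pb_w p f)
    have et : (t ≫ pbFst p f) ≫ p = (t ≫ pbSnd p f) ≫ f := congrArg (t ≫ ·) (pb_w p f)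
    have hb : ∀ x, HEq (p.base.map ((Cell.base σ).app x)) (f.base.map ((Cell.base τ).app x)) :=
      fun x => Model.Mor.cell_base_heq es et h' x
    have ha : ∀ A, HEq (p.map₁ (Cell.app σ A)) (f.map₁ (Cell.app τ A)) :=
      fun A => Model.Mor.cell_app_heq es et h' A
    -- The components over the terminal index are glued separately for each object; naturality is
    -- then checked after each projection.
    choose θa h₁ h₂ using fun A => (isFibPb_pb p f).hom₁ (C := s.obj A) (C' := t.obj A)
      (Cell.app σ A) (Cell.app τ A) (ha A)
    let θ : s ⟶ t :=
      { base :=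
          { app := fun x => ⟨(Cell.base σ).app x, (Cell.base τ).app x, hb x⟩
            naturality := fun x y k => CBPV.Pb.hom_ext ((Cell.base σ).naturality k)
              ((Cell.base τ).naturality k) }
        app := θa
        naturality := fun {x A B} k => by
          refine (isFibPb_pb p f).hom_ext ?_ ?_
          · rw [Mor.map_comp, Mor.map_comp, Mor.map_reind_toUnit, Mor.map_reind_toUnit, h₁, h₁]
            exact Cell.naturality σ k
          · rw [Mor.map_comp, Mor.map_comp, Mor.map_reind_toUnit, Mor.map_reind_toUnit, h₂, h₂]
            exact Cell.naturality τ k }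
    refine ⟨θ, ⟨cell_ext (fun x => rfl) h₁, cell_ext (fun x => rfl) h₂⟩, fun θ' hθ => ?_⟩
    have e₁ : ∀ A, (pbFst p f).map₁ (Cell.app θ' A) = Cell.app σ A := fun A =>
      congrArg (fun u : s ≫ pbFst p f ⟶ t ≫ pbFst p f => Cell.app u A) hθ.1
    have e₂ : ∀ A, (pbSnd p f).map₁ (Cell.app θ' A) = Cell.app τ A := fun A =>
      congrArg (fun u : s ≫ pbSnd p f ⟶ t ≫ pbSnd p f => Cell.app u A) hθ.2
    refine cell_ext (fun x => CBPV.Pb.hom_ext ?_ ?_) fun A => (isFibPb_pb p f).hom₁_ext ?_ ?_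
    · exact congrArg (fun u : s ≫ pbFst p f ⟶ t ≫ pbFst p f => (Cell.base u).app x) hθ.1
    · exact congrArg (fun u : s ≫ pbSnd p f ⟶ t ≫ pbSnd p f => (Cell.base u).app x) hθ.2
    · exact (e₁ A).trans (h₁ A).symm
    · exact (e₂ A).trans (h₂ A).symm

end Pb

/-! ### Stability of fibrations and splittings under pullback in `LInd` -/

/-- Pullback squares in `LInd` induce strict pullback squares of hom-categories. -/
lemma isStrictPb_postcomp {K E M N : LInd.{v, u}} {g : K ⟶ E} {q : K ⟶ M} {p : E ⟶ N}
    {f : M ⟶ N} (S : IsPullback₂ g q p f) (X : LInd.{v, u}) :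
    IsStrictPb (postcomp X g) (postcomp X q) (postcomp X p) (postcomp X f) where
  w := by
    refine CategoryTheory.Functor.hext (fun s => congrArg (s ≫ ·) S.w) fun s t σ => ?_
    exact whiskerRight_sq_heq S.w σ
  obj a c h := by
    obtain ⟨t, ht, -⟩ := S.lift a c h
    exact ⟨t, ht⟩
  obj_ext {s t} h h' := by
    obtain ⟨_, -, hu⟩ := S.lift (t ≫ g) (t ≫ q) (congrArg (t ≫ ·) S.w)
    exact (hu s ⟨h, h'⟩).trans (hu t ⟨rfl, rfl⟩).symm
  hom {s t} a b h := by
    obtain ⟨θ, hθ, -⟩ := S.lift₂ s t a b ((lift₂_condition_iff S.w a b).2 h)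
    exact ⟨θ, hθ⟩
  hom_ext {s t θ θ'} h h' := by
    obtain ⟨_, -, hu⟩ := S.lift₂ s t (θ ▷ g) (θ ▷ q) ((lift₂_condition_iff S.w _ _).2
      (whiskerRight_sq_heq S.w θ))
    exact (hu θ ⟨rfl, rfl⟩).trans (hu θ' ⟨h.symm, h'.symm⟩).symm

/-- Each functor `q ∘ -` is a strict pullback of `p ∘ -`. A 2-cell is cartesian for `q` exactly when
its whiskering with `g` is cartesian for `p`, so stability under precomposition is inherited from
`p`. -/
lemma isFibration_of_isPullback {K E M N : LInd.{v, u}} {g : K ⟶ E} {q : K ⟶ M} {p : E ⟶ N}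
    {f : M ⟶ N} (S : IsPullback₂ g q p f) (hp : IsFibration p) : IsFibration q where
  fibered X := (isStrictPb_postcomp S X).isFibered (hp.fibered X)
  precomp {X Y} h e e' φ hφ := by
    have := hp.fibered X
    have := hp.fibered Y
    have h₁ := (isStrictPb_postcomp S X).isStronglyCartesian_fst (hp.fibered X) hφ
    have h₂ : (postcomp Y p).IsCartesian ((postcomp Y p).map (h ◁ ((postcomp X g).map φ)))
      (h ◁ ((postcomp X g).map φ)) := hp.precomp h _ inferInstance
    have h₃ : (postcomp Y p).IsStronglyCartesian ((postcomp Y p).map (h ◁ ((postcomp X g).map φ)))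
      (h ◁ ((postcomp X g).map φ)) := inferInstance
    have h₄ := (isStrictPb_postcomp S Y).isStronglyCartesian (φ := h ◁ φ) h₃
    infer_instance

lemma whiskerLeft_whisker_heq {X Y M N K : LInd.{v, u}} {q : K ⟶ M} {f : M ⟶ N} (h : Y ⟶ X)
    (e : X ⟶ K) {c : X ⟶ M} (σ : c ⟶ e ≫ q) {a : X ⟶ N} (w : (e ≫ q) ≫ f = a) {b : Y ⟶ N}
    (w' : ((h ≫ e) ≫ q) ≫ f = b) :
    HEq ((h ◁ σ ≫ (α_ h e q).inv) ▷ f ≫ eqToHom w')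
      (h ◁ (σ ▷ f ≫ eqToHom w) ≫ 𝟙 _) := by
  subst w w'
  have e₁ : h ◁ σ ≫ (α_ h e q).inv = h ◁ σ := Category.comp_id (h ◁ σ)
  rw [eqToHom_refl, eqToHom_refl, Category.comp_id, Category.comp_id, Category.comp_id, e₁]
  rfl

lemma whiskerLeft_cell_heq {X Y Z : LInd.{v, u}} (h : Y ⟶ X) {F F' G G' : X ⟶ Z} (e : F = F')
    (e' : G = G') {σ : F ⟶ G} {τ : F' ⟶ G'} (H : HEq σ τ) : HEq (h ◁ σ) (h ◁ τ) := by
  subst e e' H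
  rfl

section Split

variable {K E M N : LInd.{v, u}} {g : K ⟶ E} {q : K ⟶ M} {p : E ⟶ N} {f : M ⟶ N}
  (S : IsPullback₂ g q p f) (T : Splitting₂ p) {X Y : LInd.{v, u}} (h : Y ⟶ X) (e : X ⟶ K)
  {c : X ⟶ M} (σ : c ⟶ e ≫ q)

lemma splitBase_precomp_heq :
    HEq ((isStrictPb_postcomp S Y).splitBase (h ≫ e) (h ◁ σ ≫ (α_ h e q).inv))
      (h ◁ (isStrictPb_postcomp S X).splitBase e σ ≫ (α_ h (e ≫ g) p).inv) :=
  whiskerLeft_whisker_heq h e σ _ _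

lemma splitObj_precomp :
    (isStrictPb_postcomp S Y).splitObj (T.split Y) (h ≫ e) (h ◁ σ ≫ (α_ h e q).inv) =
      h ≫ (isStrictPb_postcomp S X).splitObj (T.split X) e σ := by
  refine (isStrictPb_postcomp S Y).obj_ext ?_ ?_
  · refine ((isStrictPb_postcomp S Y).fst_splitObj (T.split Y) _ _).trans ?_
    refine Eq.trans ?_ ((T.obj_precomp h (e ≫ g) ((isStrictPb_postcomp S X).splitBase e σ)).trans
      (congrArg (h ≫ ·) ((isStrictPb_postcomp S X).fst_splitObj (T.split X) e σ).symm))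
    exact (T.split Y).obj_congr rfl rfl (splitBase_precomp_heq S h e σ)
  · exact ((isStrictPb_postcomp S Y).snd_splitObj (T.split Y) _ _).trans
      (congrArg (h ≫ ·) ((isStrictPb_postcomp S X).snd_splitObj (T.split X) e σ)).symm

/-- Both sides are determined by their whiskerings with `g` and `q`. With `g` the claim is
`T.lift_precomp`; with `q` both sides are the prescribed cell. -/
lemma splitLift_precomp :
    HEq ((isStrictPb_postcomp S Y).splitLift (T.split Y) (h ≫ e) (h ◁ σ ≫ (α_ h e q).inv))
      (h ◁ (isStrictPb_postcomp S X).splitLift (T.split X) e σ) := by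
  have key : ∀ {s s' t : Y ⟶ K} (_ : s = s') (θ : s ⟶ t) (θ' : s' ⟶ t), HEq (θ ▷ g) (θ' ▷ g) →
      HEq (θ ▷ q) (θ' ▷ q) → HEq θ θ' := by
    rintro s _ t rfl θ θ' h₁ h₂
    exact heq_of_eq ((isStrictPb_postcomp S Y).hom_ext (eq_of_heq h₁) (eq_of_heq h₂))
  refine key (splitObj_precomp S T h e σ) _ _ ?_ ?_
  · refine ((isStrictPb_postcomp S Y).fst_splitLift (T.split Y) _ _).trans ?_
    refine HEq.trans ((T.split Y).lift_congr rfl rfl (splitBase_precomp_heq S h e σ)) ?_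
    refine (heq_of_eq (T.lift_precomp h (e ≫ g) _)).trans ((eqToHom_comp_heq' _ _).trans ?_)
    exact whiskerLeft_cell_heq h ((isStrictPb_postcomp S X).fst_splitObj (T.split X) e σ).symm rfl
      ((isStrictPb_postcomp S X).fst_splitLift (T.split X) e σ).symm
  · refine ((isStrictPb_postcomp S Y).snd_splitLift (T.split Y) _ _).trans ?_
    refine (heq_of_eq (Category.comp_id (h ◁ σ))).trans ?_
    exact whiskerLeft_cell_heq h ((isStrictPb_postcomp S X).snd_splitObj (T.split X) e σ).symm rfl
      ((isStrictPb_postcomp S X).snd_splitLift (T.split X) e σ).symm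

end Split

/-- The splitting of a pullback of a split 1-cell. -/
def splittingOfIsPullback {K E M N : LInd.{v, u}} {g : K ⟶ E} {q : K ⟶ M} {p : E ⟶ N}
    {f : M ⟶ N} (S : IsPullback₂ g q p f) (T : Splitting₂ p) : Splitting₂ q where
  split X := (isStrictPb_postcomp S X).splitting (T.split X)
  obj_precomp h e _ σ := splitObj_precomp S T h e σ
  lift_precomp h e _ σ := eq_of_heq ((splitLift_precomp S T h e σ).trans
    (eqToHom_comp_heq' (splitObj_precomp S T h e σ) _).symm)

end LInd

/-! ### Pointwise cartesian lifts -/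

namespace LInd

variable {E N : LInd.{v, u}}

/-- A morphism over the terminal object that is cartesian along `p`, for morphisms over all
indices. -/
def IsCart (p : E ⟶ N) {B A : E.fib.Obj} (φ : E.fib.Hom (𝟙_ E.base) B A) : Prop :=
  ∀ ⦃c : E.base⦄ ⦃Z : E.fib.Obj⦄ (l : E.fib.Hom c Z A)
    (m : N.fib.Hom (p.base.obj c) (p.obj Z) (p.obj B)),
    N.fib.comp m (N.fib.reind (toUnit _) (p.map₁ φ)) = p.map l →
    ∃! l' : E.fib.Hom c Z B, p.map l' = m ∧ E.fib.comp l' (E.fib.reind (toUnit c) φ) = l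

/-- The 1-cell `p` has pointwise cartesian lifts. -/
def HasLifts (p : E ⟶ N) : Prop :=
  ∀ (A : E.fib.Obj) (B : N.fib.Obj) (k : N.fib.Hom (𝟙_ N.base) B (p.obj A)),
    ∃ (B' : E.fib.Obj) (_ : p.obj B' = B) (φ : E.fib.Hom (𝟙_ E.base) B' A),
      HEq (p.map₁ φ) k ∧ IsCart p φ

section Comma

variable (p : E ⟶ N)

/-- An object of the comma object of `N` over `p`. -/
structure CommaObj where
  dom : N.fib.Obj
  cod : E.fib.Obj
  hom : N.fib.Hom (𝟙_ N.base) dom (p.obj cod)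

variable {p} in
/-- A morphism of the comma object. -/
@[ext]
structure CommaHom (c : E.base) (x y : CommaObj p) where
  cod : E.fib.Hom c x.cod y.cod
  dom : N.fib.Hom (p.base.obj c) x.dom y.dom
  w : N.fib.comp dom (N.fib.reind (toUnit _) y.hom) =
    N.fib.comp (N.fib.reind (toUnit _) x.hom) (p.map cod)

/-- The comma object of `N` over `p`, indexed over the base of `E`. -/
@[reducible]
def comma : LInd.{v, u} where
  base := E.base
  fib :=
    { Obj := CommaObj p
      Hom := fun c x y => CommaHom c x y
      id := fun c x => ⟨E.fib.id _ _, N.fib.id _ _, by simp⟩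
      comp := fun {c x y z} k l => ⟨E.fib.comp k.cod l.cod, N.fib.comp k.dom l.dom, by
        rw [Mor.map_comp, IdxCat.assoc, l.w, ← IdxCat.assoc, k.w, IdxCat.assoc]⟩
      id_comp := fun k => CommaHom.ext (E.fib.id_comp _) (N.fib.id_comp _)
      comp_id := fun k => CommaHom.ext (E.fib.comp_id _) (N.fib.comp_id _)
      assoc := fun _ _ _ => CommaHom.ext (E.fib.assoc _ _ _) (N.fib.assoc _ _ _)
      reind := fun {c d x y} ρ k => ⟨E.fib.reind ρ k.cod, N.fib.reind (p.base.map ρ) k.dom, by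
        have := congrArg (N.fib.reind (p.base.map ρ)) k.w
        simpa only [IdxCat.reind_compm, IdxCat.reind_toUnit, ← Mor.map_reind] using this⟩
      reind_idm := fun ρ x => CommaHom.ext (E.fib.reind_idm _ _) (N.fib.reind_idm _ _)
      reind_compm := fun ρ _ _ _ k l =>
        CommaHom.ext (E.fib.reind_compm _ _ _) (N.fib.reind_compm _ _ _)
      reind_id := fun k => CommaHom.ext (E.fib.reind_id _)
        ((congrArg (fun r => N.fib.reind r k.dom) (p.base.map_id _)).trans (N.fib.reind_id _))
      reind_reind := fun ρ ρ' _ _ k => CommaHom.ext (E.fib.reind_reind _ _ _)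
        ((N.fib.reind_reind _ _ _).trans
          (congrArg (fun r => N.fib.reind r k.dom) (p.base.map_comp _ _).symm)) }

/-- The projection to `E`. -/
@[reducible]
def commaCod : comma p ⟶ E where
  base := 𝟭 E.base
  fib :=
    { obj := fun x => x.cod
      map := fun k => k.cod
      map_id := fun _ _ => rfl
      map_comp := fun _ _ => rfl
      map_reind := fun _ _ _ _ => rfl }

/-- The projection to `N`. -/
@[reducible]
def commaDom : comma p ⟶ N where
  base := p.base
  fib :=
    { obj := fun x => x.dom
      map := fun k => k.dom
      map_id := fun _ _ => rfl
      map_comp := fun _ _ => rfl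
      map_reind := fun _ _ _ _ => rfl }

/-- The universal 2-cell of the comma object. -/
def commaCell : commaDom p ⟶ commaCod p ≫ p where
  base := 𝟙 p.base
  app x := x.hom
  naturality k := k.w.trans (congrArg (N.fib.comp _) (N.fib.reind_id (p.map k.cod)).symm)

/-- The diagonal into the comma object. -/
@[reducible]
def commaDiag : E ⟶ comma p where
  base := 𝟭 E.base
  fib :=
    { obj := fun A => ⟨p.obj A, A, N.fib.id _ _⟩
      map := fun k => ⟨k, p.map k, by simp⟩
      map_id := fun _ _ => CommaHom.ext rfl (p.map_id _ _)
      map_comp := fun _ _ => CommaHom.ext rfl (p.map_comp _ _)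
      map_reind := fun _ _ _ _ => CommaHom.ext rfl (p.map_reind _ _) }

/-- The data of a cartesian lift of the universal 2-cell of the comma object, in components. -/
structure CommaLift where
  t : comma p ⟶ E
  φb : ∀ d : E.base, t.base.obj d ⟶ d
  φa : ∀ x : CommaObj p, E.fib.Hom (𝟙_ E.base) (t.obj x) x.cod
  φ_nat : ∀ {c : E.base} {x y : CommaObj p} (k : CommaHom c x y),
    E.fib.comp (Mor.map t (X := comma p) k) (E.fib.reind (toUnit _) (φa y)) =
      E.fib.comp (E.fib.reind (toUnit _) (φa x)) (E.fib.reind (φb c) k.cod)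
  ψb : ∀ d : E.base, d ⟶ t.base.obj d
  ψb_nat : ∀ {c d : E.base} (ρ : d ⟶ c), ρ ≫ ψb c = ψb d ≫ t.base.map ρ
  ψa : ∀ A : E.fib.Obj, E.fib.Hom (𝟙_ E.base) A (t.obj ⟨p.obj A, A, N.fib.id _ _⟩)
  ψ_nat : ∀ {c : E.base} {A B : E.fib.Obj} (k : E.fib.Hom c A B),
    E.fib.comp k (E.fib.reind (toUnit _) (ψa B)) =
      E.fib.comp (E.fib.reind (toUnit _) (ψa A))
        (E.fib.reind (ψb c) (t.map ((commaDiag p).map k)))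
  ψφb : ∀ d, ψb d ≫ φb d = 𝟙 d
  φψb : ∀ d, φb d ≫ ψb d = 𝟙 _
  ψφa : ∀ A, E.fib.comp (ψa A) (φa ⟨p.obj A, A, N.fib.id _ _⟩) = E.fib.id _ _
  w : t ≫ p = commaDom p
  p_φb : ∀ d, HEq (p.base.map (φb d)) (𝟙 (p.base.obj d))
  p_ψb : ∀ d, HEq (p.base.map (ψb d)) (𝟙 (p.base.obj d))
  p_φa : ∀ x, HEq (p.map₁ (φa x)) x.hom
  p_ψa : ∀ A, HEq (p.map₁ (ψa A)) (N.fib.id (𝟙_ N.base) (p.obj A))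
  rigid : ∀ e : (∀ x : CommaObj p, E.fib.Hom (𝟙_ E.base) (t.obj x) (t.obj x)),
    (∀ {c : E.base} {x y : CommaObj p} (k : CommaHom c x y),
      E.fib.comp (Mor.map t (X := comma p) k) (E.fib.reind (toUnit _) (e y)) =
        E.fib.comp (E.fib.reind (toUnit _) (e x)) (Mor.map t (X := comma p) k)) →
    (∀ x, E.fib.comp (e x) (φa x) = φa x) →
    (∀ x, p.map₁ (e x) = N.fib.id (𝟙_ N.base) (p.obj (t.obj x))) → ∀ x, e x = E.fib.id _ _

end Comma

/-- A map over the terminal index into some `p.obj A` is an object of the comma object, so one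
cartesian lift `φ` of the universal 2-cell produces candidate lifts for all such maps. The remaining
data is what is needed to show that the components of `φ` are themselves cartesian. -/
lemma exists_commaLift (p : E ⟶ N) (hp : IsFibration p) : Nonempty (CommaLift p) := by
  have := hp.fibered (comma p)
  have := hp.fibered E
  obtain ⟨t, φ, hφ⟩ := Functor.IsPreFibered.exists_isCartesian' (p := postcomp (comma p) p)
    (a := commaCod p) (commaCell p)
  have hl := hφ.toIsHomLift
  have w : t ≫ p = commaDom p :=
    @IsHomLift.domain_eq _ _ _ _ (postcomp (comma p) p) _ _ _ _ (commaCell p) φ hl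
  have hφ' : HEq (φ ▷ p) (commaCell p) := heq_of_isHomLift hφ.toIsHomLift
  have hi := hp.precomp (commaDiag p) φ (isCartesian_map hφ)
  have hi' : (postcomp E p).IsStronglyCartesian ((postcomp E p).map (commaDiag p ◁ φ))
    (commaDiag p ◁ φ) := inferInstance
  -- Along the diagonal the universal cell is an identity. The restriction of `φ` is still cartesian
  -- by `hp.precomp`, hence invertible.
  have h₁ : HEq (commaDiag p ◁ (φ ▷ p)) (𝟙 p) :=
    (whiskerLeft_cell_heq (commaDiag p) w rfl hφ').trans HEq.rfl
  have h₂ : IsIso ((postcomp E p).map (commaDiag p ◁ φ)) :=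
    isIso_of_heq (congrArg (commaDiag p ≫ ·) w.symm) rfl h₁.symm (IsIso.id (p : E ⟶ N))
  have h₃ : IsIso (commaDiag p ◁ φ) :=
    Functor.IsStronglyCartesian.isIso_of_base_isIso (postcomp E p)
      ((postcomp E p).map (commaDiag p ◁ φ)) (commaDiag p ◁ φ)
  obtain ⟨ψ, φψ, ψφ⟩ : ∃ ψ : 𝟙 E ⟶ commaDiag p ≫ t, commaDiag p ◁ φ ≫ ψ = 𝟙 (commaDiag p ≫ t) ∧
    ψ ≫ commaDiag p ◁ φ = 𝟙 (𝟙 E) := h₃.out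
  have pψ : HEq (ψ ▷ p) (𝟙 p) := by
    have e₁ : ψ ▷ p ≫ (commaDiag p ◁ φ) ▷ p = 𝟙 p := by
      refine (Bicategory.comp_whiskerRight ψ (commaDiag p ◁ φ) p).symm.trans ?_
      exact (congrArg (· ▷ p) ψφ).trans (Bicategory.id_whiskerRight _ _)
    have key : ∀ {C : Type (max u v)} [Category.{max u v} C] {a b : C} (s : a ⟶ b) (r : b ⟶ a),
        b = a → HEq r (𝟙 a) → s ≫ r = 𝟙 a → HEq s (𝟙 a) := by
      rintro C _ a _ s r rfl h h'
      obtain rfl := eq_of_heq h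
      rw [Category.comp_id] at h'
      exact heq_of_eq h'
    exact key (ψ ▷ p) ((commaDiag p ◁ φ) ▷ p) (congrArg (commaDiag p ≫ ·) w) h₁ e₁
  refine ⟨{ t := t
            φb := fun d => (Cell.base φ).app d
            φa := fun x => Cell.app φ x
            φ_nat := fun k => Cell.naturality φ k
            ψb := fun d => (Cell.base ψ).app d
            ψb_nat := fun ρ => (Cell.base ψ).naturality ρ
            ψa := fun A => Cell.app ψ A
            ψ_nat := fun k => Cell.naturality ψ k
            ψφb := fun d => congrArg (fun s : 𝟙 E ⟶ 𝟙 E => (Cell.base s).app d) ψφ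
            φψb := fun d =>
              congrArg (fun s : commaDiag p ≫ t ⟶ commaDiag p ≫ t => (Cell.base s).app d) φψ
            ψφa := fun A => congrArg (fun s : 𝟙 E ⟶ 𝟙 E => Cell.app s A) ψφ
            w := w
            p_φb := fun d => Model.Mor.cell_base_heq w rfl hφ' d
            p_ψb := fun d => Model.Mor.cell_base_heq rfl (congrArg (commaDiag p ≫ ·) w) pψ d
            p_φa := fun x => Model.Mor.cell_app_heq w rfl hφ' x
            p_ψa := fun A => Model.Mor.cell_app_heq rfl (congrArg (commaDiag p ≫ ·) w) pψ A
            rigid := ?_ }⟩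
  -- With identity base, `e` is an endomorphism of `t` over the identity that is absorbed by `φ`;
  -- uniqueness of factorizations through the cartesian `φ` makes it the identity.
  intro e he h h' x
  let e' : t ⟶ t :=
    { base := 𝟙 _
      app := e
      naturality := fun k => (he k).trans (congrArg (E.fib.comp _) (E.fib.reind_id _).symm) }
  have e₁ : e' ≫ φ = 𝟙 t ≫ φ := by
    rw [Category.id_comp]
    exact cell_ext (fun c => Category.id_comp _) h
  have e₂ : e' ▷ p = 𝟙 (t ≫ p) := cell_ext (fun c => p.base.map_id _) h'
  have l₁ : (postcomp (comma p) p).IsHomLift (𝟙 (commaDom p)) e' :=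
    isHomLift_of_heq w w ((heq_of_eq e₂).trans (heq_id w))
  have l₂ : (postcomp (comma p) p).IsHomLift (𝟙 (commaDom p)) (𝟙 t) := IsHomLift.id w
  have := @Functor.IsCartesian.ext _ _ _ _ (postcomp (comma p) p) _ _ _ _ (commaCell p) φ hφ _
    e' (𝟙 t) l₁ l₂ e₁
  exact congrArg (fun s : t ⟶ t => Cell.app s x) this

end LInd

/-- The identity morphism along an equality of objects. -/
def IdxCat.idOfEq {C : Type u} [Category.{v} C] (𝒞 : IdxCat.{w} C) (c : C) {A B : 𝒞.Obj}
    (e : A = B) : 𝒞.Hom c A B := cast (congrArg (𝒞.Hom c A) e) (𝒞.id c A)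

namespace IdxCat

variable {C : Type u} [Category.{v} C] {𝒞 : IdxCat.{w} C}

lemma heq_idOfEq (c : C) {A B : 𝒞.Obj} (e : A = B) : HEq (𝒞.idOfEq c e) (𝒞.id c A) :=
  cast_heq _ _

lemma reind_idOfEq {c d : C} (ρ : d ⟶ c) {A B : 𝒞.Obj} (e : A = B) :
    𝒞.reind ρ (𝒞.idOfEq c e) = 𝒞.idOfEq d e := by
  subst e
  exact 𝒞.reind_idm _ _

lemma comp_idOfEq_heq {c : C} {A B D : 𝒞.Obj} (k : 𝒞.Hom c A B) (e : B = D) :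
    HEq (𝒞.comp k (𝒞.idOfEq c e)) k := by
  subst e
  exact heq_of_eq (𝒞.comp_id _)

lemma idOfEq_comp_heq {c : C} {A B D : 𝒞.Obj} (e : A = B) (k : 𝒞.Hom c B D) :
    HEq (𝒞.comp (𝒞.idOfEq c e) k) k := by
  subst e
  exact heq_of_eq (𝒞.id_comp _)

lemma comp_idOfEq_comp {c : C} {A B B' D : 𝒞.Obj} (k : 𝒞.Hom c A B) (e : B = B')
    {l : 𝒞.Hom c B' D} {l' : 𝒞.Hom c B D} (h : HEq l l') :
    𝒞.comp (𝒞.comp k (𝒞.idOfEq c e)) l = 𝒞.comp k l' := by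
  subst e h
  exact congrArg (fun t => 𝒞.comp t l) (𝒞.comp_id k)

end IdxCat

/-! ### Pointwise cartesian lifts from the comma object -/

namespace LInd

variable {E N : LInd.{v, u}} {p : E ⟶ N}

namespace CommaLift

variable (S : CommaLift p)

/-- The action of the lifted 1-cell on morphisms. -/
def tmap {c : E.base} {x y : CommaObj p} (k : CommaHom c x y) :
    E.fib.Hom (S.t.base.obj c) (S.t.obj x) (S.t.obj y) := Mor.map S.t (X := comma p) k

lemma tmap_comp {c : E.base} {x y z : CommaObj p} (k : CommaHom c x y) (l : CommaHom c y z) :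
    S.tmap ((comma p).fib.comp k l) = E.fib.comp (S.tmap k) (S.tmap l) :=
  Mor.map_comp S.t (X := comma p) k l

lemma tmap_reind {c d : E.base} (ρ : d ⟶ c) {x y : CommaObj p} (k : CommaHom c x y) :
    S.tmap ((comma p).fib.reind ρ k) = E.fib.reind (S.t.base.map ρ) (S.tmap k) :=
  Mor.map_reind S.t (X := comma p) ρ k

lemma obj_eq (x : CommaObj p) : p.obj (S.t.obj x) = x.dom := Mor.congr_obj S.w x

lemma base_eq (c : E.base) : p.base.obj (S.t.base.obj c) = p.base.obj c := Mor.congr_base_obj S.w c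

lemma p_tmap {c : E.base} {x y : CommaObj p} (k : CommaHom c x y) :
    HEq (p.map (S.tmap k)) k.dom := Mor.congr_map S.w (X := comma p) k

/-- The object of the comma object given by an identity. -/
abbrev diag (p : E ⟶ N) (A : E.fib.Obj) : CommaObj p := ⟨p.obj A, A, N.fib.id _ _⟩

/-- The morphism into a lifted object induced by a morphism of the comma object. -/
def lam {d : E.base} {Z : E.fib.Obj} {x : CommaObj p} (k : CommaHom d (diag p Z) x) :
    E.fib.Hom d Z (S.t.obj x) :=
  E.fib.comp (E.fib.reind (toUnit d) (S.ψa Z)) (E.fib.reind (S.ψb d) (S.tmap k))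

/-- Naturality of `φ` replaces the lifted map followed by `φ` by `φ` followed by `k.cod`, and `φ` on
the diagonal cancels against its inverse `ψ`. -/
lemma lam_comp {d : E.base} {Z : E.fib.Obj} {x : CommaObj p} (k : CommaHom d (diag p Z) x) :
    E.fib.comp (S.lam k) (E.fib.reind (toUnit d) (S.φa x)) = k.cod := by
  have h := congrArg (E.fib.reind (S.ψb d)) (S.φ_nat k)
  rw [E.fib.reind_compm, E.fib.reind_compm, IdxCat.reind_toUnit, IdxCat.reind_toUnit,
    E.fib.reind_reind, S.ψφb, E.fib.reind_id] at h
  have h' := congrArg (E.fib.reind (toUnit d)) (S.ψφa Z)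
  rw [E.fib.reind_compm, E.fib.reind_idm] at h'
  rw [lam, E.fib.assoc]
  refine (congrArg (E.fib.comp _) h).trans ?_
  rw [← E.fib.assoc, h', E.fib.id_comp]

lemma p_lam {d : E.base} {Z : E.fib.Obj} {x : CommaObj p} (k : CommaHom d (diag p Z) x) :
    HEq (p.map (S.lam k)) k.dom := by
  rw [lam, Mor.map_comp, Mor.map_reind_toUnit, Mor.map_reind]
  have h₁ : HEq (N.fib.reind (toUnit (p.base.obj d)) (p.map₁ (S.ψa Z)))
      (N.fib.id (p.base.obj d) (p.obj Z)) :=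
    (IdxCat.heq_reind_toUnit rfl rfl (S.obj_eq (diag p Z)) (S.p_ψa Z)).trans
      (heq_of_eq (N.fib.reind_idm _ _))
  have h₂ : HEq (N.fib.reind (p.base.map (S.ψb d)) (p.map (S.tmap k))) k.dom :=
    (IdxCat.heq_reind (S.base_eq d) rfl (S.obj_eq _) (S.obj_eq x) (S.p_ψb d) (S.p_tmap k)).trans
      (heq_of_eq (N.fib.reind_id _))
  exact (IdxCat.heq_comp rfl rfl (S.obj_eq _) (S.obj_eq x) h₁ h₂).trans
    (heq_of_eq (N.fib.id_comp _))

/-- A morphism into a lifted object as a morphism of the comma object. -/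
def toComma {d : E.base} {Z : E.fib.Obj} {x : CommaObj p} (l : E.fib.Hom d Z (S.t.obj x)) :
    CommaHom d (diag p Z) x where
  cod := E.fib.comp l (E.fib.reind (toUnit d) (S.φa x))
  dom := N.fib.comp (p.map l) (N.fib.idOfEq _ (S.obj_eq x))
  w := by
    rw [N.fib.reind_idm, N.fib.id_comp, Mor.map_comp, Mor.map_reind_toUnit]
    exact IdxCat.comp_idOfEq_comp _ _
      (IdxCat.heq_reind_toUnit rfl (S.obj_eq x).symm rfl (S.p_φa x).symm)

/-- The universal arrow at a lifted object. -/
abbrev univ (x : CommaObj p) : CommaHom (𝟙_ E.base) (diag p (S.t.obj x)) x :=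
  S.toComma (E.fib.id _ _)

/-- Separates the contribution of `l`, which comes from the diagonal and to which naturality of `ψ`
applies, from a universal arrow depending only on `x`. -/
lemma toComma_eq {d : E.base} {Z : E.fib.Obj} {x : CommaObj p} (l : E.fib.Hom d Z (S.t.obj x)) :
    S.toComma l = (comma p).fib.comp ((commaDiag p).map l)
      ((comma p).fib.reind (toUnit d) (S.univ x)) := by
  refine CommaHom.ext ?_ ?_
  · change E.fib.comp l (E.fib.reind (toUnit d) (S.φa x)) = E.fib.comp l (E.fib.reind (toUnit d)
      (E.fib.comp (E.fib.id _ _) (E.fib.reind (toUnit _) (S.φa x))))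
    rw [E.fib.id_comp, IdxCat.reind_toUnit_unit]
  · change N.fib.comp (p.map l) (N.fib.idOfEq _ (S.obj_eq x)) = N.fib.comp (p.map l)
      (N.fib.reind (p.base.map (toUnit d)) (N.fib.comp (p.map (E.fib.id _ _))
        (N.fib.idOfEq _ (S.obj_eq x))))
    rw [Mor.map_id, N.fib.id_comp, IdxCat.reind_idOfEq]

/-- The endomorphism of a lifted object induced by the universal arrow. -/
def endo (x : CommaObj p) : E.fib.Hom (𝟙_ E.base) (S.t.obj x) (S.t.obj x) := S.lam (S.univ x)

lemma reind_endo (d : E.base) (x : CommaObj p) :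
    E.fib.reind (toUnit d) (S.endo x) = E.fib.comp (E.fib.reind (toUnit d) (S.ψa _))
      (E.fib.reind (S.ψb d) (S.tmap ((comma p).fib.reind (toUnit d) (S.univ x)))) := by
  rw [endo, lam, tmap_reind, E.fib.reind_compm, IdxCat.reind_toUnit, E.fib.reind_reind,
    E.fib.reind_reind, S.ψb_nat]

/-- By naturality of `ψ`, `lam` undoes `toComma` up to composition with one endomorphism of the
lifted object; it remains to see that `endo` is trivial. -/
lemma lam_toComma {d : E.base} {Z : E.fib.Obj} {x : CommaObj p}
    (l : E.fib.Hom d Z (S.t.obj x)) :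
    S.lam (S.toComma l) = E.fib.comp l (E.fib.reind (toUnit d) (S.endo x)) := by
  rw [S.toComma_eq, lam, tmap_comp, E.fib.reind_compm, ← E.fib.assoc]
  refine (congrArg (fun t => E.fib.comp t _) (S.ψ_nat l).symm).trans ?_
  rw [E.fib.assoc, reind_endo]

lemma toComma_tmap {c : E.base} {x y : CommaObj p} (k : CommaHom c x y) :
    S.toComma (S.tmap k) = (comma p).fib.comp
      ((comma p).fib.reind (toUnit (S.t.base.obj c)) (S.univ x))
      ((comma p).fib.reind (S.φb c) k) := by
  refine CommaHom.ext ?_ ?_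
  · change E.fib.comp (S.tmap k) (E.fib.reind (toUnit _) (S.φa y)) =
      E.fib.comp (E.fib.reind (toUnit _) (E.fib.comp (E.fib.id _ _)
        (E.fib.reind (toUnit _) (S.φa x)))) (E.fib.reind (S.φb c) k.cod)
    rw [E.fib.id_comp, IdxCat.reind_toUnit_unit]
    exact S.φ_nat k
  · change N.fib.comp (p.map (S.tmap k)) (N.fib.idOfEq _ (S.obj_eq y)) =
      N.fib.comp (N.fib.reind (p.base.map (toUnit (S.t.base.obj c))) (N.fib.comp
        (p.map (E.fib.id _ _)) (N.fib.idOfEq _ (S.obj_eq x))))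
        (N.fib.reind (p.base.map (S.φb c)) k.dom)
    rw [Mor.map_id, N.fib.id_comp, IdxCat.reind_idOfEq]
    refine eq_of_heq ((IdxCat.comp_idOfEq_heq _ _).trans ((S.p_tmap k).trans ?_))
    refine HEq.symm ((IdxCat.idOfEq_comp_heq _ _).trans ?_)
    exact (IdxCat.heq_reind rfl (S.base_eq c) rfl rfl (S.p_φb c) HEq.rfl).trans
      (heq_of_eq (N.fib.reind_id _))

/-- Applying `lam` to the comma morphism of a lifted map can be computed in two ways, by
`lam_toComma` or through the universal arrow at the source. -/
lemma endo_natural {c : E.base} {x y : CommaObj p} (k : CommaHom c x y) :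
    E.fib.comp (S.tmap k) (E.fib.reind (toUnit _) (S.endo y)) =
      E.fib.comp (E.fib.reind (toUnit _) (S.endo x)) (S.tmap k) := by
  rw [← lam_toComma, S.toComma_tmap, lam, tmap_comp, E.fib.reind_compm, ← E.fib.assoc,
    ← reind_endo, tmap_reind, E.fib.reind_reind, ← S.ψb_nat, S.φψb, E.fib.reind_id]

/-- The family `endo` is natural, absorbed by `φ` and over the identity, so `rigid` applies. This is
where uniqueness in the 2-categorical lifting property is used. -/
lemma endo_eq (x : CommaObj p) : S.endo x = E.fib.id _ _ := by
  refine S.rigid S.endo S.endo_natural (fun x => ?_) (fun x => ?_) x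
  · have h := S.lam_comp (S.univ x)
    rw [IdxCat.reind_toUnit_unit] at h
    refine h.trans ?_
    change E.fib.comp (E.fib.id _ _) (E.fib.reind (toUnit _) (S.φa x)) = _
    rw [E.fib.id_comp, IdxCat.reind_toUnit_unit]
  · have h : p.map (S.endo x) = p.map (E.fib.id _ _) :=
      eq_of_heq ((S.p_lam (S.univ x)).trans (IdxCat.comp_idOfEq_heq _ _))
    rw [Mor.map₁, h, Mor.map_id, N.fib.reind_idm]

lemma lam_toComma_self {d : E.base} {Z : E.fib.Obj} {x : CommaObj p}
    (l : E.fib.Hom d Z (S.t.obj x)) : S.lam (S.toComma l) = l := by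
  rw [lam_toComma, endo_eq, E.fib.reind_idm, E.fib.comp_id]

/-- `lam` constructs the factorization, and uniqueness is the statement that `lam` is a left inverse
of `toComma`. -/
lemma isCart (x : CommaObj p) : IsCart p (S.φa x) := by
  intro c Z l m h
  let k : CommaHom c (diag p Z) x := ⟨l, N.fib.comp m (N.fib.idOfEq _ (S.obj_eq x)), by
    rw [N.fib.reind_idm, N.fib.id_comp, ← h]
    exact IdxCat.comp_idOfEq_comp _ _
      (IdxCat.heq_reind_toUnit rfl (S.obj_eq x).symm rfl (S.p_φa x).symm)⟩
  refine ⟨S.lam k, ⟨eq_of_heq ((S.p_lam k).trans (IdxCat.comp_idOfEq_heq _ _)), S.lam_comp k⟩, ?_⟩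
  rintro l' ⟨rfl, rfl⟩
  exact (S.lam_toComma_self l').symm

end CommaLift

lemma hasLifts_of_isFibration (hp : IsFibration p) : HasLifts p := by
  obtain ⟨S⟩ := exists_commaLift p hp
  intro A B k
  exact ⟨S.t.obj ⟨B, A, k⟩, S.obj_eq ⟨B, A, k⟩, S.φa ⟨B, A, k⟩, S.p_φa ⟨B, A, k⟩,
    S.isCart ⟨B, A, k⟩⟩

end LInd

/-! ### Cartesian maps over the terminal index and cartesian 2-cells -/

namespace LInd

lemma Mor.map_eq_of_map₁_eq {X Y : LInd.{v, u}} (F : X ⟶ Y) {A B : X.fib.Obj}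
    {k k' : X.fib.Hom (𝟙_ X.base) A B} (h : F.map₁ k = F.map₁ k') : F.map k = F.map k' := by
  rw [map_eq_reind_map₁, h, ← map_eq_reind_map₁]

lemma Cell.naturality₁ {X Y : LInd.{v, u}} {F G : X ⟶ Y} (σ : F ⟶ G) {A B : X.fib.Obj}
    (k : X.fib.Hom (𝟙_ X.base) A B) :
    Y.fib.comp (F.map₁ k) (Cell.app σ B) = Y.fib.comp (Cell.app σ A) (G.map₁ k) := by
  have h := congrArg (Y.fib.reind F.unitIso) (Cell.naturality σ k)
  rw [Y.fib.reind_compm, Y.fib.reind_compm, IdxCat.reind_toUnit, IdxCat.reind_toUnit_unit,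
    IdxCat.reind_toUnit, IdxCat.reind_toUnit_unit, Y.fib.reind_reind] at h
  exact h.trans (congrArg (Y.fib.comp _)
    ((Mor.reind_map₁ G _ k).trans (IdxCat.reind_toUnit_unit _)))

namespace IsCart

variable {E N : LInd.{v, u}} {p : E ⟶ N} {B A : E.fib.Obj} {φ : E.fib.Hom (𝟙_ E.base) B A}

lemma ext (hφ : IsCart p φ) {c : E.base} {Z : E.fib.Obj} {l l' : E.fib.Hom c Z B}
    (h : p.map l = p.map l') (h' : E.fib.comp l (E.fib.reind (toUnit c) φ) =
      E.fib.comp l' (E.fib.reind (toUnit c) φ)) : l = l' := by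
  obtain ⟨_, -, hu⟩ := hφ (E.fib.comp l' (E.fib.reind (toUnit c) φ)) (p.map l')
    (by rw [Mor.map_comp, Mor.map_reind_toUnit])
  exact (hu l ⟨h, h'⟩).trans (hu l' ⟨rfl, rfl⟩).symm

lemma ext₁ (hφ : IsCart p φ) {Z : E.fib.Obj} {l l' : E.fib.Hom (𝟙_ E.base) Z B}
    (h : p.map₁ l = p.map₁ l') (h' : E.fib.comp l φ = E.fib.comp l' φ) : l = l' := by
  refine hφ.ext (Mor.map_eq_of_map₁_eq p h) ?_
  rw [IdxCat.reind_toUnit_unit, h']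

lemma exists₁ (hφ : IsCart p φ) {Z : E.fib.Obj} (l : E.fib.Hom (𝟙_ E.base) Z A)
    (m : N.fib.Hom (𝟙_ N.base) (p.obj Z) (p.obj B)) (h : N.fib.comp m (p.map₁ φ) = p.map₁ l) :
    ∃ l' : E.fib.Hom (𝟙_ E.base) Z B, p.map₁ l' = m ∧ E.fib.comp l' φ = l := by
  obtain ⟨l', ⟨h₁, h₂⟩, -⟩ := hφ l (N.fib.reind (toUnit _) m) (by
    rw [← N.fib.reind_compm, h, ← Mor.map_eq_reind_map₁])
  refine ⟨l', ?_, ?_⟩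
  · rw [Mor.map₁, h₁, IdxCat.reind_toUnit, IdxCat.reind_toUnit_unit]
  · rw [IdxCat.reind_toUnit_unit] at h₂
    exact h₂

/-- A cartesian morphism over an isomorphism is an isomorphism. -/
lemma exists_inv (hφ : IsCart p φ) {m : N.fib.Hom (𝟙_ N.base) (p.obj A) (p.obj B)}
    (h : N.fib.comp (p.map₁ φ) m = N.fib.id _ _) (h' : N.fib.comp m (p.map₁ φ) = N.fib.id _ _) :
    ∃ ψ : E.fib.Hom (𝟙_ E.base) A B, p.map₁ ψ = m ∧ E.fib.comp φ ψ = E.fib.id _ _ ∧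
      E.fib.comp ψ φ = E.fib.id _ _ := by
  obtain ⟨ψ, h₁, h₂⟩ := hφ.exists₁ (E.fib.id _ _) m (by rw [h', Mor.map₁_id])
  refine ⟨ψ, h₁, hφ.ext₁ ?_ ?_, h₂⟩
  · rw [Mor.map₁_comp, h₁, h, Mor.map₁_id]
  · rw [E.fib.assoc, h₂, E.fib.comp_id, E.fib.id_comp]

end IsCart

/-- A 2-cell with invertible base and cartesian components is cartesian. -/
lemma isStronglyCartesian_of_isCart {X E N : LInd.{v, u}} {p : E ⟶ N} {t s : X ⟶ E} (φ : t ⟶ s)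
    (hb : ∀ c, IsIso ((Cell.base φ).app c)) (hφ : ∀ A, IsCart p (Cell.app φ A)) :
    (postcomp X p).IsStronglyCartesian ((postcomp X p).map φ) φ := by
  refine isStronglyCartesian_map_iff.2 fun {z} γ ψ h => ?_
  have h₁ : ∀ A, p.map₁ (Cell.app ψ A) = N.fib.comp (Cell.app γ A) (p.map₁ (Cell.app φ A)) :=
    fun A => congrArg (fun a : z ≫ p ⟶ s ≫ p => Cell.app a A) h
  have h₂ : ∀ c, p.base.map ((Cell.base ψ).app c) =
      (Cell.base γ).app c ≫ p.base.map ((Cell.base φ).app c) :=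
    fun c => congrArg (fun a : z ≫ p ⟶ s ≫ p => (Cell.base a).app c) h
  choose χ h₃ h₄ using fun A => (hφ A).exists₁ (Cell.app ψ A) (Cell.app γ A) (h₁ A).symm
  -- The base component is forced, since that of `φ` is invertible.
  let χb : z.base ⟶ t.base :=
    { app := fun c => (Cell.base ψ).app c ≫ inv ((Cell.base φ).app c)
      naturality := fun c d k => by
        rw [← cancel_mono ((Cell.base φ).app d)]
        simp only [Category.assoc, IsIso.inv_hom_id, Category.comp_id]
        rw [(Cell.base φ).naturality, IsIso.inv_hom_id_assoc, (Cell.base ψ).naturality] }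
  have e₁ : ∀ c, χb.app c ≫ (Cell.base φ).app c = (Cell.base ψ).app c := fun c => by simp [χb]
  have e₂ : ∀ c, p.base.map (χb.app c) = (Cell.base γ).app c := fun c =>
    (cancel_mono (p.base.map ((Cell.base φ).app c))).1
      ((p.base.map_comp _ _).symm.trans ((congrArg p.base.map (e₁ c)).trans (h₂ c)))
  let θ : z ⟶ t :=
    { base := χb
      app := χ
      naturality := fun {c A B} k => by
        -- Both sides map into the domain of a cartesian component, so they are compared after `p`,
        -- where `γ` is natural, and after composing with `φ`, where `ψ` and `φ` are.
        refine (hφ B).ext ?_ ?_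
        · rw [Mor.map_comp, Mor.map_comp, Mor.map_reind_toUnit, Mor.map_reind_toUnit,
            Mor.map_reind, h₃, h₃, e₂]
          exact Cell.naturality γ k
        · rw [E.fib.assoc, ← E.fib.reind_compm, h₄, Cell.naturality ψ k, E.fib.assoc]
          have e := congrArg (E.fib.reind (χb.app c)) (Cell.naturality φ k)
          rw [E.fib.reind_compm, E.fib.reind_compm, IdxCat.reind_toUnit, IdxCat.reind_toUnit,
            E.fib.reind_reind, e₁] at e
          rw [e, ← E.fib.assoc, ← E.fib.reind_compm, h₄] }
  refine ⟨θ, ⟨cell_ext e₂ h₃, cell_ext e₁ h₄⟩, fun θ' hθ => cell_ext (fun c => ?_) fun A => ?_⟩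
  · rw [← cancel_mono ((Cell.base φ).app c)]
    exact (congrArg (fun a : z ⟶ s => (Cell.base a).app c) hθ.2).trans (e₁ c).symm
  · refine (hφ A).ext₁ ?_ ?_
    · exact (congrArg (fun a : z ≫ p ⟶ t ≫ p => Cell.app a A) hθ.1).trans (h₃ A).symm
    · exact (congrArg (fun a : z ⟶ s => Cell.app a A) hθ.2).trans (h₄ A).symm

end LInd

/-! ### Cartesian lifts and pullback squares for `self` -/

namespace DistCat

section Lifts

variable {E N : DistCat.{v, u}} (p : E ⟶ N)

lemma selfMap_map₁_snd {A B : E.carrier} (k : A ⟶ B) :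
    LInd.Mor.map₁ (selfMap p) (A := A) (B := B) (snd (𝟙_ E.carrier) A ≫ k) =
      snd _ _ ≫ p.functor.map k := by
  change LInd.Mor.unitIso (selfMap p) ▷ p.functor.obj A ≫
    prodInv p (𝟙_ E.carrier) A ≫ p.functor.map (snd _ _ ≫ k) = _
  have e : ∀ (x y z : E.carrier) (t : N.carrier) (ι : t ⟶ p.functor.obj x) (s : y ⟶ z),
      ι ▷ p.functor.obj y ≫ prodInv p x y ≫ p.functor.map (snd _ _ ≫ s) =
        snd _ _ ≫ p.functor.map s := by
    intro x y z t ι s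
    rw [Functor.map_comp, ← Category.assoc (prodInv _ _ _), prodInv_snd, ← Category.assoc,
      whiskerRight_snd]
  exact e _ _ _ _ _ _

lemma selfIdx_comp_snd {C : Type u} [Category.{v} C] [CartesianMonoidalCategory C] {c Z B A : C}
    (l : c ⊗ Z ⟶ B) (k : B ⟶ A) :
    (selfIdx C).comp (A := Z) l ((selfIdx C).reind (A := B) (B := A) (toUnit c) (snd _ _ ≫ k)) =
      l ≫ k := by
  change lift (fst c Z) l ≫ toUnit c ▷ B ≫ snd _ _ ≫ k = l ≫ k
  simp

/-- A map over `c` in `self` is an ordinary map out of `c ⊗ Z`. Composing with the product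
comparison of `p`, which is invertible, turns the indexed lifting problem into an ordinary one. -/
lemma existsUnique_self_lift {B A c Z : E.carrier} {φ : B ⟶ A}
    (hφ : p.functor.IsStronglyCartesian (p.functor.map φ) φ) (l : c ⊗ Z ⟶ A)
    (m : p.functor.obj c ⊗ p.functor.obj Z ⟶ p.functor.obj B)
    (h : m ≫ p.functor.map φ = prodInv p c Z ≫ p.functor.map l) :
    ∃! l' : c ⊗ Z ⟶ B, prodInv p c Z ≫ p.functor.map l' = m ∧ l' ≫ φ = l := by
  have := p.presProd
  have hinv : CartesianMonoidalCategory.prodComparison p.functor c Z ≫ prodInv p c Z = 𝟙 _ :=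
    IsIso.hom_inv_id _
  have hinv' : prodInv p c Z ≫ CartesianMonoidalCategory.prodComparison p.functor c Z = 𝟙 _ :=
    IsIso.inv_hom_id _
  obtain ⟨χ, ⟨h₁, h₂⟩, h₃⟩ := isStronglyCartesian_map_iff.1 hφ
    (CartesianMonoidalCategory.prodComparison p.functor c Z ≫ m) l
    (by rw [Category.assoc, h, reassoc_of% hinv])
  refine ⟨χ, ⟨?_, h₂⟩, fun χ' hχ => h₃ χ' ⟨?_, hχ.2⟩⟩
  · rw [h₁, reassoc_of% hinv']
  · rw [← hχ.1, reassoc_of% hinv]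

lemma isCart_selfMap {B A : E.carrier} (φ : B ⟶ A)
    (hφ : p.functor.IsStronglyCartesian (p.functor.map φ) φ) :
    LInd.IsCart (selfMap p) (B := B) (A := A) (snd (𝟙_ E.carrier) B ≫ φ) := by
  intro c Z l m h
  rw [selfMap_map₁_snd] at h
  obtain ⟨χ, ⟨h₁, h₂⟩, h₃⟩ := existsUnique_self_lift p hφ l m
    ((selfIdx_comp_snd m (p.functor.map φ)).symm.trans h)
  exact ⟨χ, ⟨h₁, (selfIdx_comp_snd χ φ).trans h₂⟩, fun χ' hχ =>
    h₃ χ' ⟨hχ.1, (selfIdx_comp_snd χ' φ).symm.trans hχ.2⟩⟩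

lemma exists_stronglyCartesian_lift {C D : Type*} [Category* C] [Category* D] (P : C ⥤ D)
    [P.IsFibered] (A : C) {B : D} (k : B ⟶ P.obj A) :
    ∃ (B' : C) (_ : P.obj B' = B) (φ : B' ⟶ A), HEq (P.map φ) k ∧
      P.IsStronglyCartesian (P.map φ) φ := by
  obtain ⟨B', φ, hφ⟩ := Functor.IsPreFibered.exists_isCartesian' k
  have h : P.IsStronglyCartesian k φ := inferInstance
  exact ⟨B', IsHomLift.domain_eq P k φ, φ, heq_of_isHomLift hφ.toIsHomLift,
    isStronglyCartesian_map h⟩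

/-- No fibration hypothesis on `self p` in `LInd` is needed. The given map is freed of its terminal
factor by the left unitor, lifted along `p`, and turned back into an indexed map. -/
lemma hasLifts_selfMap [p.functor.IsFibered] : LInd.HasLifts (selfMap p) := by
  intro A B k
  obtain ⟨B', hB, φ, h2, hφ⟩ := exists_stronglyCartesian_lift p.functor A
    (B := B) ((λ_ B).inv ≫ k)
  refine ⟨B', hB, snd _ _ ≫ φ, ?_, isCart_selfMap p φ hφ⟩
  rw [selfMap_map₁_snd]
  have h3 : snd (𝟙_ N.carrier) B ≫ (λ_ B).inv ≫ k = k := by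
    rw [← leftUnitor_hom, Iso.hom_inv_id_assoc]
  refine HEq.trans ?_ (heq_of_eq h3)
  have key : ∀ {b a b' : N.carrier} (x : b ⟶ a) (x' : b' ⟶ a), b = b' → HEq x x' →
      HEq (snd (𝟙_ N.carrier) b ≫ x) (snd (𝟙_ N.carrier) b' ≫ x') := by
    rintro b a _ x x' rfl h
    rw [eq_of_heq h]
  exact key _ _ hB h2

end Lifts

lemma prodComparison_heq {C D : DistCat.{v, u}} {h k : C ⟶ D} (e : h = k) (a b : C.carrier) :
    HEq (CartesianMonoidalCategory.prodComparison h.functor a b)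
      (CartesianMonoidalCategory.prodComparison k.functor a b) := by
  subst e
  rfl

lemma map_prodComparison_comp {K E N : DistCat.{v, u}} (g : K ⟶ E) (p : E ⟶ N) {c A : K.carrier}
    {B : E.carrier} (k : g.functor.obj c ⊗ g.functor.obj A ⟶ B) :
    p.functor.map (CartesianMonoidalCategory.prodComparison g.functor c A ≫ k) =
      CartesianMonoidalCategory.prodComparison (g ≫ p).functor c A ≫
        (prodInv p _ _ ≫ p.functor.map k) := by
  have := p.presProd
  have e : CartesianMonoidalCategory.prodComparison (g ≫ p).functor c A =
      p.functor.map (CartesianMonoidalCategory.prodComparison g.functor c A) ≫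
        CartesianMonoidalCategory.prodComparison p.functor _ _ :=
    CartesianMonoidalCategory.prodComparison_comp g.functor p.functor
  have hinv : CartesianMonoidalCategory.prodComparison p.functor (g.functor.obj c)
    (g.functor.obj A) ≫ prodInv p _ _ = 𝟙 _ := IsIso.hom_inv_id _
  rw [e, Functor.map_comp, Category.assoc, reassoc_of% hinv]

/-- The product comparisons of `g` and `q` convert `k` and `l` into ordinary maps out of the images
of `c ⊗ C`, where the strict pullback property applies. -/
lemma exists_self_hom {K E M N : DistCat.{v, u}} {g : K ⟶ E} {q : K ⟶ M} {p : E ⟶ N} {f : M ⟶ N}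
    (w : g ≫ p = q ≫ f) (S : IsStrictPb g.functor q.functor p.functor f.functor)
    {c C C' : K.carrier} (k : g.functor.obj c ⊗ g.functor.obj C ⟶ g.functor.obj C')
    (l : q.functor.obj c ⊗ q.functor.obj C ⟶ q.functor.obj C')
    (h : HEq (prodInv p _ _ ≫ p.functor.map k) (prodInv f _ _ ≫ f.functor.map l)) :
    ∃ t : c ⊗ C ⟶ C', prodInv g c C ≫ g.functor.map t = k ∧
      prodInv q c C ≫ q.functor.map t = l := by
  have := g.presProd
  have := q.presProd
  have ob : ∀ x, p.functor.obj (g.functor.obj x) = f.functor.obj (q.functor.obj x) := S.w_obj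
  obtain ⟨t, h₁, h₂⟩ := S.hom (CartesianMonoidalCategory.prodComparison g.functor c C ≫ k)
    (CartesianMonoidalCategory.prodComparison q.functor c C ≫ l) (by
      rw [map_prodComparison_comp g p, map_prodComparison_comp q f]
      exact heq_comp (ob _) (congrArg₂ (· ⊗ ·) (ob _) (ob _)) (ob _) (prodComparison_heq w _ _) h)
  refine ⟨t, ?_, ?_⟩
  · rw [h₁, prodInv, IsIso.inv_hom_id_assoc]
  · rw [h₂, prodInv, IsIso.inv_hom_id_assoc]

/-- `self` sends strict pullback squares to strict pullback squares. -/
lemma isFibPb_self {K E M N : DistCat.{v, u}} {g : K ⟶ E} {q : K ⟶ M} {p : E ⟶ N} {f : M ⟶ N}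
    (w : g ≫ p = q ≫ f) (S : IsStrictPb g.functor q.functor p.functor f.functor) :
    LInd.IsFibPb (selfMap g) (selfMap q) (selfMap p) (selfMap f) where
  w := by rw [← selfMap_comp, w, selfMap_comp]
  obj := S.obj
  obj_ext := S.obj_ext
  hom k l h := exists_self_hom w S k l h
  hom_ext {c C C' t t'} h h' := by
    have := g.presProd
    have := q.presProd
    have e : prodInv g c C ≫ g.functor.map t = prodInv g c C ≫ g.functor.map t' := h
    have e' : prodInv q c C ≫ q.functor.map t = prodInv q c C ≫ q.functor.map t' := h'
    rw [prodInv, cancel_epi] at e e'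
    exact S.hom_ext e e'

end DistCat

namespace LInd

/-! ### Cartesian lifts in pullbacks -/

/-- Names a copy of `k` with propositionally equal endpoints, in place of a cast. -/
lemma exists_heq_hom {C : Type u} [Category.{v} C] {𝒞 : IdxCat.{w} C} {c c' : C}
    {A B A' B' : 𝒞.Obj} (hc : c = c') (hA : A = A') (hB : B = B') (k : 𝒞.Hom c A B) :
    ∃ k' : 𝒞.Hom c' A' B', HEq k' k := by
  subst hc hA hB
  exact ⟨k, HEq.rfl⟩

variable {K E M N : LInd.{v, u}} {g : K ⟶ E} {q : K ⟶ M} {p : E ⟶ N} {f : M ⟶ N}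

variable (g q p f) in
/-- An object of the pullback over `c` together with a cartesian morphism into `s` over `σ`. -/
structure PbLift (s : E.fib.Obj) {c : M.fib.Obj} {x : N.fib.Obj}
    (σ : N.fib.Hom (𝟙_ N.base) (f.obj c) x) where
  R : K.fib.Obj
  obj_snd : q.obj R = c
  φ : E.fib.Hom (𝟙_ E.base) (g.obj R) s
  p_φ : HEq (p.map₁ φ) σ
  isCart : IsCart p φ

lemma IsFibPb.exists_pbLift (S : IsFibPb g q p f) (hp : HasLifts p) {s : E.fib.Obj}
    {c : M.fib.Obj} {x : N.fib.Obj} (hx : p.obj s = x) (σ : N.fib.Hom (𝟙_ N.base) (f.obj c) x) :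
    Nonempty (PbLift g q p f s σ) := by
  subst hx
  obtain ⟨B, hB, φ, h, h'⟩ := hp s _ σ
  obtain ⟨R, rfl, rfl⟩ := S.obj B c hB
  exact ⟨⟨R, rfl, φ, h, h'⟩⟩

namespace PbLift

variable {s : E.fib.Obj} {c : M.fib.Obj} {x : N.fib.Obj} {σ : N.fib.Hom (𝟙_ N.base) (f.obj c) x}
  (L : PbLift g q p f s σ)

/-- The image of `r` prescribes the image in `N` of the component in `E`; the cartesian map `L.φ`
supplies that component from `l`, and it is glued with `r`. -/
lemma exists_hom (S : IsFibPb g q p f) (hx : p.obj s = x) {d : K.base} {Z : K.fib.Obj}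
    {a : M.fib.Obj} (ha : q.obj Z = a)
    (r : M.fib.Hom (q.base.obj d) a c) (l : E.fib.Hom (g.base.obj d) (g.obj Z) s)
    (h : HEq (N.fib.comp (f.map r) (N.fib.reind (toUnit _) σ)) (p.map l)) :
    ∃ t : K.fib.Hom d Z L.R, HEq (q.map t) r ∧
      E.fib.comp (g.map t) (E.fib.reind (toUnit _) L.φ) = l := by
  obtain ⟨R, rfl, φ, h₁, h₂⟩ := L
  subst hx ha
  have ob : ∀ A, p.obj (g.obj A) = f.obj (q.obj A) := Mor.congr_obj S.w
  have bo : p.base.obj (g.base.obj d) = f.base.obj (q.base.obj d) := Mor.congr_base_obj S.w d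
  obtain ⟨m, hm⟩ := exists_heq_hom bo.symm (ob Z).symm (ob R).symm (f.map r)
  obtain ⟨l', ⟨h₃, h₄⟩, -⟩ := h₂ l m (eq_of_heq ((IdxCat.heq_comp bo (ob Z) (ob R) rfl hm
    (IdxCat.heq_reind_toUnit bo (ob R) rfl h₁)).trans h))
  obtain ⟨t, h₅, h₆⟩ := S.hom l' r ((heq_of_eq h₃).trans hm)
  exact ⟨t, heq_of_eq h₆, (congrArg (fun t => E.fib.comp t _) h₅).trans h₄⟩

lemma exists_hom₁ (S : IsFibPb g q p f) (hx : p.obj s = x) {Z : K.fib.Obj} {a : M.fib.Obj}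
    (ha : q.obj Z = a) (r : M.fib.Hom (𝟙_ M.base) a c) (l : E.fib.Hom (𝟙_ E.base) (g.obj Z) s)
    (h : HEq (N.fib.comp (f.map₁ r) σ) (p.map₁ l)) :
    ∃ t : K.fib.Hom (𝟙_ K.base) Z L.R, HEq (q.map₁ t) r ∧ E.fib.comp (g.map₁ t) L.φ = l := by
  obtain ⟨R, rfl, φ, h₁, h₂⟩ := L
  subst hx ha
  have ob : ∀ A, p.obj (g.obj A) = f.obj (q.obj A) := Mor.congr_obj S.w
  obtain ⟨m, hm⟩ := exists_heq_hom rfl (ob Z).symm (ob R).symm (f.map₁ r)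
  obtain ⟨l', h₃, h₄⟩ := h₂.exists₁ l m (eq_of_heq ((IdxCat.heq_comp rfl (ob Z) (ob R) rfl hm
    h₁).trans h))
  obtain ⟨t, h₅, h₆⟩ := S.hom₁ l' r ((heq_of_eq h₃).trans hm)
  exact ⟨t, heq_of_eq h₆, (congrArg (fun t => E.fib.comp t _) h₅).trans h₄⟩

/-- The component in `M` fixes the image in `N` of the component in `E`, which is then determined by
its composite with the cartesian `L.φ`. -/
lemma hom_ext (S : IsFibPb g q p f) {d : K.base} {Z : K.fib.Obj} {t t' : K.fib.Hom d Z L.R}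
    (h : q.map t = q.map t') (h' : E.fib.comp (g.map t) (E.fib.reind (toUnit _) L.φ) =
      E.fib.comp (g.map t') (E.fib.reind (toUnit _) L.φ)) : t = t' := by
  refine S.hom_ext (L.isCart.ext ?_ h') h
  refine eq_of_heq ((Mor.congr_map_of_sq S.w t).trans ?_)
  rw [h]
  exact (Mor.congr_map_of_sq S.w t').symm

lemma hom_ext₁ (S : IsFibPb g q p f) {Z : K.fib.Obj} {t t' : K.fib.Hom (𝟙_ K.base) Z L.R}
    (h : q.map₁ t = q.map₁ t') (h' : E.fib.comp (g.map₁ t) L.φ = E.fib.comp (g.map₁ t') L.φ) :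
    t = t' := by
  refine S.hom₁_ext (L.isCart.ext₁ ?_ h') h
  refine eq_of_heq ((Mor.congr_map₁_of_sq S.w t).trans ?_)
  rw [h]
  exact (Mor.congr_map₁_of_sq S.w t').symm

end PbLift

variable (g q p f) in
/-- A lift of a pair of indexed functors, related by a natural family `σ`, to an indexed functor
into the pullback. -/
structure FunctorLift {𝒳 : IdxCat.{max u v} K.base} (s : IdxFunctor 𝒳 (E.fib.changeBase g.base))
    (c : IdxFunctor 𝒳 (M.fib.changeBase q.base)) {x : 𝒳.Obj → N.fib.Obj}
    (σ : ∀ A, N.fib.Hom (𝟙_ N.base) (f.obj (c.obj A)) (x A)) where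
  R : IdxFunctor 𝒳 K.fib
  obj_snd : ∀ A, q.obj (R.obj A) = c.obj A
  map_snd : ∀ {d : K.base} {A B : 𝒳.Obj} (k : 𝒳.Hom d A B), HEq (q.map (R.map k)) (c.map k)
  φ : ∀ A, E.fib.Hom (𝟙_ E.base) (g.obj (R.obj A)) (s.obj A)
  p_φ : ∀ A, HEq (p.map₁ (φ A)) (σ A)
  isCart : ∀ A, IsCart p (φ A)
  natural : ∀ {d : K.base} {A B : 𝒳.Obj} (k : 𝒳.Hom d A B),
    E.fib.comp (g.map (R.map k)) (E.fib.reind (toUnit _) (φ B)) =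
      E.fib.comp (E.fib.reind (toUnit _) (φ A)) (s.map k)

section

variable {𝒳 : IdxCat.{max u v} K.base} {s : IdxFunctor 𝒳 (E.fib.changeBase g.base)}
  {c : IdxFunctor 𝒳 (M.fib.changeBase q.base)} {x : 𝒳.Obj → N.fib.Obj}
  {σ : ∀ A, N.fib.Hom (𝟙_ N.base) (f.obj (c.obj A)) (x A)}

/-- The cartesian lift at an object. -/
@[reducible]
def FunctorLift.at (L : FunctorLift g q p f s c σ) (A : 𝒳.Obj) :
    PbLift g q p f (s.obj A) (σ A) :=
  ⟨L.R.obj A, L.obj_snd A, L.φ A, L.p_φ A, L.isCart A⟩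

/-- Cartesian lifts of the maps `σ A` give the objects. Naturality of `σ` gives the action on maps
by the universal property, and uniqueness gives functoriality. In the hypothesis, `z` is the image
of `s.map k` with its endpoints transported. -/
lemma IsFibPb.exists_functorLift (S : IsFibPb g q p f) (hp : HasLifts p)
    (hx : ∀ A, p.obj (s.obj A) = x A)
    (nat : ∀ {d : K.base} {A B : 𝒳.Obj} (k : 𝒳.Hom d A B),
      ∃ z : N.fib.Hom (f.base.obj (q.base.obj d)) (x A) (x B), HEq z (p.map (s.map k)) ∧
        N.fib.comp (f.map (c.map k)) (N.fib.reind (toUnit _) (σ B)) =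
          N.fib.comp (N.fib.reind (toUnit _) (σ A)) z) :
    Nonempty (FunctorLift g q p f s c σ) := by
  let L := fun A => (S.exists_pbLift hp (hx A) (σ A)).some
  have ob : ∀ A, p.obj (g.obj A) = f.obj (q.obj A) := Mor.congr_obj S.w
  have bo : ∀ d, p.base.obj (g.base.obj d) = f.base.obj (q.base.obj d) := Mor.congr_base_obj S.w
  have key : ∀ {d : K.base} {A B : 𝒳.Obj} (k : 𝒳.Hom d A B),
      ∃ t : K.fib.Hom d (L A).R (L B).R, HEq (q.map t) (c.map k) ∧
        E.fib.comp (g.map t) (E.fib.reind (toUnit _) (L B).φ) =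
          E.fib.comp (E.fib.reind (toUnit _) (L A).φ) (s.map k) := by
    intro d A B k
    refine (L B).exists_hom S (hx B) (L A).obj_snd (c.map k) _ ?_
    obtain ⟨z, hz, h⟩ := nat k
    rw [Mor.map_comp, Mor.map_reind_toUnit]
    refine (heq_of_eq h).trans ?_
    exact IdxCat.heq_comp (bo d).symm ((congrArg f.obj (L A).obj_snd).symm.trans (ob _).symm)
      (hx A).symm (hx B).symm
      (IdxCat.heq_reind_toUnit (bo d).symm
        ((congrArg f.obj (L A).obj_snd).symm.trans (ob _).symm) (hx A).symm (L A).p_φ.symm) hz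
  choose t h₁ h₂ using @key
  have obR := fun A => (L A).obj_snd
  refine ⟨{ R := { obj := fun A => (L A).R
                   map := fun k => t k
                   map_id := fun d A => ?_
                   map_comp := fun {d A B D} k l => ?_
                   map_reind := fun {d d'} ρ A B k => ?_ }
            obj_snd := obR
            map_snd := fun k => h₁ k
            φ := fun A => (L A).φ
            p_φ := fun A => (L A).p_φ
            isCart := fun A => (L A).isCart
            natural := fun k => h₂ k }⟩
  · refine (L A).hom_ext S ?_ ?_
    · refine eq_of_heq ((h₁ _).trans ?_)
      rw [c.map_id, Mor.map_id]
      exact IdxCat.heq_id rfl (obR A).symm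
    · rw [h₂, s.map_id, Mor.map_id, E.fib.id_comp]
      exact E.fib.comp_id _
  · refine (L D).hom_ext S ?_ ?_
    · refine eq_of_heq ((h₁ _).trans ?_)
      rw [c.map_comp, Mor.map_comp]
      exact IdxCat.heq_comp rfl (obR A).symm (obR B).symm (obR D).symm (h₁ k).symm (h₁ l).symm
    · rw [h₂, s.map_comp, Mor.map_comp, E.fib.assoc, h₂]
      refine (E.fib.assoc _ _ _).symm.trans ?_
      rw [← h₂ k]
      exact E.fib.assoc _ _ _
  · refine (L B).hom_ext S ?_ ?_
    · refine eq_of_heq ((h₁ _).trans ?_)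
      rw [c.map_reind, Mor.map_reind]
      exact IdxCat.heq_reind rfl rfl (obR A).symm (obR B).symm HEq.rfl (h₁ k).symm
    · have h := congrArg (E.fib.reind (g.base.map ρ)) (h₂ k)
      rw [E.fib.reind_compm, E.fib.reind_compm, IdxCat.reind_toUnit, IdxCat.reind_toUnit] at h
      rw [h₂, s.map_reind, Mor.map_reind]
      exact h.symm

end

/-! ### Adjunctions in components -/

end LInd

section Bicat

variable {B : Type u} [Bicategory.{w, v} B] {a b : B} {l : a ⟶ b} {r : b ⟶ a}

lemma leftZigzag_eq (s : 𝟙 a ⟶ l ≫ r) (t : r ≫ l ⟶ 𝟙 b) :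
    leftZigzag s t = s ▷ l ≫ (α_ l r l).hom ≫ l ◁ t := by
  simp [leftZigzag, bicategoricalComp]

lemma rightZigzag_eq (s : 𝟙 a ⟶ l ≫ r) (t : r ≫ l ⟶ 𝟙 b) :
    rightZigzag s t = r ◁ s ≫ (α_ r l r).inv ≫ t ▷ r := by
  simp [rightZigzag, bicategoricalComp]

end Bicat

namespace LInd

section Adj

variable {X Y : LInd.{v, u}} {l : X ⟶ Y} {r : Y ⟶ X}

/-- The components of the unit. -/
def adjUnit (adj : Bicategory.Adjunction l r) (A : X.fib.Obj) :
    X.fib.Hom (𝟙_ X.base) A (r.obj (l.obj A)) := Cell.app adj.unit A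

/-- The components of the counit. -/
def adjCounit (adj : Bicategory.Adjunction l r) (B : Y.fib.Obj) :
    Y.fib.Hom (𝟙_ Y.base) (l.obj (r.obj B)) B := Cell.app adj.counit B

lemma leftZigzag_app (s : 𝟙 X ⟶ l ≫ r) (t : r ≫ l ⟶ 𝟙 Y) (A : X.fib.Obj)
    {s' : X.fib.Hom (𝟙_ X.base) A (r.obj (l.obj A))} (hs : Cell.app s A = s')
    {t' : Y.fib.Hom (𝟙_ Y.base) (l.obj (r.obj (l.obj A))) (l.obj A)}
    (ht : Cell.app t (l.obj A) = t') :
    Cell.app (leftZigzag s t) A = Y.fib.comp (l.map₁ s') t' := by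
  subst hs ht
  rw [leftZigzag_eq]
  exact congrArg (Y.fib.comp _) (Y.fib.id_comp _)

lemma rightZigzag_app (s : 𝟙 X ⟶ l ≫ r) (t : r ≫ l ⟶ 𝟙 Y) (B : Y.fib.Obj)
    {s' : X.fib.Hom (𝟙_ X.base) (r.obj B) (r.obj (l.obj (r.obj B)))}
    (hs : Cell.app s (r.obj B) = s') {t' : Y.fib.Hom (𝟙_ Y.base) (l.obj (r.obj B)) B}
    (ht : Cell.app t B = t') :
    Cell.app (rightZigzag s t) B = X.fib.comp s' (r.map₁ t') := by
  subst hs ht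
  rw [rightZigzag_eq]
  exact congrArg (X.fib.comp _) (X.fib.id_comp _)

lemma leftZigzag_base (s : 𝟙 X ⟶ l ≫ r) (t : r ≫ l ⟶ 𝟙 Y) (c : X.base) :
    (Cell.base (leftZigzag s t)).app c =
      l.base.map ((Cell.base s).app c) ≫ (Cell.base t).app (l.base.obj c) := by
  rw [leftZigzag_eq]
  exact congrArg (l.base.map ((Cell.base s).app c) ≫ ·) (Category.id_comp _)

lemma rightZigzag_base (s : 𝟙 X ⟶ l ≫ r) (t : r ≫ l ⟶ 𝟙 Y) (c : Y.base) :
    (Cell.base (rightZigzag s t)).app c =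
      (Cell.base s).app (r.base.obj c) ≫ r.base.map ((Cell.base t).app c) := by
  rw [rightZigzag_eq]
  exact congrArg ((Cell.base s).app (r.base.obj c) ≫ ·) (Category.id_comp _)

lemma adj_left_triangle (adj : Bicategory.Adjunction l r) (A : X.fib.Obj) :
    Y.fib.comp (l.map₁ (adjUnit adj A)) (adjCounit adj (l.obj A)) = Y.fib.id _ _ :=
  (leftZigzag_app adj.unit adj.counit A rfl rfl).symm.trans
    ((congrArg (fun a : 𝟙 X ≫ l ⟶ l ≫ 𝟙 Y => Cell.app a A) adj.left_triangle).trans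
      (Y.fib.id_comp _))

lemma adj_right_triangle (adj : Bicategory.Adjunction l r) (B : Y.fib.Obj) :
    X.fib.comp (adjUnit adj (r.obj B)) (r.map₁ (adjCounit adj B)) = X.fib.id _ _ :=
  (rightZigzag_app adj.unit adj.counit B rfl rfl).symm.trans
    ((congrArg (fun a : r ≫ 𝟙 X ⟶ 𝟙 Y ≫ r => Cell.app a B) adj.right_triangle).trans
      (X.fib.id_comp _))

end Adj

end LInd

lemma IdxFunctor.toLInd_map₁ {C : Type (max u v)} [Category.{v} C] [CartesianMonoidalCategory C]
    {𝒞 𝒟 : IdxCat.{max u v} C} (F : IdxFunctor 𝒞 𝒟) {A B : 𝒞.Obj} (k : 𝒞.Hom (𝟙_ C) A B) :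
    LInd.Mor.map₁ (F.toLInd : (LInd.mk C 𝒞 : LInd.{v, u}) ⟶ LInd.mk C 𝒟) k = F.map k := by
  have e : LInd.Mor.unitIso (F.toLInd : (LInd.mk C 𝒞 : LInd.{v, u}) ⟶ LInd.mk C 𝒟) = 𝟙 _ :=
    LInd.Mor.hom_unit_ext _ _ _
  exact (congrArg (fun t => 𝒟.reind t (F.map k)) e).trans (𝒟.reind_id _)

section IdxAdj

variable {C : Type (max u v)} [Category.{v} C] [CartesianMonoidalCategory C]
  {𝒞 𝒟 : IdxCat.{max u v} C} (F : IdxFunctor 𝒞 𝒟) (U : IdxFunctor 𝒟 𝒞)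

/-- An adjunction of locally indexed functors over a fixed base, from its components. -/
structure IdxAdj where
  η : ∀ A, 𝒞.Hom (𝟙_ C) A (U.obj (F.obj A))
  η_nat : ∀ {c : C} {A B : 𝒞.Obj} (k : 𝒞.Hom c A B),
    𝒞.comp k (𝒞.reind (toUnit c) (η B)) = 𝒞.comp (𝒞.reind (toUnit c) (η A)) (U.map (F.map k))
  θ : ∀ B, 𝒟.Hom (𝟙_ C) (F.obj (U.obj B)) B
  θ_nat : ∀ {c : C} {A B : 𝒟.Obj} (k : 𝒟.Hom c A B),
    𝒟.comp (F.map (U.map k)) (𝒟.reind (toUnit c) (θ B)) = 𝒟.comp (𝒟.reind (toUnit c) (θ A)) k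
  left : ∀ A, 𝒟.comp (F.map (η A)) (θ (F.obj A)) = 𝒟.id _ _
  right : ∀ B, 𝒞.comp (η (U.obj B)) (U.map (θ B)) = 𝒞.id _ _

variable {F U}

/-- The unit as a 2-cell. -/
def IdxAdj.unit (T : IdxAdj F U) :
    𝟙 (LInd.mk C 𝒞 : LInd.{v, u}) ⟶ F.toLInd ≫ U.toLInd where
  base := 𝟙 (𝟭 C)
  app := T.η
  naturality k := (T.η_nat k).trans (congrArg (𝒞.comp _) (𝒞.reind_id _).symm)

/-- The counit as a 2-cell. -/
def IdxAdj.counit (T : IdxAdj F U) :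
    U.toLInd ≫ F.toLInd ⟶ 𝟙 (LInd.mk C 𝒟 : LInd.{v, u}) where
  base := 𝟙 (𝟭 C)
  app := T.θ
  naturality k := (T.θ_nat k).trans (congrArg (𝒟.comp _) (𝒟.reind_id _).symm)

/-- The adjunction in `LInd`. -/
def IdxAdj.adjunction (T : IdxAdj F U) :
    Bicategory.Adjunction (B := LInd.{v, u}) F.toLInd U.toLInd where
  unit := T.unit
  counit := T.counit
  left_triangle := by
    refine LInd.cell_ext (fun c => ?_) fun A => ?_
    · refine (LInd.leftZigzag_base T.unit T.counit c).trans ?_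
      rfl
    · refine (LInd.leftZigzag_app T.unit T.counit A rfl rfl).trans ?_
      refine Eq.trans ?_ ((T.left A).trans (𝒟.id_comp _).symm)
      exact congrArg (fun t => 𝒟.comp t _) (F.toLInd_map₁ (T.η A))
  right_triangle := by
    refine LInd.cell_ext (fun c => ?_) fun A => ?_
    · refine (LInd.rightZigzag_base T.unit T.counit c).trans ?_
      rfl
    · refine (LInd.rightZigzag_app T.unit T.counit A rfl rfl).trans ?_
      refine Eq.trans ?_ ((T.right A).trans (𝒞.id_comp _).symm)
      exact congrArg (𝒞.comp _) (U.toLInd_map₁ (T.θ A))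

end IdxAdj

/-! ### The components of models and of their 1-cells -/

namespace Model

variable (M : Model.{v, u})

/-- The adjunction of a model in components. -/
def idxAdj : IdxAdj M.F M.U where
  η := LInd.adjUnit M.adj
  η_nat {c A B} k := by
    have h := LInd.Cell.naturality M.adj.unit k
    rw [M.unit_base] at h
    exact h.trans (congrArg ((DistCat.selfIdx M.val.carrier).comp _) ((DistCat.selfIdx M.val.carrier).reind_id _))
  θ := LInd.adjCounit M.adj
  θ_nat {c A B} k := by
    have h := LInd.Cell.naturality M.adj.counit k
    rw [M.counit_base] at h
    exact h.trans (congrArg (M.comp.comp _) (M.comp.reind_id _))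
  left A := (congrArg (fun t => M.comp.comp t _) (M.F.toLInd_map₁ _).symm).trans
    (LInd.adj_left_triangle M.adj A)
  right B := (congrArg ((DistCat.selfIdx M.val.carrier).comp _) (M.U.toLInd_map₁ _).symm).trans
    (LInd.adj_right_triangle M.adj B)

end Model

namespace LInd

section Lax

variable {X Y X' Y' : LInd.{v, u}} {l : X ⟶ Y} {r : Y ⟶ X} {f : X' ⟶ Y'} {r' : Y' ⟶ X'}
  {m : X ⟶ X'} {n : Y ⟶ Y'}

lemma lax_counit_app (α : l ≫ n ⟶ m ≫ f) (β : r ≫ m ⟶ n ≫ r') (t' : r' ≫ f ⟶ 𝟙 Y') (B : Y.fib.Obj)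
    {a : Y'.fib.Hom (𝟙_ Y'.base) (n.obj (l.obj (r.obj B))) (f.obj (m.obj (r.obj B)))}
    (ha : Cell.app α (r.obj B) = a)
    {b : X'.fib.Hom (𝟙_ X'.base) (m.obj (r.obj B)) (r'.obj (n.obj B))} (hb : Cell.app β B = b)
    {e : Y'.fib.Hom (𝟙_ Y'.base) (f.obj (r'.obj (n.obj B))) (n.obj B)}
    (he : Cell.app t' (n.obj B) = e) :
    Cell.app ((α_ r l n).hom ≫ r ◁ α ≫ (α_ r m f).inv ≫ β ▷ f ≫ (α_ n r' f).hom ≫ n ◁ t' ≫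
      (Bicategory.rightUnitor n).hom) B = Y'.fib.comp a (Y'.fib.comp (f.map₁ b) e) := by
  subst ha hb he
  refine (Y'.fib.id_comp _).trans (congrArg (Y'.fib.comp _) ?_)
  refine (Y'.fib.id_comp _).trans (congrArg (Y'.fib.comp _) ?_)
  exact (Y'.fib.id_comp _).trans (Y'.fib.comp_id _)

lemma lax_unit_app (α : l ≫ n ⟶ m ≫ f) (β : r ≫ m ⟶ n ≫ r') (s : 𝟙 X ⟶ l ≫ r) (A : X.fib.Obj)
    {a : Y'.fib.Hom (𝟙_ Y'.base) (n.obj (l.obj A)) (f.obj (m.obj A))} (ha : Cell.app α A = a)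
    {b : X'.fib.Hom (𝟙_ X'.base) (m.obj (r.obj (l.obj A))) (r'.obj (n.obj (l.obj A)))}
    (hb : Cell.app β (l.obj A) = b) {e : X.fib.Hom (𝟙_ X.base) A (r.obj (l.obj A))}
    (he : Cell.app s A = e) :
    Cell.app ((Bicategory.leftUnitor m).inv ≫ s ▷ m ≫ (α_ l r m).hom ≫ l ◁ β ≫ (α_ l n r').inv ≫ α ▷ r' ≫
      (α_ m f r').hom) A = X'.fib.comp (m.map₁ e) (X'.fib.comp b (r'.map₁ a)) := by
  subst ha hb he
  refine (X'.fib.id_comp _).trans (congrArg (X'.fib.comp _) ?_)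
  refine (X'.fib.id_comp _).trans (congrArg (X'.fib.comp _) ?_)
  exact (X'.fib.id_comp _).trans (X'.fib.comp_id _)

lemma lax_counit_base (α : l ≫ n ⟶ m ≫ f) (β : r ≫ m ⟶ n ≫ r') (t' : r' ≫ f ⟶ 𝟙 Y') (c : Y.base) :
    (Cell.base ((α_ r l n).hom ≫ r ◁ α ≫ (α_ r m f).inv ≫ β ▷ f ≫ (α_ n r' f).hom ≫ n ◁ t' ≫
      (Bicategory.rightUnitor n).hom)).app c = (Cell.base α).app (r.base.obj c) ≫ f.base.map ((Cell.base β).app c) ≫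
        (Cell.base t').app (n.base.obj c) := by
  refine (Category.id_comp _).trans (congrArg ((Cell.base α).app (r.base.obj c) ≫ ·) ?_)
  refine (Category.id_comp _).trans (congrArg (f.base.map ((Cell.base β).app c) ≫ ·) ?_)
  exact (Category.id_comp _).trans (Category.comp_id _)

lemma lax_unit_base (α : l ≫ n ⟶ m ≫ f) (β : r ≫ m ⟶ n ≫ r') (s : 𝟙 X ⟶ l ≫ r) (c : X.base) :
    (Cell.base ((Bicategory.leftUnitor m).inv ≫ s ▷ m ≫ (α_ l r m).hom ≫ l ◁ β ≫ (α_ l n r').inv ≫ α ▷ r' ≫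
      (α_ m f r').hom)).app c = m.base.map ((Cell.base s).app c) ≫
        (Cell.base β).app (l.base.obj c) ≫ r'.base.map ((Cell.base α).app c) := by
  refine (Category.id_comp _).trans (congrArg (m.base.map ((Cell.base s).app c) ≫ ·) ?_)
  refine (Category.id_comp _).trans (congrArg ((Cell.base β).app (l.base.obj c) ≫ ·) ?_)
  exact (Category.id_comp _).trans (Category.comp_id _)

end Lax

end LInd

namespace IdxAdj

variable {C : Type (max u v)} [Category.{v} C] [CartesianMonoidalCategory C]
  {𝒞 𝒟 : IdxCat.{max u v} C} {F : IdxFunctor 𝒞 𝒟} {U : IdxFunctor 𝒟 𝒞} (T : IdxAdj F U)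

lemma η_nat₁ {A B : 𝒞.Obj} (k : 𝒞.Hom (𝟙_ C) A B) :
    𝒞.comp k (T.η B) = 𝒞.comp (T.η A) (U.map (F.map k)) := by
  have h := T.η_nat k
  rwa [IdxCat.reind_toUnit_unit, IdxCat.reind_toUnit_unit] at h

lemma θ_nat₁ {A B : 𝒟.Obj} (k : 𝒟.Hom (𝟙_ C) A B) :
    𝒟.comp (F.map (U.map k)) (T.θ B) = 𝒟.comp (T.θ A) k := by
  have h := T.θ_nat k
  rwa [IdxCat.reind_toUnit_unit, IdxCat.reind_toUnit_unit] at h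

end IdxAdj

namespace Model

/-- The unit of a model. -/
abbrev η (M : Model.{v, u}) (A : M.val.carrier) :
    (DistCat.self M.val).fib.Hom (𝟙_ M.val.carrier) A (M.U.obj (M.F.obj A)) := M.idxAdj.η A

/-- The counit of a model. -/
abbrev θ (M : Model.{v, u}) (B : M.comp.Obj) :
    M.lind.fib.Hom (𝟙_ M.val.carrier) (M.F.obj (M.U.obj B)) B := M.idxAdj.θ B

namespace Mor

section

variable {M N : Model.{v, u}} (f : Mor M N)

/-- The 1-cell between the categories of values. -/
abbrev sf : DistCat.self M.val ⟶ DistCat.self N.val := DistCat.selfMap f.h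

/-- The components of `α`. -/
def a (A : M.val.carrier) : N.lind.fib.Hom (𝟙_ N.val.carrier) (f.lind.obj (M.F.obj A))
    (N.F.obj (f.sf.obj A)) := LInd.Cell.app f.α A

/-- The components of `β`. -/
def b (B : M.comp.Obj) : (DistCat.self N.val).fib.Hom (𝟙_ N.val.carrier)
    (f.sf.obj (M.U.obj B)) (N.U.obj (f.lind.obj B)) := LInd.Cell.app f.β B

lemma a_nat {c : M.val.carrier} {A B : M.val.carrier}
    (k : (DistCat.self M.val).fib.Hom c A B) :
    N.lind.fib.comp (f.lind.map (M.F.map k)) (N.lind.fib.reind (toUnit _) (f.a B)) =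
      N.lind.fib.comp (N.lind.fib.reind (toUnit _) (f.a A)) (N.F.map (f.sf.map k)) := by
  have h := LInd.Cell.naturality f.α k
  rw [f.α_base] at h
  exact h.trans (congrArg (N.comp.comp _) (N.comp.reind_id _))

lemma b_nat {c : M.val.carrier} {A B : M.comp.Obj} (k : M.lind.fib.Hom c A B) :
    (DistCat.self N.val).fib.comp (f.sf.map (M.U.map k))
      ((DistCat.self N.val).fib.reind (toUnit _) (f.b B)) =
      (DistCat.self N.val).fib.comp ((DistCat.self N.val).fib.reind (toUnit _) (f.b A))
        (N.U.map (f.lind.map k)) := by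
  have h := LInd.Cell.naturality f.β k
  rw [f.β_base] at h
  exact h.trans (congrArg ((DistCat.self N.val).fib.comp _) ((DistCat.self N.val).fib.reind_id _))

lemma counit_app (B : M.comp.Obj) : f.lind.map₁ (M.θ B) =
    N.lind.fib.comp (f.a (M.U.obj B)) (N.lind.fib.comp (N.F.map (f.b B)) (N.θ (f.lind.obj B))) := by
  have h := congrArg (fun t : (M.right ≫ M.left) ≫ f.lind ⟶ f.lind => LInd.Cell.app t B)
    f.isLax.counit
  have h₁ : LInd.Cell.app (M.adj.counit ▷ f.lind ≫ (Bicategory.leftUnitor f.lind).hom) B = f.lind.map₁ (M.θ B) :=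
    N.comp.comp_id _
  refine (h₁.symm.trans h).trans ?_
  refine (LInd.lax_counit_app f.α f.β N.adj.counit B rfl rfl rfl).trans ?_
  exact congrArg (fun t => N.comp.comp (f.a (M.U.obj B)) (N.comp.comp t (N.θ (f.lind.obj B))))
    (N.F.toLInd_map₁ (f.b B))

lemma unit_app (A : M.val.carrier) : N.η (f.sf.obj A) =
    (DistCat.self N.val).fib.comp (f.sf.map₁ (M.η A))
      ((DistCat.self N.val).fib.comp (f.b (M.F.obj A)) (N.U.map (f.a A))) := by
  have h := congrArg (fun t : f.sf ⟶ f.sf ≫ N.left ≫ N.right => LInd.Cell.app t A)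
    f.isLax.unit
  have h₁ : LInd.Cell.app ((Bicategory.rightUnitor f.sf).inv ≫ f.sf ◁ N.adj.unit) A = N.η (f.sf.obj A) :=
    (DistCat.self N.val).fib.id_comp _
  refine (h₁.symm.trans h).trans ?_
  refine (LInd.lax_unit_app f.α f.β M.adj.unit A rfl rfl rfl).trans ?_
  exact congrArg (fun t => (DistCat.self N.val).fib.comp (f.sf.map₁ (M.η A))
    ((DistCat.self N.val).fib.comp (f.b (M.F.obj A)) t)) (N.U.toLInd_map₁ (f.a A))

lemma a_nat₁ {A B : M.val.carrier}
    (k : (DistCat.self M.val).fib.Hom (𝟙_ M.val.carrier) A B) :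
    N.lind.fib.comp (f.lind.map₁ (M.F.map k)) (f.a B) =
      N.lind.fib.comp (f.a A) (N.F.map (f.sf.map₁ k)) := by
  have h := LInd.Cell.naturality₁ f.α k
  rw [LInd.Mor.comp_map₁, LInd.Mor.comp_map₁, IdxFunctor.toLInd_map₁, IdxFunctor.toLInd_map₁] at h
  exact h

lemma b_nat₁ {A B : M.comp.Obj} (k : M.lind.fib.Hom (𝟙_ M.val.carrier) A B) :
    (DistCat.self N.val).fib.comp (f.sf.map₁ (M.U.map k)) (f.b B) =
      (DistCat.self N.val).fib.comp (f.b A) (N.U.map (f.lind.map₁ k)) := by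
  have h := LInd.Cell.naturality₁ f.β k
  rw [LInd.Mor.comp_map₁, LInd.Mor.comp_map₁, IdxFunctor.toLInd_map₁, IdxFunctor.toLInd_map₁] at h
  exact h

/-- Doctrinal adjunction: the mate of `β` runs opposite to `α`, and the compatibilities with the
counits and the units give the two inverse laws, each by one triangle identity. -/
lemma exists_a_inv (A : M.val.carrier) : ∃ j : N.lind.fib.Hom (𝟙_ N.val.carrier)
    (N.F.obj (f.sf.obj A)) (f.lind.obj (M.F.obj A)),
    N.lind.fib.comp (f.a A) j = N.lind.fib.id _ _ ∧
      N.lind.fib.comp j (f.a A) = N.lind.fib.id _ _ := by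
  -- The witness is the mate: the image of the unit followed by `β`, transposed by the counit of
  -- `N`.
  refine ⟨N.lind.fib.comp (N.F.map ((DistCat.self N.val).fib.comp (f.sf.map₁ (M.η A))
    (f.b (M.F.obj A)))) (N.θ _), ?_, ?_⟩
  · rw [N.F.map_comp, N.lind.fib.assoc, ← N.lind.fib.assoc, ← a_nat₁, N.lind.fib.assoc,
      ← counit_app, ← LInd.Mor.map₁_comp, M.idxAdj.left, LInd.Mor.map₁_id]
  · rw [N.lind.fib.assoc, ← N.idxAdj.θ_nat₁, ← N.lind.fib.assoc, ← N.F.map_comp,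
      (DistCat.self N.val).fib.assoc, ← unit_app, N.idxAdj.left]

end

end Mor

/-! ### 1-cells of models from their components -/

section Build

variable {M N : Model.{v, u}} (h : M.val ⟶ N.val)
  (H : IdxFunctor M.comp (N.comp.changeBase h.functor))

/-- The data of a 1-cell in components. -/
structure MorData where
  preservesProducts : H.PreservesProducts M.products N.products
  a : ∀ A : M.val.carrier, N.lind.fib.Hom (𝟙_ N.val.carrier) ((pair h H).obj (M.F.obj A))
    (N.F.obj (LInd.Mor.obj (DistCat.selfMap h) A))
  a_nat : ∀ {c A B : M.val.carrier} (k : (DistCat.self M.val).fib.Hom c A B),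
    N.lind.fib.comp ((pair h H).map (M.F.map k)) (N.lind.fib.reind (toUnit _) (a B)) =
      N.lind.fib.comp (N.lind.fib.reind (toUnit _) (a A))
        (N.F.map (LInd.Mor.map (DistCat.selfMap h) k))
  b : ∀ B : M.comp.Obj, (DistCat.self N.val).fib.Hom (𝟙_ N.val.carrier)
    (LInd.Mor.obj (DistCat.selfMap h) (M.U.obj B)) (N.U.obj ((pair h H).obj B))
  b_nat : ∀ {c : M.val.carrier} {A B : M.comp.Obj} (k : M.lind.fib.Hom c A B),
    (DistCat.self N.val).fib.comp (LInd.Mor.map (DistCat.selfMap h) (M.U.map k))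
      ((DistCat.self N.val).fib.reind (toUnit _) (b B)) =
      (DistCat.self N.val).fib.comp ((DistCat.self N.val).fib.reind (toUnit _) (b A))
        (N.U.map ((pair h H).map k))
  counit_app : ∀ B : M.comp.Obj, (pair h H).map₁ (M.θ B) =
    N.lind.fib.comp (a (M.U.obj B)) (N.lind.fib.comp (N.F.map (b B)) (N.θ ((pair h H).obj B)))
  unit_app : ∀ A : M.val.carrier, N.η (LInd.Mor.obj (DistCat.selfMap h) A) =
    (DistCat.self N.val).fib.comp (LInd.Mor.map₁ (DistCat.selfMap h) (M.η A))
      ((DistCat.self N.val).fib.comp (b (M.F.obj A)) (N.U.map (a A)))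

namespace MorData

variable {h H} (T : MorData h H)

/-- The 2-cell `α`. -/
def α : M.left ≫ pair h H ⟶ DistCat.selfMap h ≫ N.left where
  base := 𝟙 h.functor
  app := T.a
  naturality k := (T.a_nat k).trans (congrArg (N.comp.comp _) (N.comp.reind_id _).symm)

/-- The 2-cell `β`. -/
def β : M.right ≫ DistCat.selfMap h ⟶ pair h H ≫ N.right where
  base := 𝟙 h.functor
  app := T.b
  naturality k := (T.b_nat k).trans (congrArg ((DistCat.self N.val).fib.comp _)
    ((DistCat.self N.val).fib.reind_id _).symm)

lemma isLax : IsLaxAdjMor M.adj N.adj T.α T.β where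
  counit := by
    refine LInd.cell_ext (fun c => ?_) fun B => ?_
    · refine Eq.trans ?_ (LInd.lax_counit_base T.α T.β N.adj.counit c).symm
      refine (Category.comp_id _).trans ?_
      refine (congrArg h.functor.map (M.counit_base c)).trans ?_
      refine (h.functor.map_id c).trans ?_
      refine ((Category.id_comp _).trans ((Category.id_comp _).trans
        (N.counit_base (h.functor.obj c)))).symm
    · have h₁ : LInd.Cell.app (M.adj.counit ▷ pair h H ≫ (Bicategory.leftUnitor (pair h H)).hom) B =
        (pair h H).map₁ (M.θ B) := N.comp.comp_id _
      refine h₁.trans ((T.counit_app B).trans ?_)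
      refine Eq.trans ?_ (LInd.lax_counit_app T.α T.β N.adj.counit B rfl rfl rfl).symm
      exact congrArg (fun t => N.comp.comp (T.a (M.U.obj B)) (N.comp.comp t (N.θ (H.obj B))))
        (N.F.toLInd_map₁ (T.b B)).symm
  unit := by
    refine LInd.cell_ext (fun c => ?_) fun A => ?_
    · refine Eq.trans ?_ (LInd.lax_unit_base T.α T.β M.adj.unit c).symm
      refine (Category.id_comp _).trans ?_
      refine (N.unit_base (h.functor.obj c)).trans ?_
      refine (((congrArg (· ≫ 𝟙 (h.functor.obj c) ≫ 𝟙 (h.functor.obj c))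
        ((congrArg h.functor.map (M.unit_base c)).trans (h.functor.map_id c)))).trans ?_).symm
      exact (Category.id_comp _).trans (Category.id_comp _)
    · have h₁ : LInd.Cell.app ((Bicategory.rightUnitor (DistCat.selfMap h)).inv ≫ DistCat.selfMap h ◁ N.adj.unit) A =
        N.η (LInd.Mor.obj (DistCat.selfMap h) A) := (DistCat.self N.val).fib.id_comp _
      refine h₁.trans ((T.unit_app A).trans ?_)
      refine Eq.trans ?_ (LInd.lax_unit_app T.α T.β M.adj.unit A rfl rfl rfl).symm
      exact congrArg (fun t => (DistCat.self N.val).fib.comp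
        (LInd.Mor.map₁ (DistCat.selfMap h) (M.η A))
        ((DistCat.self N.val).fib.comp (T.b (M.F.obj A)) t)) (N.U.toLInd_map₁ (T.a A)).symm

/-- The 1-cell given by its components. -/
@[reducible]
def mor : M ⟶ N where
  h := h
  H := H
  preservesProducts := T.preservesProducts
  α := T.α
  β := T.β
  α_base _ := rfl
  β_base _ := rfl
  isLax := T.isLax

end MorData

end Build

end Model

lemma IdxFunctor.map_heq {C : Type u} [Category.{v} C] {𝒞 𝒟 : IdxCat.{w} C} (F : IdxFunctor 𝒞 𝒟)
    {c c' : C} {A B A' B' : 𝒞.Obj} {k : 𝒞.Hom c A B} {k' : 𝒞.Hom c' A' B'} (hc : c = c')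
    (hA : A = A') (hB : B = B') (hk : HEq k k') : HEq (F.map k) (F.map k') := by
  subst hc hA hB hk
  rfl

lemma IdxCat.exists_inv_of_heq {C : Type u} [Category.{v} C] {𝒞 : IdxCat.{w} C} {c : C}
    {A B A' B' : 𝒞.Obj} {k : 𝒞.Hom c A B} {k' : 𝒞.Hom c A' B'} (hA : A = A') (hB : B = B')
    (hk : HEq k k') {j' : 𝒞.Hom c B' A'} (h : 𝒞.comp k' j' = 𝒞.id _ _)
    (h' : 𝒞.comp j' k' = 𝒞.id _ _) :
    ∃ j : 𝒞.Hom c B A, HEq j j' ∧ 𝒞.comp k j = 𝒞.id _ _ ∧ 𝒞.comp j k = 𝒞.id _ _ := by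
  subst hA hB hk
  exact ⟨j', HEq.rfl, h, h'⟩

/-! ### The inverse of `α`, and strict 1-cells in components -/

namespace Model

/-- The locally indexed category `self` of values. -/
abbrev vfib (M : Model.{v, u}) : IdxCat.{max u v} M.val.carrier := (DistCat.self M.val).fib

lemma η_heq (M : Model.{v, u}) {A A' : M.val.carrier} (h : A = A') : HEq (M.η A) (M.η A') := by
  subst h
  rfl

lemma θ_heq (M : Model.{v, u}) {A A' : M.comp.Obj} (h : A = A') : HEq (M.θ A) (M.θ A') := by
  subst h
  rfl

namespace Mor

variable {M N : Model.{v, u}} (f : Mor M N)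

lemma a_heq {A A' : M.val.carrier} (h : A = A') : HEq (f.a A) (f.a A') := by
  subst h
  rfl

lemma b_heq {A A' : M.comp.Obj} (h : A = A') : HEq (f.b A) (f.b A') := by
  subst h
  rfl

/-- The inverse of the component of `α`. -/
def aInv (A : M.val.carrier) : N.lind.fib.Hom (𝟙_ N.val.carrier) (N.F.obj (f.sf.obj A))
    (f.lind.obj (M.F.obj A)) := (f.exists_a_inv A).choose

lemma a_aInv (A : M.val.carrier) : N.lind.fib.comp (f.a A) (f.aInv A) = N.lind.fib.id _ _ :=
  (f.exists_a_inv A).choose_spec.1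

lemma aInv_a (A : M.val.carrier) : N.lind.fib.comp (f.aInv A) (f.a A) = N.lind.fib.id _ _ :=
  (f.exists_a_inv A).choose_spec.2

/-- The unit equation with `α` moved to the other side; it is the compatibility in `N` needed to
construct the lifted unit. -/
lemma unit_aInv (A : M.val.carrier) :
    N.vfib.comp (N.η (f.sf.obj A)) (N.U.map (f.aInv A)) =
      N.vfib.comp (f.sf.map₁ (M.η A)) (f.b (M.F.obj A)) := by
  rw [unit_app, IdxCat.assoc, IdxCat.assoc, ← N.U.map_comp, a_aInv, N.U.map_id, IdxCat.comp_id]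

end Mor

namespace Mor.IsStrict

variable {E N : Model.{v, u}} {p : E ⟶ N} (hp : p.IsStrict)

lemma left_obj (hp : p.IsStrict) (A : E.val.carrier) :
    p.lind.obj (E.F.obj A) = N.F.obj (p.sf.obj A) :=
  LInd.Mor.congr_obj hp.left.choose A

lemma left_map (hp : p.IsStrict) {c A B : E.val.carrier} (k : E.vfib.Hom c A B) :
    HEq (p.lind.map (E.F.map k)) (N.F.map (p.sf.map k)) :=
  LInd.Mor.congr_map hp.left.choose k

lemma left_map₁ (hp : p.IsStrict) {A B : E.val.carrier}
    (k : E.vfib.Hom (𝟙_ E.val.carrier) A B) :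
    HEq (p.lind.map₁ (E.F.map k)) (N.F.map (p.sf.map₁ k)) := by
  have h := LInd.Mor.congr_map₁ hp.left.choose k
  rw [LInd.Mor.comp_map₁, LInd.Mor.comp_map₁, IdxFunctor.toLInd_map₁, IdxFunctor.toLInd_map₁] at h
  exact h

lemma right_obj (hp : p.IsStrict) (A : E.comp.Obj) :
    p.sf.obj (E.U.obj A) = N.U.obj (p.lind.obj A) :=
  LInd.Mor.congr_obj hp.right.choose A

lemma right_map (hp : p.IsStrict) {c : E.val.carrier} {A B : E.comp.Obj}
    (k : E.lind.fib.Hom c A B) :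
    HEq (p.sf.map (E.U.map k)) (N.U.map (p.lind.map k)) :=
  LInd.Mor.congr_map hp.right.choose k

lemma right_map₁ (hp : p.IsStrict) {A B : E.comp.Obj}
    (k : E.lind.fib.Hom (𝟙_ E.val.carrier) A B) :
    HEq (p.sf.map₁ (E.U.map k)) (N.U.map (p.lind.map₁ k)) := by
  have h := LInd.Mor.congr_map₁ hp.right.choose k
  rw [LInd.Mor.comp_map₁, LInd.Mor.comp_map₁, IdxFunctor.toLInd_map₁, IdxFunctor.toLInd_map₁] at h
  exact h

lemma a_heq_id (hp : p.IsStrict) (A : E.val.carrier) :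
    HEq (p.a A) (N.lind.fib.id (𝟙_ N.val.carrier) (p.lind.obj (E.F.obj A))) := by
  obtain ⟨e, he⟩ := hp.left
  refine HEq.trans ?_ (LInd.eqToHom_app e A)
  exact heq_of_eq (congrArg (fun t : E.left ≫ p.lind ⟶ p.sf ≫ N.left => LInd.Cell.app t A) he)

lemma b_heq_id (hp : p.IsStrict) (A : E.comp.Obj) :
    HEq (p.b A) (N.vfib.id (𝟙_ N.val.carrier) (p.sf.obj (E.U.obj A))) := by
  obtain ⟨e, he⟩ := hp.right
  refine HEq.trans ?_ (LInd.eqToHom_app e A)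
  exact heq_of_eq (congrArg (fun t : E.right ≫ p.sf ⟶ p.lind ≫ N.right => LInd.Cell.app t A) he)

/-- For a strict 1-cell the components of `α` and `β` are identities up to `HEq`, so the unit
equation degenerates to strict preservation. -/
lemma map₁_η (hp : p.IsStrict) (A : E.val.carrier) :
    HEq (p.sf.map₁ (E.η A)) (N.η (p.sf.obj A)) := by
  refine HEq.symm ((heq_of_eq (p.unit_app A)).trans ?_)
  have h₁ : HEq (N.U.map (p.a A)) (N.vfib.id (𝟙_ N.val.carrier) (N.U.obj (p.lind.obj (E.F.obj A)))) :=
    (N.U.map_heq rfl rfl (hp.left_obj A).symm (hp.a_heq_id A)).trans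
      (heq_of_eq (N.U.map_id _ _))
  refine (IdxCat.heq_comp rfl rfl rfl (congrArg N.U.obj (hp.left_obj A).symm) HEq.rfl
    (IdxCat.heq_comp_id _ (congrArg N.U.obj (hp.left_obj A)) h₁)).trans ?_
  exact IdxCat.heq_comp_id _ (hp.right_obj _) (hp.b_heq_id _)

lemma map₁_θ (hp : p.IsStrict) (B : E.comp.Obj) :
    HEq (p.lind.map₁ (E.θ B)) (N.θ (p.lind.obj B)) := by
  refine (heq_of_eq (p.counit_app B)).trans ?_
  have h₁ : HEq (N.F.map (p.b B)) (N.lind.fib.id (𝟙_ N.val.carrier)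
      (N.F.obj (N.U.obj (p.lind.obj B)))) :=
    (N.F.map_heq rfl (hp.right_obj B) rfl ((hp.b_heq_id B).trans
      (IdxCat.heq_id rfl (hp.right_obj B)))).trans (heq_of_eq (N.F.map_id _ _))
  refine HEq.trans (IdxCat.heq_id_comp _ (hp.left_obj _) ((hp.a_heq_id _).trans
    (IdxCat.heq_id rfl (hp.left_obj _)))) ?_
  exact IdxCat.heq_id_comp _ (congrArg N.F.obj (hp.right_obj B)) h₁

end Mor.IsStrict

/-! ### Lifting the two adjoints to a pullback square -/

/-- A strict pullback of the value and computation categories along which the lifted model will be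
constructed. -/
structure Square {E M N : Model.{v, u}} (p : E ⟶ N) (f : M ⟶ N) where
  val : DistCat.{v, u}
  comp : IdxCat.{max u v} val.carrier
  g : val ⟶ E.val
  q : val ⟶ M.val
  G : IdxFunctor comp (E.comp.changeBase g.functor)
  Q : IdxFunctor comp (M.comp.changeBase q.functor)

namespace Square

variable {E M N : Model.{v, u}} {p : E ⟶ N} {f : M ⟶ N} (S : Square p f)

/-- The locally indexed category of computations. -/
abbrev lind : LInd.{v, u} := LInd.mk S.val.carrier S.comp

/-- The locally indexed category of values. -/
abbrev vl : LInd.{v, u} := DistCat.self S.val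

/-- The first projection on computations. -/
abbrev gl : S.lind ⟶ E.lind := @LInd.Mor.mk S.lind E.lind S.g.functor S.g.presProd S.G

/-- The second projection on computations. -/
abbrev ql : S.lind ⟶ M.lind := @LInd.Mor.mk S.lind M.lind S.q.functor S.q.presProd S.Q

/-- The first projection on values. -/
abbrev sg : S.vl ⟶ DistCat.self E.val := DistCat.selfMap S.g

/-- The second projection on values. -/
abbrev sq : S.vl ⟶ DistCat.self M.val := DistCat.selfMap S.q

/-- The square consists of strict pullbacks. -/
structure IsPb : Prop where
  comp : LInd.IsFibPb S.gl S.ql p.lind f.lind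
  val : LInd.IsFibPb S.sg S.sq p.sf f.sf

/-- The left adjoint of `E`, restricted along the first projection. -/
def leftE : IdxFunctor S.vl.fib (E.comp.changeBase S.g.functor) where
  obj A := E.F.obj (S.sg.obj A)
  map k := E.F.map (S.sg.map k)
  map_id c A := (congrArg E.F.map (S.sg.map_id c A)).trans (E.F.map_id _ _)
  map_comp k l := (congrArg E.F.map (S.sg.map_comp k l)).trans (E.F.map_comp _ _)
  map_reind ρ _ _ k := (congrArg E.F.map (S.sg.map_reind ρ k)).trans (E.F.map_reind _ _)

/-- The left adjoint of `M`, restricted along the second projection. -/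
def leftM : IdxFunctor S.vl.fib (M.comp.changeBase S.q.functor) where
  obj A := M.F.obj (S.sq.obj A)
  map k := M.F.map (S.sq.map k)
  map_id c A := (congrArg M.F.map (S.sq.map_id c A)).trans (M.F.map_id _ _)
  map_comp k l := (congrArg M.F.map (S.sq.map_comp k l)).trans (M.F.map_comp _ _)
  map_reind ρ _ _ k := (congrArg M.F.map (S.sq.map_reind ρ k)).trans (M.F.map_reind _ _)

/-- The right adjoint of `E`, restricted along the first projection. -/
def rightE : IdxFunctor S.comp (E.vfib.changeBase S.g.functor) where
  obj A := E.U.obj (S.gl.obj A)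
  map k := E.U.map (S.gl.map k)
  map_id c A := (congrArg E.U.map (S.gl.map_id c A)).trans (E.U.map_id _ _)
  map_comp k l := (congrArg E.U.map (S.gl.map_comp k l)).trans (E.U.map_comp _ _)
  map_reind ρ _ _ k := (congrArg E.U.map (S.gl.map_reind ρ k)).trans (E.U.map_reind _ _)

/-- The right adjoint of `M`, restricted along the second projection. -/
def rightM : IdxFunctor S.comp (M.vfib.changeBase S.q.functor) where
  obj A := M.U.obj (S.ql.obj A)
  map k := M.U.map (S.ql.map k)
  map_id c A := (congrArg M.U.map (S.ql.map_id c A)).trans (M.U.map_id _ _)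
  map_comp k l := (congrArg M.U.map (S.ql.map_comp k l)).trans (M.U.map_comp _ _)
  map_reind ρ _ _ k := (congrArg M.U.map (S.ql.map_reind ρ k)).trans (M.U.map_reind _ _)

/-- Lifts of the two adjoints to a strict pullback square along a strict 1-cell. -/
structure Lifts where
  isPb : S.IsPb
  strict : p.IsStrict
  left : LInd.FunctorLift S.gl S.ql p.lind f.lind S.leftE S.leftM fun A => f.a (S.sq.obj A)
  right : LInd.FunctorLift S.sg S.sq p.sf f.sf S.rightE S.rightM fun B => f.b (S.ql.obj B)

/-- Strictness of `p` puts the adjoints of `E` exactly over the codomains of the components of `α`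
and `β`, so that cartesian lifts into them make sense; naturality of `α` and `β` makes the resulting
assignments functorial. -/
lemma exists_lifts (hS : S.IsPb) (hp : p.IsStrict) (h₁ : LInd.HasLifts p.lind)
    (h₂ : LInd.HasLifts p.sf) : Nonempty S.Lifts := by
  have obv : ∀ A, p.sf.obj (S.sg.obj A) = f.sf.obj (S.sq.obj A) := LInd.Mor.congr_obj hS.val.w
  have obc : ∀ A, p.lind.obj (S.gl.obj A) = f.lind.obj (S.ql.obj A) :=
    LInd.Mor.congr_obj hS.comp.w
  have bov : ∀ d, p.h.functor.obj (S.g.functor.obj d) = f.h.functor.obj (S.q.functor.obj d) :=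
    LInd.Mor.congr_base_obj hS.val.w
  obtain ⟨L⟩ : Nonempty (LInd.FunctorLift S.gl S.ql p.lind f.lind S.leftE S.leftM
      fun A => f.a (S.sq.obj A)) := by
    refine hS.comp.exists_functorLift h₁
      (fun A => (hp.left_obj (S.sg.obj A)).trans (congrArg N.F.obj (obv A)))
      fun {d A B} k => ?_
    exact ⟨N.F.map (f.sf.map (S.sq.map k)),
      (N.F.map_heq (bov d).symm (obv A).symm (obv B).symm
        (LInd.Mor.congr_map_of_sq hS.val.w k).symm).trans (hp.left_map (S.sg.map k)).symm,
      f.a_nat (S.sq.map k)⟩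
  obtain ⟨R⟩ : Nonempty (LInd.FunctorLift S.sg S.sq p.sf f.sf S.rightE S.rightM
      fun B => f.b (S.ql.obj B)) := by
    refine hS.val.exists_functorLift h₂
      (fun A => (hp.right_obj (S.gl.obj A)).trans (congrArg N.U.obj (obc A)))
      fun {d A B} k => ?_
    exact ⟨N.U.map (f.lind.map (S.ql.map k)),
      (N.U.map_heq (bov d).symm (obc A).symm (obc B).symm
        (LInd.Mor.congr_map_of_sq hS.comp.w k).symm).trans (hp.right_map (S.gl.map k)).symm,
      f.b_nat (S.ql.map k)⟩
  exact ⟨⟨hS, hp, L, R⟩⟩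

end Square

end Model

/-- Restricting a naturality square over `c` to the terminal object. -/
lemma IdxCat.comp_eq_of_toUnit {C : Type u} [Category.{v} C] [CartesianMonoidalCategory C]
    {𝒞 : IdxCat.{w} C} {c : C} {A B A' B' : 𝒞.Obj} {x : 𝒞.Hom c A B} {y : 𝒞.Hom c A' B'}
    {a : 𝒞.Hom (𝟙_ C) A A'} {b : 𝒞.Hom (𝟙_ C) B B'} (ρ : 𝟙_ C ⟶ c)
    (h : 𝒞.comp x (𝒞.reind (toUnit _) b) = 𝒞.comp (𝒞.reind (toUnit _) a) y) :
    𝒞.comp (𝒞.reind ρ x) b = 𝒞.comp a (𝒞.reind ρ y) := by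
  have h := congrArg (𝒞.reind ρ) h
  rwa [IdxCat.reind_compm, IdxCat.reind_compm, IdxCat.reind_toUnit, IdxCat.reind_toUnit,
    IdxCat.reind_toUnit_unit, IdxCat.reind_toUnit_unit] at h

/-- Inverting the vertical sides of a naturality square; used to see that the inverses of the lifts
of `α` form a natural family. -/
lemma IdxCat.comp_inv_eq {C : Type u} [Category.{v} C] [CartesianMonoidalCategory C]
    {𝒞 : IdxCat.{w} C} {c : C} {A B A' B' : 𝒞.Obj} {x : 𝒞.Hom c A B} {y : 𝒞.Hom c A' B'}
    {a : 𝒞.Hom (𝟙_ C) A A'} {b : 𝒞.Hom (𝟙_ C) B B'} {a' : 𝒞.Hom (𝟙_ C) A' A}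
    {b' : 𝒞.Hom (𝟙_ C) B' B} (ha : 𝒞.comp a' a = 𝒞.id _ _) (hb : 𝒞.comp b b' = 𝒞.id _ _)
    (h : 𝒞.comp x (𝒞.reind (toUnit _) b) = 𝒞.comp (𝒞.reind (toUnit _) a) y) :
    𝒞.comp y (𝒞.reind (toUnit _) b') = 𝒞.comp (𝒞.reind (toUnit _) a') x := by
  have h₁ := congrArg (𝒞.reind (toUnit c)) ha
  have h₂ := congrArg (𝒞.reind (toUnit c)) hb
  rw [IdxCat.reind_compm, IdxCat.reind_idm] at h₁ h₂
  have h := congrArg (fun t => 𝒞.comp (𝒞.reind (toUnit c) a')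
    (𝒞.comp t (𝒞.reind (toUnit c) b'))) h
  rw [IdxCat.assoc, IdxCat.assoc, h₂, IdxCat.comp_id, ← IdxCat.assoc, h₁, IdxCat.id_comp] at h
  exact h.symm

/-! ### The lifted unit and counit -/

namespace Model

namespace Square

namespace Lifts

variable {E M N : Model.{v, u}} {p : E ⟶ N} {f : M ⟶ N} {S : Square p f} (L : S.Lifts)

lemma obj_w (L : S.Lifts) (A : S.vl.fib.Obj) : p.sf.obj (S.sg.obj A) = f.sf.obj (S.sq.obj A) :=
  LInd.Mor.congr_obj L.isPb.val.w A

lemma obj_wl (L : S.Lifts) (A : S.lind.fib.Obj) : p.lind.obj (S.gl.obj A) = f.lind.obj (S.ql.obj A) :=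
  LInd.Mor.congr_obj L.isPb.comp.w A

/-- The lifted left adjoint. -/
abbrev F : IdxFunctor S.vl.fib S.comp := L.left.R

/-- The lifted right adjoint. -/
abbrev U : IdxFunctor S.comp S.vl.fib := L.right.R

lemma ql_F (A : S.vl.fib.Obj) : S.ql.obj (L.F.obj A) = M.F.obj (S.sq.obj A) := L.left.obj_snd A

lemma sq_U (A : S.lind.fib.Obj) : S.sq.obj (L.U.obj A) = M.U.obj (S.ql.obj A) :=
  L.right.obj_snd A

lemma ql_F_map {c : S.val.carrier} {A B : S.vl.fib.Obj} (k : S.vl.fib.Hom c A B) :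
    HEq (S.ql.map (L.F.map k)) (M.F.map (S.sq.map k)) := L.left.map_snd k

lemma sq_U_map {c : S.val.carrier} {A B : S.lind.fib.Obj} (k : S.lind.fib.Hom c A B) :
    HEq (S.sq.map (L.U.map k)) (M.U.map (S.ql.map k)) := L.right.map_snd k

lemma ql_F_map₁ {A B : S.vl.fib.Obj} (k : S.vl.fib.Hom (𝟙_ S.val.carrier) A B) :
    HEq (S.ql.map₁ (L.F.map k)) (M.F.map (S.sq.map₁ k)) := by
  rw [LInd.Mor.map₁, LInd.Mor.map₁, M.F.map_reind]
  refine HEq.trans (IdxCat.heq_reind rfl rfl (L.ql_F A) (L.ql_F B) HEq.rfl (L.ql_F_map k)) ?_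
  exact heq_of_eq (congrArg (fun t => M.comp.reind t (M.F.map (S.sq.map k)))
    (LInd.Mor.hom_unit_ext S.sq _ _))

lemma sq_U_map₁ {A B : S.lind.fib.Obj} (k : S.lind.fib.Hom (𝟙_ S.val.carrier) A B) :
    HEq (S.sq.map₁ (L.U.map k)) (M.U.map (S.ql.map₁ k)) := by
  rw [LInd.Mor.map₁, LInd.Mor.map₁, M.U.map_reind]
  refine HEq.trans (IdxCat.heq_reind rfl rfl (L.sq_U A) (L.sq_U B) HEq.rfl (L.sq_U_map k)) ?_
  exact heq_of_eq (congrArg (fun t => M.vfib.reind t (M.U.map (S.ql.map k)))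
    (LInd.Mor.hom_unit_ext S.sq _ _))

/-- The lift of `α`. -/
def ga (A : S.vl.fib.Obj) : E.lind.fib.Hom (𝟙_ E.val.carrier) (S.gl.obj (L.F.obj A))
    (E.F.obj (S.sg.obj A)) := L.left.φ A

/-- The lift of `β`. -/
def gb (B : S.lind.fib.Obj) : E.vfib.Hom (𝟙_ E.val.carrier) (S.sg.obj (L.U.obj B))
    (E.U.obj (S.gl.obj B)) := L.right.φ B

lemma p_ga (A : S.vl.fib.Obj) : HEq (p.lind.map₁ (L.ga A)) (f.a (S.sq.obj A)) := L.left.p_φ A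

lemma p_gb (B : S.lind.fib.Obj) : HEq (p.sf.map₁ (L.gb B)) (f.b (S.ql.obj B)) := L.right.p_φ B

lemma ga_nat {c : S.val.carrier} {A B : S.vl.fib.Obj} (k : S.vl.fib.Hom c A B) :
    E.lind.fib.comp (S.gl.map (L.F.map k)) (E.lind.fib.reind (toUnit _) (L.ga B)) =
      E.lind.fib.comp (E.lind.fib.reind (toUnit _) (L.ga A)) (E.F.map (S.sg.map k)) :=
  L.left.natural k

lemma gb_nat {c : S.val.carrier} {A B : S.lind.fib.Obj} (k : S.lind.fib.Hom c A B) :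
    E.vfib.comp (S.sg.map (L.U.map k)) (E.vfib.reind (toUnit _) (L.gb B)) =
      E.vfib.comp (E.vfib.reind (toUnit _) (L.gb A)) (E.U.map (S.gl.map k)) :=
  L.right.natural k

lemma ga_nat₁ {A B : S.vl.fib.Obj} (k : S.vl.fib.Hom (𝟙_ S.val.carrier) A B) :
    E.lind.fib.comp (S.gl.map₁ (L.F.map k)) (L.ga B) =
      E.lind.fib.comp (L.ga A) (E.F.map (S.sg.map₁ k)) := by
  refine (IdxCat.comp_eq_of_toUnit (S.gl.unitIso) (L.ga_nat k)).trans ?_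
  refine congrArg (fun t => E.lind.fib.comp (L.ga A) t) ?_
  exact (E.F.map_reind _ _).symm

lemma gb_nat₁ {A B : S.lind.fib.Obj} (k : S.lind.fib.Hom (𝟙_ S.val.carrier) A B) :
    E.vfib.comp (S.sg.map₁ (L.U.map k)) (L.gb B) =
      E.vfib.comp (L.gb A) (E.U.map (S.gl.map₁ k)) := by
  refine (IdxCat.comp_eq_of_toUnit (S.sg.unitIso) (L.gb_nat k)).trans ?_
  refine congrArg (fun t => E.vfib.comp (L.gb A) t) ?_
  exact (E.U.map_reind _ _).symm

lemma left_hom_ext {d : S.val.carrier} {Z : S.lind.fib.Obj} {A : S.vl.fib.Obj}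
    {t t' : S.lind.fib.Hom d Z (L.F.obj A)} (h : S.ql.map t = S.ql.map t')
    (h' : E.lind.fib.comp (S.gl.map t) (E.lind.fib.reind (toUnit _) (L.ga A)) =
      E.lind.fib.comp (S.gl.map t') (E.lind.fib.reind (toUnit _) (L.ga A))) : t = t' :=
  (L.left.at A).hom_ext L.isPb.comp h h'

lemma left_hom_ext₁ {Z : S.lind.fib.Obj} {A : S.vl.fib.Obj}
    {t t' : S.lind.fib.Hom (𝟙_ S.val.carrier) Z (L.F.obj A)} (h : S.ql.map₁ t = S.ql.map₁ t')
    (h' : E.lind.fib.comp (S.gl.map₁ t) (L.ga A) = E.lind.fib.comp (S.gl.map₁ t') (L.ga A)) :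
    t = t' :=
  (L.left.at A).hom_ext₁ L.isPb.comp h h'

lemma right_hom_ext {d : S.val.carrier} {Z : S.vl.fib.Obj} {A : S.lind.fib.Obj}
    {t t' : S.vl.fib.Hom d Z (L.U.obj A)} (h : S.sq.map t = S.sq.map t')
    (h' : E.vfib.comp (S.sg.map t) (E.vfib.reind (toUnit _) (L.gb A)) =
      E.vfib.comp (S.sg.map t') (E.vfib.reind (toUnit _) (L.gb A))) : t = t' :=
  (L.right.at A).hom_ext L.isPb.val h h'

lemma right_hom_ext₁ {Z : S.vl.fib.Obj} {A : S.lind.fib.Obj}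
    {t t' : S.vl.fib.Hom (𝟙_ S.val.carrier) Z (L.U.obj A)} (h : S.sq.map₁ t = S.sq.map₁ t')
    (h' : E.vfib.comp (S.sg.map₁ t) (L.gb A) = E.vfib.comp (S.sg.map₁ t') (L.gb A)) : t = t' :=
  (L.right.at A).hom_ext₁ L.isPb.val h h'

lemma left_exists_hom₁ {Z : S.lind.fib.Obj} {A : S.vl.fib.Obj} {a : M.lind.fib.Obj}
    (ha : S.ql.obj Z = a) (r : M.lind.fib.Hom (𝟙_ M.val.carrier) a (M.F.obj (S.sq.obj A)))
    (l : E.lind.fib.Hom (𝟙_ E.val.carrier) (S.gl.obj Z) (E.F.obj (S.sg.obj A)))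
    (h : HEq (N.lind.fib.comp (f.lind.map₁ r) (f.a (S.sq.obj A))) (p.lind.map₁ l)) :
    ∃ t : S.lind.fib.Hom (𝟙_ S.val.carrier) Z (L.F.obj A), HEq (S.ql.map₁ t) r ∧
      E.lind.fib.comp (S.gl.map₁ t) (L.ga A) = l :=
  (L.left.at A).exists_hom₁ L.isPb.comp
    ((L.strict.left_obj _).trans (congrArg N.F.obj (L.obj_w A))) ha r l h

lemma right_exists_hom₁ {Z : S.vl.fib.Obj} {B : S.lind.fib.Obj} {a : M.vfib.Obj}
    (ha : S.sq.obj Z = a) (r : M.vfib.Hom (𝟙_ M.val.carrier) a (M.U.obj (S.ql.obj B)))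
    (l : E.vfib.Hom (𝟙_ E.val.carrier) (S.sg.obj Z) (E.U.obj (S.gl.obj B)))
    (h : HEq (N.vfib.comp (f.sf.map₁ r) (f.b (S.ql.obj B))) (p.sf.map₁ l)) :
    ∃ t : S.vl.fib.Hom (𝟙_ S.val.carrier) Z (L.U.obj B), HEq (S.sq.map₁ t) r ∧
      E.vfib.comp (S.sg.map₁ t) (L.gb B) = l :=
  (L.right.at B).exists_hom₁ L.isPb.val
    ((L.strict.right_obj _).trans (congrArg N.U.obj (L.obj_wl B))) ha r l h

lemma p_gl_F (A : S.vl.fib.Obj) :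
    p.lind.obj (S.gl.obj (L.F.obj A)) = f.lind.obj (M.F.obj (S.sq.obj A)) :=
  (L.obj_wl _).trans (congrArg f.lind.obj (L.ql_F A))

lemma p_F_sg (L : S.Lifts) (A : S.vl.fib.Obj) :
    p.lind.obj (E.F.obj (S.sg.obj A)) = N.F.obj (f.sf.obj (S.sq.obj A)) :=
  (L.strict.left_obj _).trans (congrArg N.F.obj (L.obj_w A))

/-- `α` is invertible and `ga` is a cartesian map over one of its components. -/
lemma exists_ga_inv (A : S.vl.fib.Obj) : ∃ j : E.lind.fib.Hom (𝟙_ E.val.carrier)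
    (E.F.obj (S.sg.obj A)) (S.gl.obj (L.F.obj A)),
    HEq (p.lind.map₁ j) (f.aInv (S.sq.obj A)) ∧ E.lind.fib.comp (L.ga A) j = E.lind.fib.id _ _ ∧
      E.lind.fib.comp j (L.ga A) = E.lind.fib.id _ _ := by
  obtain ⟨m, h₁, h₂, h₃⟩ := IdxCat.exists_inv_of_heq (L.p_gl_F A) (L.p_F_sg A) (L.p_ga A)
    (f.a_aInv _) (f.aInv_a _)
  obtain ⟨j, h₄, h₅, h₆⟩ := LInd.IsCart.exists_inv (L.left.isCart A) h₂ h₃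
  exact ⟨j, (heq_of_eq h₄).trans h₁, h₅, h₆⟩

/-- The inverse of the lift of `α`. -/
def gaInv (A : S.vl.fib.Obj) : E.lind.fib.Hom (𝟙_ E.val.carrier) (E.F.obj (S.sg.obj A))
    (S.gl.obj (L.F.obj A)) := (L.exists_ga_inv A).choose

lemma p_gaInv (A : S.vl.fib.Obj) : HEq (p.lind.map₁ (L.gaInv A)) (f.aInv (S.sq.obj A)) :=
  (L.exists_ga_inv A).choose_spec.1

lemma ga_gaInv (A : S.vl.fib.Obj) :
    E.lind.fib.comp (L.ga A) (L.gaInv A) = E.lind.fib.id _ _ :=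
  (L.exists_ga_inv A).choose_spec.2.1

lemma gaInv_ga (A : S.vl.fib.Obj) :
    E.lind.fib.comp (L.gaInv A) (L.ga A) = E.lind.fib.id _ _ :=
  (L.exists_ga_inv A).choose_spec.2.2

lemma gaInv_nat {c : S.val.carrier} {A B : S.vl.fib.Obj} (k : S.vl.fib.Hom c A B) :
    E.lind.fib.comp (E.F.map (S.sg.map k)) (E.lind.fib.reind (toUnit _) (L.gaInv B)) =
      E.lind.fib.comp (E.lind.fib.reind (toUnit _) (L.gaInv A)) (S.gl.map (L.F.map k)) := by
  exact IdxCat.comp_inv_eq (L.gaInv_ga A) (L.ga_gaInv B) (L.ga_nat k)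

/-- A map into the lifted right adjoint is a map in `M` together with a map in `E` into the codomain
of `gb`. The unit of `E` reaches that codomain only after composition with `gaInv`; agreement in `N`
is `unit_aInv`. -/
lemma exists_unit (A : S.vl.fib.Obj) : ∃ t : S.vl.fib.Hom (𝟙_ S.val.carrier) A
    (L.U.obj (L.F.obj A)), HEq (S.sq.map₁ t) (M.η (S.sq.obj A)) ∧
      E.vfib.comp (S.sg.map₁ t) (L.gb (L.F.obj A)) =
        E.vfib.comp (E.η (S.sg.obj A)) (E.U.map (L.gaInv A)) := by
  obtain ⟨r, hr⟩ := LInd.exists_heq_hom (𝒞 := M.vfib) rfl rfl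
    (congrArg M.U.obj (L.ql_F A)).symm (M.η (S.sq.obj A))
  obtain ⟨t, h₁, h₂⟩ := L.right_exists_hom₁ rfl r
    (E.vfib.comp (E.η (S.sg.obj A)) (E.U.map (L.gaInv A))) (by
      rw [LInd.Mor.map₁_comp]
      refine HEq.trans (IdxCat.heq_comp rfl rfl (congrArg (fun t => f.sf.obj (M.U.obj t)) (L.ql_F A))
        (congrArg (fun t => N.U.obj (f.lind.obj t)) (L.ql_F A))
        (f.sf.map₁_heq rfl (congrArg M.U.obj (L.ql_F A)) hr) (f.b_heq (L.ql_F A))) ?_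
      refine (heq_of_eq (f.unit_aInv (S.sq.obj A)).symm).trans ?_
      refine HEq.symm (IdxCat.heq_comp rfl (L.obj_w A)
        ((L.strict.right_obj _).trans (congrArg N.U.obj (L.p_F_sg A)))
        ((L.strict.right_obj _).trans (congrArg N.U.obj (L.p_gl_F A)))
        ((L.strict.map₁_η _).trans (N.η_heq (L.obj_w A))) ?_)
      exact (L.strict.right_map₁ _).trans (N.U.map_heq rfl (L.p_F_sg A) (L.p_gl_F A) (L.p_gaInv A)))
  exact ⟨t, h₁.trans hr, h₂⟩

/-- The codomain `B` is arbitrary, so no lifting is involved: two maps are glued, and their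
agreement in `N` is the counit equation of `f`. -/
lemma exists_counit (B : S.lind.fib.Obj) : ∃ t : S.lind.fib.Hom (𝟙_ S.val.carrier)
    (L.F.obj (L.U.obj B)) B, HEq (S.ql.map₁ t) (M.θ (S.ql.obj B)) ∧
      S.gl.map₁ t = E.lind.fib.comp (L.ga (L.U.obj B))
        (E.lind.fib.comp (E.F.map (L.gb B)) (E.θ (S.gl.obj B))) := by
  have e₁ : S.ql.obj (L.F.obj (L.U.obj B)) = M.F.obj (M.U.obj (S.ql.obj B)) :=
    (L.ql_F _).trans (congrArg M.F.obj (L.sq_U B))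
  have e₂ : p.sf.obj (E.U.obj (S.gl.obj B)) = N.U.obj (f.lind.obj (S.ql.obj B)) :=
    (L.strict.right_obj _).trans (congrArg N.U.obj (L.obj_wl B))
  obtain ⟨r, hr⟩ := LInd.exists_heq_hom (𝒞 := M.comp) rfl e₁.symm rfl (M.θ (S.ql.obj B))
  obtain ⟨t, h₁, h₂⟩ := L.isPb.comp.hom₁ (E.lind.fib.comp (L.ga (L.U.obj B))
    (E.lind.fib.comp (E.F.map (L.gb B)) (E.θ (S.gl.obj B)))) r (by
      refine HEq.trans ?_ (f.lind.map₁_heq e₁ rfl hr).symm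
      rw [f.counit_app, LInd.Mor.map₁_comp, LInd.Mor.map₁_comp]
      have e₃ := congrArg (fun t => N.F.obj (f.sf.obj t)) (L.sq_U B)
      have e₄ := (L.strict.left_obj (E.U.obj (S.gl.obj B))).trans (congrArg N.F.obj e₂)
      refine IdxCat.heq_comp rfl ((L.p_gl_F _).trans (congrArg (fun t => f.lind.obj (M.F.obj t))
        (L.sq_U B))) ((L.p_F_sg _).trans e₃) (L.obj_wl B)
        ((L.p_ga _).trans (f.a_heq (L.sq_U B))) ?_
      refine IdxCat.heq_comp rfl ((L.p_F_sg _).trans e₃) e₄ (L.obj_wl B) ?_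
        ((L.strict.map₁_θ _).trans (N.θ_heq (L.obj_wl B)))
      exact (L.strict.left_map₁ _).trans (N.F.map_heq rfl ((L.obj_w _).trans
        (congrArg f.sf.obj (L.sq_U B))) e₂ (L.p_gb B)))
  exact ⟨t, (heq_of_eq h₂).trans hr, h₁⟩

/-- The lifted unit. -/
def η (A : S.vl.fib.Obj) : S.vl.fib.Hom (𝟙_ S.val.carrier) A (L.U.obj (L.F.obj A)) :=
  (L.exists_unit A).choose

lemma sq_η (A : S.vl.fib.Obj) : HEq (S.sq.map₁ (L.η A)) (M.η (S.sq.obj A)) :=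
  (L.exists_unit A).choose_spec.1

lemma sg_η (A : S.vl.fib.Obj) : E.vfib.comp (S.sg.map₁ (L.η A)) (L.gb (L.F.obj A)) =
    E.vfib.comp (E.η (S.sg.obj A)) (E.U.map (L.gaInv A)) := (L.exists_unit A).choose_spec.2

/-- The lifted counit. -/
def θ (B : S.lind.fib.Obj) : S.lind.fib.Hom (𝟙_ S.val.carrier) (L.F.obj (L.U.obj B)) B :=
  (L.exists_counit B).choose

lemma ql_θ (B : S.lind.fib.Obj) : HEq (S.ql.map₁ (L.θ B)) (M.θ (S.ql.obj B)) :=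
  (L.exists_counit B).choose_spec.1

lemma gl_θ (B : S.lind.fib.Obj) : S.gl.map₁ (L.θ B) = E.lind.fib.comp (L.ga (L.U.obj B))
    (E.lind.fib.comp (E.F.map (L.gb B)) (E.θ (S.gl.obj B))) := (L.exists_counit B).choose_spec.2

end Lifts

end Square

end Model

/-! ### Naturality and triangle identities of the lifted adjunction -/

namespace IdxAdj

variable {C : Type (max u v)} [Category.{v} C] [CartesianMonoidalCategory C]
  {𝒞 𝒟 : IdxCat.{max u v} C} {F : IdxFunctor 𝒞 𝒟} {U : IdxFunctor 𝒟 𝒞}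

/-- Naturality of a map `n` that `b` and `i` relate to the unit. -/
lemma unit_natural (T : IdxAdj F U) {c : C} {A B XA XB : 𝒞.Obj} {YA YB : 𝒟.Obj} {k : 𝒞.Hom c A B}
    {nA : 𝒞.Hom (𝟙_ C) A XA} {nB : 𝒞.Hom (𝟙_ C) B XB} {bA : 𝒞.Hom (𝟙_ C) XA (U.obj YA)}
    {bB : 𝒞.Hom (𝟙_ C) XB (U.obj YB)} {iA : 𝒟.Hom (𝟙_ C) (F.obj A) YA}
    {iB : 𝒟.Hom (𝟙_ C) (F.obj B) YB} {m : 𝒞.Hom c XA XB} {l : 𝒟.Hom c YA YB}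
    (hA : 𝒞.comp nA bA = 𝒞.comp (T.η A) (U.map iA))
    (hB : 𝒞.comp nB bB = 𝒞.comp (T.η B) (U.map iB))
    (hm : 𝒞.comp m (𝒞.reind (toUnit c) bB) = 𝒞.comp (𝒞.reind (toUnit c) bA) (U.map l))
    (hl : 𝒟.comp (F.map k) (𝒟.reind (toUnit c) iB) = 𝒟.comp (𝒟.reind (toUnit c) iA) l) :
    𝒞.comp (𝒞.comp k (𝒞.reind (toUnit c) nB)) (𝒞.reind (toUnit c) bB) =
      𝒞.comp (𝒞.comp (𝒞.reind (toUnit c) nA) m) (𝒞.reind (toUnit c) bB) := by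
  rw [𝒞.assoc, 𝒞.assoc, hm, ← 𝒞.reind_compm, hB, ← 𝒞.assoc, ← 𝒞.reind_compm, hA, 𝒞.reind_compm,
    𝒞.reind_compm, ← 𝒞.assoc, T.η_nat, ← U.map_reind, ← U.map_reind, 𝒞.assoc, 𝒞.assoc,
    ← U.map_comp, ← U.map_comp, hl]

/-- Naturality of a map obtained by transposing `b` and composing with `a`. -/
lemma counit_natural (T : IdxAdj F U) {c : C} {XA XB : 𝒞.Obj} {YA YB ZA ZB : 𝒟.Obj}
    {x : 𝒟.Hom c ZA ZB} {aA : 𝒟.Hom (𝟙_ C) ZA (F.obj XA)} {aB : 𝒟.Hom (𝟙_ C) ZB (F.obj XB)}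
    {bA : 𝒞.Hom (𝟙_ C) XA (U.obj YA)} {bB : 𝒞.Hom (𝟙_ C) XB (U.obj YB)} {m : 𝒞.Hom c XA XB}
    {l : 𝒟.Hom c YA YB}
    (hx : 𝒟.comp x (𝒟.reind (toUnit c) aB) = 𝒟.comp (𝒟.reind (toUnit c) aA) (F.map m))
    (hm : 𝒞.comp m (𝒞.reind (toUnit c) bB) = 𝒞.comp (𝒞.reind (toUnit c) bA) (U.map l)) :
    𝒟.comp x (𝒟.reind (toUnit c) (𝒟.comp aB (𝒟.comp (F.map bB) (T.θ YB)))) =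
      𝒟.comp (𝒟.reind (toUnit c) (𝒟.comp aA (𝒟.comp (F.map bA) (T.θ YA)))) l := by
  rw [𝒟.reind_compm, 𝒟.reind_compm, 𝒟.reind_compm, 𝒟.reind_compm, ← 𝒟.assoc, hx, 𝒟.assoc, 𝒟.assoc,
    𝒟.assoc, ← T.θ_nat, ← 𝒟.assoc (F.map m), ← F.map_reind, ← F.map_reind, ← F.map_comp, hm,
    F.map_comp, 𝒟.assoc]

end IdxAdj

namespace Model

namespace Square

namespace Lifts

variable {E M N : Model.{v, u}} {p : E ⟶ N} {f : M ⟶ N} {S : Square p f} (L : S.Lifts)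

lemma ql_FU (B : S.lind.fib.Obj) :
    S.ql.obj (L.F.obj (L.U.obj B)) = M.F.obj (M.U.obj (S.ql.obj B)) :=
  (L.ql_F _).trans (congrArg M.F.obj (L.sq_U B))

lemma sq_UF (A : S.vl.fib.Obj) :
    S.sq.obj (L.U.obj (L.F.obj A)) = M.U.obj (M.F.obj (S.sq.obj A)) :=
  (L.sq_U _).trans (congrArg M.U.obj (L.ql_F A))

lemma sq_η_nat {c : S.val.carrier} {A B : S.vl.fib.Obj} (k : S.vl.fib.Hom c A B) :
    S.sq.map (S.vl.fib.comp k (S.vl.fib.reind (toUnit c) (L.η B))) =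
      S.sq.map (S.vl.fib.comp (S.vl.fib.reind (toUnit c) (L.η A)) (L.U.map (L.F.map k))) := by
  rw [LInd.Mor.map_comp, LInd.Mor.map_comp, LInd.Mor.map_reind_toUnit, LInd.Mor.map_reind_toUnit]
  refine eq_of_heq ((IdxCat.heq_comp rfl rfl rfl (L.sq_UF B) HEq.rfl
    (IdxCat.heq_reind_toUnit rfl rfl (L.sq_UF B) (L.sq_η B))).trans ?_)
  refine (heq_of_eq (M.idxAdj.η_nat (S.sq.map k))).trans (HEq.symm ?_)
  exact IdxCat.heq_comp rfl rfl (L.sq_UF A) (L.sq_UF B)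
    (IdxCat.heq_reind_toUnit rfl rfl (L.sq_UF A) (L.sq_η A))
    ((L.sq_U_map _).trans (M.U.map_heq rfl (L.ql_F A) (L.ql_F B) (L.ql_F_map k)))

/-- Maps into the lifted right adjoint are tested in `M`, where the unit of `M` is natural, and
after composing with `gb`, where `sg_η` reduces the claim to the unit of `E` and the naturality of
`gaInv`. -/
lemma η_nat {c : S.val.carrier} {A B : S.vl.fib.Obj} (k : S.vl.fib.Hom c A B) :
    S.vl.fib.comp k (S.vl.fib.reind (toUnit c) (L.η B)) =
      S.vl.fib.comp (S.vl.fib.reind (toUnit c) (L.η A)) (L.U.map (L.F.map k)) := by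
  refine L.right_hom_ext (L.sq_η_nat k) ?_
  rw [LInd.Mor.map_comp, LInd.Mor.map_comp, LInd.Mor.map_reind_toUnit, LInd.Mor.map_reind_toUnit]
  exact E.idxAdj.unit_natural (L.sg_η A) (L.sg_η B) (L.gb_nat _) (L.gaInv_nat k)

lemma ql_θ_nat {c : S.val.carrier} {A B : S.lind.fib.Obj} (k : S.lind.fib.Hom c A B) :
    S.ql.map (S.lind.fib.comp (L.F.map (L.U.map k)) (S.lind.fib.reind (toUnit c) (L.θ B))) =
      S.ql.map (S.lind.fib.comp (S.lind.fib.reind (toUnit c) (L.θ A)) k) := by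
  rw [LInd.Mor.map_comp, LInd.Mor.map_comp, LInd.Mor.map_reind_toUnit, LInd.Mor.map_reind_toUnit]
  refine eq_of_heq ((IdxCat.heq_comp rfl (L.ql_FU A) (L.ql_FU B) rfl
    ((L.ql_F_map _).trans (M.F.map_heq rfl (L.sq_U A) (L.sq_U B) (L.sq_U_map k)))
    (IdxCat.heq_reind_toUnit rfl (L.ql_FU B) rfl (L.ql_θ B))).trans ?_)
  refine (heq_of_eq (M.idxAdj.θ_nat (S.ql.map k))).trans (HEq.symm ?_)
  exact IdxCat.heq_comp rfl (L.ql_FU A) rfl rfl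
    (IdxCat.heq_reind_toUnit rfl (L.ql_FU A) rfl (L.ql_θ A)) HEq.rfl

lemma θ_nat {c : S.val.carrier} {A B : S.lind.fib.Obj} (k : S.lind.fib.Hom c A B) :
    S.lind.fib.comp (L.F.map (L.U.map k)) (S.lind.fib.reind (toUnit c) (L.θ B)) =
      S.lind.fib.comp (S.lind.fib.reind (toUnit c) (L.θ A)) k := by
  refine L.isPb.comp.hom_ext ?_ (L.ql_θ_nat k)
  rw [LInd.Mor.map_comp, LInd.Mor.map_comp, LInd.Mor.map_reind_toUnit, LInd.Mor.map_reind_toUnit,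
    L.gl_θ, L.gl_θ]
  exact E.idxAdj.counit_natural (L.ga_nat _) (L.gb_nat k)

lemma left_triangle (A : S.vl.fib.Obj) :
    S.lind.fib.comp (L.F.map (L.η A)) (L.θ (L.F.obj A)) = S.lind.fib.id _ _ := by
  refine L.left_hom_ext₁ ?_ ?_
  · rw [LInd.Mor.map₁_comp, LInd.Mor.map₁_id]
    refine eq_of_heq ((IdxCat.heq_comp rfl (L.ql_F A) ((L.ql_FU _).trans
      (congrArg (fun t => M.F.obj (M.U.obj t)) (L.ql_F A))) (L.ql_F A)
      ((L.ql_F_map₁ _).trans (M.F.map_heq rfl rfl (L.sq_UF A) (L.sq_η A)))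
      ((L.ql_θ _).trans (M.θ_heq (L.ql_F A)))).trans ?_)
    exact (heq_of_eq (M.idxAdj.left (S.sq.obj A))).trans (IdxCat.heq_id rfl (L.ql_F A).symm)
  -- Naturality of the counit of `E` and of `ga` brings one `ga` to the front. What remains is a
  -- left triangle of `E`, because `η`, `gb` and the image of `ga` compose to the unit of `E`.
  · rw [LInd.Mor.map₁_comp, LInd.Mor.map₁_id, IdxCat.id_comp, L.gl_θ, IdxCat.assoc, IdxCat.assoc,
      IdxCat.assoc, ← E.idxAdj.θ_nat₁, ← IdxCat.assoc, L.ga_nat₁, IdxCat.assoc]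
    refine (congrArg (E.comp.comp (L.ga A)) ?_).trans (E.comp.comp_id _)
    rw [← IdxCat.assoc, ← IdxCat.assoc, ← E.F.map_comp, L.sg_η, ← E.F.map_comp, IdxCat.assoc,
      ← E.U.map_comp, L.gaInv_ga, E.U.map_id, IdxCat.comp_id, E.idxAdj.left]

lemma right_triangle (B : S.lind.fib.Obj) :
    S.vl.fib.comp (L.η (L.U.obj B)) (L.U.map (L.θ B)) = S.vl.fib.id _ _ := by
  refine L.right_hom_ext₁ ?_ ?_
  · rw [LInd.Mor.map₁_comp, LInd.Mor.map₁_id]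
    refine eq_of_heq ((IdxCat.heq_comp rfl (L.sq_U B) ((L.sq_UF _).trans
      (congrArg (fun t => M.U.obj (M.F.obj t)) (L.sq_U B))) (L.sq_U B)
      ((L.sq_η _).trans (M.η_heq (L.sq_U B)))
      ((L.sq_U_map₁ _).trans (M.U.map_heq rfl (L.ql_FU B) rfl (L.ql_θ B)))).trans ?_)
    exact (heq_of_eq (M.idxAdj.right (S.ql.obj B))).trans (IdxCat.heq_id rfl (L.sq_U B).symm)
  -- Here `gaInv` from the unit cancels `ga` from the counit; naturality of the unit of `E` then
  -- moves `gb` in front of a right triangle.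
  · rw [LInd.Mor.map₁_comp, LInd.Mor.map₁_id, IdxCat.id_comp, IdxCat.assoc, L.gb_nat₁,
      ← IdxCat.assoc, L.sg_η, IdxCat.assoc, ← E.U.map_comp, L.gl_θ, ← IdxCat.assoc, L.gaInv_ga,
      IdxCat.id_comp, E.U.map_comp, ← IdxCat.assoc, ← E.idxAdj.η_nat₁, IdxCat.assoc,
      E.idxAdj.right, IdxCat.comp_id]

/-- The lifted adjunction. -/
def idxAdj : IdxAdj L.F L.U where
  η := L.η
  η_nat k := L.η_nat k
  θ := L.θ
  θ_nat k := L.θ_nat k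
  left := L.left_triangle
  right := L.right_triangle

end Lifts

end Square

end Model

namespace IdxCat

lemma bijective_reind {C : Type u} [Category.{v} C] {𝒞 : IdxCat.{w} C} {c d : C}
    (ρ : d ⟶ c) [IsIso ρ] (A B : 𝒞.Obj) :
    Function.Bijective fun k : 𝒞.Hom c A B => 𝒞.reind ρ k := by
  refine Function.bijective_iff_has_inverse.2 ⟨fun k => 𝒞.reind (inv ρ) k, fun k => ?_, fun k => ?_⟩
  · change 𝒞.reind (inv ρ) (𝒞.reind ρ k) = k
    rw [𝒞.reind_reind, IsIso.inv_hom_id, 𝒞.reind_id]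
  · change 𝒞.reind ρ (𝒞.reind (inv ρ) k) = k
    rw [𝒞.reind_reind, IsIso.hom_inv_id, 𝒞.reind_id]

variable {C : Type u} [Category.{v} C] [CartesianMonoidalCategory C]

/-! ### Product cones -/

/-- A product cone in a locally indexed category. -/
def IsProdCone (𝒞 : IdxCat.{w} C) {n : ℕ} {P : 𝒞.Obj} {B : Fin n → 𝒞.Obj}
    (π : ∀ i, 𝒞.Hom (𝟙_ C) P (B i)) : Prop :=
  ∀ (c : C) (A : 𝒞.Obj), Function.Bijective fun (k : 𝒞.Hom c A P) (i : Fin n) =>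
    𝒞.comp k (𝒞.reind (toUnit c) (π i))

variable {𝒞 : IdxCat.{w} C} {n : ℕ} {P P' : 𝒞.Obj} {B B' : Fin n → 𝒞.Obj}
  {π : ∀ i, 𝒞.Hom (𝟙_ C) P (B i)} {π' : ∀ i, 𝒞.Hom (𝟙_ C) P' (B' i)}

lemma IsProdCone.of_heq (h : 𝒞.IsProdCone π) (hP : P = P') (hB : ∀ i, B i = B' i)
    (hπ : ∀ i, HEq (π i) (π' i)) : 𝒞.IsProdCone π' := by
  subst hP
  obtain rfl : B = B' := funext hB
  obtain rfl : π = π' := funext fun i => eq_of_heq (hπ i)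
  exact h

lemma IsProdCone.hom_ext (h : 𝒞.IsProdCone π) {c : C} {A : 𝒞.Obj} {k l : 𝒞.Hom c A P}
    (hkl : ∀ i, 𝒞.comp k (𝒞.reind (toUnit c) (π i)) = 𝒞.comp l (𝒞.reind (toUnit c) (π i))) :
    k = l :=
  (h c A).injective (funext hkl)

lemma IsProdCone.exists_lift (h : 𝒞.IsProdCone π) {c : C} {A : 𝒞.Obj}
    (t : ∀ i, 𝒞.Hom c A (B i)) :
    ∃ k : 𝒞.Hom c A P, ∀ i, 𝒞.comp k (𝒞.reind (toUnit c) (π i)) = t i := by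
  obtain ⟨k, hk⟩ := (h c A).surjective t
  exact ⟨k, fun i => congrFun hk i⟩

lemma IsProdCone.of_iso (h : 𝒞.IsProdCone π) {φ : 𝒞.Hom (𝟙_ C) P' P} {ψ : 𝒞.Hom (𝟙_ C) P P'}
    (h₁ : 𝒞.comp φ ψ = 𝒞.id _ _) (h₂ : 𝒞.comp ψ φ = 𝒞.id _ _) :
    𝒞.IsProdCone fun i => 𝒞.comp φ (π i) := by
  have e₁ : ∀ c, 𝒞.comp (𝒞.reind (toUnit c) φ) (𝒞.reind (toUnit c) ψ) = 𝒞.id _ _ := fun c => by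
    rw [← 𝒞.reind_compm, h₁, 𝒞.reind_idm]
  have e₂ : ∀ c, 𝒞.comp (𝒞.reind (toUnit c) ψ) (𝒞.reind (toUnit c) φ) = 𝒞.id _ _ := fun c => by
    rw [← 𝒞.reind_compm, h₂, 𝒞.reind_idm]
  refine fun c A => ⟨fun k l hkl => ?_, fun t => ?_⟩
  · have : 𝒞.comp k (𝒞.reind (toUnit c) φ) = 𝒞.comp l (𝒞.reind (toUnit c) φ) := by
      refine h.hom_ext fun i => ?_
      have := congrFun hkl i
      simpa only [𝒞.reind_compm, 𝒞.assoc] using this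
    rw [← 𝒞.comp_id k, ← e₁, ← 𝒞.assoc, this, 𝒞.assoc, e₁, 𝒞.comp_id]
  · obtain ⟨k, hk⟩ := h.exists_lift t
    refine ⟨𝒞.comp k (𝒞.reind (toUnit c) ψ), funext fun i => ?_⟩
    change 𝒞.comp (𝒞.comp k (𝒞.reind (toUnit c) ψ)) (𝒞.reind (toUnit c) (𝒞.comp φ (π i))) = t i
    rw [𝒞.reind_compm, 𝒞.assoc, ← 𝒞.assoc (𝒞.reind (toUnit c) ψ), e₂, 𝒞.id_comp, hk]

lemma IsProdCone.exists_iso (h : 𝒞.IsProdCone π) {π'' : ∀ i, 𝒞.Hom (𝟙_ C) P' (B i)}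
    (h' : 𝒞.IsProdCone π'') : ∃ (φ : 𝒞.Hom (𝟙_ C) P' P) (ψ : 𝒞.Hom (𝟙_ C) P P'),
      (∀ i, 𝒞.comp φ (π i) = π'' i) ∧ 𝒞.comp φ ψ = 𝒞.id _ _ ∧ 𝒞.comp ψ φ = 𝒞.id _ _ := by
  obtain ⟨φ, hφ⟩ := h.exists_lift π''
  obtain ⟨ψ, hψ⟩ := h'.exists_lift π
  simp only [IdxCat.reind_toUnit_unit] at hφ hψ
  refine ⟨φ, ψ, hφ, h'.hom_ext fun i => ?_, h.hom_ext fun i => ?_⟩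
  · rw [IdxCat.reind_toUnit_unit, 𝒞.assoc, hψ, hφ, 𝒞.id_comp]
  · rw [IdxCat.reind_toUnit_unit, 𝒞.assoc, hφ, hψ, 𝒞.id_comp]

lemma Products.isProdCone (Q : 𝒞.Products) (B : Fin n → 𝒞.Obj) : 𝒞.IsProdCone (Q.π B) :=
  fun c A => Q.universal B c A

/-! ### Power cones -/

/-- A morphism exhibiting its domain as a power of its codomain. -/
def IsPower (𝒞 : IdxCat.{w} C) {c : C} {P B : 𝒞.Obj} (e : 𝒞.Hom c P B) : Prop :=
  ∀ (b : C) (A : 𝒞.Obj), Function.Bijective fun k : 𝒞.Hom b A P =>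
    𝒞.comp (𝒞.reind (fst b c) k) (𝒞.reind (snd b c) e)

lemma IsPower.of_heq {c c' : C} {P P' B B' : 𝒞.Obj} {e : 𝒞.Hom c P B} {e' : 𝒞.Hom c' P' B'}
    (h : 𝒞.IsPower e) (hc : c = c') (hP : P = P') (hB : B = B') (he : HEq e e') :
    𝒞.IsPower e' := by
  subst hc hP hB he
  exact h

/-- The universal property with respect to a binary product that need not be the chosen one. -/
lemma IsPower.bijective {c : C} {P B : 𝒞.Obj} {e : 𝒞.Hom c P B} (h : 𝒞.IsPower e) {b x : C}
    (s : x ⟶ b) (t : x ⟶ c) [IsIso (CartesianMonoidalCategory.lift s t)] (A : 𝒞.Obj) :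
    Function.Bijective fun k : 𝒞.Hom b A P => 𝒞.comp (𝒞.reind s k) (𝒞.reind t e) := by
  have := (bijective_reind (𝒞 := 𝒞) (CartesianMonoidalCategory.lift s t) A B).comp (h b A)
  refine (congrArg Function.Bijective ?_).mp this
  funext k
  simp

lemma Powers.isPower (Q : 𝒞.Powers) (c : C) (B : 𝒞.Obj) : 𝒞.IsPower (Q.eval c B) :=
  fun b A => Q.universal b c A B

end IdxCat

/-! ### Products and powers in pullbacks -/

namespace LInd

variable {X Y Z : LInd.{v, u}}

lemma Mor.isIso_lift_map (F : X ⟶ Y) (a b : X.base) :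
    IsIso (CartesianMonoidalCategory.lift (F.base.map (fst a b)) (F.base.map (snd a b))) :=
  inferInstanceAs (IsIso (CartesianMonoidalCategory.prodComparison F.base a b))

lemma Mor.map_heq_map₁ (F : X ⟶ Y) (h : F.base.obj (𝟙_ X.base) = 𝟙_ Y.base) {A B : X.fib.Obj}
    (k : X.fib.Hom (𝟙_ X.base) A B) : HEq (F.map k) (F.map₁ k) := by
  rw [F.map_eq_reind_map₁]
  exact (IdxCat.heq_reind_toUnit h rfl rfl HEq.rfl).trans
    (heq_of_eq (IdxCat.reind_toUnit_unit _))

/-- Product cones are preserved. -/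
def Mor.PreservesProdCones (F : X ⟶ Y) : Prop :=
  ∀ {n : ℕ} {P : X.fib.Obj} {B : Fin n → X.fib.Obj} {π : ∀ i, X.fib.Hom (𝟙_ X.base) P (B i)},
    X.fib.IsProdCone π → Y.fib.IsProdCone fun i => F.map₁ (π i)

/-- Every product cone is isomorphic to the chosen one, and `map₁` carries the isomorphism along. -/
lemma Mor.preservesProdCones_of_chosen (F : X ⟶ Y) (Q : X.fib.Products)
    (h : ∀ {n : ℕ} (B : Fin n → X.fib.Obj), Y.fib.IsProdCone fun i => F.map₁ (Q.π B i)) :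
    F.PreservesProdCones := by
  intro n P B π hπ
  obtain ⟨φ, ψ, h₁, h₂, h₃⟩ := (Q.isProdCone B).exists_iso hπ
  have := (h B).of_iso (φ := F.map₁ φ) (ψ := F.map₁ ψ) (by rw [← F.map₁_comp, h₂, F.map₁_id])
    (by rw [← F.map₁_comp, h₃, F.map₁_id])
  simpa only [← F.map₁_comp, h₁] using this

lemma Mor.preservesProdCones (F : X ⟶ Y) {Q : X.fib.Products} {Q' : Y.fib.Products}
    (h : F.fib.PreservesProducts Q Q') : F.PreservesProdCones := by
  refine F.preservesProdCones_of_chosen Q fun {n} B => ?_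
  obtain ⟨m, m', h₁, h₂, h₃⟩ := h B
  have e₂ := congrArg (Y.fib.reind F.unitIso) h₂
  have e₃ := congrArg (Y.fib.reind F.unitIso) h₃
  rw [Y.fib.reind_compm, Y.fib.reind_idm] at e₂ e₃
  refine ((Q'.isProdCone fun i => F.obj (B i)).of_iso e₂ e₃).of_heq rfl (fun _ => rfl)
    fun i => heq_of_eq ?_
  have := congrArg (Y.fib.reind F.unitIso) (h₁ i)
  rwa [Y.fib.reind_compm, IdxCat.reind_toUnit, IdxCat.reind_toUnit_unit] at this

lemma Mor.preservesProducts (F : X ⟶ Y) (Q : X.fib.Products) (Q' : Y.fib.Products)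
    (h : ∀ {n : ℕ} (B : Fin n → X.fib.Obj), Y.fib.IsProdCone fun i => F.map₁ (Q.π B i)) :
    F.fib.PreservesProducts Q Q' := by
  intro n B
  obtain ⟨φ, ψ, h₁, h₂, h₃⟩ := (Q'.isProdCone fun i => F.obj (B i)).exists_iso (h B)
  refine ⟨Y.fib.reind (toUnit _) φ, Y.fib.reind (toUnit _) ψ, fun i => ?_, ?_, ?_⟩
  · rw [← Y.fib.reind_compm]
    exact (congrArg _ (h₁ i)).trans (F.map_eq_reind_map₁ _).symm
  · rw [← Y.fib.reind_compm, h₂, Y.fib.reind_idm]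
  · rw [← Y.fib.reind_compm, h₃, Y.fib.reind_idm]

namespace IsFibPb

variable {K E M N : LInd.{v, u}} {g : K ⟶ E} {q : K ⟶ M} {p : E ⟶ N} {f : M ⟶ N}

/-- Product cones in a pullback are detected componentwise. -/
lemma isProdCone (S : IsFibPb g q p f) (hp : p.PreservesProdCones) {n : ℕ} {P : K.fib.Obj}
    {B : Fin n → K.fib.Obj} {π : ∀ i, K.fib.Hom (𝟙_ K.base) P (B i)}
    (hg : E.fib.IsProdCone fun i => g.map₁ (π i)) (hq : M.fib.IsProdCone fun i => q.map₁ (π i)) :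
    K.fib.IsProdCone π := by
  have ob : ∀ A, p.obj (g.obj A) = f.obj (q.obj A) := Mor.congr_obj S.w
  have bo : ∀ d, p.base.obj (g.base.obj d) = f.base.obj (q.base.obj d) := Mor.congr_base_obj S.w
  refine fun c A => ⟨fun k l hkl => ?_, fun t => ?_⟩
  · refine S.hom_ext (hg.hom_ext fun i => ?_) (hq.hom_ext fun i => ?_)
    · have := congrArg g.map (congrFun hkl i)
      rwa [Mor.map_comp, Mor.map_comp, Mor.map_reind_toUnit] at this
    · have := congrArg q.map (congrFun hkl i)
      rwa [Mor.map_comp, Mor.map_comp, Mor.map_reind_toUnit] at this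
  · obtain ⟨k, hk⟩ := hg.exists_lift fun i => g.map (t i)
    obtain ⟨l, hl⟩ := hq.exists_lift fun i => q.map (t i)
    obtain ⟨m, hm⟩ := exists_heq_hom (bo c).symm (ob A).symm (ob P).symm (f.map l)
    -- The two tuples have equal images in `N`: `p` preserves the product cone, so its projections
    -- detect the equality.
    have e : p.map k = m := by
      refine (hp hg).hom_ext fun i => eq_of_heq ?_
      have h₁ := congrArg p.map (hk i)
      have h₂ := congrArg f.map (hl i)
      rw [Mor.map_comp, Mor.map_reind_toUnit] at h₁ h₂
      refine (heq_of_eq h₁).trans ((Mor.congr_map_of_sq S.w (t i)).trans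
        ((heq_of_eq h₂).symm.trans (HEq.symm ?_)))
      exact IdxCat.heq_comp (bo c) (ob A) (ob P) (ob (B i)) hm
        (IdxCat.heq_reind_toUnit (bo c) (ob P) (ob (B i)) (Mor.congr_map₁_of_sq S.w (π i)))
    obtain ⟨s, h₁, h₂⟩ := S.hom k l ((heq_of_eq e).trans hm)
    refine ⟨s, funext fun i => S.hom_ext ?_ ?_⟩
    · rw [Mor.map_comp, Mor.map_reind_toUnit, h₁, hk]
    · rw [Mor.map_comp, Mor.map_reind_toUnit, h₂, hl]

/-- Products in a pullback along a 1-cell with cartesian lifts. -/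
lemma exists_product (S : IsFibPb g q p f) (hL : HasLifts p) (hp : p.PreservesProdCones)
    (hf : f.PreservesProdCones) {n : ℕ} (B : Fin n → K.fib.Obj) {s : E.fib.Obj}
    {πE : ∀ i, E.fib.Hom (𝟙_ E.base) s (g.obj (B i))} (hE : E.fib.IsProdCone πE) {c : M.fib.Obj}
    {πM : ∀ i, M.fib.Hom (𝟙_ M.base) c (q.obj (B i))} (hM : M.fib.IsProdCone πM) :
    ∃ (R : K.fib.Obj) (π : ∀ i, K.fib.Hom (𝟙_ K.base) R (B i)), q.obj R = c ∧
      (∀ i, HEq (q.map₁ (π i)) (πM i)) ∧ K.fib.IsProdCone π ∧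
        E.fib.IsProdCone fun i => g.map₁ (π i) := by
  have ob : ∀ A, p.obj (g.obj A) = f.obj (q.obj A) := Mor.congr_obj S.w
  choose πN hN using fun i => exists_heq_hom (𝒞 := N.fib) rfl rfl (ob (B i)) (p.map₁ (πE i))
  -- Both `f.obj c` and `p.obj s` are products in `N` of one family. Lifting the comparison `σ`
  -- moves the product of `E` over `f.obj c`, and invertibility of `σ` keeps it a product.
  obtain ⟨σ, σ', h₁, h₂, h₃⟩ := ((hp hE).of_heq rfl (fun i => ob (B i))
    fun i => (hN i).symm).exists_iso (hf hM)
  obtain ⟨R, hR, φ, hφ, hc⟩ := (S.exists_pbLift hL rfl σ).some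
  have oR : p.obj (g.obj R) = f.obj c := (ob R).trans (congrArg f.obj hR)
  obtain ⟨m, -, h₄, h₅⟩ := IdxCat.exists_inv_of_heq oR rfl hφ h₂ h₃
  obtain ⟨ψ, -, h₆, h₇⟩ := hc.exists_inv h₄ h₅
  choose πM' hM' using fun i => exists_heq_hom (𝒞 := M.fib) rfl hR.symm rfl (πM i)
  have key : ∀ i, ∃ t : K.fib.Hom (𝟙_ K.base) R (B i), g.map₁ t = E.fib.comp φ (πE i) ∧
      q.map₁ t = πM' i := fun i => by
    refine S.hom₁ _ _ ?_
    rw [Mor.map₁_comp]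
    refine (IdxCat.heq_comp rfl oR rfl (ob (B i)) hφ (hN i).symm).trans ?_
    exact (heq_of_eq (h₁ i)).trans (f.map₁_heq hR rfl (hM' i)).symm
  choose π hg hq using key
  have hcone : E.fib.IsProdCone fun i => g.map₁ (π i) :=
    (hE.of_iso h₆ h₇).of_heq rfl (fun _ => rfl) fun i => heq_of_eq (hg i).symm
  have hq' : ∀ i, HEq (q.map₁ (π i)) (πM i) := fun i => (heq_of_eq (hq i)).trans (hM' i)
  exact ⟨R, π, hR, hq', S.isProdCone hp hcone (hM.of_heq hR.symm (fun _ => rfl)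
    fun i => (hq' i).symm), hcone⟩

/-- Powers in a pullback along a 1-cell with cartesian lifts that preserves powers. -/
lemma exists_power (S : IsFibPb g q p f) (hL : HasLifts p) {c : K.base} (B : K.fib.Obj)
    {s : E.fib.Obj} {eE : E.fib.Hom (g.base.obj c) s (g.obj B)} (hE : E.fib.IsPower eE)
    {d : M.fib.Obj} {eM : M.fib.Hom (q.base.obj c) d (q.obj B)} (hM : M.fib.IsPower eM)
    (hN : N.fib.IsPower (p.map eE)) :
    ∃ (R : K.fib.Obj) (e : K.fib.Hom c R B), q.obj R = d ∧ HEq (q.map e) eM ∧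
      K.fib.IsPower e := by
  have ob : ∀ A, p.obj (g.obj A) = f.obj (q.obj A) := Mor.congr_obj S.w
  have bo : ∀ d, p.base.obj (g.base.obj d) = f.base.obj (q.base.obj d) := Mor.congr_base_obj S.w
  obtain ⟨eN, heN⟩ := exists_heq_hom (𝒞 := N.fib) (bo c) rfl (ob B) (p.map eE)
  have hN' : N.fib.IsPower eN := hN.of_heq (bo c) rfl (ob B) heN.symm
  -- Any index is its own product with the terminal one; this allows transposing over the terminal
  -- index.
  have : IsIso (CartesianMonoidalCategory.lift (toUnit (f.base.obj (q.base.obj c)))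
    (𝟙 (f.base.obj (q.base.obj c)))) := 
      ⟨snd (𝟙_ N.base) _, by simp, CartesianMonoidalCategory.hom_ext _ _
        (toUnit_unique _ _) (by simp)⟩
  -- `σ` is the transpose of the image of the evaluation in `M`. It is not invertible in general,
  -- since `f` need not preserve powers, so the universal property below must come from
  -- cartesianness of its lift.
  obtain ⟨σ, hσ⟩ := (hN'.bijective (toUnit (f.base.obj (q.base.obj c)))
    (𝟙 (f.base.obj (q.base.obj c))) (f.obj d)).surjective (f.map eM)
  replace hσ : N.fib.comp (N.fib.reind (toUnit _) σ) eN = f.map eM := by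
    simpa only [IdxCat.reind_id] using hσ
  have hs : ∀ {x y : N.base} {A : N.fib.Obj} (i : x ⟶ y) (j : x ⟶ f.base.obj (q.base.obj c))
      (k : N.fib.Hom y A (f.obj d)), N.fib.comp (N.fib.reind i (N.fib.comp k
        (N.fib.reind (toUnit _) σ))) (N.fib.reind j eN) =
          N.fib.comp (N.fib.reind i k) (N.fib.reind j (f.map eM)) := by
    intro x y A i j k
    rw [← hσ, IdxCat.reind_compm, IdxCat.reind_compm, IdxCat.reind_toUnit, IdxCat.reind_toUnit,
      IdxCat.assoc]
  let L := (S.exists_pbLift hL rfl σ).some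
  have oR : p.obj (g.obj L.R) = f.obj d := (ob L.R).trans (congrArg f.obj L.obj_snd)
  obtain ⟨eM', heM⟩ := exists_heq_hom (𝒞 := M.fib) rfl L.obj_snd.symm rfl eM
  -- The evaluation in the pullback: in `E` it is the cartesian lift followed by `eE`, in `M` it is
  -- `eM`, and they agree by the definition of `σ`.
  obtain ⟨e, h₁, h₂⟩ := S.hom (E.fib.comp (E.fib.reind (toUnit _) L.φ) eE) eM' (by
    rw [Mor.map_comp, Mor.map_reind_toUnit]
    refine (IdxCat.heq_comp (bo c) oR rfl (ob B) (IdxCat.heq_reind_toUnit (bo c) oR rfl L.p_φ)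
      heN.symm).trans ?_
    exact (heq_of_eq hσ).trans (f.map_heq rfl L.obj_snd rfl heM).symm)
  have hqe : HEq (q.map e) eM := (heq_of_eq h₂).trans heM
  have hq : M.fib.IsPower (q.map e) := hM.of_heq rfl L.obj_snd.symm rfl hqe.symm
  have hge : ∀ {b : K.base} {A : K.fib.Obj} (k : K.fib.Hom b A L.R),
      g.map (K.fib.comp (K.fib.reind (fst b c) k) (K.fib.reind (snd b c) e)) =
        E.fib.comp (E.fib.reind (g.base.map (fst b c)) (E.fib.comp (g.map k)
          (E.fib.reind (toUnit _) L.φ))) (E.fib.reind (g.base.map (snd b c)) eE) := by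
    intro b A k
    rw [Mor.map_comp, Mor.map_reind, Mor.map_reind, h₁, IdxCat.reind_compm, IdxCat.reind_compm,
      IdxCat.reind_toUnit, IdxCat.reind_toUnit, IdxCat.assoc]
  refine ⟨L.R, e, L.obj_snd, hqe, fun b A => ⟨fun k l hkl => ?_, fun t => ?_⟩⟩
  all_goals
    have iE := g.isIso_lift_map b c
    have iM := q.isIso_lift_map b c
    -- Base functors preserve products only up to isomorphism, so the image of `b ⊗ c` is treated as
    -- a product that is not the chosen one.
    have iN : IsIso (CartesianMonoidalCategory.lift (p.base.map (g.base.map (fst b c)))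
      (p.base.map (g.base.map (snd b c)))) := Mor.isIso_lift_map (g ≫ p) b c
  · refine L.hom_ext S ((hq.bijective (q.base.map (fst b c)) (q.base.map (snd b c)) _).injective ?_)
      ((hE.bijective (g.base.map (fst b c)) (g.base.map (snd b c)) _).injective ?_)
    · have := congrArg q.map hkl
      dsimp only at this
      rwa [Mor.map_comp, Mor.map_comp, Mor.map_reind, Mor.map_reind, Mor.map_reind] at this
    · have := congrArg g.map hkl
      dsimp only at this
      rwa [hge, hge] at this
  · obtain ⟨r, hr⟩ := (hM.bijective (q.base.map (fst b c)) (q.base.map (snd b c)) _).surjective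
      (q.map t)
    obtain ⟨l, hl⟩ := (hE.bijective (g.base.map (fst b c)) (g.base.map (snd b c)) _).surjective
      (g.map t)
    dsimp only at hr hl
    obtain ⟨m, hm⟩ := exists_heq_hom (bo b).symm (ob A).symm rfl
      (N.fib.comp (f.map r) (N.fib.reind (toUnit _) σ))
    -- The transposes found in `E` and `M` match in `N` because evaluation at the power of `N` is
    -- injective; only then can they be combined into a map to the lift.
    have em : p.map l = m := by
      refine (hN.bijective (p.base.map (g.base.map (fst b c)))
        (p.base.map (g.base.map (snd b c))) _).injective
        (eq_of_heq ?_)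
      have h₃ := congrArg p.map hl
      have h₄ := congrArg f.map hr
      rw [Mor.map_comp, Mor.map_reind, Mor.map_reind] at h₃ h₄
      refine (heq_of_eq h₃).trans ((Mor.congr_map_of_sq S.w t).trans
        ((heq_of_eq h₄).symm.trans (HEq.symm ?_)))
      refine (IdxCat.heq_comp (bo (b ⊗ c)) (ob A) rfl (ob B) (IdxCat.heq_reind (bo b) (bo (b ⊗ c))
        (ob A) rfl (Mor.congr_base_map S.w (fst b c)) hm) (IdxCat.heq_reind (bo c) (bo (b ⊗ c))
        rfl (ob B) (Mor.congr_base_map S.w (snd b c)) heN.symm)).trans (heq_of_eq ?_)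
      exact hs _ _ _
    obtain ⟨k, h₃, h₄⟩ := L.exists_hom S rfl rfl r l (by
      rw [em]
      exact hm.symm)
    refine ⟨k, S.hom_ext ?_ ?_⟩
    · dsimp only
      rw [hge, h₄, hl]
    · dsimp only
      rw [Mor.map_comp, Mor.map_reind, Mor.map_reind, ← hr]
      exact eq_of_heq (IdxCat.heq_comp rfl rfl L.obj_snd rfl
        (IdxCat.heq_reind rfl rfl rfl L.obj_snd HEq.rfl h₃)
        (IdxCat.heq_reind rfl rfl L.obj_snd rfl HEq.rfl hqe))

end IsFibPb

end LInd

/-! ### Distributivity of coproducts in the computations -/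

namespace DistCat

/-- Distributivity with respect to the image of a coproduct under a bicartesian functor. -/
lemma bijective_reind_map {C D : DistCat.{v, u}} (h : C ⟶ D) {𝒟 : IdxCat.{max u v} D.carrier}
    (h𝒟 : 𝒟.CoproductsDistribute) {n : ℕ} {b : Fin n → C.carrier} {s : Cofan b} (hs : IsColimit s)
    (a : C.carrier) (A B : 𝒟.Obj) :
    Function.Bijective fun (k : 𝒟.Hom (h.functor.obj (a ⊗ s.pt)) A B) (i : Fin n) =>
      𝒟.reind (h.functor.map (a ◁ s.inj i)) k := by
  let s' : Cofan fun i => h.functor.obj (b i) :=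
    Cofan.mk (h.functor.obj s.pt) fun i => h.functor.map (s.inj i)
  have hs' : IsColimit s' := isColimitCofanMkObjOfIsColimit h.functor b _ hs
  have h₁ := h𝒟 _ s' hs' (h.functor.obj a) A B
  have e : ∀ i, h.functor.map (a ◁ s.inj i) ≫
      CartesianMonoidalCategory.prodComparison h.functor a s.pt =
      CartesianMonoidalCategory.prodComparison h.functor a (b i) ≫ h.functor.obj a ◁ s'.inj i :=
    fun i => CartesianMonoidalCategory.prodComparison_natural_whiskerLeft h.functor (s.inj i)
  have h₂ := IdxCat.bijective_reind (𝒞 := 𝒟)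
    (CartesianMonoidalCategory.prodComparison h.functor a s.pt) A B
  have h₃ := Function.Bijective.piMap fun i => IdxCat.bijective_reind (𝒞 := 𝒟)
    (CartesianMonoidalCategory.prodComparison h.functor a (b i)) A B
  -- By naturality of the product comparisons the map in question is conjugate, by invertible
  -- reindexings, to the distributivity bijection for the image coproduct.
  refine (Function.Bijective.of_comp_iff _ h₂).1 ((congrArg Function.Bijective ?_).mp (h₃.comp h₁))
  funext k i
  change 𝒟.reind _ (𝒟.reind _ k) = 𝒟.reind _ (𝒟.reind _ k)
  rw [IdxCat.reind_reind, IdxCat.reind_reind, e]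

end DistCat

namespace Model.Square

variable {E M N : Model.{v, u}} {p : E ⟶ N} {f : M ⟶ N} {S : Square p f}

/-- Injectivity holds in each component. For surjectivity, the copairings in `E` and `M` are glued;
they agree in `N` since distributivity there makes the restrictions to the summands jointly
injective. -/
lemma IsPb.coproductsDistribute (hS : S.IsPb) : S.comp.CoproductsDistribute := by
  intro n b s hs a A B
  have bo : ∀ d, p.lind.base.obj (S.gl.base.obj d) = f.lind.base.obj (S.ql.base.obj d) :=
    LInd.Mor.congr_base_obj hS.comp.w
  have ob : ∀ A, p.lind.obj (S.gl.obj A) = f.lind.obj (S.ql.obj A) :=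
    LInd.Mor.congr_obj hS.comp.w
  have hE := DistCat.bijective_reind_map S.g E.distributive hs a (S.gl.obj A) (S.gl.obj B)
  have hM := DistCat.bijective_reind_map S.q M.distributive hs a (S.ql.obj A) (S.ql.obj B)
  have hN := DistCat.bijective_reind_map (S.g ≫ p.h) N.distributive hs a
    (p.lind.obj (S.gl.obj A)) (p.lind.obj (S.gl.obj B))
  refine ⟨fun k l hkl => hS.comp.hom_ext (hE.injective ?_) (hM.injective ?_), fun t => ?_⟩
  · funext i
    exact (S.gl.map_reind _ k).symm.trans ((congrArg S.gl.map (congrFun hkl i)).trans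
      (S.gl.map_reind _ l))
  · funext i
    exact (S.ql.map_reind _ k).symm.trans ((congrArg S.ql.map (congrFun hkl i)).trans
      (S.ql.map_reind _ l))
  · obtain ⟨k, hk⟩ := hE.surjective fun i => S.gl.map (t i)
    obtain ⟨l, hl⟩ := hM.surjective fun i => S.ql.map (t i)
    obtain ⟨m, hm⟩ := LInd.exists_heq_hom (𝒞 := N.lind.fib) (bo _).symm (ob A).symm (ob B).symm
      (f.lind.map (c := S.ql.base.obj (a ⊗ s.pt)) l)
    have em : p.lind.map (c := S.gl.base.obj (a ⊗ s.pt)) k = m := by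
      refine hN.injective (funext fun i => eq_of_heq ?_)
      have h₁ : p.lind.map (c := S.gl.base.obj (a ⊗ b i)) _ = _ :=
        congrArg p.lind.map (congrFun hk i)
      have h₂ : f.lind.map (c := S.ql.base.obj (a ⊗ b i)) _ = _ :=
        congrArg f.lind.map (congrFun hl i)
      refine (heq_of_eq (p.lind.map_reind (S.g.functor.map (a ◁ s.inj i)) k).symm).trans
        ((heq_of_eq h₁).trans ((LInd.Mor.congr_map_of_sq hS.comp.w (t i)).trans
          ((heq_of_eq h₂).symm.trans ((heq_of_eq (f.lind.map_reind _ l)).trans (HEq.symm ?_)))))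
      exact IdxCat.heq_reind (bo _) (bo _) (ob A) (ob B)
        (LInd.Mor.congr_base_map hS.comp.w (a ◁ s.inj i)) hm
    obtain ⟨r, h₁, h₂⟩ := hS.comp.hom k l ((heq_of_eq em).trans hm)
    refine ⟨r, funext fun i => hS.comp.hom_ext ?_ ?_⟩
    · refine (S.gl.map_reind _ r).trans (Eq.trans ?_ (congrFun hk i))
      rw [h₁]
    · refine (S.ql.map_reind _ r).trans (Eq.trans ?_ (congrFun hl i))
      rw [h₂]

end Model.Square

lemma IdxFunctor.map_idOfEq {C : Type u} [Category.{v} C] {𝒞 𝒟 : IdxCat.{w} C}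
    (F : IdxFunctor 𝒞 𝒟) (c : C) {A B : 𝒞.Obj} (e : A = B) :
    F.map (𝒞.idOfEq c e) = 𝒟.idOfEq c (congrArg F.obj e) := by
  subst e
  exact F.map_id c A

lemma LInd.eq_eqToHom {X Y : LInd.{v, u}} {F G : X ⟶ Y} (e : F = G) (σ : F ⟶ G)
    (hb : ∀ c, HEq ((LInd.Cell.base σ).app c) (𝟙 (F.base.obj c)))
    (ha : ∀ A, HEq (LInd.Cell.app σ A) (Y.fib.id (𝟙_ Y.base) (F.obj A))) : σ = eqToHom e := by
  subst e
  exact LInd.cell_ext (fun c => eq_of_heq (hb c)) fun A => eq_of_heq (ha A)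

/-! ### The lifted model and its projections -/

namespace Model

namespace Square

variable {E M N : Model.{v, u}} {p : E ⟶ N} {f : M ⟶ N} {S : Square p f}

lemma IsPb.exists_products (hS : S.IsPb) (hL : LInd.HasLifts p.lind) (hq : S.q.IsStrict) :
    ∃ Q : S.comp.Products, S.Q.StrictlyPreservesProducts Q M.products ∧
      S.Q.PreservesProducts Q M.products ∧ S.G.PreservesProducts Q E.products := by
  choose R π h₁ h₂ h₃ h₄ using fun {n : ℕ} (B : Fin n → S.comp.Obj) =>
    hS.comp.exists_product hL (p.lind.preservesProdCones p.preservesProducts)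
      (f.lind.preservesProdCones f.preservesProducts) B
      (E.products.isProdCone fun i => S.gl.obj (B i))
      (M.products.isProdCone fun i => S.ql.obj (B i))
  let Q : S.comp.Products := ⟨R, π, fun B => h₃ B⟩
  refine ⟨Q, ⟨h₁, fun B i => ?_⟩, S.ql.preservesProducts Q M.products fun B => ?_,
    S.gl.preservesProducts Q E.products fun B => h₄ B⟩
  -- Strictness compares `map` with the projections themselves; since `q` fixes the terminal index,
  -- it agrees with `map₁`.
  · exact (S.ql.map_heq_map₁ hq.unit _).trans (h₂ B i)
  · exact (M.products.isProdCone fun i => S.ql.obj (B i)).of_heq (h₁ B).symm (fun _ => rfl)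
      fun i => (h₂ B i).symm

/-- Strict preservation of powers by `p` is used here: it shows that the evaluation of `E` remains a
power evaluation in `N`. -/
lemma IsPb.exists_powers (hS : S.IsPb) (hL : LInd.HasLifts p.lind) (hp : p.IsStrict) :
    ∃ Q : S.comp.Powers, S.Q.StrictlyPreservesPowers Q M.powers := by
  choose R e h₁ h₂ h₃ using fun (c : S.val.carrier) (B : S.comp.Obj) =>
    hS.comp.exists_power hL (c := c) B
      (E.powers.isPower (S.g.functor.obj c) (S.gl.obj B))
      (M.powers.isPower (S.q.functor.obj c) (S.ql.obj B))
      ((N.powers.isPower (p.h.functor.obj (S.g.functor.obj c)) (p.lind.obj (S.gl.obj B))).of_heq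
        rfl (hp.powers.obj _ _).symm rfl (hp.powers.eval _ _).symm)
  exact ⟨⟨R, e, fun b c A B => h₃ c B b A⟩, ⟨h₁, h₂⟩⟩

namespace Lifts

variable (L : S.Lifts)

/-- The lifted model. -/
@[reducible]
def model (Q : S.comp.Products) (R : S.comp.Powers) : Model.{v, u} where
  val := S.val
  comp := S.comp
  F := L.F
  U := L.U
  adj := L.idxAdj.adjunction
  unit_base _ := rfl
  counit_base _ := rfl
  products := Q
  powers := R
  distributive := L.isPb.coproductsDistribute

variable (Q : S.comp.Products) (R : S.comp.Powers)

/-- The components of the first projection. -/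
@[reducible]
def fstData (hG : S.G.PreservesProducts Q E.products) :
    MorData (M := L.model Q R) (N := E) S.g S.G where
  preservesProducts := hG
  a := L.ga
  a_nat k := L.ga_nat k
  b := L.gb
  b_nat k := L.gb_nat k
  counit_app := L.gl_θ
  unit_app A := by
    change _ = E.vfib.comp (S.sg.map₁ (L.η A)) _
    rw [← IdxCat.assoc, L.sg_η, IdxCat.assoc, ← E.U.map_comp, L.gaInv_ga, E.U.map_id,
      IdxCat.comp_id]

/-- The components of the second projection. -/
@[reducible]
def sndData (hQ : S.Q.PreservesProducts Q M.products) :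
    MorData (M := L.model Q R) (N := M) S.q S.Q where
  preservesProducts := hQ
  a A := M.lind.fib.idOfEq _ (L.ql_F A)
  a_nat k := by
    rw [IdxCat.reind_idOfEq, IdxCat.reind_idOfEq]
    exact eq_of_heq ((IdxCat.comp_idOfEq_heq _ _).trans
      ((L.ql_F_map k).trans (IdxCat.idOfEq_comp_heq _ _).symm))
  b B := M.vfib.idOfEq _ (L.sq_U B)
  b_nat k := by
    rw [IdxCat.reind_idOfEq, IdxCat.reind_idOfEq]
    exact eq_of_heq ((IdxCat.comp_idOfEq_heq _ _).trans
      ((L.sq_U_map k).trans (IdxCat.idOfEq_comp_heq _ _).symm))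
  counit_app B := by
    rw [M.F.map_idOfEq]
    exact eq_of_heq ((L.ql_θ B).trans (((IdxCat.idOfEq_comp_heq _ _).trans
      (IdxCat.idOfEq_comp_heq _ _)).symm))
  unit_app A := by
    rw [M.U.map_idOfEq]
    refine eq_of_heq ((L.sq_η A).symm.trans (HEq.symm ?_))
    exact (IdxCat.heq_comp rfl rfl rfl (congrArg M.U.obj (L.ql_F A).symm) HEq.rfl
      (IdxCat.comp_idOfEq_heq _ _)).trans (IdxCat.comp_idOfEq_heq _ _)

/-- The first projection. -/
@[reducible]
def fst (hG : S.G.PreservesProducts Q E.products) : L.model Q R ⟶ E := (L.fstData Q R hG).mor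

/-- The second projection. -/
@[reducible]
def snd (hQ : S.Q.PreservesProducts Q M.products) : L.model Q R ⟶ M := (L.sndData Q R hQ).mor

lemma snd_isStrict (hQ : S.Q.PreservesProducts Q M.products) (hq : S.q.IsStrict)
    (hQ' : S.Q.StrictlyPreservesProducts Q M.products)
    (hR : S.Q.StrictlyPreservesPowers R M.powers) : (L.snd Q R hQ).IsStrict where
  base := hq
  products := hQ'
  powers := hR
  left := by
    have e : (L.model Q R).left ≫ S.ql = S.sq ≫ M.left :=
      LInd.Mor.hext rfl L.ql_F fun k => L.ql_F_map k
    exact ⟨e, LInd.eq_eqToHom e _ (fun _ => HEq.rfl) fun A => IdxCat.heq_idOfEq _ (L.ql_F A)⟩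
  right := by
    have e : (L.model Q R).right ≫ S.sq = S.ql ≫ M.right :=
      LInd.Mor.hext rfl L.sq_U fun k => L.sq_U_map k
    exact ⟨e, LInd.eq_eqToHom e _ (fun _ => HEq.rfl) fun A => IdxCat.heq_idOfEq _ (L.sq_U A)⟩

end Lifts

end Square

end Model

lemma IdxCat.comp_idOfEq_cancel {C : Type u} [Category.{v} C] {𝒞 : IdxCat.{w} C} {c : C}
    {A B D : 𝒞.Obj} {k l : 𝒞.Hom c A B} (e : B = D)
    (h : 𝒞.comp k (𝒞.idOfEq c e) = 𝒞.comp l (𝒞.idOfEq c e)) : k = l :=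
  eq_of_heq ((IdxCat.comp_idOfEq_heq k e).symm.trans
    ((heq_of_eq h).trans (IdxCat.comp_idOfEq_heq l e)))

/-! ### Components of composite 1-cells and of 2-cells -/

namespace Model

namespace Mor

variable {X K E : Model.{v, u}}

lemma comp_a (t : X ⟶ K) (r : K ⟶ E) (A : X.val.carrier) :
    Mor.a (t ≫ r) A = E.lind.fib.comp (r.lind.map₁ (t.a A)) (r.a (t.sf.obj A)) :=
  comp_α_app t r A

lemma comp_b (t : X ⟶ K) (r : K ⟶ E) (B : X.comp.Obj) :
    Mor.b (t ≫ r) B = E.vfib.comp (r.sf.map₁ (t.b B)) (r.b (t.lind.obj B)) :=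
  comp_β_app t r B

lemma congr_a {s t : X ⟶ K} (e : s = t) (A : X.val.carrier) : HEq (s.a A) (t.a A) := by
  subst e
  rfl

lemma congr_b {s t : X ⟶ K} (e : s = t) (B : X.comp.Obj) : HEq (s.b B) (t.b B) := by
  subst e
  rfl

/-- The component at a value type of the 2-cell `self γ`. -/
def vapp {s t : X ⟶ K} (θ : s.lind ⟶ t.lind) (A : X.val.carrier) :
    K.vfib.Hom (𝟙_ K.val.carrier) (s.sf.obj A) (t.sf.obj A) :=
  LInd.Cell.app (DistCat.selfMap₂ (h := s.h) (k := t.h) (LInd.Cell.base θ)) A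

lemma map₁_vapp {s t : X ⟶ K} (r : K ⟶ E) {θ : s.lind ⟶ t.lind} {σ : s ≫ r ⟶ t ≫ r}
    (h : θ ▷ r.lind = Cell.cell σ) (A : X.val.carrier) :
    r.sf.map₁ (vapp θ A) = vapp (s := s ≫ r) (t := t ≫ r) (Cell.cell σ) A := by
  refine (DistCat.selfMap_map₁_snd r.h _).trans ?_
  refine congrArg (fun z => CartesianMonoidalCategory.snd _ _ ≫ z) ?_
  exact congrArg (fun z : s.lind ≫ r.lind ⟶ t.lind ≫ r.lind => (LInd.Cell.base z).app A) h

end Mor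

namespace Cell

variable {X K E : Model.{v, u}}

lemma left_app {s t : X ⟶ K} (σ : s ⟶ t) (A : X.val.carrier) :
    K.lind.fib.comp (LInd.Cell.app (Cell.cell σ) (X.F.obj A)) (t.a A) =
      K.lind.fib.comp (s.a A) (K.F.map (Mor.vapp (Cell.cell σ) A)) := by
  refine (congrArg (fun z : X.left ≫ s.lind ⟶ t.sf ≫ K.left => LInd.Cell.app z A)
    (Cell.left σ)).trans ?_
  exact congrArg (K.comp.comp (s.a A)) (K.F.toLInd_map₁ (Mor.vapp (Cell.cell σ) A))

lemma right_app {s t : X ⟶ K} (σ : s ⟶ t) (B : X.comp.Obj) :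
    K.vfib.comp (Mor.vapp (Cell.cell σ) (X.U.obj B)) (t.b B) =
      K.vfib.comp (s.b B) (K.U.map (LInd.Cell.app (Cell.cell σ) B)) := by
  refine (congrArg (fun z : X.right ≫ s.sf ⟶ t.lind ≫ K.right => LInd.Cell.app z B)
    (Cell.right σ)).trans ?_
  exact congrArg (K.vfib.comp (s.b B)) (K.U.toLInd_map₁ (LInd.Cell.app (Cell.cell σ) B))

/-- A 2-cell of models from a 2-cell of `LInd` that is compatible with the components. -/
def ofApp {s t : X ⟶ K} (θ : s.lind ⟶ t.lind)
    (hl : ∀ A, K.lind.fib.comp (LInd.Cell.app θ (X.F.obj A)) (t.a A) =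
      K.lind.fib.comp (s.a A) (K.F.map (Mor.vapp θ A)))
    (hr : ∀ B, K.vfib.comp (Mor.vapp θ (X.U.obj B)) (t.b B) =
      K.vfib.comp (s.b B) (K.U.map (LInd.Cell.app θ B))) : s ⟶ t where
  cell := θ
  left := by
    refine LInd.cell_ext (fun c => ?_) fun A => (hl A).trans ?_
    · change (LInd.Cell.base θ).app c ≫ (LInd.Cell.base t.α).app c =
        (LInd.Cell.base s.α).app c ≫ (LInd.Cell.base θ).app c
      rw [t.α_base, s.α_base]
      exact (Category.comp_id _).trans (Category.id_comp _).symm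
    · exact congrArg (K.comp.comp (s.a A)) (K.F.toLInd_map₁ (Mor.vapp θ A)).symm
  right := by
    refine LInd.cell_ext (fun c => ?_) fun B => (hr B).trans ?_
    · change (LInd.Cell.base θ).app c ≫ (LInd.Cell.base t.β).app c =
        (LInd.Cell.base s.β).app c ≫ (LInd.Cell.base θ).app c
      rw [t.β_base, s.β_base]
      exact (Category.comp_id _).trans (Category.id_comp _).symm
    · exact congrArg (K.vfib.comp (s.b B)) (K.U.toLInd_map₁ (LInd.Cell.app θ B)).symm

variable {s t : X ⟶ K} (r : K ⟶ E) {θ : s.lind ⟶ t.lind} {σ : s ≫ r ⟶ t ≫ r}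

/-- Compatibility of `θ` with `α`, but only after applying `r` and composing with the components of
`α` of `r`. For the two projections jointly this is enough, since the components of one are
cartesian and those of the other are identities. -/
lemma map_left_app (h : θ ▷ r.lind = Cell.cell σ) (A : X.val.carrier) :
    E.lind.fib.comp (r.lind.map₁ (K.lind.fib.comp (LInd.Cell.app θ (X.F.obj A)) (t.a A)))
      (r.a (t.sf.obj A)) =
    E.lind.fib.comp (r.lind.map₁ (K.lind.fib.comp (s.a A) (K.F.map (Mor.vapp θ A))))
      (r.a (t.sf.obj A)) := by
  have h₁ := left_app σ A
  rw [Mor.comp_a, Mor.comp_a, ← Mor.map₁_vapp r h] at h₁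
  have h₂ : r.lind.map₁ (LInd.Cell.app θ (X.F.obj A)) = LInd.Cell.app (Cell.cell σ) (X.F.obj A) :=
    congrArg (fun z : s.lind ≫ r.lind ⟶ t.lind ≫ r.lind => LInd.Cell.app z (X.F.obj A)) h
  rw [LInd.Mor.map₁_comp, LInd.Mor.map₁_comp, IdxCat.assoc, IdxCat.assoc, r.a_nat₁, h₂]
  exact h₁.trans (IdxCat.assoc _ _ _ _)

lemma map_right_app (h : θ ▷ r.lind = Cell.cell σ) (B : X.comp.Obj) :
    E.vfib.comp (r.sf.map₁ (K.vfib.comp (Mor.vapp θ (X.U.obj B)) (t.b B)))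
      (r.b (t.lind.obj B)) =
    E.vfib.comp (r.sf.map₁ (K.vfib.comp (s.b B) (K.U.map (LInd.Cell.app θ B))))
      (r.b (t.lind.obj B)) := by
  have h₁ := right_app σ B
  rw [Mor.comp_b, Mor.comp_b, ← Mor.map₁_vapp r h] at h₁
  have h₂ : r.lind.map₁ (LInd.Cell.app θ B) = LInd.Cell.app (Cell.cell σ) B :=
    congrArg (fun z : s.lind ≫ r.lind ⟶ t.lind ≫ r.lind => LInd.Cell.app z B) h
  rw [LInd.Mor.map₁_comp, LInd.Mor.map₁_comp, IdxCat.assoc, IdxCat.assoc, r.b_nat₁, h₂]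
  exact h₁.trans (IdxCat.assoc _ _ _ _)

end Cell

/-- Associators of models are transports along equalities, so on underlying cells the condition
reduces to the one in `LInd`. -/
lemma lift₂_cell {X K E M N : Model.{v, u}} {g : K ⟶ E} {q : K ⟶ M} {p : E ⟶ N} {f : M ⟶ N}
    (w : g ≫ p = q ≫ f) {s t : X ⟶ K} (σ : s ≫ g ⟶ t ≫ g) (τ : s ≫ q ⟶ t ≫ q)
    (h : (α_ s g p).inv ≫ σ ▷ p ≫ (α_ t g p).hom ≫ t ◁ eqToHom w =
      s ◁ eqToHom w ≫ (α_ s q f).inv ≫ τ ▷ f ≫ (α_ t q f).hom) :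
    HEq (Cell.cell σ ▷ p.lind) (Cell.cell τ ▷ f.lind) := by
  have w' : g.lind ≫ p.lind = q.lind ≫ f.lind := congrArg Mor.lind w
  have e₁ : ∀ r : X ⟶ K, Cell.cell (r ◁ eqToHom w) = r.lind ◁ eqToHom w' := fun r =>
    congrArg (r.lind ◁ ·) (eqToHom_cell w)
  have h' := congrArg Cell.cell h
  refine (LInd.conj_id_eqToHom_iff (Cell.cell σ ▷ p.lind) (Cell.cell τ ▷ f.lind)
    (i := Cell.cell (α_ s g p).inv) (j := Cell.cell (α_ t g p).hom)
    (i' := Cell.cell (α_ s q f).inv) (j' := Cell.cell (α_ t q f).hom)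
    (x := Cell.cell (t ◁ eqToHom w)) (y := Cell.cell (s ◁ eqToHom w))
    (eqToHom_cell (mor_assoc s g p).symm) (eqToHom_cell (mor_assoc t g p))
    (eqToHom_cell (mor_assoc s q f).symm) (eqToHom_cell (mor_assoc t q f))
    (congrArg (s.lind ≫ ·) w') (congrArg (t.lind ≫ ·) w')
    ((e₁ t).trans (Bicategory.whiskerLeft_eqToHom t.lind w'))
    ((e₁ s).trans (Bicategory.whiskerLeft_eqToHom s.lind w'))).1 h'

end Model

namespace LInd.Mor

variable {X Y : LInd.{v, u}} (F : X ⟶ Y)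

lemma map_comp_reind_toUnit {c : X.base} {A B D : X.fib.Obj} (x : X.fib.Hom c A B)
    (y : X.fib.Hom (𝟙_ X.base) B D) : F.map (X.fib.comp x (X.fib.reind (toUnit c) y)) =
      Y.fib.comp (F.map x) (Y.fib.reind (toUnit _) (F.map₁ y)) := by
  rw [map_comp, map_reind_toUnit]

lemma map_reind_toUnit_comp {c : X.base} {A B D : X.fib.Obj} (y : X.fib.Hom (𝟙_ X.base) A B)
    (x : X.fib.Hom c B D) : F.map (X.fib.comp (X.fib.reind (toUnit c) y) x) =
      Y.fib.comp (Y.fib.reind (toUnit _) (F.map₁ y)) (F.map x) := by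
  rw [map_comp, map_reind_toUnit]

lemma map_comp_reind_toUnit_comp {c : X.base} {A B D : X.fib.Obj} {G : Y.fib.Obj}
    (x : X.fib.Hom c A B) (y : X.fib.Hom (𝟙_ X.base) B D) (z : Y.fib.Hom (𝟙_ Y.base) (F.obj D) G) :
    Y.fib.comp (F.map (X.fib.comp x (X.fib.reind (toUnit c) y))) (Y.fib.reind (toUnit _) z) =
      Y.fib.comp (F.map x) (Y.fib.reind (toUnit _) (Y.fib.comp (F.map₁ y) z)) := by
  rw [map_comp_reind_toUnit, Y.fib.assoc, Y.fib.reind_compm]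

lemma map_reind_toUnit_comp_comp {c : X.base} {A B D : X.fib.Obj} {B' D' : Y.fib.Obj}
    (y : X.fib.Hom (𝟙_ X.base) A B) {x : X.fib.Hom c B D} {z : Y.fib.Hom (𝟙_ Y.base) (F.obj D) D'}
    {z' : Y.fib.Hom (𝟙_ Y.base) (F.obj B) B'} {x' : Y.fib.Hom (F.base.obj c) B' D'}
    (h : Y.fib.comp (F.map x) (Y.fib.reind (toUnit _) z) =
      Y.fib.comp (Y.fib.reind (toUnit _) z') x') :
    Y.fib.comp (F.map (X.fib.comp (X.fib.reind (toUnit c) y) x)) (Y.fib.reind (toUnit _) z) =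
      Y.fib.comp (Y.fib.reind (toUnit _) (Y.fib.comp (F.map₁ y) z')) x' := by
  rw [map_reind_toUnit_comp, Y.fib.assoc, h, Y.fib.reind_compm, Y.fib.assoc]

end LInd.Mor

/-! ### 1-cells into the lifted model -/

namespace Model

namespace Square

variable {E M N : Model.{v, u}} {p : E ⟶ N} {f : M ⟶ N} {S : Square p f}

variable (S) in
/-- A factorization of a pair of 1-cells through a square, before the 2-cells are lifted. -/
structure Factor {X : Model.{v, u}} (a : X ⟶ E) (c : X ⟶ M) where
  w : a ≫ p = c ≫ f
  h : X.val ⟶ S.val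
  H : IdxFunctor X.comp (S.comp.changeBase h.functor)
  gl : (@LInd.Mor.mk X.lind S.lind h.functor h.presProd H : X.lind ⟶ S.lind) ≫ S.gl = a.lind
  ql : (@LInd.Mor.mk X.lind S.lind h.functor h.presProd H : X.lind ⟶ S.lind) ≫ S.ql = c.lind
  sg : DistCat.selfMap h ≫ S.sg = a.sf
  sq : DistCat.selfMap h ≫ S.sq = c.sf

namespace Factor

variable {X : Model.{v, u}} {a : X ⟶ E} {c : X ⟶ M} (T : S.Factor a c) (L : S.Lifts)

/-- The 1-cell between computations. -/
abbrev tl : X.lind ⟶ S.lind := @LInd.Mor.mk X.lind S.lind T.h.functor T.h.presProd T.H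

/-- The 1-cell between values. -/
abbrev ts : DistCat.self X.val ⟶ S.vl := DistCat.selfMap T.h

lemma base_gl (T : S.Factor a c) (d : X.val.carrier) :
    S.gl.base.obj (T.tl.base.obj d) = a.lind.base.obj d := LInd.Mor.congr_base_obj T.gl d

lemma base_ql (T : S.Factor a c) (d : X.val.carrier) :
    S.ql.base.obj (T.tl.base.obj d) = c.lind.base.obj d := LInd.Mor.congr_base_obj T.ql d

lemma gl_obj (A : X.lind.fib.Obj) : S.gl.obj (T.tl.obj A) = a.lind.obj A :=
  LInd.Mor.congr_obj T.gl A

lemma ql_obj (A : X.lind.fib.Obj) : S.ql.obj (T.tl.obj A) = c.lind.obj A :=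
  LInd.Mor.congr_obj T.ql A

lemma sg_obj (A : X.vfib.Obj) : S.sg.obj (T.ts.obj A) = a.sf.obj A := LInd.Mor.congr_obj T.sg A

lemma sq_obj (A : X.vfib.Obj) : S.sq.obj (T.ts.obj A) = c.sf.obj A := LInd.Mor.congr_obj T.sq A

lemma gl_map {d : X.val.carrier} {A B : X.lind.fib.Obj} (k : X.lind.fib.Hom d A B) :
    HEq (S.gl.map (T.tl.map k)) (a.lind.map k) := LInd.Mor.congr_map T.gl k

lemma ql_map {d : X.val.carrier} {A B : X.lind.fib.Obj} (k : X.lind.fib.Hom d A B) :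
    HEq (S.ql.map (T.tl.map k)) (c.lind.map k) := LInd.Mor.congr_map T.ql k

lemma sg_map {d : X.val.carrier} {A B : X.vfib.Obj} (k : X.vfib.Hom d A B) :
    HEq (S.sg.map (T.ts.map k)) (a.sf.map k) := LInd.Mor.congr_map T.sg k

lemma sq_map {d : X.val.carrier} {A B : X.vfib.Obj} (k : X.vfib.Hom d A B) :
    HEq (S.sq.map (T.ts.map k)) (c.sf.map k) := LInd.Mor.congr_map T.sq k

lemma gl_map₁ {A B : X.lind.fib.Obj} (k : X.lind.fib.Hom (𝟙_ X.val.carrier) A B) :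
    HEq (S.gl.map₁ (T.tl.map₁ k)) (a.lind.map₁ k) :=
  (heq_of_eq (LInd.Mor.comp_map₁ T.tl S.gl k).symm).trans (LInd.Mor.congr_map₁ T.gl k)

lemma ql_map₁ {A B : X.lind.fib.Obj} (k : X.lind.fib.Hom (𝟙_ X.val.carrier) A B) :
    HEq (S.ql.map₁ (T.tl.map₁ k)) (c.lind.map₁ k) :=
  (heq_of_eq (LInd.Mor.comp_map₁ T.tl S.ql k).symm).trans (LInd.Mor.congr_map₁ T.ql k)

lemma sg_map₁ {A B : X.vfib.Obj} (k : X.vfib.Hom (𝟙_ X.val.carrier) A B) :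
    HEq (S.sg.map₁ (T.ts.map₁ k)) (a.sf.map₁ k) :=
  (heq_of_eq (LInd.Mor.comp_map₁ T.ts S.sg k).symm).trans (LInd.Mor.congr_map₁ T.sg k)

lemma sq_map₁ {A B : X.vfib.Obj} (k : X.vfib.Hom (𝟙_ X.val.carrier) A B) :
    HEq (S.sq.map₁ (T.ts.map₁ k)) (c.sf.map₁ k) :=
  (heq_of_eq (LInd.Mor.comp_map₁ T.ts S.sq k).symm).trans (LInd.Mor.congr_map₁ T.sq k)

/-- The target is a cartesian lift, so the component of `α` is prescribed by that of `c` in `M` and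
by that of `a` after `ga`. They agree in `N` by the square `T.w`, to which the strict `p`
contributes only identities. -/
lemma exists_a (A : X.vfib.Obj) : ∃ t : S.lind.fib.Hom (𝟙_ S.val.carrier)
    (T.tl.obj (X.F.obj A)) (L.F.obj (T.ts.obj A)), HEq (S.ql.map₁ t) (c.a A) ∧
      HEq (E.lind.fib.comp (S.gl.map₁ t) (L.ga (T.ts.obj A))) (a.a A) := by
  have e₁ := congrArg M.F.obj (T.sq_obj A)
  have e₂ := congrArg E.F.obj (T.sg_obj A)
  obtain ⟨r, hr⟩ := LInd.exists_heq_hom (𝒞 := M.lind.fib) rfl rfl e₁.symm (c.a A)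
  obtain ⟨l, hl⟩ := LInd.exists_heq_hom (𝒞 := E.lind.fib) rfl (T.gl_obj (X.F.obj A)).symm
    e₂.symm (a.a A)
  obtain ⟨t, h₁, h₂⟩ := L.left_exists_hom₁ (T.ql_obj (X.F.obj A)) r l (by
    refine (IdxCat.heq_comp rfl rfl (congrArg f.lind.obj e₁) (congrArg
      (fun z => N.F.obj (f.sf.obj z)) (T.sq_obj A)) (f.lind.map₁_heq rfl e₁ hr)
      (f.a_heq (T.sq_obj A))).trans ?_
    refine (heq_of_eq (Mor.comp_a c f A).symm).trans ((Mor.congr_a T.w.symm A).trans ?_)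
    refine (heq_of_eq (Mor.comp_a a p A)).trans ?_
    refine (IdxCat.heq_comp_id _ (L.strict.left_obj _) (L.strict.a_heq_id _)).trans ?_
    exact (p.lind.map₁_heq (T.gl_obj (X.F.obj A)) e₂ hl).symm)
  exact ⟨t, h₁.trans hr, (heq_of_eq h₂).trans hl⟩

lemma exists_b (B : X.lind.fib.Obj) : ∃ t : S.vl.fib.Hom (𝟙_ S.val.carrier)
    (T.ts.obj (X.U.obj B)) (L.U.obj (T.tl.obj B)), HEq (S.sq.map₁ t) (c.b B) ∧
      HEq (E.vfib.comp (S.sg.map₁ t) (L.gb (T.tl.obj B))) (a.b B) := by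
  have e₁ := congrArg M.U.obj (T.ql_obj B)
  have e₂ := congrArg E.U.obj (T.gl_obj B)
  obtain ⟨r, hr⟩ := LInd.exists_heq_hom (𝒞 := M.vfib) rfl rfl e₁.symm (c.b B)
  obtain ⟨l, hl⟩ := LInd.exists_heq_hom (𝒞 := E.vfib) rfl (T.sg_obj (X.U.obj B)).symm
    e₂.symm (a.b B)
  obtain ⟨t, h₁, h₂⟩ := L.right_exists_hom₁ (T.sq_obj (X.U.obj B)) r l (by
    refine (IdxCat.heq_comp rfl rfl (congrArg f.sf.obj e₁) (congrArg
      (fun z => N.U.obj (f.lind.obj z)) (T.ql_obj B)) (f.sf.map₁_heq rfl e₁ hr)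
      (f.b_heq (T.ql_obj B))).trans ?_
    refine (heq_of_eq (Mor.comp_b c f B).symm).trans ((Mor.congr_b T.w.symm B).trans ?_)
    refine (heq_of_eq (Mor.comp_b a p B)).trans ?_
    refine (IdxCat.heq_comp_id _ (L.strict.right_obj _) (L.strict.b_heq_id _)).trans ?_
    exact (p.sf.map₁_heq (T.sg_obj (X.U.obj B)) e₂ hl).symm)
  exact ⟨t, h₁.trans hr, (heq_of_eq h₂).trans hl⟩

/-- The lift of the components of `α`. -/
def ta (A : X.vfib.Obj) : S.lind.fib.Hom (𝟙_ S.val.carrier) (T.tl.obj (X.F.obj A))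
    (L.F.obj (T.ts.obj A)) := (T.exists_a L A).choose

lemma ql_ta (A : X.vfib.Obj) : HEq (S.ql.map₁ (T.ta L A)) (c.a A) :=
  (T.exists_a L A).choose_spec.1

lemma gl_ta (A : X.vfib.Obj) :
    HEq (E.lind.fib.comp (S.gl.map₁ (T.ta L A)) (L.ga (T.ts.obj A))) (a.a A) :=
  (T.exists_a L A).choose_spec.2

/-- The lift of the components of `β`. -/
def tb (B : X.lind.fib.Obj) : S.vl.fib.Hom (𝟙_ S.val.carrier) (T.ts.obj (X.U.obj B))
    (L.U.obj (T.tl.obj B)) := (T.exists_b L B).choose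

lemma sq_tb (B : X.lind.fib.Obj) : HEq (S.sq.map₁ (T.tb L B)) (c.b B) :=
  (T.exists_b L B).choose_spec.1

lemma sg_tb (B : X.lind.fib.Obj) :
    HEq (E.vfib.comp (S.sg.map₁ (T.tb L B)) (L.gb (T.tl.obj B))) (a.b B) :=
  (T.exists_b L B).choose_spec.2

lemma ql_F_ts (A : X.vfib.Obj) : S.ql.obj (L.F.obj (T.ts.obj A)) = M.F.obj (c.sf.obj A) :=
  (L.ql_F _).trans (congrArg M.F.obj (T.sq_obj A))

lemma sq_U_tl (B : X.lind.fib.Obj) : S.sq.obj (L.U.obj (T.tl.obj B)) = M.U.obj (c.lind.obj B) :=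
  (L.sq_U _).trans (congrArg M.U.obj (T.ql_obj B))

/-- On the two testing components the claim becomes naturality of the given `α` of `c` and of `a`.
-/
lemma ta_nat {d : X.val.carrier} {A B : X.vfib.Obj} (k : X.vfib.Hom d A B) :
    S.lind.fib.comp (T.tl.map (X.F.map k)) (S.lind.fib.reind (toUnit _) (T.ta L B)) =
      S.lind.fib.comp (S.lind.fib.reind (toUnit _) (T.ta L A)) (L.F.map (T.ts.map k)) := by
  refine L.left_hom_ext ?_ ?_
  · refine (LInd.Mor.map_comp_reind_toUnit _ _ _).trans (Eq.trans ?_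
      (LInd.Mor.map_reind_toUnit_comp _ _ _).symm)
    refine eq_of_heq ((IdxCat.heq_comp (T.base_ql d) (T.ql_obj _) (T.ql_obj _) (T.ql_F_ts L B)
      (T.ql_map _) (IdxCat.heq_reind_toUnit (T.base_ql d) (T.ql_obj _) (T.ql_F_ts L B)
        (T.ql_ta L B))).trans ?_)
    refine (heq_of_eq (c.a_nat k)).trans (HEq.symm ?_)
    exact IdxCat.heq_comp (T.base_ql d) (T.ql_obj _) (T.ql_F_ts L A) (T.ql_F_ts L B)
      (IdxCat.heq_reind_toUnit (T.base_ql d) (T.ql_obj _) (T.ql_F_ts L A) (T.ql_ta L A))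
      ((L.ql_F_map _).trans (M.F.map_heq (T.base_ql d) (T.sq_obj A) (T.sq_obj B) (T.sq_map k)))
  · refine (S.gl.map_comp_reind_toUnit_comp _ _ _).trans (Eq.trans ?_
      (S.gl.map_reind_toUnit_comp_comp _ (L.ga_nat (T.ts.map k))).symm)
    have e : ∀ A, E.F.obj (S.sg.obj (T.ts.obj A)) = E.F.obj (a.sf.obj A) :=
      fun A => congrArg E.F.obj (T.sg_obj A)
    refine eq_of_heq ((IdxCat.heq_comp (T.base_gl d) (T.gl_obj _) (T.gl_obj _) (e B)
      (T.gl_map _) (IdxCat.heq_reind_toUnit (T.base_gl d) (T.gl_obj _) (e B)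
        (T.gl_ta L B))).trans ?_)
    refine (heq_of_eq (a.a_nat k)).trans (HEq.symm ?_)
    exact IdxCat.heq_comp (T.base_gl d) (T.gl_obj _) (e A) (e B)
      (IdxCat.heq_reind_toUnit (T.base_gl d) (T.gl_obj _) (e A) (T.gl_ta L A))
      (E.F.map_heq (T.base_gl d) (T.sg_obj A) (T.sg_obj B) (T.sg_map k))

lemma tb_nat {d : X.val.carrier} {A B : X.lind.fib.Obj} (k : X.lind.fib.Hom d A B) :
    S.vl.fib.comp (T.ts.map (X.U.map k)) (S.vl.fib.reind (toUnit _) (T.tb L B)) =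
      S.vl.fib.comp (S.vl.fib.reind (toUnit _) (T.tb L A)) (L.U.map (T.tl.map k)) := by
  refine L.right_hom_ext ?_ ?_
  · refine (LInd.Mor.map_comp_reind_toUnit _ _ _).trans (Eq.trans ?_
      (LInd.Mor.map_reind_toUnit_comp _ _ _).symm)
    refine eq_of_heq ((IdxCat.heq_comp (T.base_ql d) (T.sq_obj _) (T.sq_obj _) (T.sq_U_tl L B)
      (T.sq_map _) (IdxCat.heq_reind_toUnit (T.base_ql d) (T.sq_obj _) (T.sq_U_tl L B)
        (T.sq_tb L B))).trans ?_)
    refine (heq_of_eq (c.b_nat k)).trans (HEq.symm ?_)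
    exact IdxCat.heq_comp (T.base_ql d) (T.sq_obj _) (T.sq_U_tl L A) (T.sq_U_tl L B)
      (IdxCat.heq_reind_toUnit (T.base_ql d) (T.sq_obj _) (T.sq_U_tl L A) (T.sq_tb L A))
      ((L.sq_U_map _).trans (M.U.map_heq (T.base_ql d) (T.ql_obj A) (T.ql_obj B) (T.ql_map k)))
  · refine (S.sg.map_comp_reind_toUnit_comp _ _ _).trans (Eq.trans ?_
      (S.sg.map_reind_toUnit_comp_comp _ (L.gb_nat (T.tl.map k))).symm)
    have e : ∀ A, E.U.obj (S.gl.obj (T.tl.obj A)) = E.U.obj (a.lind.obj A) :=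
      fun A => congrArg E.U.obj (T.gl_obj A)
    refine eq_of_heq ((IdxCat.heq_comp (T.base_gl d) (T.sg_obj _) (T.sg_obj _) (e B)
      (T.sg_map _) (IdxCat.heq_reind_toUnit (T.base_gl d) (T.sg_obj _) (e B)
        (T.sg_tb L B))).trans ?_)
    refine (heq_of_eq (a.b_nat k)).trans (HEq.symm ?_)
    exact IdxCat.heq_comp (T.base_gl d) (T.sg_obj _) (e A) (e B)
      (IdxCat.heq_reind_toUnit (T.base_gl d) (T.sg_obj _) (e A) (T.sg_tb L A))
      (E.U.map_heq (T.base_gl d) (T.gl_obj A) (T.gl_obj B) (T.gl_map k))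

lemma counit_app (B : X.lind.fib.Obj) : T.tl.map₁ (X.θ B) =
    S.lind.fib.comp (T.ta L (X.U.obj B))
      (S.lind.fib.comp (L.F.map (T.tb L B)) (L.θ (T.tl.obj B))) := by
  refine L.isPb.comp.hom₁_ext ?_ ?_
  · rw [LInd.Mor.map₁_comp, LInd.Mor.map₁_comp, L.gl_θ, ← E.comp.assoc (S.gl.map₁ _) (L.ga _),
      L.ga_nat₁, IdxCat.assoc, ← E.comp.assoc (E.F.map _) (E.F.map _), ← E.F.map_comp,
      ← IdxCat.assoc]
    have e₁ := T.sg_obj (X.U.obj B)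
    refine eq_of_heq ((T.gl_map₁ _).trans ((heq_of_eq (a.counit_app B)).trans (HEq.symm ?_)))
    have e₂ := congrArg E.U.obj (T.gl_obj B)
    exact IdxCat.heq_comp rfl (T.gl_obj _) (congrArg E.F.obj e₁) (T.gl_obj B) (T.gl_ta L _)
      (IdxCat.heq_comp rfl (congrArg E.F.obj e₁) (congrArg E.F.obj e₂) (T.gl_obj B)
        (E.F.map_heq rfl e₁ e₂ (T.sg_tb L B)) (E.θ_heq (T.gl_obj B)))
  · rw [LInd.Mor.map₁_comp, LInd.Mor.map₁_comp]
    refine eq_of_heq ((T.ql_map₁ _).trans ((heq_of_eq (c.counit_app B)).trans (HEq.symm ?_)))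
    have e₁ := (L.ql_FU _).trans (congrArg (fun z => M.F.obj (M.U.obj z)) (T.ql_obj B))
    exact IdxCat.heq_comp rfl (T.ql_obj _) (T.ql_F_ts L _) (T.ql_obj B) (T.ql_ta L _)
      (IdxCat.heq_comp rfl (T.ql_F_ts L _) e₁ (T.ql_obj B)
        ((L.ql_F_map₁ _).trans (M.F.map_heq rfl (T.sq_obj _) (T.sq_U_tl L B) (T.sq_tb L B)))
        ((L.ql_θ _).trans (M.θ_heq (T.ql_obj B))))

lemma unit_app (A : X.vfib.Obj) : L.η (T.ts.obj A) =
    S.vl.fib.comp (T.ts.map₁ (X.η A))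
      (S.vl.fib.comp (T.tb L (X.F.obj A)) (L.U.map (T.ta L A))) := by
  refine L.right_hom_ext₁ ?_ ?_
  · rw [LInd.Mor.map₁_comp, LInd.Mor.map₁_comp]
    refine eq_of_heq ((L.sq_η _).trans ((M.η_heq (T.sq_obj A)).trans
      ((heq_of_eq (c.unit_app A)).trans (HEq.symm ?_))))
    have e₁ := (L.sq_UF _).trans (congrArg (fun z => M.U.obj (M.F.obj z)) (T.sq_obj A))
    exact IdxCat.heq_comp rfl (T.sq_obj _) (T.sq_obj _) e₁ (T.sq_map₁ _)
      (IdxCat.heq_comp rfl (T.sq_obj _) (T.sq_U_tl L _) e₁ (T.sq_tb L _)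
        ((L.sq_U_map₁ _).trans (M.U.map_heq rfl (T.ql_obj _) (T.ql_F_ts L A) (T.ql_ta L A))))
  · have e₁ := congrArg E.U.obj (T.gl_obj (X.F.obj A))
    have e₂ := congrArg (fun z => E.U.obj (E.F.obj z)) (T.sg_obj A)
    -- The unit equation of `a`, with its components expressed through the lifts. Composing with
    -- `gaInv` then cancels the trailing `ga`.
    have h : E.η (S.sg.obj (T.ts.obj A)) = E.vfib.comp (S.sg.map₁ (T.ts.map₁ (X.η A)))
        (E.vfib.comp (E.vfib.comp (S.sg.map₁ (T.tb L (X.F.obj A))) (L.gb (T.tl.obj (X.F.obj A))))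
          (E.U.map (E.lind.fib.comp (S.gl.map₁ (T.ta L A)) (L.ga (T.ts.obj A))))) := by
      refine eq_of_heq ((E.η_heq (T.sg_obj A)).trans
        ((heq_of_eq (a.unit_app A)).trans (HEq.symm ?_)))
      exact IdxCat.heq_comp rfl (T.sg_obj _) (T.sg_obj _) e₂ (T.sg_map₁ _)
        (IdxCat.heq_comp rfl (T.sg_obj _) e₁ e₂ (T.sg_tb L _)
          (E.U.map_heq rfl (T.gl_obj _) (congrArg E.F.obj (T.sg_obj A)) (T.gl_ta L A)))
    rw [L.sg_η, h, LInd.Mor.map₁_comp, LInd.Mor.map₁_comp, IdxCat.assoc, IdxCat.assoc,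
      IdxCat.assoc, IdxCat.assoc, IdxCat.assoc, L.gb_nat₁, ← E.U.map_comp, IdxCat.assoc,
      L.ga_gaInv, IdxCat.comp_id]

variable (Q : S.comp.Products) (R : S.comp.Powers)

/-- The components of the induced 1-cell. -/
@[reducible]
def morData : MorData (M := X) (N := L.model Q R) T.h T.H where
  preservesProducts := by
    -- Product cones in the pullback are detected componentwise, and the components are the images
    -- under `a` and `c`.
    refine LInd.Mor.preservesProducts T.tl X.products Q fun {n} B => ?_
    have h := X.products.isProdCone B
    refine L.isPb.comp.isProdCone (p.lind.preservesProdCones p.preservesProducts)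
      ((a.lind.preservesProdCones a.preservesProducts h).of_heq (T.gl_obj _).symm
        (fun i => (T.gl_obj _).symm) fun i => (T.gl_map₁ _).symm)
      ((c.lind.preservesProdCones c.preservesProducts h).of_heq (T.ql_obj _).symm
        (fun i => (T.ql_obj _).symm) fun i => (T.ql_map₁ _).symm)
  a := T.ta L
  a_nat k := T.ta_nat L k
  b := T.tb L
  b_nat k := T.tb_nat L k
  counit_app := T.counit_app L
  unit_app := T.unit_app L

/-- The induced 1-cell. -/
@[reducible]
def mor : X ⟶ L.model Q R := (T.morData L Q R).mor

variable (hG : S.G.PreservesProducts Q E.products) (hQ : S.Q.PreservesProducts Q M.products)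

lemma mor_fst (h₁ : T.h ≫ S.g = a.h) : T.mor L Q R ≫ L.fst Q R hG = a := by
  refine mor_ext h₁ ?_ (fun A => ?_) fun B => ?_
  · exact congr_arg_heq LInd.Mor.fib T.gl
  · exact (heq_of_eq (Mor.comp_a _ _ A)).trans (T.gl_ta L A)
  · exact (heq_of_eq (Mor.comp_b _ _ B)).trans (T.sg_tb L B)

lemma mor_snd (h₁ : T.h ≫ S.q = c.h) : T.mor L Q R ≫ L.snd Q R hQ = c := by
  refine mor_ext h₁ ?_ (fun A => ?_) fun B => ?_
  · exact congr_arg_heq LInd.Mor.fib T.ql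
  · exact (heq_of_eq (Mor.comp_a _ _ A)).trans ((IdxCat.comp_idOfEq_heq _ (L.ql_F _)).trans (T.ql_ta L A))
  · exact (heq_of_eq (Mor.comp_b _ _ B)).trans ((IdxCat.comp_idOfEq_heq _ (L.sq_U _)).trans (T.sq_tb L B))

end Factor

end Square

end Model

/-! ### The two-dimensional universal property and the cartesian 2-cells -/

lemma IsPullback₂.existsUnique_of_heq {X K E M N : LInd.{v, u}} {g : K ⟶ E}
    {q : K ⟶ M} {p : E ⟶ N} {f : M ⟶ N} (hI : IsPullback₂ g q p f) {s t : X ⟶ K}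
    (σ : s ≫ g ⟶ t ≫ g) (τ : s ≫ q ⟶ t ≫ q) (h : HEq (σ ▷ p) (τ ▷ f)) :
    ∃! θ : s ⟶ t, θ ▷ g = σ ∧ θ ▷ q = τ :=
  hI.lift₂ s t σ τ ((LInd.lift₂_condition_iff hI.w σ τ).2 h)

namespace Model

/-- A 2-cell of models is a 2-cell of `LInd` satisfying two equations. Existence and uniqueness of
the underlying cell come from the pullback in `LInd`, and only the equations need checking. -/
lemma existsUnique_cell {X K E M N : Model.{v, u}} {g : K ⟶ E} {q : K ⟶ M} {p : E ⟶ N} {f : M ⟶ N}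
    (hI : IsPullback₂ g.lind q.lind p.lind f.lind) {s t : X ⟶ K} {σ : s ≫ g ⟶ t ≫ g}
    {τ : s ≫ q ⟶ t ≫ q} (h : HEq (Cell.cell σ ▷ p.lind) (Cell.cell τ ▷ f.lind))
    (hl : ∀ θ : s.lind ⟶ t.lind, θ ▷ g.lind = Cell.cell σ → θ ▷ q.lind = Cell.cell τ → ∀ A,
      K.lind.fib.comp (LInd.Cell.app θ (X.F.obj A)) (t.a A) =
        K.lind.fib.comp (s.a A) (K.F.map (Mor.vapp θ A)))
    (hr : ∀ θ : s.lind ⟶ t.lind, θ ▷ g.lind = Cell.cell σ → θ ▷ q.lind = Cell.cell τ → ∀ B,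
      K.vfib.comp (Mor.vapp θ (X.U.obj B)) (t.b B) =
        K.vfib.comp (s.b B) (K.U.map (LInd.Cell.app θ B))) :
    ∃! θ : s ⟶ t, θ ▷ g = σ ∧ θ ▷ q = τ := by
  obtain ⟨θ, ⟨h₁, h₂⟩, hu⟩ := IsPullback₂.existsUnique_of_heq (s := s.lind) (t := t.lind) hI
    (Cell.cell σ) (Cell.cell τ) h
  refine ⟨Cell.ofApp θ (hl θ h₁ h₂) (hr θ h₁ h₂), ⟨Cell.ext h₁, Cell.ext h₂⟩,
    fun θ' hθ => Cell.ext ?_⟩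
  exact hu _ ⟨congrArg Cell.cell hθ.1, congrArg Cell.cell hθ.2⟩

namespace Square

variable {E M N : Model.{v, u}} {p : E ⟶ N} {f : M ⟶ N} {S : Square p f}

namespace Lifts

variable (L : S.Lifts) (Q : S.comp.Products) (R : S.comp.Powers)
  (hG : S.G.PreservesProducts Q E.products) (hQ : S.Q.PreservesProducts Q M.products)

/-- On one side the strict `p` adds identities to a lift of a component of `α` or `β`; on the other
the strict second projection adds identities to that same component. -/
lemma fst_comp_eq (h : S.g ≫ p.h = S.q ≫ f.h) : L.fst Q R hG ≫ p = L.snd Q R hQ ≫ f := by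
  refine mor_ext h (congr_arg_heq LInd.Mor.fib L.isPb.comp.w) (fun A => ?_) fun B => ?_
  · refine (heq_of_eq (Mor.comp_a (L.fst Q R hG) p A)).trans (HEq.trans ?_
      (heq_of_eq (Mor.comp_a (L.snd Q R hQ) f A)).symm)
    refine (IdxCat.heq_comp_id _ (L.strict.left_obj _) (L.strict.a_heq_id _)).trans
      ((L.p_ga A).trans (HEq.symm ?_))
    have e : S.ql.obj (L.F.obj A) = M.F.obj (S.sq.obj A) := L.ql_F A
    refine IdxCat.heq_id_comp (f.a (S.sq.obj A)) (congrArg f.lind.obj e) ?_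
    refine (f.lind.map₁_heq e rfl ((IdxCat.heq_idOfEq _ e).trans (IdxCat.heq_id rfl e))).trans ?_
    exact heq_of_eq (f.lind.map₁_id _)
  · refine (heq_of_eq (Mor.comp_b (L.fst Q R hG) p B)).trans (HEq.trans ?_
      (heq_of_eq (Mor.comp_b (L.snd Q R hQ) f B)).symm)
    refine (IdxCat.heq_comp_id _ (L.strict.right_obj _) (L.strict.b_heq_id _)).trans
      ((L.p_gb B).trans (HEq.symm ?_))
    have e : S.sq.obj (L.U.obj B) = M.U.obj (S.ql.obj B) := L.sq_U B
    refine IdxCat.heq_id_comp (f.b (S.ql.obj B)) (congrArg f.sf.obj e) ?_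
    refine (f.sf.map₁_heq e rfl ((IdxCat.heq_idOfEq _ e).trans (IdxCat.heq_id rfl e))).trans ?_
    exact heq_of_eq (f.sf.map₁_id _)

/-- The components of `α` and `β` map into domains of cartesian lifts, hence are determined by their
composites with the two projections. -/
lemma mor_eq {X : Model.{v, u}} {s t : X ⟶ L.model Q R} (hh : s.h = t.h) (hH : HEq s.H t.H)
    (e₁ : s ≫ L.fst Q R hG = t ≫ L.fst Q R hG) (e₂ : s ≫ L.snd Q R hQ = t ≫ L.snd Q R hQ) :
    s = t := by
  obtain ⟨h, H, hp, α, β, hα, hβ, hl⟩ := s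
  obtain ⟨h', H', hp', α', β', hα', hβ', hl'⟩ := t
  obtain rfl : h = h' := hh
  obtain rfl : H = H' := eq_of_heq hH
  refine mor_ext rfl HEq.rfl (fun A => heq_of_eq ?_) fun B => heq_of_eq ?_
  · have h₁ := eq_of_heq (Mor.congr_a e₁ A)
    have h₂ := eq_of_heq (Mor.congr_a e₂ A)
    rw [Mor.comp_a, Mor.comp_a] at h₁ h₂
    exact L.left_hom_ext₁ (IdxCat.comp_idOfEq_cancel (L.ql_F _) h₂) h₁
  · have h₁ := eq_of_heq (Mor.congr_b e₁ B)
    have h₂ := eq_of_heq (Mor.congr_b e₂ B)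
    rw [Mor.comp_b, Mor.comp_b] at h₁ h₂
    exact L.right_hom_ext₁ (IdxCat.comp_idOfEq_cancel (L.sq_U _) h₂) h₁

lemma existsUnique_lift (hD : IsPullback₂ S.g S.q p.h f.h)
    (hI : IsPullback₂ S.gl S.ql p.lind f.lind) {X : Model.{v, u}} {a : X ⟶ E} {c : X ⟶ M}
    (T : S.Factor a c) (h₁ : T.h ≫ S.g = a.h) (h₂ : T.h ≫ S.q = c.h) :
    ∃! t : X ⟶ L.model Q R, t ≫ L.fst Q R hG = a ∧ t ≫ L.snd Q R hQ = c := by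
  have h₃ := T.mor_fst L Q R hG h₁
  have h₄ := T.mor_snd L Q R hQ h₂
  refine ⟨T.mor L Q R, ⟨h₃, h₄⟩, fun t ht => ?_⟩
  have e₁ : t.h = T.h := by
    obtain ⟨_, -, hu⟩ := hD.lift a.h c.h (congrArg Mor.h T.w)
    exact (hu t.h ⟨congrArg Mor.h ht.1, congrArg Mor.h ht.2⟩).trans (hu T.h ⟨h₁, h₂⟩).symm
  have e₂ : t.lind = T.tl := by
    obtain ⟨_, -, hu⟩ := hI.lift a.lind c.lind (congrArg Mor.lind T.w)
    exact (hu t.lind ⟨congrArg Mor.lind ht.1, congrArg Mor.lind ht.2⟩).trans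
      (hu T.tl ⟨T.gl, T.ql⟩).symm
  exact L.mor_eq Q R hG hQ e₁ (congr_arg_heq LInd.Mor.fib e₂) (ht.1.trans h₃.symm)
    (ht.2.trans h₄.symm)

section

variable {X : Model.{v, u}} {s t : X ⟶ L.model Q R} {θ : s.lind ⟶ t.lind}
  {σ : s ≫ L.fst Q R hG ⟶ t ≫ L.fst Q R hG} {τ : s ≫ L.snd Q R hQ ⟶ t ≫ L.snd Q R hQ}

/-- Tested on the two projections: the first ends in the cartesian `ga`, the second in an identity
that cancels. -/
lemma cell_left (h₁ : θ ▷ Mor.lind (L.fst Q R hG) = Cell.cell σ)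
    (h₂ : θ ▷ Mor.lind (L.snd Q R hQ) = Cell.cell τ) (A : X.val.carrier) :
    S.lind.fib.comp (LInd.Cell.app θ (X.F.obj A)) (t.a A) =
      S.lind.fib.comp (s.a A) (L.F.map (Mor.vapp θ A)) :=
  L.left_hom_ext₁ (IdxCat.comp_idOfEq_cancel (L.ql_F _)
    (Cell.map_left_app (L.snd Q R hQ) h₂ A)) (Cell.map_left_app (L.fst Q R hG) h₁ A)

lemma cell_right (h₁ : θ ▷ Mor.lind (L.fst Q R hG) = Cell.cell σ)
    (h₂ : θ ▷ Mor.lind (L.snd Q R hQ) = Cell.cell τ) (B : X.comp.Obj) :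
    S.vl.fib.comp (Mor.vapp θ (X.U.obj B)) (t.b B) =
      S.vl.fib.comp (s.b B) (L.U.map (LInd.Cell.app θ B)) :=
  L.right_hom_ext₁ (IdxCat.comp_idOfEq_cancel (L.sq_U _)
    (Cell.map_right_app (L.snd Q R hQ) h₂ B)) (Cell.map_right_app (L.fst Q R hG) h₁ B)

end

/-- The lifted model is a pullback. -/
lemma isPullback (hD : IsPullback₂ S.g S.q p.h f.h)
    (hI : IsPullback₂ S.gl S.ql p.lind f.lind)
    (hF : ∀ {X : Model.{v, u}} (a : X ⟶ E) (c : X ⟶ M), a ≫ p = c ≫ f →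
      ∃ T : S.Factor a c, T.h ≫ S.g = a.h ∧ T.h ≫ S.q = c.h) :
    IsPullback₂ (L.fst Q R hG) (L.snd Q R hQ) p f where
  w := L.fst_comp_eq Q R hG hQ hD.w
  lift a c w := by
    obtain ⟨T, h₁, h₂⟩ := hF a c w
    exact L.existsUnique_lift Q R hG hQ hD hI T h₁ h₂
  lift₂ _ _ σ τ h := existsUnique_cell (g := L.fst Q R hG) (q := L.snd Q R hQ) hI
    (lift₂_cell _ σ τ h) (fun _ h₁ h₂ => L.cell_left Q R hG hQ h₁ h₂)
    fun _ h₁ h₂ => L.cell_right Q R hG hQ h₁ h₂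

/-- The base component is an identity and the components are cartesian by construction, so the
pointwise criterion `isStronglyCartesian_of_isCart` applies. -/
lemma isStronglyCartesian_α :
    (postcomp S.vl p.lind).IsStronglyCartesian (S.sq ◁ f.α) (L.fst Q R hG).α := by
  have e₁ : (L.model Q R).left ≫ S.ql = S.sq ≫ M.left :=
    LInd.Mor.hext rfl L.ql_F fun k => L.ql_F_map k
  have ha : ((L.model Q R).left ≫ S.gl) ≫ p.lind = S.sq ≫ M.left ≫ f.lind :=
    (congrArg ((L.model Q R).left ≫ ·) L.isPb.comp.w).trans (congrArg (· ≫ f.lind) e₁)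
  have hb : (S.sg ≫ E.left) ≫ p.lind = S.sq ≫ f.sf ≫ N.left :=
    (congrArg (S.sg ≫ ·) L.strict.left.choose).trans (congrArg (· ≫ N.left) L.isPb.val.w)
  refine isStronglyCartesian_of_heq ha hb (LInd.cell_hext ha hb (fun c => ?_) fun A => L.p_ga A)
    (LInd.isStronglyCartesian_of_isCart _ (fun c => ?_) fun A => L.left.isCart A)
  · refine (heq_of_eq (p.h.functor.map_id _)).trans (HEq.trans ?_
      (heq_of_eq (f.α_base (S.q.functor.obj c)).symm))
    exact heq_id (LInd.Mor.congr_base_obj L.isPb.comp.w c)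
  · exact inferInstanceAs (IsIso (𝟙 (S.g.functor.obj c)))

lemma isStronglyCartesian_β :
    (postcomp S.lind p.sf).IsStronglyCartesian (S.ql ◁ f.β) (L.fst Q R hG).β := by
  have e₁ : (L.model Q R).right ≫ S.sq = S.ql ≫ M.right :=
    LInd.Mor.hext rfl L.sq_U fun k => L.sq_U_map k
  have ha : ((L.model Q R).right ≫ S.sg) ≫ p.sf = S.ql ≫ M.right ≫ f.sf :=
    (congrArg ((L.model Q R).right ≫ ·) L.isPb.val.w).trans (congrArg (· ≫ f.sf) e₁)
  have hb : (S.gl ≫ E.right) ≫ p.sf = S.ql ≫ f.lind ≫ N.right :=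
    (congrArg (S.gl ≫ ·) L.strict.right.choose).trans (congrArg (· ≫ N.right) L.isPb.comp.w)
  refine isStronglyCartesian_of_heq ha hb (LInd.cell_hext ha hb (fun c => ?_) fun A => L.p_gb A)
    (LInd.isStronglyCartesian_of_isCart _ (fun c => ?_) fun A => L.right.isCart A)
  · refine (heq_of_eq (p.h.functor.map_id _)).trans (HEq.trans ?_
      (heq_of_eq (f.β_base (S.q.functor.obj c)).symm))
    exact heq_id (LInd.Mor.congr_base_obj L.isPb.comp.w c)
  · exact inferInstanceAs (IsIso (𝟙 (S.g.functor.obj c)))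

end Lifts

end Square

/-! ### The concrete pullback square of values and computations -/

section Pb

variable {E M N : Model.{v, u}} (p : E ⟶ N) (f : M ⟶ N) [p.h.functor.IsFibered]

/-- The pullback of the value and computation categories. -/
@[reducible]
def pbSquare : Square p f where
  val := DistCat.pb p.h f.h
  comp := LInd.pbFib p.lind f.lind
  g := DistCat.pbFst p.h f.h
  q := DistCat.pbSnd p.h f.h
  G :=
    { obj := fun A => A.left
      map := fun k => k.left
      map_id := fun _ _ => rfl
      map_comp := fun _ _ => rfl
      map_reind := fun _ _ _ _ => rfl }
  Q :=
    { obj := fun A => A.right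
      map := fun k => k.right
      map_id := fun _ _ => rfl
      map_comp := fun _ _ => rfl
      map_reind := fun _ _ _ _ => rfl }

lemma pbSquare_isPullback :
    IsPullback₂ (pbSquare p f).gl (pbSquare p f).ql p.lind f.lind :=
  letI : CartesianMonoidalCategory (Pb p.lind.base f.lind.base) := (DistCat.pb p.h f.h).cart
  haveI : PreservesFiniteProducts (Pb.fst p.lind.base f.lind.base) :=
    (DistCat.pbFst p.h f.h).presProd
  haveI : PreservesFiniteProducts (Pb.snd p.lind.base f.lind.base) :=
    (DistCat.pbSnd p.h f.h).presProd
  LInd.isPullback_pb p.lind f.lind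

lemma pbSquare_isPb : (pbSquare p f).IsPb where
  comp :=
    letI : CartesianMonoidalCategory (Pb p.lind.base f.lind.base) := (DistCat.pb p.h f.h).cart
    haveI : PreservesFiniteProducts (Pb.fst p.lind.base f.lind.base) :=
      (DistCat.pbFst p.h f.h).presProd
    haveI : PreservesFiniteProducts (Pb.snd p.lind.base f.lind.base) :=
      (DistCat.pbSnd p.h f.h).presProd
    LInd.isFibPb_pb p.lind f.lind
  val := DistCat.isFibPb_self (DistCat.pb_w p.h f.h) (Pb.isStrictPb p.h.functor f.h.functor)

variable {p f} in
/-- A commutative square of 1-cells factors through the pullback. -/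
def pbFactor {X : Model.{v, u}} {a : X ⟶ E} {c : X ⟶ M} (w : a ≫ p = c ≫ f) :
    (pbSquare p f).Factor a c where
  w := w
  h := DistCat.pbLift p.h f.h a.h c.h (congrArg Mor.h w)
  H := LInd.pbLiftFib a.lind c.lind (congrArg Mor.lind w)
  gl := rfl
  ql := rfl
  sg := (DistCat.selfMap_comp _ _).symm
  sq := (DistCat.selfMap_comp _ _).symm

end Pb

end Model

end CBPV

end

theorem mainTheorem1 {M N E : CBPV.Model.{v, u}} (p : E ⟶ N) (hp : CBPV.Model.IsCBPVFibration p)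
    (f : M ⟶ N) :
    ∃ (K : CBPV.Model.{v, u}) (g : K ⟶ E) (q : K ⟶ M),
      CBPV.IsPullback₂ g q p f ∧
      CBPV.Model.IsCBPVFibration q ∧
      (CBPV.Model.IsSplitCBPVFibration p → CBPV.Model.IsSplitCBPVFibration q) ∧
      CBPV.IsPullback₂ g.h q.h p.h f.h ∧
      CBPV.IsPullback₂ g.lind q.lind p.lind f.lind ∧
      (postcomp (CBPV.DistCat.self K.val) p.lind).IsStronglyCartesian
        (CBPV.DistCat.selfMap q.h ◁ f.α) g.α ∧
      (postcomp K.lind (CBPV.DistCat.selfMap p.h)).IsStronglyCartesian (q.lind ◁ f.β) g.β := by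
  have := hp.baseFibration
  have hS := CBPV.Model.pbSquare_isPb p f
  have hI := CBPV.Model.pbSquare_isPullback p f
  have hD := CBPV.DistCat.isPullback_pb p.h f.h
  have hq := CBPV.DistCat.pbSnd_isStrict p.h f.h
  have hB := CBPV.Pb.isStrictPb p.h.functor f.h.functor
  -- Lifts of computation maps come from the fibration in `LInd`; those of value maps, in the next
  -- line, from the fibration of value categories.
  have hL := CBPV.LInd.hasLifts_of_isFibration hp.fibration
  obtain ⟨L⟩ := CBPV.Model.Square.exists_lifts _ hS hp.strict hL (CBPV.DistCat.hasLifts_selfMap p.h)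
  obtain ⟨Q, hQ₁, hQ₂, hG⟩ := hS.exists_products hL hq
  obtain ⟨R, hR⟩ := hS.exists_powers hL hp.strict
  have hfib : CBPV.Model.IsCBPVFibration (L.snd Q R hQ₂) :=
    { strict := L.snd_isStrict Q R hQ₂ hq hQ₁ hR
      fibration := CBPV.LInd.isFibration_of_isPullback hI hp.fibration
      baseFibration := hB.isFibered hp.baseFibration
      -- The opposite of a strict pullback is again one, so the opfibration is inherited exactly as
      -- the fibration.
      baseOpfibration := hB.op.isFibered hp.baseOpfibration }
  refine ⟨L.model Q R, L.fst Q R hG, L.snd Q R hQ₂,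
    L.isPullback Q R hG hQ₂ hD hI fun a c w => ⟨CBPV.Model.pbFactor w, rfl, rfl⟩, hfib, fun hs => ?_,
    hD, hI, L.isStronglyCartesian_α Q R hG, L.isStronglyCartesian_β Q R hG⟩
  exact
    { toIsCBPVFibration := hfib
      split := hs.split.map (CBPV.LInd.splittingOfIsPullback hI)
      baseSplit := hs.baseSplit.map hB.splitting
      baseOpsplit := hs.baseOpsplit.map hB.op.splitting }
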